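/- **Setting.** Let $\Lambda\subset\mathbb R^2$ be the reciprocal lattice spanned by a basis $b_1,b_2$. For each valley $\alpha=\pm$ let $E_\alpha$ be a complex Hilbert space with an antiunitary $C=C_{2z}\mathcal T$, $C^2=1$ (spinless part), and a unitary representation $G\mapsto e^{-iG\cdot r}$ of $\Lambda$ commuting with $C$. Let $H_\alpha(k)$, $k\in\mathbb R^2$, be self-adjoint (possibly unbounded) Bloch Hamiltonians on $E_\alpha$ that commute with $C$ and satisfy $H_\alpha(k+G)=e^{-iG\cdot r}H_\alpha(k)e^{iG\cdot r}$. Spin enters only as a degeneracy, $H_\alpha\otimes s_0$. Suppose that $H_\alpha$ has an isolated set of two bands: there are continuous $\Lambda$-periodic functions $\ell<h$ such that the part of the spectrum of $H_\alpha(k)$ in $(\ell(k),h(k))$ consists of eigenvalues with a two-dimensional total eigenspace. Let $P_\alpha(k)$ be the orthogonal projection onto that eigenspace; it depends smoothly on $k$. A *gauge* is a choice, for every $k$ (no continuity required), of an orthonormal basis $|u_{\alpha,k}\rangle=(|u_{\alpha,k,1}\rangle,|u_{\alpha,k,2}\rangle)$ of the range of $P_\alpha(k)$ with $|u_{\alpha,k+G}\rangle=e^{-iG\cdot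 r}|u_{\alpha,k}\rangle$. Put $|u^C\rangle=C|u\rangle$. The Wilson line of a path $\gamma$ from $k$ to $k'$ is $W_\alpha(\gamma)=\lim_{L\to\infty}\langle u_{\alpha,k}|P_\alpha(k_1)\cdots P_\alpha(k_L)|u_{\alpha,k'}\rangle$, where $k_j=\gamma(j/(L+1))$; $\det W_\alpha(k,k')$ is computed along the straight path. Assume orientability: for each $\alpha$ and each $\beta=1,2$ there is a $k$ with $\det W_\alpha(k,k+b_\beta)=1$. For a base point $k_0$, with the principal square root and $\tau_y$ the Pauli matrix, put $$\eta_{\alpha,k_0}(k)=\sqrt{\det\langle u^C_{\alpha,k_0}|u_{\alpha,k_0}\rangle}\,\det W_\alpha(k_0,k),\qquad Q_{\alpha,k_0}(k)=\tfrac{\eta^*_{\alpha,k_0}(k)}{\sqrt2}|u_{\alpha,k}\rangle(-i\tau_y)\langle u^C_{\alpha,k}|,$$ $$\Phi_{\alpha,k_0}=\tfrac1{\sqrt2}\mathrm{Tr}\,Q_{\alpha,k_0}[\partial_{k_x}P_\alpha,\partial_{k_y}P_\alpha],\qquad \mathcal N_{\alpha,k_0}=\tfrac1{2\pi}\int_{\text{cell}}\Phi_{\alpha,k_0}\,d^2k.$$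 Let $\mathcal N_\alpha=|\mathcal N_{\alpha,k_0}|$ be the Euler number. Assume $\mathcal N_\pm\ne0$, and put $Q_\alpha=\frac{\mathcal N_{\alpha,k_0}}{\mathcal N_\alpha}Q_{\alpha,k_0}$ and $\Phi_\alpha=\frac{\mathcal N_{\alpha,k_0}}{\mathcal N_\alpha}\Phi_{\alpha,k_0}$. Let $\sum_k c^\dagger_{+,k}\,\Delta(k)\otimes\Pi\,(c^\dagger_{-,-k})^T+h.c.$ be a $C_{2z}\mathcal T$-invariant intervalley pairing, with $\Delta(k)$ a $\Lambda$-periodic $2\times2$ matrix, $\Pi$ a constant spin matrix satisfying $s_y\Pi^*s_y=\Pi$ and $\Pi^\dagger\Pi=s_0$, and $\sum_{a,a'}\Delta_{aa'}(k)|u_{+,k,a}\rangle|u_{-,-k,a'}\rangle$ smooth in $k$. For $b\in\{\perp,\parallel\}$ with $(-1)^\perp=1$, $(-1)^\parallel=-1$, define $$P_\Delta(k)=|u_{+,k}\rangle\Delta(k)\langle u^C_{-,-k}|,\quad P_b(k)=\tfrac12P_\Delta(k)-(-1)^bQ_+(k)P_\Delta(k)Q_-(-k),\quad \Delta_b(k)=\langle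 u_{+,k}|P_b(k)|u^C_{-,-k}\rangle,$$ $|\Delta_b|=\sqrt{\frac12\mathrm{Tr}\,\Delta_b\Delta_b^\dagger}$ and, where $|\Delta_b|\neq0$, $\hat P_b=P_b/|\Delta_b|$ and $v_b=\frac1{\sqrt2}\mathrm{Tr}[Q_+\hat P_b\nabla_k\hat P_b^\dagger]$. For a closed region $D$ of the torus $\mathbb R^2/\Lambda$ with piecewise smooth positively oriented boundary $\partial D$ avoiding the zeros of $\Delta_b$, put $$\mathcal W_b(D)=\frac1{2\pi}\oint_{\partial D}v_b\cdot dk+\frac1{2\pi}\int_D\big[\Phi_+(k)-(-1)^b\Phi_-(-k)\big]d^2k .$$ **Theorem.** 1. $\Delta=\Delta_\perp+\Delta_\parallel$, $P_b(k)=|u_{+,k}\rangle\Delta_b(k)\langle u^C_{-,-k}|$, and $P_b$ is smooth. The quantities $\mathcal N_\pm$, $P_\Delta$, $Q_\pm$, $P_b$, $|\Delta_b|$, $v_b$, $\mathcal W_b(D)$ do not depend on the gauges or base points, and under $|u_{\alpha,k}\rangle\to|u_{\alpha,k}\rangle R_{\alpha,k}$ one has $\Delta_b(k)\to R_{+,k}^\dagger\Delta_b(k)R_{-,-k}^*$,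 as for $\Delta$. The numbers $\mathcal N_\pm$ are integers. 2. Suppose that $|\Delta_b|$ is not identically zero and that its zeros on the torus form finitely many connected components $i$ (isolated points, lines or areas of zeros; possibly none). Then every $i$ has a region $D$ that is connected, contains $i$ in its interior, contains no other zeros, and whose boundary touches no zeros. For all such $D$ the number $\mathcal W_b(D)$ is one and the same integer $\mathcal W_{b,i}$, and $$\sum_i\mathcal W_{b,i}=\mathcal N_+-(-1)^b\mathcal N_- .$$ 3. If $\mathcal N_+-(-1)^b\mathcal N_-\ne0$, then $\Delta_b$ has a zero. In particular, for $\mathcal N_\pm=1$, $\Delta_\parallel$ must have zeros, with total winding $2$ under the hypotheses of 2. In contrast, on the same normal state and with the same $\Pi$ there is a pairing satisfying all the assumptions whose $\Delta_\perp$ vanishes nowhere. 4. A real oriented gauge is a gauge with $C|u_\alpha\rangle=|u_\alpha\rangle$ all of whose straight Wilson lines have determinant $1$; its Chern gauge is $|u^{Ch}_\alpha\rangle=|u_\alpha\rangle\frac1{\sqrt2}\begin{pmatrix}1&1\\ i&-i\end{pmatrix}$. Let $C_{\alpha,a}$ be the Chern number of its $a$-th component, that is, $\frac1{2\pi}\int_{\text{cell}}F_{\alpha,a}\,d^2k$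 with $F_{\alpha,a}=-i\,\mathrm{Tr}\,p\,[\partial_{k_x}p,\partial_{k_y}p]$ and $p=|u^{Ch}_{\alpha,k,a}\rangle\langle u^{Ch}_{\alpha,k,a}|$. There are Chern gauges in both valleys with $C_{\alpha,1}=\mathcal N_\alpha$. For all such Chern gauges $C_{\alpha,2}=-\mathcal N_\alpha$, and under the hypotheses of 2 $$\sum_i\mathcal W_{b,i}=-C_{+,2}+(-1)^bC_{-,2}.$$ -/

import Mathlib

open MeasureTheory Filter Topology
open scoped ContDiff ComplexConjugate TensorProduct Matrix Kronecker InnerProductSpace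

noncomputable section

namespace EulerPairing

/-- Momentum space `ℝ²` with its Euclidean structure. -/
abbrev Plane : Type := EuclideanSpace ℝ (Fin 2)

/-- The coordinate unit vectors `e_x`, `e_y`. -/
def unitVec (i : Fin 2) : Plane := EuclideanSpace.single i (1 : ℝ)

/-- The reciprocal lattice spanned by `b₁`, `b₂`. -/
abbrev recip (b : Module.Basis (Fin 2) ℝ Plane) : Submodule ℤ Plane :=
  Submodule.span ℤ (Set.range b)

/-- The reciprocal unit cell with opposite edges identified. -/
abbrev Torus (b : Module.Basis (Fin 2) ℝ Plane) : Type :=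
  Plane ⧸ (recip b).toAddSubgroup

/-- The projection `ℝ² → ℝ² / Λ`. -/
def toTorus (b : Module.Basis (Fin 2) ℝ Plane) (k : Plane) : Torus b := QuotientAddGroup.mk k

/-- The reciprocal unit cell `{s b₁ + t b₂ : 0 ≤ s, t < 1}`. -/
abbrev unitCell (b : Module.Basis (Fin 2) ℝ Plane) : Set Plane := ZSpan.fundamentalDomain b

/-- The straight path from `k` to `k'`, parametrized by `[0,1]`. -/
def segmentPath (k k' : Plane) : ℝ → Plane := fun t => AffineMap.lineMap k k' t

/-- The Pauli matrix `σ_y`. -/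
def pauliY : Matrix (Fin 2) (Fin 2) ℂ := !![0, -Complex.I; Complex.I, 0]

section Operators

variable {E F : Type*} [NormedAddCommGroup E] [InnerProductSpace ℂ E]
  [NormedAddCommGroup F] [InnerProductSpace ℂ F]

/-- The operator `∑ M_{a a'} |u_a⟩⟨w_{a'}|`. -/
def ketbra (u : Fin 2 → E) (M : Matrix (Fin 2) (Fin 2) ℂ) (w : Fin 2 → F) : F →L[ℂ] E :=
  ∑ a, ∑ a', M a a' • InnerProductSpace.rankOne ℂ (u a) (w a')

/-- The trace of a finite-rank operator on a (possibly infinite-dimensional) space: the trace of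
its restriction to its own range. It is only used for operators of finite rank. -/
def frTrace (A : E →L[ℂ] E) : ℂ :=
  LinearMap.trace ℂ (LinearMap.range (A : E →ₗ[ℂ] E))
    ((A : E →ₗ[ℂ] E).restrict (p := LinearMap.range (A : E →ₗ[ℂ] E))
      (q := LinearMap.range (A : E →ₗ[ℂ] E)) (fun x _ => LinearMap.mem_range_self _ x))

/-- The partial derivative `∂_{k_i} A` of an operator-valued function. -/
def pderiv (A : Plane → E →L[ℂ] F) (i : Fin 2) (k : Plane) : E →L[ℂ] F :=
  fderiv ℝ A k (unitVec i)

/-- `Tr[X ∂_{k_x}P ∂_{k_y}P] - Tr[X ∂_{k_y}P ∂_{k_x}P]` at `k`, for an operator `X` of finite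
rank. -/
def curvatureTrace (X : E →L[ℂ] E) (P : Plane → E →L[ℂ] E) (k : Plane) : ℂ :=
  frTrace (X ∘L pderiv P 0 k ∘L pderiv P 1 k) - frTrace (X ∘L pderiv P 1 k ∘L pderiv P 0 k)

end Operators

/-- The (spinless part of the) normal state of one valley: a Bloch Hamiltonian `H(k)`, `k ∈ ℝ²`,
on a Hilbert space `E` carrying the spinless antiunitary symmetry `C = C₂𝓏𝒯` with `C² = 1` and the
unitaries `T G = e^{-iG·r}`, together with an isolated set of two bands. -/
structure Valley (b : Module.Basis (Fin 2) ℝ Plane) (E : Type*) [NormedAddCommGroup E]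
    [InnerProductSpace ℂ E] [CompleteSpace E] where
  /-- the antiunitary operator `C₂𝓏𝒯` -/
  C : E ≃ₗᵢ⋆[ℂ] E
  C_sq : ∀ x, C (C x) = x
  /-- the unitary operators `e^{-iG·r}` -/
  T : recip b → E ≃ₗᵢ[ℂ] E
  T_add : ∀ G G' x, T (G + G') x = T G (T G' x)
  C_T : ∀ G x, C (T G x) = T G (C x)
  /-- the Bloch Hamiltonian, bounded or unbounded -/
  H : Plane → E →ₗ.[ℂ] E
  H_selfAdjoint : ∀ k, IsSelfAdjoint (H k)
  H_C : ∀ k x y, (x, y) ∈ (H k).graph → (C x, C y) ∈ (H k).graph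
  H_T : ∀ k (G : recip b) x y, (x, y) ∈ (H k).graph → (T G x, T G y) ∈ (H (k + G)).graph
  /-- lower edge of an energy window containing exactly the two bands at each momentum -/
  lo : Plane → ℝ
  /-- upper edge of the energy window -/
  hi : Plane → ℝ
  lo_continuous : Continuous lo
  hi_continuous : Continuous hi
  lo_periodic : ∀ k (G : recip b), lo (k + G) = lo k
  hi_periodic : ∀ k (G : recip b), hi (k + G) = hi k
  /-- the projection onto the two bands -/
  P : Plane → E →L[ℂ] E
  P_proj : ∀ k, IsStarProjection (P k)
  /-- `P k` projects onto the span of the eigenvectors with energies in the window -/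
  P_range : ∀ k, LinearMap.range (P k : E →ₗ[ℂ] E) =
    Submodule.span ℂ {x : E | ∃ e : ℝ, lo k < e ∧ e < hi k ∧ (x, (e : ℂ) • x) ∈ (H k).graph}
  P_rank : ∀ k, Module.finrank ℂ (LinearMap.range (P k : E →ₗ[ℂ] E)) = 2
  /-- on the orthogonal complement of the two bands, `H k` has no spectrum in the window -/
  isolated : ∀ k x y, (x, y) ∈ (H k).graph → P k x = 0 →
    (hi k - lo k) / 2 * ‖x‖ ≤ ‖y - (((lo k + hi k) / 2 : ℝ) : ℂ) • x‖
  /-- smooth dependence on the momentum -/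
  P_smooth : ContDiff ℝ ∞ P

namespace Valley

variable {b : Module.Basis (Fin 2) ℝ Plane} {E : Type*} [NormedAddCommGroup E]
  [InnerProductSpace ℂ E] [CompleteSpace E]

/-- A gauge: at each momentum an orthonormal basis `u(k) = (|u_{k,1}⟩, |u_{k,2}⟩)` of the two bands,
with `|u_{k+G}⟩ = e^{-iG·r}|u_k⟩`; no continuity in `k` is required. -/
structure IsGauge (V : Valley b E) (u : Plane → Fin 2 → E) : Prop where
  orthonormal : ∀ k, Orthonormal ℂ (u k)
  mem : ∀ k a, V.P k (u k a) = u k a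
  periodic : ∀ k (G : recip b) a, u (k + G) a = V.T G (u k a)

/-- `⟨u_{γ(0)}| P(k_1) P(k_2) ⋯ P(k_L) |u_{γ(1)}⟩` with `k_j = γ(j / (L+1))`. -/
def wilsonApprox (V : Valley b E) (u : Plane → Fin 2 → E) (γ : ℝ → Plane) (L : ℕ) :
    Matrix (Fin 2) (Fin 2) ℂ :=
  Matrix.of fun a a' => inner ℂ (u (γ 0) a)
    ((List.ofFn fun j : Fin L => V.P (γ (((j : ℕ) + 1 : ℝ) / ((L : ℝ) + 1)))).prod (u (γ 1) a'))

/-- The Wilson line matrix along the path `γ` from `γ 0` to `γ 1`. -/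
def wilson (V : Valley b E) (u : Plane → Fin 2 → E) (γ : ℝ → Plane) :
    Matrix (Fin 2) (Fin 2) ℂ :=
  limUnder atTop (V.wilsonApprox u γ)

/-- `det W(k → k')`, computed along the straight path. -/
def detW (V : Valley b E) (u : Plane → Fin 2 → E) (k k' : Plane) : ℂ :=
  (V.wilson u (segmentPath k k')).det

/-- Orientability: for each `β = 1, 2` the Wilson line from some `k` straight to `k + b_β` has
determinant one (in any gauge; this determinant does not depend on the gauge). -/
def Orientable (V : Valley b E) : Prop :=
  ∀ u, V.IsGauge u → ∀ β : Fin 2, ∃ k, V.detW u k (k + b β) = 1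

/-- `|u_a^{C₂𝓏𝒯}⟩ = C₂𝓏𝒯 |u_a⟩`. -/
def conjFrame (V : Valley b E) (u : Plane → Fin 2 → E) (k : Plane) (a : Fin 2) : E :=
  V.C (u k a)

/-- The sewing matrix `U(k)` of `C₂𝓏𝒯`, with `C₂𝓏𝒯|u_k⟩ = |u_k⟩U(k)`. -/
def sewing (V : Valley b E) (u : Plane → Fin 2 → E) (k : Plane) : Matrix (Fin 2) (Fin 2) ℂ :=
  Matrix.of fun a a' => inner ℂ (u k a) (V.conjFrame u k a')

/-- `η_{k₀}(k) = √det⟨u_{k₀}^{C₂𝓏𝒯}|u_{k₀}⟩ · det W(k₀,k)`, principal square root. -/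
def eta (V : Valley b E) (u : Plane → Fin 2 → E) (k₀ k : Plane) : ℂ :=
  (Matrix.det (Matrix.of fun a a' => inner ℂ (V.conjFrame u k₀ a) (u k₀ a'))) ^ (1 / 2 : ℂ) *
    V.detW u k₀ k

/-- `Q_{k₀}(k) = (η_{k₀}(k)^* / √2) |u_k⟩(-iτ_y)⟨u_k^{C₂𝓏𝒯}|`. -/
def Q₀ (V : Valley b E) (u : Plane → Fin 2 → E) (k₀ k : Plane) : E →L[ℂ] E :=
  (conj (V.eta u k₀ k) / (Real.sqrt 2 : ℂ)) •
    ketbra (u k) (-Complex.I • pauliY) (V.conjFrame u k)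

/-- `Φ_{k₀}(k) = (1/√2) Tr[Q_{k₀} ∂_{k_x}P ∂_{k_y}P] - (∂_{k_x} ↔ ∂_{k_y})`. -/
def Φ₀ (V : Valley b E) (u : Plane → Fin 2 → E) (k₀ k : Plane) : ℂ :=
  (1 / (Real.sqrt 2 : ℂ)) * curvatureTrace (V.Q₀ u k₀ k) V.P k

/-- `N_{k₀} = (1/2π) ∫_{cell} Φ_{k₀}`. -/
def N₀ (V : Valley b E) (u : Plane → Fin 2 → E) (k₀ : Plane) : ℂ :=
  (1 / (2 * Real.pi) : ℂ) * ∫ k in unitCell b, V.Φ₀ u k₀ k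

/-- The Euler number `N = |N_{k₀}|`. -/
def eulerNumber (V : Valley b E) (u : Plane → Fin 2 → E) (k₀ : Plane) : ℝ := ‖V.N₀ u k₀‖

/-- `Q(k) = (N_{k₀} / N) Q_{k₀}(k)`. -/
def Q (V : Valley b E) (u : Plane → Fin 2 → E) (k₀ k : Plane) : E →L[ℂ] E :=
  (V.N₀ u k₀ / (V.eulerNumber u k₀ : ℂ)) • V.Q₀ u k₀ k

/-- `Φ(k) = (N_{k₀} / N) Φ_{k₀}(k)`. -/
def Φ (V : Valley b E) (u : Plane → Fin 2 → E) (k₀ k : Plane) : ℂ :=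
  (V.N₀ u k₀ / (V.eulerNumber u k₀ : ℂ)) * V.Φ₀ u k₀ k

/-- A real oriented gauge: the frame is `C₂𝓏𝒯`-invariant and all its Wilson lines have
determinant one. -/
structure IsRealOriented (V : Valley b E) (u : Plane → Fin 2 → E) : Prop extends V.IsGauge u where
  real : ∀ k a, V.C (u k a) = u k a
  oriented : ∀ k k', V.detW u k k' = 1

/-- The Chern gauge `|u^{Ch}⟩ = |u⟩ (1/√2) (1 1; i -i)` built from a real oriented gauge `u`. -/
def chernFrame (u : Plane → Fin 2 → E) (k : Plane) : Fin 2 → E :=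
  ![(1 / (Real.sqrt 2 : ℂ)) • (u k 0 + Complex.I • u k 1),
    (1 / (Real.sqrt 2 : ℂ)) • (u k 0 - Complex.I • u k 1)]

/-- The rank-one projection `|u_a⟩⟨u_a|`. -/
def bandProj (u : Plane → Fin 2 → E) (a : Fin 2) (k : Plane) : E →L[ℂ] E :=
  InnerProductSpace.rankOne ℂ (u k a) (u k a)

/-- The Chern number `(1/2π) ∫_{cell} F_a` of the `a`-th component of a frame, with Berry
curvature `F_a = -i Tr[p ∂_{k_x}p ∂_{k_y}p] - (∂_{k_x} ↔ ∂_{k_y})`, `p = |u_a⟩⟨u_a|`. -/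
def chernNumber (b : Module.Basis (Fin 2) ℝ Plane) (u : Plane → Fin 2 → E) (a : Fin 2) : ℂ :=
  (1 / (2 * Real.pi) : ℂ) *
    ∫ k in unitCell b, -Complex.I * curvatureTrace (bandProj u a k) (bandProj u a) k

end Valley

/-- The two pairing channels `⊥` and `∥`. -/
inductive Channel
  | perp
  | para

/-- `(-1)^b`: `(-1)^⊥ = 1`, `(-1)^∥ = -1`. -/
def Channel.sgn : Channel → ℤ
  | .perp => 1
  | .para => -1

section Pairing

variable {b : Module.Basis (Fin 2) ℝ Plane}
  {E₁ : Type*} [NormedAddCommGroup E₁] [InnerProductSpace ℂ E₁] [CompleteSpace E₁]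
  {E₂ : Type*} [NormedAddCommGroup E₂] [InnerProductSpace ℂ E₂] [CompleteSpace E₂]

/-- An intervalley `C₂𝓏𝒯`-invariant pairing
`∑_k c†_{+,k} (Δ(k) ⊗ Π) (c†_{-,-k})ᵀ + h.c.`, with `c†` the creation operators of the gauges
`u₁` (valley `+`) and `u₂` (valley `-`). As `C₂𝓏𝒯` acts by
`c†_{±,k} ↦ c†_{±,k} (U_±(k) ⊗ i s_y)` and is antilinear, invariance reads
`(U₊(k) ⊗ i s_y) (Δ(k) ⊗ Π)^* (U₋(-k) ⊗ i s_y)ᵀ = Δ(k) ⊗ Π`. -/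
structure IsPairing (V₁ : Valley b E₁) (V₂ : Valley b E₂) (u₁ : Plane → Fin 2 → E₁)
    (u₂ : Plane → Fin 2 → E₂) (Δ : Plane → Matrix (Fin 2) (Fin 2) ℂ)
    (Sp : Matrix (Fin 2) (Fin 2) ℂ) : Prop where
  periodic : ∀ k (G : recip b), Δ (k + G) = Δ k
  spin_invariant : pauliY * Sp.map conj * pauliY = Sp
  spin_unitary : Spᴴ * Sp = 1
  invariant : ∀ k, (V₁.sewing u₁ k ⊗ₖ (Complex.I • pauliY)) * (Δ k ⊗ₖ Sp).map conj *
    (V₂.sewing u₂ (-k) ⊗ₖ (Complex.I • pauliY))ᵀ = Δ k ⊗ₖ Sp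
  smooth : ContDiff ℝ ∞ fun k => ∑ a, ∑ a', Δ k a a' • (u₁ k a ⊗ₜ[ℂ] u₂ (-k) a')

/-- `P_Δ(k) = |u_{+,k}⟩ Δ(k) ⟨u_{-,-k}^{C₂𝓏𝒯}|`. -/
def PΔ (V₂ : Valley b E₂) (u₁ : Plane → Fin 2 → E₁) (u₂ : Plane → Fin 2 → E₂)
    (Δ : Plane → Matrix (Fin 2) (Fin 2) ℂ) (k : Plane) : E₂ →L[ℂ] E₁ :=
  ketbra (u₁ k) (Δ k) (V₂.conjFrame u₂ (-k))

/-- The pairing matrix after passing from the gauges `u₁`, `u₂` to the gauges `u₁'`, `u₂'`: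
with `|u'_{α,k}⟩ = |u_{α,k}⟩R_{α,k}`, it is `R_{+,k}† Δ(k) R_{-,-k}^*`. -/
def changeGauge (u₁ u₁' : Plane → Fin 2 → E₁) (u₂ u₂' : Plane → Fin 2 → E₂)
    (Δ : Plane → Matrix (Fin 2) (Fin 2) ℂ) (k : Plane) : Matrix (Fin 2) (Fin 2) ℂ :=
  (Matrix.of fun a a' => inner ℂ (u₁ k a) (u₁' k a'))ᴴ * Δ k *
    (Matrix.of fun a a' => inner ℂ (u₂ (-k) a) (u₂' (-k) a')).map conj

/-- The data entering the channel splitting: the two valleys, a gauge and a base point for each of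
them, and a pairing matrix. -/
structure Data (b : Module.Basis (Fin 2) ℝ Plane) (E₁ E₂ : Type*)
    [NormedAddCommGroup E₁] [InnerProductSpace ℂ E₁] [CompleteSpace E₁]
    [NormedAddCommGroup E₂] [InnerProductSpace ℂ E₂] [CompleteSpace E₂] where
  V₁ : Valley b E₁
  V₂ : Valley b E₂
  u₁ : Plane → Fin 2 → E₁
  u₂ : Plane → Fin 2 → E₂
  k₁ : Plane
  k₂ : Plane
  Δ : Plane → Matrix (Fin 2) (Fin 2) ℂ

/-- The four sides of the unit square, traversed counterclockwise. -/
def squareSide (i : Fin 4) (t : ℝ) : ℝ × ℝ :=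
  (![(t, 0), (1, t), (1 - t, 1), (0, 1 - t)] : Fin 4 → ℝ × ℝ) i

/-- A closed region of the torus with piecewise smooth boundary, presented by a decomposition into
finitely many positively oriented non-overlapping curvilinear quadrilaterals
`cell j : [0,1]² → ℝ²` (modulo the lattice). Each of the four sides of each quadrilateral is either
listed in `bdry`, or glued, with reversed orientation, to another such side. -/
structure Region (b : Module.Basis (Fin 2) ℝ Plane) where
  /-- number of quadrilaterals -/
  n : ℕ
  cell : Fin n → ℝ × ℝ → Plane
  smooth : ∀ j, ContDiff ℝ 2 (cell j)
  jac_pos : ∀ j, ∀ p ∈ Set.Ioo (0 : ℝ) 1 ×ˢ Set.Ioo (0 : ℝ) 1,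
    0 < (fderiv ℝ (cell j) p (1, 0)) 0 * (fderiv ℝ (cell j) p (0, 1)) 1 -
      (fderiv ℝ (cell j) p (1, 0)) 1 * (fderiv ℝ (cell j) p (0, 1)) 0
  nonoverlap : ∀ j j', ∀ p ∈ Set.Ioo (0 : ℝ) 1 ×ˢ Set.Ioo (0 : ℝ) 1,
    ∀ p' ∈ Set.Ioo (0 : ℝ) 1 ×ˢ Set.Ioo (0 : ℝ) 1,
      cell j p - cell j' p' ∈ recip b → j = j' ∧ p = p'
  /-- the sides forming the oriented boundary -/
  bdry : Finset (Fin n × Fin 4)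
  partner : Fin n × Fin 4 → Fin n × Fin 4
  partner_not_mem : ∀ s ∉ bdry, partner s ∉ bdry
  partner_partner : ∀ s ∉ bdry, partner (partner s) = s
  glued : ∀ s ∉ bdry, ∃ G ∈ recip b, ∀ t ∈ Set.Icc (0 : ℝ) 1,
    cell (partner s).1 (squareSide (partner s).2 t) = cell s.1 (squareSide s.2 (1 - t)) + G

namespace Region

/-- The sides of the quadrilaterals, traversed counterclockwise. -/
def side (D : Region b) (s : Fin D.n × Fin 4) (t : ℝ) : Plane :=
  D.cell s.1 (squareSide s.2 t)

/-- The (lattice-periodic) subset of `ℝ²` covered by the region. -/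
def carrier (D : Region b) : Set Plane :=
  {k | ∃ j, ∃ p ∈ Set.Icc (0 : ℝ) 1 ×ˢ Set.Icc (0 : ℝ) 1, ∃ G ∈ recip b, k = D.cell j p + G}

/-- The line integral `∮_{∂D} v · dk` of a periodic one-form `v` along the oriented boundary. -/
def boundaryIntegral (D : Region b) (v : Plane → Plane → ℂ) : ℂ :=
  ∑ s ∈ D.bdry, ∫ t in (0 : ℝ)..1, v (D.side s t) (deriv (D.side s) t)

end Region

namespace Data

/-- The same physical system, described in other gauges and with other base points. -/
def regauge (S : Data b E₁ E₂) (u₁' : Plane → Fin 2 → E₁) (u₂' : Plane → Fin 2 → E₂)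
    (k₁' k₂' : Plane) : Data b E₁ E₂ where
  V₁ := S.V₁
  V₂ := S.V₂
  u₁ := u₁'
  u₂ := u₂'
  k₁ := k₁'
  k₂ := k₂'
  Δ := changeGauge S.u₁ u₁' S.u₂ u₂' S.Δ

/-- The same normal state, gauges and base points with another pairing matrix. -/
def withPairing (S : Data b E₁ E₂) (Δ' : Plane → Matrix (Fin 2) (Fin 2) ℂ) : Data b E₁ E₂ :=
  { S with Δ := Δ' }

/-- `P_Δ(k)`. -/
def PΔ (S : Data b E₁ E₂) : Plane → E₂ →L[ℂ] E₁ := EulerPairing.PΔ S.V₂ S.u₁ S.u₂ S.Δ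

/-- `Q_+(k)`. -/
def Q₁ (S : Data b E₁ E₂) : Plane → E₁ →L[ℂ] E₁ := S.V₁.Q S.u₁ S.k₁

/-- `Q_-(k)`. -/
def Q₂ (S : Data b E₁ E₂) : Plane → E₂ →L[ℂ] E₂ := S.V₂.Q S.u₂ S.k₂

/-- The Euler number `N_+`. -/
def N₁ (S : Data b E₁ E₂) : ℝ := S.V₁.eulerNumber S.u₁ S.k₁

/-- The Euler number `N_-`. -/
def N₂ (S : Data b E₁ E₂) : ℝ := S.V₂.eulerNumber S.u₂ S.k₂

/-- `P_b(k) = ½ P_Δ(k) - (-1)^b Q_+(k) P_Δ(k) Q_-(-k)`. -/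
def Pb (S : Data b E₁ E₂) (c : Channel) (k : Plane) : E₂ →L[ℂ] E₁ :=
  (1 / 2 : ℂ) • S.PΔ k - (c.sgn : ℂ) • (S.Q₁ k ∘L S.PΔ k ∘L S.Q₂ (-k))

/-- The channel `Δ_b(k)`: the matrix of `P_b(k)`, i.e.
`P_b(k) = |u_{+,k}⟩ Δ_b(k) ⟨u_{-,-k}^{C₂𝓏𝒯}|`. -/
def Δb (S : Data b E₁ E₂) (c : Channel) (k : Plane) : Matrix (Fin 2) (Fin 2) ℂ :=
  Matrix.of fun a a' => inner ℂ (S.u₁ k a) (S.Pb c k (S.V₂.conjFrame S.u₂ (-k) a'))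

/-- `|Δ_b(k)| = √(½ Tr[Δ_b(k) Δ_b(k)†])`. -/
def absΔ (S : Data b E₁ E₂) (c : Channel) (k : Plane) : ℝ :=
  Real.sqrt ((1 / 2) * (Matrix.trace (S.Δb c k * (S.Δb c k)ᴴ)).re)

/-- `P̂_b(k) = P_b(k) / |Δ_b(k)|`. -/
def Phat (S : Data b E₁ E₂) (c : Channel) (k : Plane) : E₂ →L[ℂ] E₁ :=
  ((S.absΔ c k : ℂ))⁻¹ • S.Pb c k

/-- `v_b(k) · w = (1/√2) Tr[Q_+(k) P̂_b(k) (w · ∇) P̂_b(k)†]`; only used where `|Δ_b(k)| ≠ 0`. -/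
def vb (S : Data b E₁ E₂) (c : Channel) (k w : Plane) : ℂ :=
  (1 / (Real.sqrt 2 : ℂ)) * frTrace (S.Q₁ k ∘L S.Phat c k ∘L
    fderiv ℝ (fun q => ContinuousLinearMap.adjoint (S.Phat c q)) k w)

/-- `W_b(D) = (1/2π) ∮_{∂D} v_b · dk + (1/2π) ∫_D [Φ_+(k) - (-1)^b Φ_-(-k)] d²k`. -/
def winding (S : Data b E₁ E₂) (c : Channel) (D : Region b) : ℂ :=
  (1 / (2 * Real.pi) : ℂ) * D.boundaryIntegral (S.vb c) +
    (1 / (2 * Real.pi) : ℂ) * ∫ k in D.carrier ∩ unitCell b,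
      (S.V₁.Φ S.u₁ S.k₁ k - (c.sgn : ℂ) * S.V₂.Φ S.u₂ S.k₂ (-k))

/-- The zeros of `Δ_b` on the torus. -/
def zeroSet (S : Data b E₁ E₂) (c : Channel) : Set (Torus b) :=
  toTorus b '' {k | S.absΔ c k = 0}

/-- The connected regions of zeros (points, lines, areas). -/
abbrev ZeroRegion (S : Data b E₁ E₂) (c : Channel) : Type :=
  ConnectedComponents (S.zeroSet c)

/-- The momenta lying in the region `i` of zeros. -/
def zeroPoints (S : Data b E₁ E₂) (c : Channel) (i : S.ZeroRegion c) : Set Plane :=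
  {k | ∃ h : toTorus b k ∈ S.zeroSet c,
    (ConnectedComponents.mk (⟨toTorus b k, h⟩ : S.zeroSet c)) = i}

/-- `D` is a valid choice of `D_{b,i}`: it is connected on the torus, contains the region `i` of
zeros in its interior and no other zeros, and its boundary touches no zeros. -/
structure Encloses (S : Data b E₁ E₂) (c : Channel) (D : Region b) (i : S.ZeroRegion c) :
    Prop where
  connected : IsConnected (toTorus b '' D.carrier)
  interior : S.zeroPoints c i ⊆ interior D.carrier
  no_other : ∀ k ∈ D.carrier, S.absΔ c k = 0 → k ∈ S.zeroPoints c i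
  boundary : ∀ s ∈ D.bdry, ∀ t ∈ Set.Icc (0 : ℝ) 1, S.absΔ c (D.side s t) ≠ 0

/-- Every region `i` of zeros of `Δ_b` has a well-defined integer winding number `W_{b,i}` (the
common value of `W_b(D)` over all valid choices of `D = D_{b,i}`, of which there is at least
one), and `∑_i W_{b,i} = x`. -/
def TotalWinding (S : Data b E₁ E₂) (c : Channel) (x : ℂ) : Prop :=
  ∃ w : S.ZeroRegion c → ℤ,
    (∀ i, (∃ D, S.Encloses c D i) ∧ ∀ D, S.Encloses c D i → S.winding c D = (w i : ℂ)) ∧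
    ((∑ᶠ i, w i : ℤ) : ℂ) = x

end Data

end Pairing

end EulerPairing

end

open EulerPairing

open MeasureTheory Filter Topology
open scoped ContDiff ComplexConjugate TensorProduct Matrix Kronecker InnerProductSpace NNReal

set_option linter.unusedSectionVars false
set_option linter.unusedSimpArgs false

noncomputable section

/-! Fix a valley. The `C`-invariant vectors in the range of `P k` form a real plane, and `√2 Q` is a
rotation `J k` of that plane by a right angle: `-iτ_y` is antisymmetric, so a change of frame
multiplies `|u⟩(-iτ_y)⟨u^C|` by a determinant, and the phase `η*` removes this determinant
(`exists_Q₀_eq`). Two continuous families of such rotations agree up to one global sign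
(`cstr_family_unique`). This fact gives the independence of gauges and base points (`sign_change`),
the parallelism and smoothness of `J`, and, since orientability fixes the sign across the cell, its
lattice equivariance (`cstr_equivariant`). The factor `N_{k₀} / N` fixes the remaining sign.

The eigenline of `J` with eigenvalue `-i` is a complex line bundle on the torus, whose Berry
curvature is `½ Tr J [∂ₓP, ∂ᵧP] = Φ` (`berry_lineProj`). The Euler number is thus a Chern number.

Because `J² = -1` on the plane, `P_b` is the part of `P_Δ` with `J₊ P_b = (-1)^b P_b J₋(-k)`
(`J₁_Pb`). It maps the eigenline of `(-1)^b J₋(-k)` to that of `J₊(k)`, is determined by this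
restriction because it is real, and satisfies `P_b P_b† = |Δ_b|² P₊` (`Pb_mul_adj`). So `Δ_b`
amounts to a map of line bundles with Chern numbers `(-1)^b N₋` and `N₊`, with the same zeros; the
winding numbers are studied for such maps (`IsLineMap`). Away from the zeros `v_b` is the difference
of the connection forms of corresponding unit sections (`imForm_eq_sub`), so its curl cancels the
curvature term (`curl_normForm`). After a smooth cut-off of `v_b` near the zeros, Stokes' theorem
turns `W_b(D)` into the integral of a density supported near the zeros. Hence `W_b(D)` depends only
on the enclosed zeros (`lineWinding_congr`), and the sum over all components is the curvature
integral over the closed torus, where the exact part drops out (`sum_lineWinding`).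

For integrality, the zeros are enclosed by regions made of small parallelograms (`exists_region`).
Transport around a parallelogram is `exp(i flux)` (`hasHolonomy`), transports along glued sides
cancel, and along boundary sides the transport is `exp(-i ∫ v)` up to quotients of phases, which
telescope (`lineWinding_integer`). A region without boundary gives the integrality of Chern numbers
(`chern_integer`).

A pairing with nowhere vanishing `Δ_⊥` exists for `N₊ = N₋` because line bundles on the torus with
equal Chern numbers are isomorphic (`exists_smooth_iso`): transport along a comb of lines gives
sections with explicit transition phases, these are absorbed by an exponential, and a convolution
makes the result smooth. Adding the conjugate by `C` makes the isomorphism a real pairing. Finally,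
the two vectors of a Chern gauge span the eigenlines of the rotation `rot` of its real frame for
`-i` and `+i`; the second Chern number follows from the first by `J ↦ -J`. -/

namespace EulerPairing

/-! ### Real differential calculus of complex operators and antilinear maps. -/

section RealStructure

variable {E F G : Type*} [NormedAddCommGroup E] [InnerProductSpace ℂ E]
  [NormedAddCommGroup F] [InnerProductSpace ℂ F] [NormedAddCommGroup G] [InnerProductSpace ℂ G]
  {X : Type*} [NormedAddCommGroup X] [NormedSpace ℝ X]

/-- Composition of complex operators as a real bilinear map. -/
def compR (E F G : Type*) [NormedAddCommGroup E] [InnerProductSpace ℂ E]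
    [NormedAddCommGroup F] [InnerProductSpace ℂ F] [NormedAddCommGroup G]
    [InnerProductSpace ℂ G] : (F →L[ℂ] G) →L[ℝ] (E →L[ℂ] F) →L[ℝ] (E →L[ℂ] G) :=
  (ContinuousLinearMap.compL ℂ E F G).bilinearRestrictScalars ℝ

/-- Evaluation of complex operators as a real bilinear map. -/
def applyR (E F : Type*) [NormedAddCommGroup E] [InnerProductSpace ℂ E]
    [NormedAddCommGroup F] [InnerProductSpace ℂ F] : (E →L[ℂ] F) →L[ℝ] E →L[ℝ] F :=
  (ContinuousLinearMap.id ℂ (E →L[ℂ] F)).bilinearRestrictScalars ℝ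

@[simp] lemma compR_apply (A : F →L[ℂ] G) (B : E →L[ℂ] F) : compR E F G A B = A ∘L B := rfl

@[simp] lemma applyR_apply (A : E →L[ℂ] F) (x : E) : applyR E F A x = A x := rfl

lemma _root_.ContDiffAt.opComp {n : WithTop ℕ∞} {A : X → F →L[ℂ] G} {B : X → E →L[ℂ] F} {k : X}
    (hA : ContDiffAt ℝ n A k) (hB : ContDiffAt ℝ n B k) :
    ContDiffAt ℝ n (fun q => A q ∘L B q) k :=
  ContDiffAt.comp (f := fun q => (A q, B q))
    (g := fun x : (F →L[ℂ] G) × (E →L[ℂ] F) => compR E F G x.1 x.2) k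
    (compR E F G).isBoundedBilinearMap.contDiff.contDiffAt (hA.prodMk hB)

lemma _root_.ContDiffAt.opApply {n : WithTop ℕ∞} {A : X → E →L[ℂ] F} {v : X → E} {k : X}
    (hA : ContDiffAt ℝ n A k) (hv : ContDiffAt ℝ n v k) :
    ContDiffAt ℝ n (fun q => A q (v q)) k :=
  ContDiffAt.comp (f := fun q => (A q, v q))
    (g := fun x : (E →L[ℂ] F) × E => applyR E F x.1 x.2) k
    (applyR E F).isBoundedBilinearMap.contDiff.contDiffAt (hA.prodMk hv)

lemma _root_.HasFDerivAt.opComp {A : X → F →L[ℂ] G} {B : X → E →L[ℂ] F} {k : X}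
    {A' : X →L[ℝ] F →L[ℂ] G} {B' : X →L[ℝ] E →L[ℂ] F}
    (hA : HasFDerivAt A A' k) (hB : HasFDerivAt B B' k) :
    HasFDerivAt (fun q => A q ∘L B q)
      ((compR E F G).precompR X (A k) B' + (compR E F G).precompL X A' (B k)) k :=
  (compR E F G).hasFDerivAt_of_bilinear hA hB

lemma _root_.HasFDerivAt.opApply {A : X → E →L[ℂ] F} {v : X → E} {k : X}
    {A' : X →L[ℝ] E →L[ℂ] F} {v' : X →L[ℝ] E}
    (hA : HasFDerivAt A A' k) (hv : HasFDerivAt v v' k) :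
    HasFDerivAt (fun q => A q (v q))
      ((applyR E F).precompR X (A k) v' + (applyR E F).precompL X A' (v k)) k :=
  (applyR E F).hasFDerivAt_of_bilinear hA hv

lemma _root_.HasDerivAt.opApply {A : ℝ → E →L[ℂ] F} {v : ℝ → E} {t : ℝ}
    {A' : E →L[ℂ] F} {v' : E} (hA : HasDerivAt A A' t) (hv : HasDerivAt v v' t) :
    HasDerivAt (fun q => A q (v q)) (A' (v t) + A t v') t := by
  have := (HasFDerivAt.opApply hA.hasFDerivAt hv.hasFDerivAt).hasDerivAt
  simpa [ContinuousLinearMap.precompR, ContinuousLinearMap.precompL, add_comm] using this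

lemma fderiv_opComp {A : X → F →L[ℂ] G} {B : X → E →L[ℂ] F} {k : X}
    (hA : DifferentiableAt ℝ A k) (hB : DifferentiableAt ℝ B k) (w : X) :
    fderiv ℝ (fun q => A q ∘L B q) k w =
      fderiv ℝ A k w ∘L B k + A k ∘L fderiv ℝ B k w := by
  rw [(HasFDerivAt.opComp hA.hasFDerivAt hB.hasFDerivAt).fderiv]
  simp [ContinuousLinearMap.precompR, ContinuousLinearMap.precompL, add_comm]

lemma fderiv_opApply {A : X → E →L[ℂ] F} {v : X → E} {k : X}
    (hA : DifferentiableAt ℝ A k) (hv : DifferentiableAt ℝ v k) (w : X) :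
    fderiv ℝ (fun q => A q (v q)) k w = fderiv ℝ A k w (v k) + A k (fderiv ℝ v k w) := by
  rw [(HasFDerivAt.opApply hA.hasFDerivAt hv.hasFDerivAt).fderiv]
  simp [ContinuousLinearMap.precompR, ContinuousLinearMap.precompL, add_comm]

/-- The adjoint as a real linear map. -/
def adjR (E F : Type*) [NormedAddCommGroup E] [InnerProductSpace ℂ E] [CompleteSpace E]
    [NormedAddCommGroup F] [InnerProductSpace ℂ F] [CompleteSpace F] :
    (E →L[ℂ] F) →L[ℝ] (F →L[ℂ] E) :=
  AddMonoidHom.toRealLinearMap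
    ((ContinuousLinearMap.adjoint (𝕜 := ℂ) (E := E) (F := F)).toLinearEquiv.toAddEquiv.toAddMonoidHom)
    (ContinuousLinearMap.adjoint (𝕜 := ℂ) (E := E) (F := F)).continuous

/-- An antiunitary map as a real linear map. -/
def antiR (C : E ≃ₗᵢ⋆[ℂ] F) : E →L[ℝ] F :=
  AddMonoidHom.toRealLinearMap C.toLinearEquiv.toAddEquiv.toAddMonoidHom C.continuous

@[simp] lemma antiR_apply (C : E ≃ₗᵢ⋆[ℂ] F) (x : E) : antiR C x = C x := rfl

section Adjoint
variable [CompleteSpace E] [CompleteSpace F]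

@[simp] lemma adjR_apply (A : E →L[ℂ] F) : adjR E F A = ContinuousLinearMap.adjoint A := rfl

lemma _root_.ContDiffAt.opAdjoint {n : WithTop ℕ∞} {A : X → E →L[ℂ] F} {k : X}
    (hA : ContDiffAt ℝ n A k) :
    ContDiffAt ℝ n (fun q => ContinuousLinearMap.adjoint (A q)) k :=
  (adjR E F).contDiff.contDiffAt.comp k hA

lemma fderiv_adjoint {A : X → E →L[ℂ] F} {k : X} (hA : DifferentiableAt ℝ A k) (w : X) :
    fderiv ℝ (fun q => ContinuousLinearMap.adjoint (A q)) k w =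
      ContinuousLinearMap.adjoint (fderiv ℝ A k w) := by
  have := ((adjR E F).hasFDerivAt.comp k hA.hasFDerivAt).fderiv
  rw [show (fun q => ContinuousLinearMap.adjoint (A q)) = (adjR E F) ∘ A from rfl, this]
  simp

end Adjoint

lemma fderiv_applyConst {A : X → E →L[ℂ] F} {k : X} (hA : DifferentiableAt ℝ A k) (w : X)
    (x : E) : fderiv ℝ (fun q => A q x) k w = fderiv ℝ A k w x := by
  rw [fderiv_opApply hA (differentiableAt_const x)]
  simp

/-- A derivative of operators intertwining `S` and `S'` intertwines them. -/
lemma fderiv_intertwine {A : X → E →L[ℂ] F} {A' : X → E →L[ℂ] F} {k : X}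
    (S : E →L[ℝ] E) (S' : F →L[ℝ] F)
    (hA : DifferentiableAt ℝ A k) (hA' : DifferentiableAt ℝ A' k)
    (h : ∀ q x, S' (A q x) = A' q (S x)) (w : X) (x : E) :
    S' (fderiv ℝ A k w x) = fderiv ℝ A' k w (S x) := by
  rw [← fderiv_applyConst hA, ← fderiv_applyConst hA']
  have h1 : (fun q => A' q (S x)) = S' ∘ (fun q => A q x) := by
    funext q; exact (h q x).symm
  have h2 : DifferentiableAt ℝ (fun q => A q x) k :=
    (HasFDerivAt.opApply hA.hasFDerivAt (hasFDerivAt_const x k)).differentiableAt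
  rw [h1, fderiv_comp k S'.differentiableAt h2]
  simp

end RealStructure

/-! ### Antiunitary maps and inner products. -/

section Antiunitary

variable {E : Type*} [NormedAddCommGroup E] [InnerProductSpace ℂ E]

/-- Norm preservation gives equality of the real parts by polarization. Applied to `I • x`, which
`C` sends to `-I • C x`, it shows that the imaginary part changes sign. -/
lemma anti_inner (C : E ≃ₗᵢ⋆[ℂ] E) (x y : E) : inner ℂ (C x) (C y) = inner ℂ y x := by
  have hadd : ∀ x y : E, (inner ℂ (C x) (C y)).re = (inner ℂ x y).re := by
    intro x y
    have h1 := norm_add_sq (𝕜 := ℂ) x y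
    have h2 := norm_add_sq (𝕜 := ℂ) (C x) (C y)
    rw [← map_add, C.norm_map, C.norm_map, C.norm_map] at h2
    have : RCLike.re (inner ℂ (C x) (C y)) = RCLike.re (inner ℂ x y) := by linarith
    simpa using this
  apply Complex.ext
  · rw [hadd, ← inner_conj_symm, Complex.conj_re]
  · have h := hadd (Complex.I • x) y
    rw [C.map_smulₛₗ] at h
    simp only [inner_smul_left, Complex.conj_I, map_neg, neg_neg] at h
    rw [← inner_conj_symm y x, Complex.conj_im]
    have h' : -(inner ℂ (C x) (C y)).im = (inner ℂ x y).im := by simpa using h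
    linarith

end Antiunitary

/-! ### The trace of a finite-rank operator in an orthonormal basis. -/

section Trace

variable {E : Type*} [NormedAddCommGroup E] [InnerProductSpace ℂ E]

/-- `A` factors through its range, which lies in the span of `u`; cyclicity of the trace moves the
computation from the range to that span. -/
lemma frTrace_eq_sum {n : ℕ} {u : Fin n → E} (hu : Orthonormal ℂ u) (A : E →L[ℂ] E)
    (hA : ∀ x, A x ∈ Submodule.span ℂ (Set.range u)) :
    frTrace A = ∑ a, inner ℂ (u a) (A (u a)) := by
  set V := Submodule.span ℂ (Set.range u) with hV
  have hle : LinearMap.range (A : E →ₗ[ℂ] E) ≤ V := by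
    rintro _ ⟨x, rfl⟩; exact hA x
  have : FiniteDimensional ℂ V := FiniteDimensional.span_of_finite ℂ (Set.finite_range u)
  have : FiniteDimensional ℂ (LinearMap.range (A : E →ₗ[ℂ] E)) :=
    Submodule.finiteDimensional_of_le hle
  let ι : LinearMap.range (A : E →ₗ[ℂ] E) →ₗ[ℂ] V := Submodule.inclusion hle
  let A' : V →ₗ[ℂ] LinearMap.range (A : E →ₗ[ℂ] E) :=
    (A : E →ₗ[ℂ] E).rangeRestrict ∘ₗ V.subtype
  have h1 : frTrace A = LinearMap.trace ℂ _ (A' ∘ₗ ι) := by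
    unfold frTrace; congr 1
  rw [h1, LinearMap.trace_comp_comm']
  have hw := orthonormal_span hu
  have hsp : ⊤ ≤ Submodule.span ℂ (Set.range fun i : Fin n =>
      (⟨u i, Submodule.subset_span (Set.mem_range_self i)⟩ : V)) := by
    have := (Module.Basis.span hu.linearIndependent).span_eq
    refine this.ge.trans (Submodule.span_mono ?_)
    rintro _ ⟨i, rfl⟩
    exact ⟨i, (Module.Basis.span_apply hu.linearIndependent i).symm⟩
  let bas : OrthonormalBasis (Fin n) ℂ V := OrthonormalBasis.mk hw hsp
  rw [LinearMap.trace_eq_sum_inner _ bas]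
  refine Finset.sum_congr rfl fun a _ => ?_
  have : bas a = ⟨u a, Submodule.subset_span (Set.mem_range_self a)⟩ := by
    simp [bas]
  rw [this]
  rfl

end Trace

/-! ### Parallel transport as a limit of products of projections. -/

section Transport

variable {E : Type*} [NormedAddCommGroup E] [InnerProductSpace ℂ E] [CompleteSpace E]

/-- `P(a) P(a+d) ⋯ P(a+nd)`. -/
def prodStep (P : Plane → E →L[ℂ] E) (a d : Plane) : ℕ → E →L[ℂ] E
  | 0 => P a
  | n + 1 => prodStep P a d n * P (a + ((n : ℝ) + 1) • d)

/-- Approximate parallel transport along the segment from `k` to `k'` in `L + 1` steps. -/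
def transportApprox (P : Plane → E →L[ℂ] E) (k k' : Plane) (L : ℕ) : E →L[ℂ] E :=
  prodStep P k (((L : ℝ) + 1)⁻¹ • (k' - k)) (L + 1)

/-- Parallel transport, from the range of `P k'` to the range of `P k`, along the segment. -/
def transport (P : Plane → E →L[ℂ] E) (k k' : Plane) : E →L[ℂ] E :=
  limUnder atTop (transportApprox P k k')

/-- A Lipschitz family of orthogonal projections. -/
structure IsProjFamily (P : Plane → E →L[ℂ] E) (K : ℝ) : Prop where
  proj : ∀ k, IsStarProjection (P k)
  lip : ∀ k k', ‖P k - P k'‖ ≤ K * ‖k - k'‖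

variable {P : Plane → E →L[ℂ] E} {K : ℝ}

lemma norm_starProjection_le {p : E →L[ℂ] E} (hp : IsStarProjection p) : ‖p‖ ≤ 1 := by
  exact IsStarProjection.norm_le p hp

lemma norm_one_sub_starProjection_le {p : E →L[ℂ] E} (hp : IsStarProjection p) :
    ‖1 - p‖ ≤ 1 := norm_starProjection_le hp.one_sub

namespace IsProjFamily

variable (h : IsProjFamily P K)
include h

lemma idem (k : Plane) : P k * P k = P k := (h.proj k).isIdempotentElem

lemma norm_le (k : Plane) : ‖P k‖ ≤ 1 := norm_starProjection_le (h.proj k)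

/-- Inserting a point between two projections costs the product of the two distances. -/
lemma norm_insert_le (a m c : Plane) :
    ‖P a * P m * P c - P a * P c‖ ≤ K ^ 2 * (‖a - m‖ * ‖m - c‖) := by
  -- Since `P m * (1 - P m) = 0`, the right side is `-P a (1 - P m) P c`; written this way it has
  -- two small factors.
  have e : P a * P m * P c - P a * P c = (P a - P m) * (1 - P m) * (P m - P c) := by
    have h1 := h.idem m
    have h2 : (P a - P m) * (1 - P m) = P a * (1 - P m) := by
      rw [sub_mul, mul_sub (P m), h1]; simp
    have h3 : (1 - P m) * (P m - P c) = -((1 - P m) * P c) := by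
      rw [mul_sub, sub_mul 1 (P m) (P m), h1]; simp
    rw [h2, mul_assoc (P a) (1 - P m), h3]
    noncomm_ring
  rw [e]
  have h1 := h.lip a m
  have h2 := h.lip m c
  calc ‖(P a - P m) * (1 - P m) * (P m - P c)‖
      ≤ ‖P a - P m‖ * ‖1 - P m‖ * ‖P m - P c‖ :=
        (norm_mul_le _ _).trans (mul_le_mul_of_nonneg_right (norm_mul_le _ _) (norm_nonneg _))
    _ ≤ (K * ‖a - m‖) * 1 * (K * ‖m - c‖) := by
        gcongr
        · exact mul_nonneg ((norm_nonneg _).trans h1) zero_le_one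
        · exact (norm_nonneg _).trans h1
        · exact norm_one_sub_starProjection_le (h.proj m)
    _ = _ := by ring

lemma continuous : Continuous P := by
  have : LipschitzWith (Real.toNNReal K) P := LipschitzWith.of_dist_le_mul fun x y => by
    rw [dist_eq_norm, dist_eq_norm]
    exact (h.lip x y).trans (mul_le_mul_of_nonneg_right (Real.le_coe_toNNReal K) (norm_nonneg _))
  exact this.continuous

lemma norm_prodStep_le (a d : Plane) (n : ℕ) : ‖prodStep P a d n‖ ≤ 1 := by
  induction n with
  | zero => exact h.norm_le a
  | succ n ih =>
    exact (norm_mul_le _ _).trans (mul_le_one₀ ih (norm_nonneg _) (h.norm_le _))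

lemma mul_prodStep (a d : Plane) (n : ℕ) : P a * prodStep P a d n = prodStep P a d n := by
  induction n with
  | zero => exact h.idem a
  | succ n ih => rw [prodStep, ← mul_assoc, ih]

lemma prodStep_mul (a d : Plane) (n : ℕ) :
    prodStep P a d n * P (a + (n : ℝ) • d) = prodStep P a d n := by
  cases n with
  | zero => simpa [prodStep] using h.idem a
  | succ n => rw [prodStep, mul_assoc]; push_cast; rw [h.idem]

lemma prodStep_add (a d : Plane) (n m : ℕ) :
    prodStep P a d (n + m) = prodStep P a d n * prodStep P (a + (n : ℝ) • d) d m := by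
  induction m with
  | zero => exact (h.prodStep_mul a d n).symm
  | succ m ih =>
    rw [← add_assoc, prodStep, ih, prodStep, mul_assoc]
    congr 3
    push_cast
    module

lemma prodStep_succ' (a d : Plane) (n : ℕ) :
    prodStep P a d (n + 1) = P a * prodStep P (a + d) d n := by
  rw [add_comm, h.prodStep_add]
  have := h.mul_prodStep (a + d) d n
  simp only [prodStep, Nat.cast_zero, zero_add, one_smul, Nat.cast_one, mul_assoc, this]

lemma star_prodStep (a d : Plane) (n : ℕ) :
    star (prodStep P a d n) = prodStep P (a + (n : ℝ) • d) (-d) n := by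
  induction n with
  | zero => simpa [prodStep] using (h.proj a).isSelfAdjoint.star_eq
  | succ n ih =>
    rw [h.prodStep_succ' _ (-d), prodStep, star_mul, ih, (h.proj _).isSelfAdjoint.star_eq]
    push_cast
    congr 2
    module

/-- By `norm_insert_le` each new factor costs the distance already covered times the step; these
costs add up to at most the square of the total length. -/
lemma norm_prodStep_sub_le (a d : Plane) (n : ℕ) :
    ‖prodStep P a d n - P a * P (a + (n : ℝ) • d)‖ ≤ K ^ 2 * (n * ‖d‖) ^ 2 := by
  induction n with
  | zero => simp [prodStep, h.idem a]
  | succ n ih =>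
    have e : prodStep P a d (n + 1) - P a * P (a + ((n + 1 : ℕ) : ℝ) • d) =
        (prodStep P a d n - P a * P (a + (n : ℝ) • d)) * P (a + ((n : ℝ) + 1) • d) +
        (P a * P (a + (n : ℝ) • d) * P (a + ((n : ℝ) + 1) • d) -
          P a * P (a + ((n : ℝ) + 1) • d)) := by
      rw [prodStep]; push_cast; noncomm_ring
    rw [e]
    have h1 := h.norm_insert_le a (a + (n : ℝ) • d) (a + ((n : ℝ) + 1) • d)
    have n1 : ‖a - (a + (n : ℝ) • d)‖ = n * ‖d‖ := by
      rw [sub_add_cancel_left, norm_neg, norm_smul]; simp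
    have n2 : ‖(a + (n : ℝ) • d) - (a + ((n : ℝ) + 1) • d)‖ = ‖d‖ := by
      rw [show (a + (n : ℝ) • d) - (a + ((n : ℝ) + 1) • d) = -d by module, norm_neg]
    rw [n1, n2] at h1
    have h2 : ‖(prodStep P a d n - P a * P (a + (n : ℝ) • d)) * P (a + ((n : ℝ) + 1) • d)‖ ≤
        K ^ 2 * (n * ‖d‖) ^ 2 :=
      (norm_mul_le _ _).trans ((mul_le_of_le_one_right (norm_nonneg _) (h.norm_le _)).trans ih)
    refine (norm_add_le _ _).trans ((add_le_add h2 h1).trans ?_)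
    push_cast
    have : 0 ≤ K ^ 2 * ((n + 1) * ‖d‖ ^ 2) := by positivity
    nlinarith

/-- The coarse steps are replaced one after the other. Each replacement costs the square of the step
length, and the remaining factors are contractions. -/
lemma norm_prodStep_refine_le (a e : Plane) (r n : ℕ) :
    ‖prodStep P a ((r : ℝ) • e) n - prodStep P a e (n * r)‖ ≤ n * (K ^ 2 * (r * ‖e‖) ^ 2) := by
  induction n with
  | zero => simp [prodStep]
  | succ n ih =>
    set X := prodStep P a ((r : ℝ) • e) n with hX
    set Y := prodStep P a e (n * r) with hY
    set c := a + ((n * r : ℕ) : ℝ) • e with hc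
    set Z := prodStep P c e r
    have e1 : prodStep P a e ((n + 1) * r) = Y * Z := by
      rw [add_mul, one_mul, h.prodStep_add]
    have e2 : prodStep P a ((r : ℝ) • e) (n + 1) = X * (P c * P (c + (r : ℝ) • e)) := by
      have h1 := h.prodStep_mul a ((r : ℝ) • e) n
      rw [show a + (n : ℝ) • (r : ℝ) • e = c by rw [hc]; push_cast; module] at h1
      rw [prodStep, ← mul_assoc, ← hX, h1]
      congr 2
      rw [hc]; push_cast; module
    have e3 : prodStep P a ((r : ℝ) • e) (n + 1) - prodStep P a e ((n + 1) * r) =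
        X * -(Z - P c * P (c + (r : ℝ) • e)) + (X - Y) * Z := by
      rw [e1, e2]; noncomm_ring
    rw [e3]
    have b1 := h.norm_prodStep_sub_le c e r
    have b2 : ‖X * -(Z - P c * P (c + (r : ℝ) • e))‖ ≤ K ^ 2 * (r * ‖e‖) ^ 2 := by
      refine (norm_mul_le _ _).trans ?_
      rw [norm_neg]
      exact (mul_le_of_le_one_left (norm_nonneg _) (h.norm_prodStep_le _ _ _)).trans b1
    have b3 : ‖(X - Y) * Z‖ ≤ n * (K ^ 2 * (r * ‖e‖) ^ 2) :=
      (norm_mul_le _ _).trans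
        ((mul_le_of_le_one_right (norm_nonneg _) (h.norm_prodStep_le _ _ _)).trans ih)
    refine (norm_add_le _ _).trans ((add_le_add b2 b3).trans (le_of_eq ?_))
    push_cast; ring

lemma norm_steps_sub_le (k k' : Plane) (n m : ℕ) (hn : 0 < n) (hm : 0 < m) :
    ‖prodStep P k ((n : ℝ)⁻¹ • (k' - k)) n -
      prodStep P k (((n * m : ℕ) : ℝ)⁻¹ • (k' - k)) (n * m)‖ ≤ K ^ 2 * ‖k' - k‖ ^ 2 / n := by
  have hn' : (0 : ℝ) < n := by exact_mod_cast hn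
  have hm' : (0 : ℝ) < m := by exact_mod_cast hm
  have := h.norm_prodStep_refine_le k (((n * m : ℕ) : ℝ)⁻¹ • (k' - k)) m n
  rw [smul_smul, show (m : ℝ) * ((n * m : ℕ) : ℝ)⁻¹ = (n : ℝ)⁻¹ by push_cast; field_simp] at this
  refine this.trans (le_of_eq ?_)
  rw [norm_smul, Real.norm_of_nonneg (by positivity)]
  push_cast
  field_simp

/-- Both subdivisions are compared with their common refinement into `(n + 1) * (m + 1)` steps. This
is the Cauchy estimate that makes the Wilson line converge. -/
lemma norm_transportApprox_sub_le (k k' : Plane) (n m : ℕ) :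
    ‖transportApprox P k k' n - transportApprox P k k' m‖ ≤
      K ^ 2 * ‖k' - k‖ ^ 2 / (n + 1) + K ^ 2 * ‖k' - k‖ ^ 2 / (m + 1) := by
  have h1 := h.norm_steps_sub_le k k' (n + 1) (m + 1) (by omega) (by omega)
  have h2 := h.norm_steps_sub_le k k' (m + 1) (n + 1) (by omega) (by omega)
  rw [mul_comm (m + 1) (n + 1), norm_sub_rev] at h2
  have e : transportApprox P k k' n - transportApprox P k k' m =
    (prodStep P k (((n + 1 : ℕ) : ℝ)⁻¹ • (k' - k)) (n + 1) -
      prodStep P k ((((n + 1) * (m + 1) : ℕ) : ℝ)⁻¹ • (k' - k)) ((n + 1) * (m + 1))) +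
    (prodStep P k ((((n + 1) * (m + 1) : ℕ) : ℝ)⁻¹ • (k' - k)) ((n + 1) * (m + 1)) -
      prodStep P k (((m + 1 : ℕ) : ℝ)⁻¹ • (k' - k)) (m + 1)) := by
    rw [sub_add_sub_cancel]
    simp [transportApprox]
  rw [e]
  refine (norm_add_le _ _).trans ((add_le_add h1 h2).trans (le_of_eq ?_))
  push_cast; ring

lemma tendsto_transport (k k' : Plane) :
    Tendsto (transportApprox P k k') atTop (𝓝 (transport P k k')) := by
  apply CauchySeq.tendsto_limUnder
  refine cauchySeq_of_le_tendsto_0 (fun N : ℕ => 2 * (K ^ 2 * ‖k' - k‖ ^ 2) * (1 / ((N : ℝ) + 1)))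
    (fun n m N hn hm => ?_) ?_
  · rw [dist_eq_norm]
    refine (h.norm_transportApprox_sub_le k k' n m).trans ?_
    have h1 : (N : ℝ) ≤ n := by exact_mod_cast hn
    have h2 : (N : ℝ) ≤ m := by exact_mod_cast hm
    have h3 : K ^ 2 * ‖k' - k‖ ^ 2 / (n + 1) ≤ K ^ 2 * ‖k' - k‖ ^ 2 / (N + 1) := by gcongr
    have h4 : K ^ 2 * ‖k' - k‖ ^ 2 / (m + 1) ≤ K ^ 2 * ‖k' - k‖ ^ 2 / (N + 1) := by gcongr
    refine (add_le_add h3 h4).trans (le_of_eq ?_)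
    ring
  · have := (tendsto_one_div_add_atTop_nhds_zero_nat (𝕜 := ℝ)).const_mul
      (2 * (K ^ 2 * ‖k' - k‖ ^ 2))
    simpa using this

lemma norm_transportApprox_sub_transport_le (k k' : Plane) (n : ℕ) :
    ‖transportApprox P k k' n - transport P k k'‖ ≤ K ^ 2 * ‖k' - k‖ ^ 2 / (n + 1) := by
  have h1 : Tendsto (fun m : ℕ => K ^ 2 * ‖k' - k‖ ^ 2 / ((n : ℝ) + 1) +
      K ^ 2 * ‖k' - k‖ ^ 2 * (1 / ((m : ℝ) + 1))) atTop
      (𝓝 (K ^ 2 * ‖k' - k‖ ^ 2 / (n + 1) + K ^ 2 * ‖k' - k‖ ^ 2 * 0)) :=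
    (tendsto_one_div_add_atTop_nhds_zero_nat.const_mul _).const_add _
  rw [mul_zero, add_zero] at h1
  refine le_of_tendsto_of_tendsto' ((h.tendsto_transport k k').const_sub _).norm h1 fun m => ?_
  refine (h.norm_transportApprox_sub_le k k' n m).trans (le_of_eq ?_)
  ring

/-- The rate of convergence at `n = 0`. Being quadratic in the length, this error does not
contribute to the derivative of the transport. -/
lemma norm_transport_sub_le (k k' : Plane) :
    ‖transport P k k' - P k * P k'‖ ≤ K ^ 2 * ‖k' - k‖ ^ 2 := by
  have := h.norm_transportApprox_sub_transport_le k k' 0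
  have e : transportApprox P k k' 0 = P k * P k' := by
    simp [transportApprox, prodStep]
  rw [e, norm_sub_rev] at this
  simpa using this

lemma proj_mul_transport (k k' : Plane) : P k * transport P k k' = transport P k k' := by
  refine tendsto_nhds_unique ((h.tendsto_transport k k').const_mul (P k)) ?_
  refine (h.tendsto_transport k k').congr fun n => ?_
  rw [transportApprox, h.mul_prodStep]

lemma star_transport (k k' : Plane) : star (transport P k k') = transport P k' k := by
  refine tendsto_nhds_unique (h.tendsto_transport k k').star ?_
  refine (h.tendsto_transport k' k).congr fun n => ?_
  rw [transportApprox, transportApprox, h.star_prodStep]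
  have : ((n : ℝ) + 1) ≠ 0 := by positivity
  push_cast
  rw [smul_smul, mul_inv_cancel₀ this, one_smul, ← smul_neg]
  congr 1 <;> abel_nf

lemma transport_mul_proj (k k' : Plane) : transport P k k' * P k' = transport P k k' := by
  have := congrArg star (h.proj_mul_transport k' k)
  rwa [star_mul, h.star_transport, (h.proj k').isSelfAdjoint.star_eq] at this

/-- Dropping the last factor replaces `P m P c P m` by `P m`, at the cost of one squared step. With
`n` steps of length `O(1/n)` the total is `O(1/n)`, so the limit is a partial isometry. -/
lemma norm_prodStep_mul_star_sub_le (a d : Plane) (n : ℕ) :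
    ‖prodStep P a d n * star (prodStep P a d n) - P a‖ ≤ n * (K ^ 2 * ‖d‖ ^ 2) := by
  induction n with
  | zero => simp [prodStep, (h.proj a).isSelfAdjoint.star_eq, h.idem]
  | succ n ih =>
    set X := prodStep P a d n with hX
    set m := a + (n : ℝ) • d
    set c := a + ((n : ℝ) + 1) • d
    have hXm : X * P m = X := h.prodStep_mul a d n
    have hXs : P m * star X = star X := by
      have := congrArg star hXm
      rwa [star_mul, (h.proj m).isSelfAdjoint.star_eq] at this
    have e1 : prodStep P a d (n + 1) * star (prodStep P a d (n + 1)) =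
        X * (P m * P c * P m) * star X := by
      rw [prodStep, star_mul, (h.proj c).isSelfAdjoint.star_eq, ← hX]
      calc X * P c * (P c * star X) = X * (P c * P c) * star X := by noncomm_ring
        _ = (X * P m) * P c * (P m * star X) := by rw [h.idem, hXm, hXs]
        _ = _ := by noncomm_ring
    have e2 : X * (P m * P c * P m) * star X - P a =
        X * (P m * P c * P m - P m * P m) * star X + (X * star X - P a) := by
      rw [mul_sub, sub_mul, h.idem, hXm]; abel
    rw [e1, e2]
    have b := h.norm_insert_le m c m
    have hmc : ‖m - c‖ = ‖d‖ := by
      rw [show m - c = -d by simp only [m, c]; module, norm_neg]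
    rw [norm_sub_rev c m, hmc] at b
    have hXn : ‖X‖ ≤ 1 := h.norm_prodStep_le a d n
    have b1 : ‖X * (P m * P c * P m - P m * P m) * star X‖ ≤ K ^ 2 * ‖d‖ ^ 2 := by
      refine (norm_mul_le _ _).trans ?_
      rw [norm_star]
      refine (mul_le_of_le_one_right (norm_nonneg _) hXn).trans ((norm_mul_le _ _).trans ?_)
      refine (mul_le_of_le_one_left (norm_nonneg _) hXn).trans (b.trans (le_of_eq ?_))
      ring
    refine (norm_add_le _ _).trans ((add_le_add b1 ih).trans (le_of_eq ?_))
    push_cast; ring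

lemma transport_mul_star (k k' : Plane) :
    transport P k k' * star (transport P k k') = P k := by
  have h1 := (h.tendsto_transport k k').mul (h.tendsto_transport k k').star
  rw [← sub_eq_zero, ← norm_le_zero_iff]
  have h2 : Tendsto (fun m : ℕ => K ^ 2 * ‖k' - k‖ ^ 2 * (1 / ((m : ℝ) + 1))) atTop (𝓝 0) := by
    simpa using (tendsto_one_div_add_atTop_nhds_zero_nat (𝕜 := ℝ)).const_mul
      (K ^ 2 * ‖k' - k‖ ^ 2)
  refine le_of_tendsto_of_tendsto' (h1.sub_const (P k)).norm h2 fun n => ?_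
  refine (h.norm_prodStep_mul_star_sub_le _ _ _).trans (le_of_eq ?_)
  have : ((n : ℝ) + 1) ≠ 0 := by positivity
  rw [norm_smul, norm_inv, Real.norm_of_nonneg (by positivity)]
  push_cast
  field_simp

lemma transport_mul_reverse (k k' : Plane) : transport P k k' * transport P k' k = P k := by
  rw [← h.star_transport k k', h.transport_mul_star]

lemma transport_self (k : Plane) : transport P k k = P k := by
  have := h.norm_transport_sub_le k k
  simpa [sub_eq_zero, h.idem] using this

lemma norm_transport_le (k k' : Plane) : ‖transport P k k'‖ ≤ 1 :=
  le_of_tendsto' (h.tendsto_transport k k').norm fun _ => h.norm_prodStep_le _ _ _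

lemma continuous_prodStep (n : ℕ) :
    Continuous fun x : Plane × Plane => prodStep P x.1 x.2 n := by
  have hc := h.continuous
  induction n with
  | zero => exact hc.comp continuous_fst
  | succ n ih => exact ih.mul (hc.comp (by fun_prop))

/-- The rate of convergence is locally uniform in the endpoints, and each approximation is
continuous. -/
lemma continuous_transport : Continuous fun x : Plane × Plane => transport P x.1 x.2 := by
  have hl : TendstoLocallyUniformly (fun n (x : Plane × Plane) => transportApprox P x.1 x.2 n)
      (fun x => transport P x.1 x.2) atTop := by
    rw [Metric.tendstoLocallyUniformly_iff]
    intro ε hε x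
    have hopen : {y : Plane × Plane | ‖y.2 - y.1‖ < ‖x.2 - x.1‖ + 1} ∈ 𝓝 x :=
      (isOpen_lt (by fun_prop) continuous_const).mem_nhds (by simp)
    refine ⟨_, hopen, ?_⟩
    have h2 : Tendsto (fun m : ℕ => K ^ 2 * (‖x.2 - x.1‖ + 1) ^ 2 * (1 / ((m : ℝ) + 1)))
        atTop (𝓝 0) := by
      simpa using (tendsto_one_div_add_atTop_nhds_zero_nat (𝕜 := ℝ)).const_mul
        (K ^ 2 * (‖x.2 - x.1‖ + 1) ^ 2)
    filter_upwards [h2.eventually (gt_mem_nhds hε)] with n hn y hy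
    rw [dist_comm, dist_eq_norm]
    refine (h.norm_transportApprox_sub_transport_le y.1 y.2 n).trans_lt (lt_of_le_of_lt ?_ hn)
    rw [mul_one_div]
    have hy' : ‖y.2 - y.1‖ ≤ ‖x.2 - x.1‖ + 1 := le_of_lt hy
    gcongr
  refine hl.continuous (Frequently.of_forall fun n => ?_)
  exact (h.continuous_prodStep (n + 1)).comp (by fun_prop :
    Continuous fun x : Plane × Plane => (x.1, ((n : ℝ) + 1)⁻¹ • (x.2 - x.1)))

lemma tendsto_steps (k k' : Plane) :
    Tendsto (fun n : ℕ => prodStep P k ((n : ℝ)⁻¹ • (k' - k)) n) atTop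
      (𝓝 (transport P k k')) := by
  rw [← tendsto_add_atTop_iff_nat 1]
  refine (h.tendsto_transport k k').congr fun n => ?_
  simp [transportApprox]

/-- A subdivision into a multiple of `N` steps passes exactly through the point at `j / N`, so the
finite products already split there. -/
lemma transport_comp_rat (a d : Plane) (N j : ℕ) (hN : 0 < N) (hj : j ≤ N) :
    transport P a (a + d) = transport P a (a + ((j : ℝ) / N) • d) *
      transport P (a + ((j : ℝ) / N) • d) (a + d) := by
  set c := a + ((j : ℝ) / N) • d with hc
  rcases Nat.eq_zero_or_pos j with rfl | hj0
  · simp [hc, h.transport_self, h.proj_mul_transport]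
  rcases hj.eq_or_lt with rfl | hjN
  · have hne : (j : ℝ) ≠ 0 := by exact_mod_cast hN.ne'
    simp [hc, div_self hne, h.transport_self, h.transport_mul_proj]
  have t1 : Tendsto (fun m : ℕ => N * m) atTop atTop :=
    tendsto_id.const_mul_atTop' hN
  have t2 : Tendsto (fun m : ℕ => j * m) atTop atTop :=
    tendsto_id.const_mul_atTop' hj0
  have t3 : Tendsto (fun m : ℕ => (N - j) * m) atTop atTop :=
    tendsto_id.const_mul_atTop' (by omega)
  refine tendsto_nhds_unique ((h.tendsto_steps a (a + d)).comp t1)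
    (((h.tendsto_steps a c).comp t2 |>.mul ((h.tendsto_steps c (a + d)).comp t3)).congr' ?_)
  filter_upwards [eventually_gt_atTop 0] with m hm
  have hm' : (m : ℝ) ≠ 0 := by exact_mod_cast hm.ne'
  have hN' : (N : ℝ) ≠ 0 := by exact_mod_cast hN.ne'
  have hj' : (j : ℝ) ≠ 0 := by exact_mod_cast hj0.ne'
  have hNj : (N : ℝ) - j ≠ 0 := sub_ne_zero.mpr (by exact_mod_cast hjN.ne')
  have e1 : ((j * m : ℕ) : ℝ)⁻¹ • (c - a) = ((N * m : ℕ) : ℝ)⁻¹ • (a + d - a) := by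
    rw [hc, add_sub_cancel_left, add_sub_cancel_left, smul_smul]
    congr 1; push_cast; field_simp
  have e2 : (((N - j) * m : ℕ) : ℝ)⁻¹ • (a + d - c) = ((N * m : ℕ) : ℝ)⁻¹ • (a + d - a) := by
    rw [hc, add_sub_cancel_left, add_sub_add_left_eq_sub]
    have : d - ((j : ℝ) / N) • d = (1 - (j : ℝ) / N) • d := by module
    rw [this, smul_smul]
    congr 1; rw [Nat.cast_mul, Nat.cast_sub hj]; push_cast; field_simp
  have e3 : c = a + ((j * m : ℕ) : ℝ) • (((N * m : ℕ) : ℝ)⁻¹ • (a + d - a)) := by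
    rw [hc, add_sub_cancel_left, smul_smul]
    congr 2; push_cast; field_simp
  simp only [Function.comp]
  rw [e1, e2]
  conv_lhs => rw [e3]
  rw [← h.prodStep_add]
  congr 1
  rw [← add_mul, Nat.add_sub_cancel' hj]

/-- The points `⌊t N⌋ / N` tend to `t`, and the transport is continuous in its endpoints. -/
lemma transport_comp_of_mem (a d : Plane) (t : ℝ) (ht : t ∈ Set.Icc (0 : ℝ) 1) :
    transport P a (a + d) = transport P a (a + t • d) * transport P (a + t • d) (a + d) := by
  obtain ⟨φ, hφ, hs⟩ : ∃ φ : ℕ → ℕ, (∀ N, φ N ≤ N) ∧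
      Tendsto (fun N : ℕ => (φ N : ℝ) / (N : ℝ)) atTop (𝓝 t) := by
    refine ⟨fun N => ⌊t * N⌋₊, fun N => ?_, ?_⟩
    · apply Nat.floor_le_of_le
      have : (0 : ℝ) ≤ N := Nat.cast_nonneg N
      nlinarith [ht.2]
    · have h0 : Tendsto (fun x : ℝ => (⌊t * x⌋₊ : ℝ) / x) atTop (𝓝 t) :=
        tendsto_nat_floor_mul_div_atTop ht.1
      exact h0.comp tendsto_natCast_atTop_atTop
  have hc := h.continuous_transport
  have c0 : Continuous fun s : ℝ => a + s • d := by fun_prop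
  have c2 : Continuous fun s : ℝ => transport P a (a + s • d) :=
    hc.comp₂ continuous_const c0
  have c3 : Continuous fun s : ℝ => transport P (a + s • d) (a + d) :=
    hc.comp₂ c0 continuous_const
  have c1 : Continuous fun s : ℝ => transport P a (a + s • d) * transport P (a + s • d) (a + d) :=
    c2.mul c3
  have hmain : Tendsto (fun N : ℕ => transport P a (a + ((φ N : ℝ) / (N : ℝ)) • d) *
      transport P (a + ((φ N : ℝ) / (N : ℝ)) • d) (a + d)) atTop
      (𝓝 (transport P a (a + t • d) * transport P (a + t • d) (a + d))) :=
    (c1.tendsto t).comp hs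
  refine tendsto_nhds_unique (Tendsto.congr' ?_ tendsto_const_nhds) hmain
  filter_upwards [eventually_gt_atTop 0] with N hN
  exact h.transport_comp_rat a d N _ hN (hφ N)

/-- Parallel transport along a line is multiplicative. -/
lemma transport_comp (a d : Plane) (s t u : ℝ) :
    transport P (a + s • d) (a + t • d) * transport P (a + t • d) (a + u • d) =
      transport P (a + s • d) (a + u • d) := by
  -- This is the ordered case. The other orders follow by taking adjoints (`rev`) and by cancelling
  -- a segment run back and forth (`swapR`).
  have mono : ∀ s t u : ℝ, s ≤ t → t ≤ u →
      transport P (a + s • d) (a + t • d) * transport P (a + t • d) (a + u • d) =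
      transport P (a + s • d) (a + u • d) := by
    intro s t u hst htu
    rcases hst.eq_or_lt with rfl | hst
    · rw [h.transport_self, h.proj_mul_transport]
    have hsu : 0 < u - s := by linarith
    have := h.transport_comp_of_mem (a + s • d) ((u - s) • d) ((t - s) / (u - s))
      ⟨div_nonneg (by linarith) hsu.le, (div_le_one hsu).mpr (by linarith)⟩
    rw [smul_smul, div_mul_cancel₀ _ hsu.ne',
      show a + s • d + (u - s) • d = a + u • d by module,
      show a + s • d + (t - s) • d = a + t • d by module] at this
    exact this.symm
  have rev : ∀ s t u : ℝ,
      transport P (a + u • d) (a + t • d) * transport P (a + t • d) (a + s • d) =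
        transport P (a + u • d) (a + s • d) →
      transport P (a + s • d) (a + t • d) * transport P (a + t • d) (a + u • d) =
      transport P (a + s • d) (a + u • d) := by
    intro s t u hh
    have := congrArg star hh
    rwa [star_mul, h.star_transport, h.star_transport, h.star_transport] at this
  have swapR : ∀ s t u : ℝ,
      transport P (a + s • d) (a + u • d) * transport P (a + u • d) (a + t • d) =
        transport P (a + s • d) (a + t • d) →
      transport P (a + s • d) (a + t • d) * transport P (a + t • d) (a + u • d) =
      transport P (a + s • d) (a + u • d) := by
    intro s t u hh
    rw [← hh, mul_assoc, h.transport_mul_reverse, h.transport_mul_proj]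
  rcases le_total s t with h1 | h1 <;> rcases le_total t u with h2 | h2 <;>
    rcases le_total s u with h3 | h3
  · exact mono _ _ _ h1 h2
  · exact mono _ _ _ h1 h2
  · exact swapR _ _ _ (mono _ _ _ h3 h2)
  · exact rev _ _ _ (swapR _ _ _ (mono _ _ _ h3 h1))
  · exact rev _ _ _ (swapR _ _ _ (rev _ _ _ (mono _ _ _ h1 h3)))
  · exact swapR _ _ _ (rev _ _ _ (mono _ _ _ h2 h3))
  · exact rev _ _ _ (mono _ _ _ h2 h1)
  · exact rev _ _ _ (mono _ _ _ h2 h1)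

/-- With `U` the transport from `a + t • d` to `a`, multiplicativity and `norm_transport_sub_le`
show that the transport from `a + s • d` differs from `U * P (a + s • d)` by `O((s - t)²)`. -/
lemma hasDerivAt_transport (a d : Plane) (t : ℝ) (hP : DifferentiableAt ℝ P (a + t • d)) :
    HasDerivAt (fun s : ℝ => transport P a (a + s • d))
      (transport P a (a + t • d) * fderiv ℝ P (a + t • d) d) t := by
  set U := transport P a (a + t • d) with hU
  have d0 : HasDerivAt (fun s : ℝ => a + s • d) d t := by
    simpa using ((hasDerivAt_id t).smul_const d).const_add a
  have d1 : HasDerivAt (fun s : ℝ => P (a + s • d)) (fderiv ℝ P (a + t • d) d) t :=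
    hP.hasFDerivAt.comp_hasDerivAt t d0
  have d2 : HasDerivAt (fun s : ℝ => U * P (a + s • d)) (U * fderiv ℝ P (a + t • d) d) t :=
    d1.const_mul U
  have key : ∀ s : ℝ, ‖transport P a (a + s • d) - U * P (a + s • d)‖ ≤
      K ^ 2 * ‖d‖ ^ 2 * (s - t) ^ 2 := by
    intro s
    have e : transport P a (a + s • d) - U * P (a + s • d) =
        U * (transport P (a + t • d) (a + s • d) - P (a + t • d) * P (a + s • d)) := by
      have := h.transport_comp a d 0 t s
      rw [zero_smul, add_zero] at this
      rw [mul_sub, this, ← mul_assoc, h.transport_mul_proj]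
    rw [e]
    refine (norm_mul_le _ _).trans ((mul_le_of_le_one_left (norm_nonneg _)
      (h.norm_transport_le _ _)).trans ((h.norm_transport_sub_le _ _).trans (le_of_eq ?_)))
    rw [show a + s • d - (a + t • d) = (s - t) • d by module, norm_smul, mul_pow,
      Real.norm_eq_abs, sq_abs]
    ring
  have d3 : HasDerivAt (fun s : ℝ => transport P a (a + s • d) - U * P (a + s • d)) 0 t := by
    rw [hasDerivAt_iff_isLittleO]
    have h0 : transport P a (a + t • d) - U * P (a + t • d) = 0 := by
      have := key t
      simpa using this
    simp only [h0, sub_zero, smul_zero]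
    refine Asymptotics.IsBigO.trans_isLittleO (g := fun s => (s - t) ^ 2)
      (Asymptotics.IsBigO.of_bound (K ^ 2 * ‖d‖ ^ 2) (Eventually.of_forall fun s => ?_)) ?_
    · refine (key s).trans (le_of_eq ?_)
      rw [Real.norm_of_nonneg (sq_nonneg _)]
    · simpa using Asymptotics.isLittleO_pow_sub_sub t one_lt_two
  have d4 := d3.add d2
  rw [zero_add] at d4
  refine d4.congr_of_eventuallyEq (Eventually.of_forall fun s => ?_)
  simp

end IsProjFamily

/-- Maps intertwining two families of projections along two segments intertwine the parallel
transports. -/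
lemma transport_intertwine {F : Type*} [NormedAddCommGroup F] [InnerProductSpace ℂ F]
    [CompleteSpace F] {P' : Plane → F →L[ℂ] F} {K' : ℝ}
    (h : IsProjFamily P K) (h' : IsProjFamily P' K') (S : E → F) (hS : Continuous S)
    (k k' c c' : Plane)
    (hSP : ∀ (t : ℝ) x, S (P (k + t • (k' - k)) x) = P' (c + t • (c' - c)) (S x)) (x : E) :
    S (transport P k k' x) = transport P' c c' (S x) := by
  have h1 : ∀ (r : ℝ) (n : ℕ) x, S (prodStep P k (r • (k' - k)) n x) =
      prodStep P' c (r • (c' - c)) n (S x) := by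
    intro r n
    induction n with
    | zero => intro x; simpa [prodStep] using hSP 0 x
    | succ n ih =>
      intro x
      simp only [prodStep, mul_apply_eq_comp, ih, smul_smul, hSP]
  have t1 : Tendsto (fun n => S (transportApprox P k k' n x)) atTop
      (𝓝 (S (transport P k k' x))) :=
    (hS.tendsto _).comp (((ContinuousLinearMap.apply ℂ E x).continuous.tendsto _).comp (h.tendsto_transport k k'))
  have t2 : Tendsto (fun n => transportApprox P' c c' n (S x)) atTop
      (𝓝 (transport P' c c' (S x))) :=
    ((ContinuousLinearMap.apply ℂ F (S x)).continuous.tendsto _).comp (h'.tendsto_transport c c')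
  refine tendsto_nhds_unique t1 (t2.congr fun n => ?_)
  exact (h1 _ _ x).symm

end Transport

/-! ### Projections, real planes and their complex structures. -/

section Frames

variable {E : Type*} [NormedAddCommGroup E] [InnerProductSpace ℂ E] [CompleteSpace E]
  {F : Type*} [NormedAddCommGroup F] [InnerProductSpace ℂ F]

lemma proj_inner {p : E →L[ℂ] E} (hp : IsStarProjection p) (x y : E) :
    inner ℂ (p x) y = inner ℂ x (p y) := by
  rw [← ContinuousLinearMap.adjoint_inner_left, ← ContinuousLinearMap.star_eq_adjoint,
    hp.isSelfAdjoint.star_eq]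

lemma proj_apply_apply {p : E →L[ℂ] E} (hp : IsStarProjection p) (x : E) : p (p x) = p x := by
  have := congrArg (fun q : E →L[ℂ] E => q x) hp.isIdempotentElem
  exact this

/-- Bijections between the ranges of two projections preserving orthogonality intertwine the
projections. -/
lemma proj_intertwine {p : E →L[ℂ] E} {q : E →L[ℂ] E} (hp : IsStarProjection p)
    (hq : IsStarProjection q) (S : E → E) (hsub : ∀ x y, S (x - y) = S x - S y)
    (horth : ∀ x y, inner ℂ x y = 0 → inner ℂ (S x) (S y) = 0)
    (h1 : ∀ x, q (S (p x)) = S (p x)) (h2 : ∀ y, ∃ x, S (p x) = q y) (x : E) :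
    S (p x) = q (S x) := by
  -- The vector `x - p x` is orthogonal to the range of `p`, so its image is orthogonal to the image
  -- of that range, which is the range of `q`.
  have h3 : q (S (x - p x)) = 0 := by
    rw [← inner_self_eq_zero (𝕜 := ℂ), proj_inner hq, proj_apply_apply hq]
    obtain ⟨z, hz⟩ := h2 (S (x - p x))
    rw [← hz, ← inner_conj_symm, horth (p z), map_zero]
    rw [proj_inner hp, map_sub, proj_apply_apply hp, sub_self, inner_zero_right]
  rw [hsub, map_sub, h1, sub_eq_zero] at h3
  exact h3.symm

/-- An orthonormal basis of the range of a projection. -/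
structure IsFrame {n : ℕ} (p : E →L[ℂ] E) (u : Fin n → E) : Prop where
  orthonormal : Orthonormal ℂ u
  expand : ∀ x, p x = ∑ a, inner ℂ (u a) x • u a

namespace IsFrame

variable {n : ℕ} {p : E →L[ℂ] E} {u : Fin n → E}

lemma inner_eq (h : IsFrame p u) (a c : Fin n) : inner ℂ (u a) (u c) = if a = c then 1 else 0 :=
  orthonormal_iff_ite.mp h.orthonormal a c

lemma apply (h : IsFrame p u) (a : Fin n) : p (u a) = u a := by
  rw [h.expand]
  simp [h.inner_eq]

lemma expand_of_mem (h : IsFrame p u) {x : E} (hx : p x = x) :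
    x = ∑ a, inner ℂ (u a) x • u a := by
  rw [← h.expand, hx]

lemma of_finrank [NeZero n] (hp : IsStarProjection p) (hu : Orthonormal ℂ u) (hpu : ∀ a, p (u a) = u a)
    (hr : Module.finrank ℂ (LinearMap.range (p : E →ₗ[ℂ] E)) = n) : IsFrame p u := by
  refine ⟨hu, fun x => ?_⟩
  have : FiniteDimensional ℂ (LinearMap.range (p : E →ₗ[ℂ] E)) :=
    Module.finite_of_finrank_pos (by rw [hr]; exact Nat.pos_of_ne_zero (NeZero.ne n))
  have hle : Submodule.span ℂ (Set.range u) ≤ LinearMap.range (p : E →ₗ[ℂ] E) := by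
    rw [Submodule.span_le]
    rintro _ ⟨a, rfl⟩
    exact ⟨u a, hpu a⟩
  have hspan : Submodule.span ℂ (Set.range u) = LinearMap.range (p : E →ₗ[ℂ] E) := by
    apply Submodule.eq_of_le_of_finrank_eq hle
    rw [hr, finrank_span_eq_card hu.linearIndependent, Fintype.card_fin]
  have hx : p x ∈ Submodule.span ℂ (Set.range u) := by
    rw [hspan]; exact ⟨x, rfl⟩
  obtain ⟨c, hc⟩ := (Submodule.mem_span_range_iff_exists_fun ℂ).mp hx
  rw [← hc]
  refine Finset.sum_congr rfl fun a _ => ?_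
  congr 1
  rw [← hpu a, proj_inner hp, ← hc, hu.inner_right_fintype]

lemma exists_of_finrank [NeZero n] (hp : IsStarProjection p)
    (hr : Module.finrank ℂ (LinearMap.range (p : E →ₗ[ℂ] E)) = n) :
    ∃ u : Fin n → E, IsFrame p u := by
  have : FiniteDimensional ℂ (LinearMap.range (p : E →ₗ[ℂ] E)) :=
    Module.finite_of_finrank_pos (by rw [hr]; exact Nat.pos_of_ne_zero (NeZero.ne n))
  let bas := (stdOrthonormalBasis ℂ (LinearMap.range (p : E →ₗ[ℂ] E))).reindex (finCongr hr)
  refine ⟨fun a => (bas a : E), of_finrank hp ?_ (fun a => ?_) hr⟩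
  · exact bas.orthonormal.comp_linearIsometry (Submodule.subtypeₗᵢ _)
  · obtain ⟨x, hx⟩ := (bas a).2
    rw [← hx]
    exact proj_apply_apply hp x

lemma frTrace_eq (h : IsFrame p u) {A : E →L[ℂ] E} (hA : ∀ x, p (A x) = A x) :
    frTrace A = ∑ a, inner ℂ (u a) (A (u a)) := by
  refine frTrace_eq_sum h.orthonormal A fun x => ?_
  rw [h.expand_of_mem (hA x)]
  exact Submodule.sum_mem _ fun a _ => Submodule.smul_mem _ _ (Submodule.subset_span ⟨a, rfl⟩)

lemma op_ext (h : IsFrame p u) {A B : E →L[ℂ] F} (hA : ∀ x, A (p x) = A x)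
    (hB : ∀ x, B (p x) = B x) (hAB : ∀ a, A (u a) = B (u a)) : A = B := by
  ext x
  rw [← hA, ← hB, h.expand]
  simp [hAB]

end IsFrame

/-- The rotation by a right angle in the oriented plane with orthonormal basis `e`. -/
def rot (e : Fin 2 → E) : E →L[ℂ] E :=
  InnerProductSpace.rankOne ℂ (e 1) (e 0) - InnerProductSpace.rankOne ℂ (e 0) (e 1)

lemma rot_apply (e : Fin 2 → E) (x : E) :
    rot e x = inner ℂ (e 0) x • e 1 - inner ℂ (e 1) x • e 0 := by
  simp [rot]

lemma ketbra_pauliY (u w : Fin 2 → E) (x : E) :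
    ketbra u (-Complex.I • pauliY) w x = inner ℂ (w 0) x • u 1 - inner ℂ (w 1) x • u 0 := by
  simp [ketbra, pauliY, Fin.sum_univ_two]
  abel

/-- `J` is a complex structure on the real plane of `C`-invariant vectors in the range of the
rank-two projection `p`. -/
structure IsCStr (C : E ≃ₗᵢ⋆[ℂ] E) (p J : E →L[ℂ] E) : Prop where
  proj_apply : ∀ x, p (J x) = J x
  apply_proj : ∀ x, J (p x) = J x
  sq : ∀ x, J (J x) = -p x
  skew : ∀ x y, inner ℂ (J x) y = -inner ℂ x (J y)
  real : ∀ x, C (J x) = J (C x)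

/-- A rank-two projection commuting with the antiunitary involution `C`. -/
structure IsRealPlane (C : E ≃ₗᵢ⋆[ℂ] E) (p : E →L[ℂ] E) : Prop where
  invol : ∀ x, C (C x) = x
  proj : IsStarProjection p
  comm : ∀ x, C (p x) = p (C x)
  frame : ∃ u : Fin 2 → E, IsFrame p u

/-- An orthonormal basis consisting of `C`-invariant vectors. -/
structure IsRealFrame (C : E ≃ₗᵢ⋆[ℂ] E) (p : E →L[ℂ] E) (e : Fin 2 → E) : Prop
    extends IsFrame p e where
  real : ∀ a, C (e a) = e a

variable {C : E ≃ₗᵢ⋆[ℂ] E} {p J : E →L[ℂ] E}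

/-- The vector `y + C y` is real; if it vanishes, then `I • y` is real and nonzero. A real factor
normalizes it. -/
lemma exists_real_unit (hC : ∀ x, C (C x) = x) {S : Submodule ℂ E} (hS : ∀ x ∈ S, C x ∈ S)
    {y : E} (hy : y ∈ S) (hy0 : y ≠ 0) : ∃ e ∈ S, C e = e ∧ ‖e‖ = 1 := by
  have key : ∀ z ∈ S, z ≠ 0 → C z = z → ∃ e ∈ S, C e = e ∧ ‖e‖ = 1 := by
    intro z hz hz0 hCz
    refine ⟨((‖z‖⁻¹ : ℝ) : ℂ) • z, S.smul_mem _ hz, ?_, ?_⟩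
    · rw [C.map_smulₛₗ, hCz, Complex.conj_ofReal]
    · rw [norm_smul, Complex.norm_real, norm_inv, norm_norm,
        inv_mul_cancel₀ (norm_ne_zero_iff.mpr hz0)]
  by_cases h : y + C y = 0
  · refine key (Complex.I • y) (S.smul_mem _ hy) (smul_ne_zero Complex.I_ne_zero hy0) ?_
    rw [C.map_smulₛₗ, (eq_neg_of_add_eq_zero_right h), Complex.conj_I]
    simp
  · refine key _ (S.add_mem hy (hS y hy)) h ?_
    rw [map_add, hC, add_comm]

lemma real_inner (x y : E) (hx : C x = x) (hy : C y = y) :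
    conj (inner ℂ x y : ℂ) = inner ℂ x y := by
  rw [inner_conj_symm, ← anti_inner C x y, hx, hy]

/-- The vectors of the plane orthogonal to the real vector `e₀` form a `C`-stable subspace, nonzero
because the plane has dimension two. The choice `e₀ = 0` yields the first vector of a real frame,
and that vector in turn yields the second. -/
lemma IsRealPlane.exists_real_unit_orthogonal (h : IsRealPlane C p) (e₀ : E) (he₀ : C e₀ = e₀) :
    ∃ e, p e = e ∧ C e = e ∧ ‖e‖ = 1 ∧ inner ℂ e₀ e = 0 := by
  obtain ⟨u, hu⟩ := h.frame
  let S : Submodule ℂ E := LinearMap.eqLocus (p : E →ₗ[ℂ] E) LinearMap.id ⊓ (ℂ ∙ e₀)ᗮ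
  have memS : ∀ x, x ∈ S ↔ p x = x ∧ inner ℂ e₀ x = 0 := by
    intro x
    simp [S, Submodule.mem_orthogonal_singleton_iff_inner_right]
  obtain ⟨y, hy, hy0⟩ : ∃ y ∈ S, y ≠ 0 := by
    by_cases h0 : (inner ℂ e₀ (u 0) : ℂ) = 0
    · exact ⟨u 0, (memS _).mpr ⟨hu.apply 0, h0⟩, hu.orthonormal.ne_zero 0⟩
    · refine ⟨inner ℂ e₀ (u 0) • u 1 - inner ℂ e₀ (u 1) • u 0, (memS _).mpr ⟨?_, ?_⟩, ?_⟩
      · simp [hu.apply]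
      · simp [inner_sub_right, inner_smul_right, mul_comm]
      · intro hz
        have := congrArg (fun z => (inner ℂ (u 1) z : ℂ)) hz
        simp [inner_sub_right, inner_smul_right, hu.inner_eq] at this
        exact h0 (this.resolve_right (hu.orthonormal.ne_zero 1))
  obtain ⟨e, he, hCe, hne⟩ := exists_real_unit (C := C) h.invol (S := S) (fun x hx => by
    obtain ⟨h1, h2⟩ := (memS x).mp hx
    refine (memS _).mpr ⟨by rw [← h.comm, h1], ?_⟩
    rw [← he₀, anti_inner, ← inner_conj_symm, h2, map_zero]) hy hy0
  obtain ⟨h1, h2⟩ := (memS e).mp he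
  exact ⟨e, h1, hCe, hne, h2⟩

lemma isFrame_pair {p : E →L[ℂ] E} (hp : IsStarProjection p) (hf : ∃ u : Fin 2 → E, IsFrame p u)
    {e : Fin 2 → E} (he : Orthonormal ℂ e) (hpe : ∀ a, p (e a) = e a) : IsFrame p e := by
  refine IsFrame.of_finrank hp he hpe ?_
  obtain ⟨u, hu⟩ := hf
  have : LinearMap.range (p : E →ₗ[ℂ] E) = Submodule.span ℂ (Set.range u) := by
    apply le_antisymm
    · rintro _ ⟨x, rfl⟩
      rw [ContinuousLinearMap.coe_coe, hu.expand]
      exact Submodule.sum_mem _ fun a _ => Submodule.smul_mem _ _ (Submodule.subset_span ⟨a, rfl⟩)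
    · rw [Submodule.span_le]
      rintro _ ⟨a, rfl⟩
      exact ⟨u a, hu.apply a⟩
  rw [this, finrank_span_eq_card hu.orthonormal.linearIndependent, Fintype.card_fin]

lemma orthonormal_pair {e : Fin 2 → E} (h0 : ‖e 0‖ = 1) (h1 : ‖e 1‖ = 1)
    (h01 : inner ℂ (e 0) (e 1) = 0) : Orthonormal ℂ e := by
  refine ⟨fun i => by fin_cases i <;> assumption, fun i j hij => ?_⟩
  fin_cases i <;> fin_cases j
  · exact absurd rfl hij
  · exact h01
  · show inner ℂ (e 1) (e 0) = 0
    rw [← inner_conj_symm, h01, map_zero]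
  · exact absurd rfl hij

lemma IsRealPlane.exists_realFrame (h : IsRealPlane C p) : ∃ e, IsRealFrame C p e := by
  obtain ⟨e0, p0, c0, n0, -⟩ := h.exists_real_unit_orthogonal 0 (map_zero C)
  obtain ⟨e1, p1, c1, n1, o1⟩ := h.exists_real_unit_orthogonal e0 c0
  refine ⟨![e0, e1], isFrame_pair h.proj h.frame (orthonormal_pair n0 n1 o1) ?_, ?_⟩ <;>
  · intro a; fin_cases a <;> assumption

namespace IsRealFrame

variable {e : Fin 2 → E}

lemma isCStr (h : IsRealFrame C p e) : IsCStr C p (rot e) where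
  proj_apply x := by simp [rot_apply, h.apply]
  apply_proj x := by
    simp only [rot_apply, h.expand, Fin.sum_univ_two, inner_add_right, inner_smul_right,
      h.inner_eq]
    simp
  sq x := by
    simp only [rot_apply, h.expand, Fin.sum_univ_two, inner_sub_right, inner_smul_right,
      h.inner_eq]
    simp
    abel
  skew x y := by
    simp only [rot_apply, inner_sub_left, inner_sub_right, inner_smul_left, inner_smul_right,
      inner_conj_symm]
    ring
  real x := by
    have hi : ∀ a, conj (inner ℂ (e a) x : ℂ) = inner ℂ (e a) (C x) := fun a => by
      rw [inner_conj_symm, ← anti_inner C, h.real]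
    simp [rot_apply, C.map_smulₛₗ, h.real, hi]

lemma frTrace_real (h : IsRealFrame C p e) {A : E →L[ℂ] E} (hA : ∀ x, p (A x) = A x)
    (hr : ∀ x, C (A x) = A (C x)) : conj (frTrace A) = frTrace A := by
  rw [h.frTrace_eq hA, map_sum]
  refine Finset.sum_congr rfl fun a _ => ?_
  refine real_inner _ _ (h.real a) ?_
  rw [hr, h.real]

end IsRealFrame

namespace IsCStr

lemma inner_apply_self (hJ : IsCStr C p J) {x : E} (hx : C x = x) : inner ℂ x (J x) = 0 := by
  have h1 := real_inner (C := C) x (J x) hx (by rw [hJ.real, hx])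
  have h2 := hJ.skew x x
  rw [← inner_conj_symm, h1] at h2
  have : (2 : ℂ) * inner ℂ x (J x) = 0 := by linear_combination h2
  simpa using this

lemma norm_apply (hJ : IsCStr C p J) {x : E} (hx : p x = x) : ‖J x‖ = ‖x‖ := by
  have h1 : (inner ℂ (J x) (J x) : ℂ) = inner ℂ x x := by
    rw [hJ.skew, hJ.sq, hx, inner_neg_right, neg_neg]
  rw [inner_self_eq_norm_sq_to_K, inner_self_eq_norm_sq_to_K] at h1
  have h2 : ‖J x‖ ^ 2 = ‖x‖ ^ 2 := by exact_mod_cast h1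
  exact (pow_left_inj₀ (norm_nonneg _) (norm_nonneg _) two_ne_zero).mp h2

/-- Real frames adapted to a complex structure. -/
lemma exists_adapted (hp : IsRealPlane C p) (hJ : IsCStr C p J) :
    ∃ e, IsRealFrame C p e ∧ J (e 0) = e 1 ∧ J (e 1) = -e 0 := by
  obtain ⟨e0, p0, c0, n0, -⟩ := hp.exists_real_unit_orthogonal 0 (map_zero C)
  refine ⟨![e0, J e0], ⟨isFrame_pair hp.proj hp.frame (orthonormal_pair n0 ?_ ?_) ?_, ?_⟩, rfl, ?_⟩
  · exact (hJ.norm_apply p0).trans n0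
  · exact hJ.inner_apply_self c0
  · intro a; fin_cases a
    · exact p0
    · exact hJ.proj_apply e0
  · intro a; fin_cases a
    · exact c0
    · show C (J e0) = J e0
      rw [hJ.real, c0]
  · show J (J e0) = -e0
    rw [hJ.sq, p0]

lemma eq_rot (hJ : IsCStr C p J) {e : Fin 2 → E} (he : IsRealFrame C p e) (h0 : J (e 0) = e 1) :
    J = rot e := by
  refine he.op_ext hJ.apply_proj he.isCStr.apply_proj fun a => ?_
  fin_cases a
  · show J (e 0) = rot e (e 0)
    rw [rot_apply, he.inner_eq, he.inner_eq, h0]; simp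
  · have : J (e 1) = -e 0 := by rw [← h0, hJ.sq, he.apply]
    show J (e 1) = rot e (e 1)
    rw [rot_apply, he.inner_eq, he.inner_eq, this]; simp

/-- Real skew operators on a plane are multiples of the complex structure. -/
lemma exists_smul (hp : IsRealPlane C p) (hJ : IsCStr C p J) {A : E →L[ℂ] E}
    (h1 : ∀ x, p (A x) = A x) (h2 : ∀ x, A (p x) = A x)
    (hs : ∀ x y, inner ℂ (A x) y = -inner ℂ x (A y)) (hr : ∀ x, C (A x) = A (C x)) :
    ∃ r : ℝ, A = (r : ℂ) • J := by
  obtain ⟨e, he, j0, j1⟩ := exists_adapted hp hJ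
  have hz : ∀ a, (inner ℂ (e a) (A (e a)) : ℂ) = 0 := by
    intro a
    have h3 := real_inner (C := C) (e a) (A (e a)) (he.real a) (by rw [hr, he.real])
    have h4 := hs (e a) (e a)
    rw [← inner_conj_symm, h3] at h4
    have : (2 : ℂ) * inner ℂ (e a) (A (e a)) = 0 := by linear_combination h4
    simpa using this
  have h3 := real_inner (C := C) (e 1) (A (e 0)) (he.real 1) (by rw [hr, he.real])
  obtain ⟨r, hrr⟩ := Complex.conj_eq_iff_real.mp h3
  have h01 : (inner ℂ (e 0) (A (e 1)) : ℂ) = -r := by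
    have := hs (e 0) (e 1)
    rw [← inner_conj_symm, h3, hrr] at this
    rw [this, neg_neg]
  refine ⟨r, he.op_ext h2 (fun x => by simp [hJ.apply_proj]) fun a => ?_⟩
  fin_cases a
  · show A (e 0) = (r : ℂ) • J (e 0)
    rw [he.expand_of_mem (h1 (e 0)), Fin.sum_univ_two, hz, hrr, j0]; simp
  · show A (e 1) = (r : ℂ) • J (e 1)
    rw [he.expand_of_mem (h1 (e 1)), Fin.sum_univ_two, hz, h01, j1]; simp

lemma ne_zero (hp : IsRealPlane C p) (hJ : IsCStr C p J) : J ≠ 0 := by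
  obtain ⟨e, he, j0, -⟩ := exists_adapted hp hJ
  intro h
  rw [h] at j0
  exact he.orthonormal.ne_zero 1 j0.symm

/-- By `exists_smul`, `J' = r J` with `r` real, and comparing squares gives `r² = 1`. The two signs
are the two orientations of the real plane. -/
lemma eq_or_neg (hp : IsRealPlane C p) (hJ : IsCStr C p J) {J' : E →L[ℂ] E}
    (hJ' : IsCStr C p J') : J' = J ∨ J' = -J := by
  obtain ⟨r, hr⟩ := exists_smul hp hJ hJ'.proj_apply hJ'.apply_proj hJ'.skew hJ'.real
  obtain ⟨e, he, j0, j1⟩ := exists_adapted hp hJ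
  have h1 := hJ'.sq (e 0)
  rw [hr, he.apply] at h1
  simp only [_root_.smul_apply, map_smul, j0, j1, smul_smul, smul_neg, neg_inj] at h1
  have h2 : ((r : ℂ) * r - 1) • e 0 = 0 := by rw [sub_smul, h1, one_smul, sub_self]
  have h3 : (r : ℂ) * r - 1 = 0 := (smul_eq_zero.mp h2).resolve_right (he.orthonormal.ne_zero 0)
  have h4 : ((r : ℂ) - 1) * (r + 1) = 0 := by linear_combination h3
  rcases mul_eq_zero.mp h4 with h5 | h5
  · left; rw [hr, sub_eq_zero.mp h5, one_smul]
  · right; rw [hr, eq_neg_of_add_eq_zero_left h5, neg_smul, one_smul]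

/-- Real symmetric operators commuting with the complex structure are multiples of the
projection. -/
lemma exists_smul_proj (hp : IsRealPlane C p) (hJ : IsCStr C p J) {A : E →L[ℂ] E}
    (h1 : ∀ x, p (A x) = A x) (h2 : ∀ x, A (p x) = A x)
    (hs : ∀ x y, inner ℂ (A x) y = inner ℂ x (A y)) (hr : ∀ x, C (A x) = A (C x))
    (hc : ∀ x, A (J x) = J (A x)) : ∃ r : ℝ, A = (r : ℂ) • p := by
  -- `A ∘ J` is skew because `A` is symmetric and commutes with `J`; from `A J = r J` the factor `J`
  -- is then cancelled by evaluating at `J x`.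
  obtain ⟨r, hAJ⟩ := exists_smul (A := A ∘L J) hp hJ (fun x => h1 _)
    (fun x => by simp [hJ.apply_proj])
    (fun x y => by simp [hs, hJ.skew, hc]) (fun x => by simp [hr, hJ.real])
  refine ⟨r, ?_⟩
  ext x
  have h3 := congrArg (fun B : E →L[ℂ] E => B (J x)) hAJ
  simp only [ContinuousLinearMap.comp_apply, hJ.sq, _root_.smul_apply, map_neg, h2,
    smul_neg, neg_inj] at h3
  simpa using h3

end IsCStr

end Frames

/-! ### Lattice-equivariant families of projections. -/

section Bundle

variable {E : Type*} [NormedAddCommGroup E] [InnerProductSpace ℂ E] [CompleteSpace E]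
  {F : Type*} [NormedAddCommGroup F] [InnerProductSpace ℂ F]
  {b : Module.Basis (Fin 2) ℝ Plane}

/-- A smooth lattice-equivariant family of orthogonal projections. -/
structure IsBundle (b : Module.Basis (Fin 2) ℝ Plane) (T : recip b → E ≃ₗᵢ[ℂ] E)
    (p : Plane → E →L[ℂ] E) : Prop where
  proj : ∀ k, IsStarProjection (p k)
  smooth : ContDiff ℝ ∞ p
  equiv : ∀ k (G : recip b) x, T G (p k x) = p (k + G) (T G x)

lemma fderiv_equivariant {A : Plane → E →L[ℂ] F} (hA : Differentiable ℝ A) (T : E ≃ₗᵢ[ℂ] E)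
    (T' : F ≃ₗᵢ[ℂ] F) (G : Plane) (h : ∀ k x, T' (A k x) = A (k + G) (T x)) (k w : Plane) (x : E) :
    T' (fderiv ℝ A k w x) = fderiv ℝ A (k + G) w (T x) := by
  have hA' : Differentiable ℝ fun q => A (q + G) := hA.comp (by fun_prop)
  have := fderiv_intertwine (T.toContinuousLinearEquiv.toContinuousLinearMap.restrictScalars ℝ)
    (T'.toContinuousLinearEquiv.toContinuousLinearMap.restrictScalars ℝ) (hA k) (hA' k)
    (fun q x => h q x) w x
  rw [fderiv_comp_add_right] at this
  exact this

lemma exists_bound_fundamentalDomain {f : Plane → ℝ} (hf : Continuous f) :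
    ∃ M, ∀ k ∈ closure (ZSpan.fundamentalDomain b), |f k| ≤ M := by
  have hc : IsCompact (closure (ZSpan.fundamentalDomain b)) :=
    (ZSpan.fundamentalDomain_isBounded b).isCompact_closure
  exact hc.exists_bound_of_continuousOn hf.continuousOn

/-- The derivative is bounded on the compact closure of the unit cell, equivariance carries the
bound to the whole plane, and the mean value inequality gives the Lipschitz constant. -/
lemma IsBundle.exists_isProjFamily {T : recip b → E ≃ₗᵢ[ℂ] E} {p : Plane → E →L[ℂ] E}
    (h : IsBundle b T p) : ∃ K, IsProjFamily p K := by
  have hd : Differentiable ℝ p := h.smooth.differentiable (by simp)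
  obtain ⟨M, hM⟩ := exists_bound_fundamentalDomain (b := b)
    (f := fun k => ‖fderiv ℝ p k‖) (h.smooth.continuous_fderiv (by simp)).norm
  have hM0 : 0 ≤ M := (abs_nonneg _).trans
    (hM _ (subset_closure (ZSpan.fract_mem_fundamentalDomain b 0)))
  have hb : ∀ k, ‖fderiv ℝ p k‖ ≤ M := by
    intro k
    have h1 := hM _ (subset_closure (ZSpan.fract_mem_fundamentalDomain b k))
    rw [abs_of_nonneg (norm_nonneg _)] at h1
    refine ContinuousLinearMap.opNorm_le_bound _ hM0 fun w => ?_
    refine ContinuousLinearMap.opNorm_le_bound _ (by positivity) fun y => ?_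
    set G : recip b := ZSpan.floor b k
    obtain ⟨x, rfl⟩ := (T G).surjective y
    have h2 := fderiv_equivariant hd (T G) (T G) (G : Plane) (fun k x => h.equiv k G x)
      (ZSpan.fract b k) w x
    have h3 : ZSpan.fract b k + (G : Plane) = k := by simp [ZSpan.fract, G]
    rw [h3] at h2
    rw [← h2, LinearIsometryEquiv.norm_map, LinearIsometryEquiv.norm_map]
    refine (ContinuousLinearMap.le_opNorm _ _).trans ?_
    gcongr
    refine (ContinuousLinearMap.le_opNorm _ _).trans ?_
    gcongr
  refine ⟨M, h.proj, fun k k' => ?_⟩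
  exact convex_univ.norm_image_sub_le_of_norm_fderiv_le (fun x _ => hd x) (fun x _ => hb x)
    (Set.mem_univ k') (Set.mem_univ k)

lemma transport_equivariant {T : recip b → E ≃ₗᵢ[ℂ] E} {p : Plane → E →L[ℂ] E}
    (h : IsBundle b T p) (k k' : Plane) (G : recip b) (x : E) :
    T G (transport p k k' x) = transport p (k + G) (k' + G) (T G x) := by
  obtain ⟨K, hK⟩ := h.exists_isProjFamily
  refine transport_intertwine hK hK (T G) (T G).continuous _ _ _ _ (fun t x => ?_) x
  rw [h.equiv]
  congr 2
  rw [add_sub_add_right_eq_sub]; abel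

end Bundle

/-! ### Continuous families of complex structures: uniqueness, parallelism, smoothness. -/

section CStrFamily

variable {E : Type*} [NormedAddCommGroup E] [InnerProductSpace ℂ E] [CompleteSpace E]
  {C : E ≃ₗᵢ⋆[ℂ] E} {P J J' : Plane → E →L[ℂ] E} {K : ℝ}

/-- The sets where `J' = J` and where `J' = -J` are closed and complementary, and the plane is
connected. -/
lemma cstr_family_unique (hP : ∀ k, IsRealPlane C (P k)) (hJ : ∀ k, IsCStr C (P k) (J k))
    (hJ' : ∀ k, IsCStr C (P k) (J' k)) (hc : Continuous J) (hc' : Continuous J') :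
    J' = J ∨ J' = -J := by
  have h1 : IsClosed {k | J' k = J k} := isClosed_eq hc' hc
  have h2 : IsClosed {k | J' k = -J k} := isClosed_eq hc' hc.neg
  have h3 : {k | J' k = J k}ᶜ = {k | J' k = -J k} := by
    ext k
    simp only [Set.mem_compl_iff, Set.mem_ofPred_eq]
    constructor
    · exact fun h => (IsCStr.eq_or_neg (hP k) (hJ k) (hJ' k)).resolve_left h
    · intro h h'
      apply IsCStr.ne_zero (hP k) (hJ k)
      have : (2 : ℂ) • J k = 0 := by rw [two_smul]; nth_rw 1 [← h', h]; simp
      simpa using this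
  have h4 : IsClopen {k | J' k = J k} := ⟨h1, by rw [← isClosed_compl_iff, h3]; exact h2⟩
  rcases isClopen_iff.mp h4 with h5 | h5
  · right
    rw [h5, Set.compl_empty] at h3
    funext k
    exact h3.le (Set.mem_univ k)
  · left
    funext k
    exact h5.ge (Set.mem_univ k)

lemma cstr_family_eq (hP : ∀ k, IsRealPlane C (P k)) (hJ : ∀ k, IsCStr C (P k) (J k))
    (hJ' : ∀ k, IsCStr C (P k) (J' k)) (hc : Continuous J) (hc' : Continuous J')
    (k : Plane) (hk : J' k = J k) : J' = J := by
  refine (cstr_family_unique hP hJ hJ' hc hc').resolve_right fun h => ?_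
  apply IsCStr.ne_zero (hP k) (hJ k)
  have : (2 : ℂ) • J k = 0 := by rw [two_smul]; nth_rw 1 [← hk, h]; simp
  simpa using this

lemma transport_real (hK : IsProjFamily P K) (hP : ∀ k, IsRealPlane C (P k)) (k k' : Plane)
    (x : E) : C (transport P k k' x) = transport P k k' (C x) :=
  transport_intertwine hK hK C C.continuous _ _ _ _ (fun _ x => (hP _).comm x) x

section
variable (hK : IsProjFamily P K)
include hK

lemma IsProjFamily.transport_reverse_apply (k k' : Plane) (x : E) :
    transport P k k' (transport P k' k x) = P k x :=
  congrArg (fun A : E →L[ℂ] E => A x) (hK.transport_mul_reverse k k')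

lemma IsProjFamily.proj_transport_apply (k k' : Plane) (x : E) :
    P k (transport P k k' x) = transport P k k' x :=
  congrArg (fun A : E →L[ℂ] E => A x) (hK.proj_mul_transport k k')

lemma IsProjFamily.transport_proj_apply (k k' : Plane) (x : E) :
    transport P k k' (P k' x) = transport P k k' x :=
  congrArg (fun A : E →L[ℂ] E => A x) (hK.transport_mul_proj k k')

lemma IsProjFamily.transport_inner (k k' : Plane) (x y : E) :
    inner ℂ (transport P k k' x) y = inner ℂ x (transport P k' k y) := by
  rw [← hK.star_transport k k', ContinuousLinearMap.star_eq_adjoint,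
    ContinuousLinearMap.adjoint_inner_right]

/-- Parallel transport of a complex structure. -/
lemma isCStr_transport (hP : ∀ k, IsRealPlane C (P k)) {k₀ : Plane} {J₀ : E →L[ℂ] E}
    (hJ : IsCStr C (P k₀) J₀) (k : Plane) :
    IsCStr C (P k) (transport P k k₀ ∘L J₀ ∘L transport P k₀ k) where
  proj_apply x := hK.proj_transport_apply _ _ _
  apply_proj x := by simp [hK.transport_proj_apply]
  sq x := by
    simp [hK.transport_reverse_apply, hJ.apply_proj, hJ.sq, hK.transport_proj_apply]
  skew x y := by
    simp [hK.transport_inner, hJ.skew]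
  real x := by
    simp [transport_real hK hP, hJ.real]

lemma continuous_cstr_transport (k₀ : Plane) (J₀ : E →L[ℂ] E) :
    Continuous fun k => transport P k k₀ ∘L J₀ ∘L transport P k₀ k := by
  have h1 : Continuous fun k => transport P k k₀ :=
    hK.continuous_transport.comp₂ continuous_id continuous_const
  have h2 : Continuous fun k => transport P k₀ k :=
    hK.continuous_transport.comp₂ continuous_const continuous_id
  exact h1.clm_comp (continuous_const.clm_comp h2)

/-- A continuous family of complex structures is parallel. -/
lemma cstr_parallel (hP : ∀ k, IsRealPlane C (P k)) (hJ : ∀ k, IsCStr C (P k) (J k))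
    (hc : Continuous J) (k k' : Plane) (x : E) :
    transport P k k' (J k' x) = J k (transport P k k' x) := by
  -- Transporting the single structure `J k'` to all momenta gives a second continuous family that
  -- agrees with `J` at `k'`, hence everywhere.
  have h1 := cstr_family_eq hP hJ (isCStr_transport hK hP (hJ k')) hc
    (continuous_cstr_transport hK k' (J k')) k' (by
      ext x
      simp [hK.transport_self, (hJ k').proj_apply, (hJ k').apply_proj])
  have h2 := congrArg (fun f : Plane → E →L[ℂ] E => f k (transport P k k' x)) h1
  simpa [hK.transport_reverse_apply, (hJ k').apply_proj] using h2

end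

/-- A continuous family of complex structures is smooth. -/
lemma cstr_smooth (hs : ContDiff ℝ ∞ P) (hP : ∀ k, IsRealPlane C (P k))
    (hJ : ∀ k, IsCStr C (P k) (J k)) (hc : Continuous J) : ContDiff ℝ ∞ J := by
  rw [contDiff_iff_contDiffAt]
  intro k'
  obtain ⟨e, he, -, -⟩ := (hJ k').exists_adapted (hP k')
  set A : Plane → E →L[ℂ] E := fun q => P q ∘L J k' ∘L P q with hA
  have hAs : ∀ q, ContDiffAt ℝ ∞ A q := fun q =>
    hs.contDiffAt.opComp (contDiffAt_const.opComp hs.contDiffAt)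
  have hpi : ∀ q x, P q (P q x) = P q x := fun q x => proj_apply_apply (hP q).proj x
  have hl : ∀ q, ∃ r : ℝ, A q = (r : ℂ) • J q := fun q => by
    refine (hJ q).exists_smul (hP q) (fun x => ?_) (fun x => ?_) (fun x y => ?_) (fun x => ?_)
    · simp [hA, hpi]
    · simp [hA, hpi]
    · simp [hA, proj_inner (hP q).proj, (hJ k').skew]
    · simp [hA, (hP q).comm, (hJ k').real]
  choose l hl using hl
  have hPe : ContDiffAt ℝ ∞ (fun q => ‖P q (e 0)‖ ^ 2) k' :=
    (hs.contDiffAt.opApply contDiffAt_const).norm_sq ℂ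
  have hAe : ContDiffAt ℝ ∞ (fun q => ‖A q (e 0)‖ ^ 2) k' :=
    ((hAs k').opApply contDiffAt_const).norm_sq ℂ
  have hPe' : ‖P k' (e 0)‖ ^ 2 = 1 := by rw [he.apply, he.orthonormal.1]; simp
  have hinner : ∀ q, (inner ℂ (J q (e 0)) (A q (e 0)) : ℂ) = ((l q * ‖P q (e 0)‖ ^ 2 : ℝ) : ℂ) := by
    intro q
    rw [hl, _root_.smul_apply, inner_smul_right, (hJ q).skew, (hJ q).sq,
      inner_neg_right, neg_neg, ← hpi q (e 0), ← proj_inner (hP q).proj,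
      inner_self_eq_norm_sq_to_K, hpi]
    push_cast; rfl
  have hnorm : ∀ q, ‖A q (e 0)‖ ^ 2 = (l q) ^ 2 * ‖P q (e 0)‖ ^ 2 := by
    intro q
    rw [hl, _root_.smul_apply, norm_smul, ← (hJ q).apply_proj, (hJ q).norm_apply (hpi q _),
      mul_pow, Complex.norm_real, Real.norm_eq_abs, sq_abs]
  have hAk : A k' = J k' := by
    ext x; simp [hA, (hJ k').proj_apply, (hJ k').apply_proj]
  have hlk : l k' = 1 := by
    have h1 := hinner k'
    rw [hAk, (hJ k').skew, (hJ k').sq, he.apply, inner_neg_right, neg_neg, he.inner_eq, if_pos rfl,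
      he.orthonormal.1] at h1
    have : (1 : ℝ) = l k' * 1 ^ 2 := by exact_mod_cast h1
    simpa using this.symm
  have hcont : ContinuousAt (fun q => (inner ℂ (J q (e 0)) (A q (e 0)) : ℂ).re) k' := by
    have h1 : ContinuousAt (fun q => J q (e 0)) k' :=
      (hc.clm_apply continuous_const).continuousAt
    have h2 : ContinuousAt (fun q => A q (e 0)) k' :=
      ((hAs k').opApply contDiffAt_const).continuousAt
    exact Complex.continuous_re.continuousAt.comp (Filter.Tendsto.inner h1 h2)
  have hpos : ∀ᶠ q in 𝓝 k', 0 < l q := by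
    have h1 : ∀ᶠ q in 𝓝 k', 0 < (inner ℂ (J q (e 0)) (A q (e 0)) : ℂ).re := by
      refine hcont.eventually (lt_mem_nhds ?_)
      show 0 < (inner ℂ (J k' (e 0)) (A k' (e 0)) : ℂ).re
      rw [hinner, Complex.ofReal_re, hlk, hPe']
      norm_num
    filter_upwards [h1] with q hq
    rw [hinner, Complex.ofReal_re] at hq
    exact pos_of_mul_pos_left hq (sq_nonneg _)
  have hPpos : ∀ᶠ q in 𝓝 k', 0 < ‖P q (e 0)‖ ^ 2 :=
    hPe.continuousAt.eventually (lt_mem_nhds (by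
      show 0 < ‖P k' (e 0)‖ ^ 2
      rw [hPe']; norm_num))
  have hg : ContDiffAt ℝ ∞ (fun q => (Real.sqrt (‖A q (e 0)‖ ^ 2 / ‖P q (e 0)‖ ^ 2))⁻¹ • A q) k' := by
    refine ContDiffAt.smul (ContDiffAt.inv (ContDiffAt.sqrt (hAe.div hPe ?_) ?_) ?_) (hAs k')
    · rw [hPe']; norm_num
    · show ‖A k' (e 0)‖ ^ 2 / ‖P k' (e 0)‖ ^ 2 ≠ 0
      rw [hnorm, hlk, hPe']; norm_num
    · show √(‖A k' (e 0)‖ ^ 2 / ‖P k' (e 0)‖ ^ 2) ≠ 0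
      rw [hnorm, hlk, hPe']; norm_num
  refine hg.congr_of_eventuallyEq ?_
  filter_upwards [hpos, hPpos] with q h1 h2
  rw [hnorm, mul_div_cancel_right₀ _ h2.ne', Real.sqrt_sq h1.le, hl q]
  ext x
  simp only [_root_.smul_apply]
  rw [← Complex.coe_smul, smul_smul, ← Complex.ofReal_mul, inv_mul_cancel₀ h1.ne',
    Complex.ofReal_one, one_smul]

end CStrFamily

/-! ### Determinants of frame changes. -/

section FrameChange

variable {E : Type*} [NormedAddCommGroup E] [InnerProductSpace ℂ E] [CompleteSpace E]
  {C : E ≃ₗᵢ⋆[ℂ] E} {p : E →L[ℂ] E} {e u : Fin 2 → E}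

/-- The matrix expressing `u` in the orthonormal basis `e`. -/
def coeffs (e u : Fin 2 → E) : Matrix (Fin 2) (Fin 2) ℂ :=
  Matrix.of fun a c => inner ℂ (e a) (u c)

lemma IsFrame.eq_coeffs (he : IsFrame p e) {v : Fin 2 → E} (hv : ∀ a, p (v a) = v a) (c : Fin 2) :
    v c = coeffs e v 0 c • e 0 + coeffs e v 1 c • e 1 := by
  have := he.expand_of_mem (hv c)
  rwa [Fin.sum_univ_two] at this

lemma IsFrame.conjTranspose_coeffs_mul (he : IsFrame p e) {v w : Fin 2 → E}
    (hw : ∀ a, p (w a) = w a) :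
    (coeffs e v)ᴴ * coeffs e w = Matrix.of fun a c => inner ℂ (v a) (w c) := by
  ext a c
  have h1 := congrArg (fun z => (inner ℂ (v a) z : ℂ)) (he.expand_of_mem (hw c))
  simp only [Fin.sum_univ_two, inner_add_right, inner_smul_right] at h1
  simp only [Matrix.mul_apply, Fin.sum_univ_two, Matrix.conjTranspose_apply, coeffs, Matrix.of_apply]
  rw [h1, ← inner_conj_symm (v a) (e 0), ← inner_conj_symm (v a) (e 1)]
  simp only [starRingEnd_apply]
  ring

lemma IsFrame.conj_det_mul_det (he : IsFrame p e) (hu : IsFrame p u) :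
    conj (coeffs e u).det * (coeffs e u).det = 1 := by
  have h1 := he.conjTranspose_coeffs_mul (v := u) hu.apply
  have h2 := congrArg Matrix.det h1
  rw [Matrix.det_mul, Matrix.det_conjTranspose] at h2
  rw [starRingEnd_apply, h2]
  simp [Matrix.det_fin_two, hu.inner_eq]

/-- `-iτ_y` is antisymmetric, so a change of basis multiplies it by the determinant. Applying `C` to
the bras is what makes the coefficients enter without complex conjugation. -/
lemma IsRealFrame.ketbra_eq (he : IsRealFrame C p e) (hu : ∀ a, p (u a) = u a) :
    ketbra u (-Complex.I • pauliY) (fun a => C (u a)) = (coeffs e u).det • rot e := by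
  ext x
  rw [ketbra_pauliY, _root_.smul_apply, rot_apply, he.eq_coeffs hu 0, he.eq_coeffs hu 1]
  simp only [map_add, C.map_smulₛₗ, he.real, inner_add_left, inner_smul_left, Complex.conj_conj,
    Matrix.det_fin_two]
  module

/-- With `M = coeffs e u` the matrix is `Mᵀ M`. -/
lemma IsRealFrame.det_conj_inner (he : IsRealFrame C p e) (hu : ∀ a, p (u a) = u a) :
    (Matrix.of fun a a' => (inner ℂ (C (u a)) (u a') : ℂ)).det = (coeffs e u).det ^ 2 := by
  have h1 : ∀ a a', (inner ℂ (C (u a)) (u a') : ℂ) =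
      coeffs e u 0 a * coeffs e u 0 a' + coeffs e u 1 a * coeffs e u 1 a' := by
    intro a a'
    conv_lhs => rw [he.eq_coeffs hu a, he.eq_coeffs hu a']
    simp only [map_add, C.map_smulₛₗ, he.real, inner_add_left, inner_smul_left, Complex.conj_conj,
      inner_add_right, inner_smul_right, he.inner_eq]
    simp only [if_true, Fin.zero_eq_one_iff, one_ne_zero, zero_ne_one, if_false, mul_one, mul_zero,
      add_zero, zero_add, Nat.reduceEqDiff, OfNat.one_ne_ofNat]
    ring
  simp only [Matrix.det_fin_two, Matrix.of_apply, h1]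
  ring

lemma cpow_half_sq (z : ℂ) : (z ^ 2) ^ (1 / 2 : ℂ) = z ∨ (z ^ 2) ^ (1 / 2 : ℂ) = -z := by
  have h := Complex.cpow_nat_inv_pow (z ^ 2) two_ne_zero
  rw [show (1 / 2 : ℂ) = ((2 : ℕ) : ℂ)⁻¹ by norm_num]
  exact sq_eq_sq_iff_eq_or_eq_neg.mp h

end FrameChange

/-! ### Wilson lines of a valley, and the complex structure defined by `Q`. -/

namespace Valley

variable {b : Module.Basis (Fin 2) ℝ Plane} {E : Type*} [NormedAddCommGroup E]
  [InnerProductSpace ℂ E] [CompleteSpace E] (V : Valley b E)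

lemma T_zero (x : E) : V.T 0 x = x := by
  apply (V.T 0).injective
  rw [← V.T_add, add_zero]

lemma T_neg_apply (G : recip b) (x : E) : V.T G (V.T (-G) x) = x := by
  rw [← V.T_add, add_neg_cancel, V.T_zero]

lemma T_apply_neg (G : recip b) (x : E) : V.T (-G) (V.T G x) = x := by
  rw [← V.T_add, neg_add_cancel, V.T_zero]

lemma mem_range_iff (k : Plane) (x : E) :
    x ∈ Submodule.span ℂ {x : E | ∃ e : ℝ, V.lo k < e ∧ e < V.hi k ∧
      (x, (e : ℂ) • x) ∈ (V.H k).graph} ↔ V.P k x = x := by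
  rw [← V.P_range]
  constructor
  · rintro ⟨y, rfl⟩; exact proj_apply_apply (V.P_proj k) y
  · intro h; exact ⟨x, h⟩

/-- The energies are real and `C` commutes with `H`, so `C` maps eigenvectors to eigenvectors of the
same energy. -/
lemma P_C_of_mem {k : Plane} {x : E} (hx : V.P k x = x) : V.P k (V.C x) = V.C x := by
  rw [← V.mem_range_iff] at hx ⊢
  induction hx using Submodule.span_induction with
  | mem x h =>
    obtain ⟨e, h1, h2, h3⟩ := h
    refine Submodule.subset_span ⟨e, h1, h2, ?_⟩
    have := V.H_C k _ _ h3
    rwa [V.C.map_smulₛₗ, Complex.conj_ofReal] at this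
  | zero => simp
  | add x y _ _ hx hy => rw [map_add]; exact Submodule.add_mem _ hx hy
  | smul a x _ hx => rw [V.C.map_smulₛₗ]; exact Submodule.smul_mem _ _ hx

lemma P_T_of_mem {k : Plane} (G : recip b) {x : E} (hx : V.P k x = x) :
    V.P (k + G) (V.T G x) = V.T G x := by
  rw [← V.mem_range_iff] at hx ⊢
  induction hx using Submodule.span_induction with
  | mem x h =>
    obtain ⟨e, h1, h2, h3⟩ := h
    refine Submodule.subset_span ⟨e, by rwa [V.lo_periodic], by rwa [V.hi_periodic], ?_⟩
    have := V.H_T k G _ _ h3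
    rwa [map_smul] at this
  | zero => simp
  | add x y _ _ hx hy => rw [map_add]; exact Submodule.add_mem _ hx hy
  | smul a x _ hx => rw [map_smul]; exact Submodule.smul_mem _ _ hx

lemma isRealPlane (k : Plane) : IsRealPlane V.C (V.P k) where
  invol := V.C_sq
  proj := V.P_proj k
  comm x := by
    refine proj_intertwine (V.P_proj k) (V.P_proj k) V.C (map_sub V.C) (fun x y h => ?_)
      (fun x => V.P_C_of_mem (proj_apply_apply (V.P_proj k) x)) (fun y => ⟨V.C (V.P k y), ?_⟩) x
    · rw [anti_inner, ← inner_conj_symm, h, map_zero]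
    · rw [V.P_C_of_mem (proj_apply_apply (V.P_proj k) y), V.C_sq]
  frame := IsFrame.exists_of_finrank (V.P_proj k) (V.P_rank k)

lemma isBundle : IsBundle b V.T V.P where
  proj := V.P_proj
  smooth := V.P_smooth
  equiv k G x := by
    refine proj_intertwine (V.P_proj k) (V.P_proj (k + G)) (V.T G) (map_sub (V.T G))
      (fun x y h => ?_) (fun x => V.P_T_of_mem G (proj_apply_apply (V.P_proj k) x))
      (fun y => ⟨V.T (-G) (V.P (k + G) y), ?_⟩) x
    · rwa [LinearIsometryEquiv.inner_map_map]
    · have h1 := V.P_T_of_mem (-G) (proj_apply_apply (V.P_proj (k + G)) y)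
      rw [show k + (G : Plane) + ((-G : recip b) : Plane) = k by
        rw [Submodule.coe_neg]; abel] at h1
      rw [h1, V.T_neg_apply]

variable {V} {u : Plane → Fin 2 → E}

lemma IsGauge.isFrame (hu : V.IsGauge u) (k : Plane) : IsFrame (V.P k) (u k) :=
  IsFrame.of_finrank (V.P_proj k) (hu.orthonormal k) (hu.mem k) (V.P_rank k)

lemma prodStep_eq_list (P : Plane → E →L[ℂ] E) (a d : Plane) (n : ℕ) :
    prodStep P a d n = P a * (List.ofFn fun j : Fin n => P (a + ((j : ℝ) + 1) • d)).prod := by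
  induction n with
  | zero => simp [prodStep]
  | succ n ih =>
    rw [prodStep, ih, List.ofFn_succ', List.concat_eq_append, List.prod_append]
    simp [mul_assoc]

/-- The approximations `transportApprox` contain in addition the projections at the two endpoints;
these fix the frame vectors, so the matrix elements coincide for every `L`. -/
lemma wilson_segment (hu : V.IsGauge u) (k k' : Plane) :
    V.wilson u (segmentPath k k') =
      Matrix.of fun a a' => inner ℂ (u k a) (transport V.P k k' (u k' a')) := by
  obtain ⟨K, hK⟩ := V.isBundle.exists_isProjFamily
  apply Filter.Tendsto.limUnder_eq
  have h0 : ∀ L, V.wilsonApprox u (segmentPath k k') L =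
      Matrix.of fun a a' => inner ℂ (u k a) (transportApprox V.P k k' L (u k' a')) := by
    intro L
    ext a a'
    have hL : ((L : ℝ) + 1) ≠ 0 := by positivity
    simp only [wilsonApprox, Matrix.of_apply, segmentPath, AffineMap.lineMap_apply_zero,
      AffineMap.lineMap_apply_one, transportApprox]
    rw [prodStep, prodStep_eq_list, smul_smul, mul_inv_cancel₀ hL, one_smul, add_sub_cancel]
    simp only [mul_apply_eq_comp, ContinuousLinearMap.comp_apply, hu.mem]
    rw [← proj_inner (V.P_proj k), hu.mem]
    congr 4
    ext j : 1
    rw [AffineMap.lineMap_apply, smul_smul, vsub_eq_sub, vadd_eq_add, add_comm, div_eq_mul_inv]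
  refine tendsto_pi_nhds.mpr fun a => tendsto_pi_nhds.mpr fun a' => ?_
  simp only [h0, Matrix.of_apply]
  exact tendsto_const_nhds.inner (((ContinuousLinearMap.apply ℂ E (u k' a')).continuous.tendsto
    _).comp (hK.tendsto_transport k k'))

lemma transport_realFrame {k : Plane} {e : Fin 2 → E} (he : IsRealFrame V.C (V.P k) e)
    (k' : Plane) : IsRealFrame V.C (V.P k') (fun a => transport V.P k' k (e a)) := by
  obtain ⟨K, hK⟩ := V.isBundle.exists_isProjFamily
  refine ⟨isFrame_pair (V.P_proj k') (V.isRealPlane k').frame ?_ fun a =>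
    hK.proj_transport_apply _ _ _, fun a => ?_⟩
  · rw [orthonormal_iff_ite]
    intro a c
    rw [hK.transport_inner, hK.transport_reverse_apply, he.apply, he.inner_eq]
  · rw [transport_real hK V.isRealPlane, he.real]

/-- In the basis `e` at `k` and its transport at `k'`, the transport is the identity matrix; only
the two frame changes remain. -/
lemma detW_eq (hu : V.IsGauge u) {k : Plane} {e : Fin 2 → E} (he : IsRealFrame V.C (V.P k) e)
    (k' : Plane) : V.detW u k k' = conj (coeffs e (u k)).det *
      (coeffs (fun a => transport V.P k' k (e a)) (u k')).det := by
  obtain ⟨K, hK⟩ := V.isBundle.exists_isProjFamily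
  have h1 := he.conjTranspose_coeffs_mul (v := u k)
    (w := fun c => transport V.P k k' (u k' c)) (fun a => hK.proj_transport_apply _ _ _)
  have h2 : coeffs e (fun c => transport V.P k k' (u k' c)) =
      coeffs (fun a => transport V.P k' k (e a)) (u k') := by
    ext a c
    simp only [coeffs, Matrix.of_apply, hK.transport_inner]
  rw [detW, wilson_segment hu, ← h1, Matrix.det_mul, Matrix.det_conjTranspose, h2,
    starRingEnd_apply]

lemma rot_transport (k : Plane) (e : Fin 2 → E) (k' : Plane) :
    rot (fun a => transport V.P k' k (e a)) =
      transport V.P k' k ∘L rot e ∘L transport V.P k k' := by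
  obtain ⟨K, hK⟩ := V.isBundle.exists_isProjFamily
  ext x
  simp [rot_apply, hK.transport_inner]

/-- `√2 Q_{k₀}` is a parallel complex structure. -/
lemma exists_Q₀_eq (hu : V.IsGauge u) (k₀ : Plane) : ∃ J₀, IsCStr V.C (V.P k₀) J₀ ∧
    ∀ k, (Real.sqrt 2 : ℂ) • V.Q₀ u k₀ k =
      transport V.P k k₀ ∘L J₀ ∘L transport V.P k₀ k := by
  obtain ⟨e, he⟩ := (V.isRealPlane k₀).exists_realFrame
  have hs2 : (Real.sqrt 2 : ℂ) ≠ 0 := by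
    rw [Complex.ofReal_ne_zero]; positivity
  have hd0 := he.conj_det_mul_det (hu.isFrame k₀)
  -- `s = ±1` records which root of the squared determinant the principal branch picks. By
  -- `detW_eq`, `η` reduces to `s` times the determinant of the frame at `k`, and its conjugate
  -- cancels the determinant produced by `ketbra_eq`.
  have key : ∀ s : ℂ, (Matrix.det (Matrix.of fun a a' =>
      (inner ℂ (V.conjFrame u k₀ a) (u k₀ a') : ℂ))) ^ (1 / 2 : ℂ) = s * (coeffs e (u k₀)).det →
      ∀ k, (Real.sqrt 2 : ℂ) • V.Q₀ u k₀ k =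
      transport V.P k k₀ ∘L (conj s • rot e) ∘L transport V.P k₀ k := by
    intro s hs k
    have he' := transport_realFrame he k
    have hd1 := he'.conj_det_mul_det (hu.isFrame k)
    have hk : ketbra (u k) (-Complex.I • pauliY) (V.conjFrame u k) =
        (coeffs (fun a => transport V.P k k₀ (e a)) (u k)).det •
          rot (fun a => transport V.P k k₀ (e a)) := he'.ketbra_eq (hu.mem k)
    rw [Q₀, hk, smul_smul, smul_smul, eta, detW_eq hu he, hs, ContinuousLinearMap.smul_comp,
      ContinuousLinearMap.comp_smul, ← rot_transport k₀ e]
    congr 1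
    simp only [map_mul, Complex.conj_conj]
    field_simp
    linear_combination (conj s * conj (coeffs (fun a => transport V.P k k₀ (e a)) (u k)).det *
      (coeffs (fun a => transport V.P k k₀ (e a)) (u k)).det) * hd0 + conj s * hd1
  have hdet : (Matrix.det (Matrix.of fun a a' =>
      (inner ℂ (V.conjFrame u k₀ a) (u k₀ a') : ℂ))) = (coeffs e (u k₀)).det ^ 2 :=
    he.det_conj_inner (hu.mem k₀)
  have hrot := he.isCStr
  rw [hdet] at key
  rcases cpow_half_sq (coeffs e (u k₀)).det with h | h
  · refine ⟨rot e, hrot, ?_⟩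
    simpa using key 1 (by rw [h, one_mul])
  · refine ⟨-rot e, ⟨fun x => ?_, fun x => ?_, fun x => ?_, fun x y => ?_, fun x => ?_⟩, ?_⟩
    · simp [hrot.proj_apply]
    · simp [hrot.apply_proj]
    · simp [hrot.sq]
    · simp [hrot.skew]
    · simp [hrot.real]
    · simpa using key (-1) (by rw [h]; ring)

/-- The unnormalized complex structure. -/
def J₀ (V : Valley b E) (u : Plane → Fin 2 → E) (k₀ k : Plane) : E →L[ℂ] E :=
  (Real.sqrt 2 : ℂ) • V.Q₀ u k₀ k

lemma isCStr_J₀ (hu : V.IsGauge u) (k₀ k : Plane) : IsCStr V.C (V.P k) (V.J₀ u k₀ k) := by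
  obtain ⟨K, hK⟩ := V.isBundle.exists_isProjFamily
  obtain ⟨J, hJ, h⟩ := exists_Q₀_eq hu k₀
  rw [J₀, h]
  exact isCStr_transport hK V.isRealPlane hJ k

lemma continuous_J₀ (hu : V.IsGauge u) (k₀ : Plane) : Continuous (V.J₀ u k₀) := by
  obtain ⟨K, hK⟩ := V.isBundle.exists_isProjFamily
  obtain ⟨J, hJ, h⟩ := exists_Q₀_eq hu k₀
  exact (continuous_cstr_transport hK k₀ J).congr fun k => (h k).symm

lemma contDiff_J₀ (hu : V.IsGauge u) (k₀ : Plane) : ContDiff ℝ ∞ (V.J₀ u k₀) :=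
  cstr_smooth V.P_smooth V.isRealPlane (isCStr_J₀ hu k₀) (continuous_J₀ hu k₀)

lemma isRealFrame_T {k : Plane} {e : Fin 2 → E} (he : IsRealFrame V.C (V.P k) e) (G : recip b) :
    IsRealFrame V.C (V.P (k + G)) (fun a => V.T G (e a)) := by
  refine ⟨isFrame_pair (V.P_proj _) (V.isRealPlane _).frame ?_ fun a => ?_, fun a => ?_⟩
  · exact he.orthonormal.comp_linearIsometry (V.T G).toLinearIsometry
  · rw [← V.isBundle.equiv, he.apply]
  · rw [V.C_T, he.real]

lemma rot_T (e : Fin 2 → E) (G : recip b) (x : E) :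
    rot (fun a => V.T G (e a)) (V.T G x) = V.T G (rot e x) := by
  simp [rot_apply]

/-- In an orientable valley, continuous complex structures are equivariant. -/
lemma cstr_equivariant (hO : V.Orientable) (hu : V.IsGauge u) {J : Plane → E →L[ℂ] E}
    (hJ : ∀ k, IsCStr V.C (V.P k) (J k)) (hc : Continuous J) (G : recip b) (k : Plane) (x : E) :
    V.T G (J k x) = J (k + G) (V.T G x) := by
  obtain ⟨K, hK⟩ := V.isBundle.exists_isProjFamily
  obtain ⟨G, hG⟩ := G
  induction hG using Submodule.span_induction generalizing k x with
  | mem G h =>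
    obtain ⟨β, rfl⟩ := h
    obtain ⟨k', hk'⟩ := hO u hu β
    set G : recip b := ⟨b β, Submodule.subset_span ⟨β, rfl⟩⟩
    -- The translate of `J` by `b β` is again a continuous family of complex structures. By
    -- uniqueness it equals `J` as soon as it does at `k'`, where the Wilson line has determinant
    -- one.
    set J' : Plane → E →L[ℂ] E := fun q =>
      (V.T (-G)).toContinuousLinearEquiv.toContinuousLinearMap ∘L J (q + b β) ∘L
        (V.T G).toContinuousLinearEquiv.toContinuousLinearMap with hJ'def
    have hJ'a : ∀ q x, J' q x = V.T (-G) (J (q + b β) (V.T G x)) := fun q x => rfl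
    have hPT : ∀ q x, V.T (-G) (V.P (q + b β) x) = V.P q (V.T (-G) x) := by
      intro q x
      rw [V.isBundle.equiv]
      congr 2
      rw [Submodule.coe_neg]; simp [G]
    have hJ' : ∀ q, IsCStr V.C (V.P q) (J' q) := fun q => by
      have hq := hJ (q + b β)
      refine ⟨fun x => ?_, fun x => ?_, fun x => ?_, fun x y => ?_, fun x => ?_⟩
      · rw [hJ'a, ← hPT, hq.proj_apply]
      · rw [hJ'a, V.isBundle.equiv]
        exact congrArg _ (hq.apply_proj _)
      · rw [hJ'a, hJ'a, V.T_neg_apply, hq.sq, map_neg, hPT, V.T_apply_neg]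
      · have h1 : ∀ a c : E, (inner ℂ (V.T (-G) a) c : ℂ) = inner ℂ a (V.T G c) := fun a c => by
          rw [← LinearIsometryEquiv.inner_map_map (V.T G), V.T_neg_apply]
        have h2 : ∀ a c : E, (inner ℂ (V.T G a) c : ℂ) = inner ℂ a (V.T (-G) c) := fun a c => by
          rw [← LinearIsometryEquiv.inner_map_map (V.T (-G)), V.T_apply_neg]
        rw [hJ'a, hJ'a, h1, hq.skew, h2]
      · rw [hJ'a, hJ'a, V.C_T, hq.real, V.C_T]
    have hc' : Continuous J' :=
      continuous_const.clm_comp ((hc.comp (continuous_add_const _)).clm_comp continuous_const)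
    have hk'' : J' k' = J k' := by
      obtain ⟨e, he, j0, j1⟩ := (hJ k').exists_adapted (V.isRealPlane k')
      have r0 := (hJ k').eq_rot he j0
      have he' := transport_realFrame he (k' + b β)
      have r1 : J (k' + b β) = rot (fun a => transport V.P (k' + b β) k' (e a)) := by
        refine (hJ _).eq_rot he' ?_
        rw [← cstr_parallel hK V.isRealPlane hJ hc, j0]
      have heT : IsRealFrame V.C (V.P (k' + b β)) (fun a => V.T G (e a)) := isRealFrame_T he G
      have k1 := he'.ketbra_eq (hu.mem (k' + b β))
      have k2 := heT.ketbra_eq (hu.mem (k' + b β))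
      have c2 : coeffs (fun a => V.T G (e a)) (u (k' + b β)) = coeffs e (u k') := by
        ext a c
        have := hu.periodic k' G c
        change u (k' + b β) c = _ at this
        simp [coeffs, this]
      have d0 := he.conj_det_mul_det (hu.isFrame k')
      rw [detW_eq hu he] at hk'
      -- Determinant one means that the frame `u` has the same determinant relative to the
      -- transported frame as relative to `T G e`; hence both frames define the same rotation.
      have d1 : (coeffs (fun a => transport V.P (k' + b β) k' (e a)) (u (k' + b β))).det =
          (coeffs e (u k')).det := by
        linear_combination (-(coeffs (fun a => transport V.P (k' + b β) k' (e a))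
          (u (k' + b β))).det) * d0 + (coeffs e (u k')).det * hk'
      rw [k1, d1, c2] at k2
      have hne : (coeffs e (u k')).det ≠ 0 := fun h0 => by simp [h0] at d0
      have k3 := smul_right_injective _ hne k2
      ext x
      rw [hJ'a, r1, k3, rot_T, V.T_apply_neg, r0]
    have h1 := congrArg (fun f : Plane → E →L[ℂ] E => f k x)
      (cstr_family_eq V.isRealPlane hJ hJ' hc hc' k' hk'')
    simp only [hJ'a] at h1
    rw [← h1, V.T_neg_apply]
  | zero =>
    have : (⟨0, Submodule.zero_mem _⟩ : recip b) = 0 := rfl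
    simp only [this, V.T_zero, Submodule.coe_zero, add_zero]
  | add G G' hG hG' h1 h2 =>
    have : (⟨G + G', Submodule.add_mem _ hG hG'⟩ : recip b) = ⟨G, hG⟩ + ⟨G', hG'⟩ := rfl
    rw [this, V.T_add, V.T_add, h2, h1]
    simp only [Submodule.coe_add]
    rw [add_assoc, add_comm G']
  | smul n G hG h =>
    have hneg : ∀ (G' : recip b), (∀ k x, V.T G' (J k x) = J (k + G') (V.T G' x)) →
        ∀ k x, V.T (-G') (J k x) = J (k + (-G' : recip b)) (V.T (-G') x) := by
      intro G' h' k x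
      apply (V.T G').injective
      rw [h', V.T_neg_apply, V.T_neg_apply, Submodule.coe_neg, neg_add_cancel_right]
    have hnat : ∀ (m : ℕ) k x, V.T (m • (⟨G, hG⟩ : recip b)) (J k x) =
        J (k + (m • (⟨G, hG⟩ : recip b) : recip b)) (V.T (m • (⟨G, hG⟩ : recip b)) x) := by
      intro m
      induction m with
      | zero => intro k x; simp only [zero_smul, V.T_zero, Submodule.coe_zero, add_zero]
      | succ m ih =>
        intro k x
        rw [add_smul, one_smul, V.T_add, V.T_add, h, ih]
        simp only [Submodule.coe_add]
        rw [add_assoc, add_comm G]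
    have : (⟨n • G, Submodule.smul_mem _ n hG⟩ : recip b) = n • (⟨G, hG⟩ : recip b) := rfl
    rw [this]
    rcases Int.eq_nat_or_neg n with ⟨m, rfl | rfl⟩
    · rw [natCast_zsmul]; exact hnat m k x
    · rw [neg_smul, natCast_zsmul]; exact hneg _ (hnat m) k x

end Valley

/-! ### Derivatives of projections and of complex structures. -/

section ProjDeriv

variable {E : Type*} [NormedAddCommGroup E] [InnerProductSpace ℂ E] [CompleteSpace E]
  {X : Type*} [NormedAddCommGroup X] [NormedSpace ℝ X]
  {p P J : X → E →L[ℂ] E} {C : E ≃ₗᵢ⋆[ℂ] E} {k : X}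

lemma fderiv_proj_add (hp : ∀ k, IsStarProjection (p k)) (hd : DifferentiableAt ℝ p k) (w : X)
    (x : E) : fderiv ℝ p k w x = fderiv ℝ p k w (p k x) + p k (fderiv ℝ p k w x) := by
  have h1 : (fun q => p q ∘L p q) = p := by
    funext q; exact (hp q).isIdempotentElem
  have h2 := fderiv_opComp hd hd w
  rw [h1] at h2
  conv_lhs => rw [h2]
  simp

lemma proj_fderiv_proj (hp : ∀ k, IsStarProjection (p k)) (hd : DifferentiableAt ℝ p k) (w : X)
    (x : E) : p k (fderiv ℝ p k w (p k x)) = 0 := by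
  have h1 := congrArg (p k) (fderiv_proj_add hp hd w (p k x))
  rw [map_add, proj_apply_apply (hp k), proj_apply_apply (hp k)] at h1
  simpa using h1

lemma fderiv_inner_symm {A B : X → E →L[ℂ] E} (hA : DifferentiableAt ℝ A k)
    (h : ∀ q x y, (inner ℂ (A q x) y : ℂ) = inner ℂ x (B q y))
    (w : X) (x y : E) : (inner ℂ (fderiv ℝ A k w x) y : ℂ) = inner ℂ x (fderiv ℝ B k w y) := by
  have h1 : B = fun q => ContinuousLinearMap.adjoint (A q) := by
    funext q
    rw [ContinuousLinearMap.eq_adjoint_iff]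
    intro x y
    rw [← inner_conj_symm, ← h, inner_conj_symm]
  rw [h1, fderiv_adjoint hA, ContinuousLinearMap.adjoint_inner_right]

lemma fderiv_real {A : X → E →L[ℂ] E} (hA : DifferentiableAt ℝ A k)
    (h : ∀ q x, C (A q x) = A q (C x)) (w : X) (x : E) :
    C (fderiv ℝ A k w x) = fderiv ℝ A k w (C x) :=
  fderiv_intertwine (antiR C) (antiR C) hA hA (fun q x => h q x) w x

/-- Complex structures are parallel: their derivative is determined by that of the projection. -/
lemma fderiv_cstr (hP : ∀ k, IsRealPlane C (P k)) (hJ : ∀ k, IsCStr C (P k) (J k))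
    (hPd : DifferentiableAt ℝ P k) (hJd : DifferentiableAt ℝ J k) (w : X) (x : E) :
    fderiv ℝ J k w x = fderiv ℝ P k w (J k x) + J k (fderiv ℝ P k w x) := by
  set a := fderiv ℝ P k w with ha
  set j := fderiv ℝ J k w with hj
  have h1 : ∀ x, j x = a (J k x) + P k (j x) := fun x => by
    have e : (fun q => P q ∘L J q) = J := by
      funext q; ext x; exact (hJ q).proj_apply x
    have h2 := fderiv_opComp hPd hJd w
    rw [e] at h2
    rw [hj]; nth_rw 1 [h2]; simp [ha]
  have h2 : ∀ x, j x = j (P k x) + J k (a x) := fun x => by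
    have e : (fun q => J q ∘L P q) = J := by
      funext q; ext x; exact (hJ q).apply_proj x
    have h2 := fderiv_opComp hJd hPd w
    rw [e] at h2
    rw [hj]; nth_rw 1 [h2]; simp [ha]
  have h3 : ∀ x, j (J k x) + J k (j x) = -a x := fun x => by
    have e : (fun q => J q ∘L J q) = fun q => -P q := by
      funext q; ext x; exact (hJ q).sq x
    have h2 := congrArg (fun A : E →L[ℂ] E => A x) (fderiv_opComp hJd hJd w)
    rw [e, fderiv_fun_neg] at h2
    simpa using h2.symm
  have hpp : ∀ x, P k (P k x) = P k x := proj_apply_apply (hP k).proj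
  have hskew : ∀ x y, (inner ℂ (j x) y : ℂ) = -inner ℂ x (j y) := fun x y => by
    have := fderiv_inner_symm (B := fun q => -J q) hJd
      (fun q x y => by simp [(hJ q).skew]) w x y
    rw [fderiv_fun_neg] at this
    simpa using this
  -- The diagonal block of the derivative of `J` is real and skew, hence `r J`. Differentiating `J²
  -- = -P` and using that `dP` has no diagonal block forces `r P = 0`.
  obtain ⟨r, hr⟩ := (hJ k).exists_smul (A := P k ∘L j ∘L P k) (hP k) (fun x => hpp _)
    (fun x => by simp [hpp]) (fun x y => by simp [proj_inner (hP k).proj, hskew])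
    (fun x => by simp [(hP k).comm, hj, fderiv_real hJd fun q x => (hJ q).real x])
  have hr' : ∀ x, P k (j (P k x)) = (r : ℂ) • J k x := fun x =>
    congrArg (fun A : E →L[ℂ] E => A x) hr
  have hpap : ∀ x, P k (a (P k x)) = 0 := proj_fderiv_proj (fun q => (hP q).proj) hPd w
  have hrP : ∀ x, (r : ℂ) • P k x = 0 := by
    intro x
    have h4 := congrArg (P k) (h3 (P k x))
    have h5 : P k (j (J k (P k x))) = -((r : ℂ) • P k x) := by
      rw [(hJ k).apply_proj, ← (hJ k).proj_apply x, hr', (hJ k).sq, smul_neg]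
    have h7 : P k (J k (j (P k x))) = -((r : ℂ) • P k x) := by
      rw [(hJ k).proj_apply, ← (hJ k).apply_proj (j _), hr', map_smul, (hJ k).sq, smul_neg]
    rw [map_neg, hpap, map_add, h5, h7] at h4
    have h8 : (2 : ℂ) • ((r : ℂ) • P k x) = 0 := by
      rw [two_smul, ← neg_eq_zero, neg_add, h4, neg_zero]
    simpa using h8
  have hr0 : ∀ x, (r : ℂ) • J k x = 0 := fun x => by
    rw [← (hJ k).proj_apply]; exact hrP _
  have h6 : P k (j x) = J k (a x) := by
    have h7 := congrArg (P k) (h2 x)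
    rwa [map_add, hr', hr0, zero_add, (hJ k).proj_apply] at h7
  rw [h1, h6]

end ProjDeriv

/-! ### The eigenline of a complex structure and its Berry curvature. -/

section LineProj

variable {E : Type*} [NormedAddCommGroup E] [InnerProductSpace ℂ E] [CompleteSpace E]
  {C : E ≃ₗᵢ⋆[ℂ] E}

/-- The projection onto the eigenvectors of the complex structure `J` with eigenvalue `-i`. -/
def lineProj (P J : Plane → E →L[ℂ] E) (k : Plane) : E →L[ℂ] E :=
  (1 / 2 : ℂ) • (P k + Complex.I • J k)

lemma lineProj_apply (P J : Plane → E →L[ℂ] E) (k : Plane) (x : E) :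
    lineProj P J k x = (1 / 2 : ℂ) • (P k x + Complex.I • J k x) := rfl

/-- Berry curvature of a family of projections. -/
def berry (p : Plane → E →L[ℂ] E) (k : Plane) : ℂ := -Complex.I * curvatureTrace (p k) p k

/-- A rank-one projection with unit vector `ℓ`. -/
def IsLine (p : E →L[ℂ] E) (ℓ : E) : Prop := ‖ℓ‖ = 1 ∧ ∀ x, p x = inner ℂ ℓ x • ℓ

namespace IsLine

variable {p : E →L[ℂ] E} {ℓ : E}

lemma apply (h : IsLine p ℓ) : p ℓ = ℓ := by
  rw [h.2, inner_self_eq_norm_sq_to_K, h.1]; simp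

lemma isFrame (h : IsLine p ℓ) : IsFrame p ![ℓ] := by
  refine ⟨⟨fun i => by fin_cases i; exact h.1, fun i j hij => ?_⟩, fun x => by simpa using h.2 x⟩
  exact absurd (Subsingleton.elim i j) hij

lemma frTrace_eq (h : IsLine p ℓ) {A : E →L[ℂ] E} (hA : ∀ x, p (A x) = A x) :
    frTrace A = inner ℂ ℓ (A ℓ) := by
  rw [h.isFrame.frTrace_eq hA]; simp

lemma inner_self (h : IsLine p ℓ) : (inner ℂ ℓ ℓ : ℂ) = 1 := by
  rw [inner_self_eq_norm_sq_to_K, h.1]; simp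

lemma eq_smul (h : IsLine p ℓ) {x : E} (hx : p x = x) : x = (inner ℂ ℓ x : ℂ) • ℓ := by
  rw [← h.2, hx]

end IsLine

/-- From `J e₀ = e₁` and `J e₁ = -e₀` follows `J (e₀ + i e₁) = -i (e₀ + i e₁)`. -/
lemma chernFrame_isLine {P J : Plane → E →L[ℂ] E} {k : Plane} {e : Plane → Fin 2 → E}
    (he : IsRealFrame C (P k) (e k)) (hJ : J k = rot (e k)) :
    IsLine (lineProj P J k) (Valley.chernFrame e k 0) := by
  have hs : (1 / (Real.sqrt 2 : ℂ)) * (1 / (Real.sqrt 2 : ℂ)) = 1 / 2 := by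
    rw [div_mul_div_comm, ← Complex.ofReal_mul, Real.mul_self_sqrt (by norm_num)]; norm_num
  have hc : conj (1 / (Real.sqrt 2 : ℂ)) = 1 / (Real.sqrt 2 : ℂ) := by
    rw [map_div₀, Complex.conj_ofReal, map_one]
  have hv : Valley.chernFrame e k 0 = (1 / (Real.sqrt 2 : ℂ)) • (e k 0 + Complex.I • e k 1) := rfl
  constructor
  · have h1 : (inner ℂ (Valley.chernFrame e k 0) (Valley.chernFrame e k 0) : ℂ) = 1 := by
      rw [hv]
      simp only [inner_smul_left, inner_smul_right, inner_add_left, inner_add_right, he.inner_eq, hc]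
      simp only [if_true, zero_ne_one, one_ne_zero, if_false, Complex.conj_I]
      linear_combination 2 * hs - (1 / (Real.sqrt 2 : ℂ)) * (1 / (Real.sqrt 2 : ℂ)) * Complex.I_sq
    have h2 : ‖Valley.chernFrame e k 0‖ ^ 2 = 1 := by
      rw [@norm_sq_eq_re_inner ℂ, h1]; simp
    nlinarith [norm_nonneg (Valley.chernFrame e k 0)]
  · intro x
    rw [lineProj_apply, hJ, rot_apply, he.expand, Fin.sum_univ_two, hv]
    simp only [inner_smul_left, inner_add_left, map_mul, hc, Complex.conj_I, smul_add, smul_smul,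
      smul_sub]
    have hI := Complex.I_sq
    match_scalars
    · linear_combination (-(inner ℂ (e k 0) x - Complex.I * inner ℂ (e k 1) x)) * hs
    · linear_combination (-(inner ℂ (e k 0) x - Complex.I * inner ℂ (e k 1) x)) * Complex.I * hs
        + (1 / 2 : ℂ) * inner ℂ (e k 1) x * hI

variable {P J : Plane → E →L[ℂ] E} {k : Plane}

lemma lineProj_isStarProjection (hp : IsRealPlane C (P k)) (hJ : IsCStr C (P k) (J k)) :
    IsStarProjection (lineProj P J k) := by
  constructor
  · show lineProj P J k * lineProj P J k = lineProj P J k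
    ext x
    have hpp : P k (P k x) = P k x := proj_apply_apply hp.proj x
    simp only [mul_apply_eq_comp, ContinuousLinearMap.comp_apply, lineProj_apply, map_smul,
      map_add, hJ.sq, hJ.proj_apply, hJ.apply_proj, hpp]
    match_scalars
    · linear_combination (-(1 / 4 : ℂ)) * Complex.I_sq
    · ring
  · rw [ContinuousLinearMap.isSelfAdjoint_iff_isSymmetric]
    intro x y
    have h1 := proj_inner hp.proj x y
    have h2 := hJ.skew x y
    simp only [ContinuousLinearMap.coe_coe, lineProj_apply, inner_smul_left, inner_smul_right,
      inner_add_left, inner_add_right, h1, h2, map_div₀, map_one, map_ofNat, Complex.conj_I]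
    ring

lemma lineProj_exists_isLine (hp : IsRealPlane C (P k)) (hJ : IsCStr C (P k) (J k)) :
    ∃ e : Fin 2 → E, IsRealFrame C (P k) e ∧ J k (e 0) = e 1 ∧ J k (e 1) = -e 0 ∧
      IsLine (lineProj P J k) (Valley.chernFrame (fun _ => e) k 0) := by
  obtain ⟨e, he, j0, j1⟩ := hJ.exists_adapted hp
  exact ⟨e, he, j0, j1, chernFrame_isLine (e := fun _ => e) he (hJ.eq_rot he j0)⟩

/-- The Berry curvature of the eigenline of a complex structure. -/
lemma berry_lineProj (hP : ∀ k, IsRealPlane C (P k)) (hJ : ∀ k, IsCStr C (P k) (J k))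
    (hPs : Differentiable ℝ P) (hJs : Differentiable ℝ J) (k : Plane) :
    berry (lineProj P J) k = (1 / 2) * curvatureTrace (J k) P k := by
  obtain ⟨e, he, j0, j1, hl⟩ := lineProj_exists_isLine (hP k) (hJ k)
  set ℓ := Valley.chernFrame (fun _ => e) k 0 with hℓ
  have hv : ℓ = (1 / (Real.sqrt 2 : ℂ)) • (e 0 + Complex.I • e 1) := rfl
  have hs : (1 / (Real.sqrt 2 : ℂ)) * (1 / (Real.sqrt 2 : ℂ)) = 1 / 2 := by
    rw [div_mul_div_comm, ← Complex.ofReal_mul, Real.mul_self_sqrt (by norm_num)]; norm_num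
  have hc : conj (1 / (Real.sqrt 2 : ℂ)) = 1 / (Real.sqrt 2 : ℂ) := by
    rw [map_div₀, Complex.conj_ofReal, map_one]
  have hpr := lineProj_isStarProjection (hP k) (hJ k)
  have hJl : J k ℓ = -Complex.I • ℓ := by
    rw [hv, map_smul, map_add, map_smul, j0, j1]
    match_scalars
    · linear_combination (1 / (Real.sqrt 2 : ℂ)) * Complex.I_sq
    · ring
  have hPl : P k ℓ = ℓ := by rw [hv, map_smul, map_add, map_smul, he.apply, he.apply]
  have hld : ∀ w x, fderiv ℝ (lineProj P J) k w x =
      (1 / 2 : ℂ) • (fderiv ℝ P k w x + Complex.I • fderiv ℝ J k w x) := by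
    intro w x
    have h1 : HasFDerivAt (lineProj P J)
        ((1 / 2 : ℂ) • (fderiv ℝ P k + Complex.I • fderiv ℝ J k)) k :=
      ((hPs k).hasFDerivAt.add ((hJs k).hasFDerivAt.const_smul Complex.I)).const_smul (1 / 2 : ℂ)
    rw [h1.fderiv]; rfl
  have hpap : ∀ w x, P k (fderiv ℝ P k w (P k x)) = 0 :=
    fun w x => proj_fderiv_proj (fun q => (hP q).proj) (hPs k) w x
  -- `dP` maps `ℓ` to a vector orthogonal to the plane, which `J` annihilates. Then `dJ ℓ = -i dP ℓ`
  -- by `fderiv_cstr`, and the two halves add up.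
  have hdl : ∀ w, fderiv ℝ (lineProj P J) k w ℓ = fderiv ℝ P k w ℓ := by
    intro w
    have h1 : J k (fderiv ℝ P k w ℓ) = 0 := by
      rw [← (hJ k).apply_proj]; nth_rw 1 [← hPl]; rw [hpap, map_zero]
    rw [hld, fderiv_cstr hP hJ (hPs k) (hJs k), h1, hJl, map_smul]
    match_scalars
    linear_combination (-(1 / 2 : ℂ)) * Complex.I_sq
  have hlinesymm : ∀ w x y, (inner ℂ (fderiv ℝ (lineProj P J) k w x) y : ℂ) =
      inner ℂ x (fderiv ℝ (lineProj P J) k w y) := by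
    have hd : Differentiable ℝ (lineProj P J) := (hPs.add (hJs.const_smul Complex.I)).const_smul (1 / 2 : ℂ)
    exact fun w => fderiv_inner_symm (hd k)
      (fun q => proj_inner (lineProj_isStarProjection (hP q) (hJ q))) w
  have hPsymm : ∀ w x y, (inner ℂ (fderiv ℝ P k w x) y : ℂ) = inner ℂ x (fderiv ℝ P k w y) :=
    fun w => fderiv_inner_symm (hPs k) (fun q => proj_inner (hP q).proj) w
  have hreal : ∀ w a, C (fderiv ℝ P k w (e a)) = fderiv ℝ P k w (e a) := fun w a => by
    rw [fderiv_real (hPs k) (fun q => (hP q).comm), he.real]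
  -- The vectors `dP e_a` are real, so their inner products are symmetric. The first two terms of
  -- `t3` therefore cancel in the antisymmetrized trace.
  have hsw : ∀ w w' a c, (inner ℂ (fderiv ℝ P k w (e a)) (fderiv ℝ P k w' (e c)) : ℂ) =
      inner ℂ (fderiv ℝ P k w' (e c)) (fderiv ℝ P k w (e a)) := fun w w' a c => by
    rw [← real_inner (C := C) _ _ (hreal w' c) (hreal w a), inner_conj_symm]
  have t1 : ∀ w w', frTrace (lineProj P J k ∘L fderiv ℝ (lineProj P J) k w ∘L
      fderiv ℝ (lineProj P J) k w') = inner ℂ (fderiv ℝ P k w ℓ) (fderiv ℝ P k w' ℓ) := by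
    intro w w'
    rw [hl.frTrace_eq]
    swap
    · exact fun x => proj_apply_apply hpr _
    simp only [ContinuousLinearMap.comp_apply]
    rw [← proj_inner hpr, hl.apply, ← hlinesymm, hdl, hdl]
  have t2 : ∀ w w', frTrace (J k ∘L fderiv ℝ P k w ∘L fderiv ℝ P k w') =
      inner ℂ (fderiv ℝ P k w (e 0)) (fderiv ℝ P k w' (e 1)) -
      inner ℂ (fderiv ℝ P k w (e 1)) (fderiv ℝ P k w' (e 0)) := by
    intro w w'
    rw [he.frTrace_eq]
    swap
    · exact fun x => (hJ k).proj_apply _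
    rw [Fin.sum_univ_two]
    have hsk : ∀ x y, (inner ℂ x (J k y) : ℂ) = -inner ℂ (J k x) y := fun x y => by
      rw [(hJ k).skew, neg_neg]
    simp only [ContinuousLinearMap.comp_apply, hsk, j0, j1, inner_neg_left, map_neg, ← hPsymm]
    ring
  have t3 : ∀ w w', (inner ℂ (fderiv ℝ P k w ℓ) (fderiv ℝ P k w' ℓ) : ℂ) = (1 / 2) *
      (inner ℂ (fderiv ℝ P k w (e 0)) (fderiv ℝ P k w' (e 0)) +
       inner ℂ (fderiv ℝ P k w (e 1)) (fderiv ℝ P k w' (e 1)) +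
       Complex.I * inner ℂ (fderiv ℝ P k w (e 0)) (fderiv ℝ P k w' (e 1)) -
       Complex.I * inner ℂ (fderiv ℝ P k w (e 1)) (fderiv ℝ P k w' (e 0))) := by
    intro w w'
    rw [hv]
    simp only [map_smul, map_add, inner_smul_left, inner_smul_right, inner_add_left,
      inner_add_right, hc, Complex.conj_I]
    linear_combination (inner ℂ (fderiv ℝ P k w (e 0)) (fderiv ℝ P k w' (e 0)) +
       inner ℂ (fderiv ℝ P k w (e 1)) (fderiv ℝ P k w' (e 1)) +
       Complex.I * inner ℂ (fderiv ℝ P k w (e 0)) (fderiv ℝ P k w' (e 1)) -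
       Complex.I * inner ℂ (fderiv ℝ P k w (e 1)) (fderiv ℝ P k w' (e 0))) * hs -
       (1 / (Real.sqrt 2 : ℂ)) * (1 / (Real.sqrt 2 : ℂ)) *
        inner ℂ (fderiv ℝ P k w (e 1)) (fderiv ℝ P k w' (e 1)) * Complex.I_sq
  unfold berry curvatureTrace pderiv
  rw [t1, t1, t2, t2, t3, t3, hsw (unitVec 1) (unitVec 0) 0 0, hsw (unitVec 1) (unitVec 0) 1 1,
    hsw (unitVec 1) (unitVec 0) 0 1, hsw (unitVec 1) (unitVec 0) 1 0]
  linear_combination (-(inner ℂ (fderiv ℝ P k (unitVec 0) (e 0)) (fderiv ℝ P k (unitVec 1) (e 1))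
    - inner ℂ (fderiv ℝ P k (unitVec 0) (e 1)) (fderiv ℝ P k (unitVec 1) (e 0)))) * Complex.I_sq

lemma curvatureTrace_cstr_real (hP : ∀ k, IsRealPlane C (P k)) (hJ : IsCStr C (P k) (J k))
    (hPs : Differentiable ℝ P) : conj (curvatureTrace (J k) P k) = curvatureTrace (J k) P k := by
  obtain ⟨e, he⟩ := (hP k).exists_realFrame
  have hd : ∀ w x, C (fderiv ℝ P k w x) = fderiv ℝ P k w (C x) :=
    fun w x => fderiv_real (hPs k) (fun q => (hP q).comm) w x
  have h : ∀ i j, conj (frTrace (J k ∘L pderiv P i k ∘L pderiv P j k)) =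
      frTrace (J k ∘L pderiv P i k ∘L pderiv P j k) := fun i j =>
    he.frTrace_real (fun x => hJ.proj_apply _) (fun x => by simp [hJ.real, pderiv, hd])
  rw [curvatureTrace, map_sub, h, h]

/-- `frTrace` is defined through the range of its argument, which may change with `c`; the scaling
is therefore read off in a fixed frame of the plane. -/
lemma curvatureTrace_smul (hP : ∀ k, IsRealPlane C (P k)) (hJ : IsCStr C (P k) (J k)) (c : ℂ) :
    curvatureTrace (c • J k) P k = c * curvatureTrace (J k) P k := by
  obtain ⟨e, he⟩ := (hP k).exists_realFrame
  have h : ∀ i j, frTrace ((c • J k) ∘L pderiv P i k ∘L pderiv P j k) =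
      c * frTrace (J k ∘L pderiv P i k ∘L pderiv P j k) := fun i j => by
    rw [he.frTrace_eq (A := (c • J k) ∘L pderiv P i k ∘L pderiv P j k)
      (fun x => by simp [hJ.proj_apply]), he.frTrace_eq
      (A := J k ∘L pderiv P i k ∘L pderiv P j k) (fun x => hJ.proj_apply _)]
    simp [Fin.sum_univ_two, inner_smul_right]
    ring
  rw [curvatureTrace, h, h, curvatureTrace]
  ring

end LineProj

/-! ### Reflection of the momentum and of the orientation. -/

section Flip

variable {b : Module.Basis (Fin 2) ℝ Plane} {E : Type*} [NormedAddCommGroup E]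
  [InnerProductSpace ℂ E] [CompleteSpace E] {C : E ≃ₗᵢ⋆[ℂ] E} {p P J : Plane → E →L[ℂ] E}

/-- Each of the two derivatives changes sign under reflection. -/
lemma curvatureTrace_comp_neg (X : E →L[ℂ] E) (p : Plane → E →L[ℂ] E) (k : Plane) :
    curvatureTrace X (fun q => p (-q)) k = curvatureTrace X p (-k) := by
  have h : ∀ i, pderiv (fun q => p (-q)) i k = -pderiv p i (-k) := fun i => by
    have := ContinuousLinearEquiv.comp_right_fderiv (𝕜 := ℝ) (f := p) (x := k)
      (ContinuousLinearEquiv.neg ℝ (M := Plane))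
    change fderiv ℝ (fun q => p (-q)) k (unitVec i) = _
    change fderiv ℝ (fun q => p (-q)) k = _ at this
    rw [this]
    exact map_neg (fderiv ℝ p (-k)) (unitVec i)
  simp [curvatureTrace, h]

/-- The second valley enters the pairing at `-k`, so the lattice acts on it through `-G`. -/
lemma IsBundle.comp_neg {T : recip b → E ≃ₗᵢ[ℂ] E} (h : IsBundle b T p) :
    IsBundle b (fun G => T (-G)) (fun q => p (-q)) where
  proj k := h.proj _
  smooth := h.smooth.comp contDiff_neg
  equiv k G x := by
    rw [h.equiv, Submodule.coe_neg, neg_add]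

lemma IsCStr.neg {p J : E →L[ℂ] E} (h : IsCStr C p J) : IsCStr C p (-J) where
  proj_apply x := by simp [h.proj_apply]
  apply_proj x := by simp [h.apply_proj]
  sq x := by simp [h.sq]
  skew x y := by simp [h.skew]
  real x := by simp [h.real]

lemma IsCStr.sgn_smul {p J : E →L[ℂ] E} (h : IsCStr C p J) (c : Channel) :
    IsCStr C p ((c.sgn : ℂ) • J) := by
  cases c
  · simpa [Channel.sgn] using h
  · simpa [Channel.sgn] using h.neg

lemma lineProj_isBundle {T : recip b → E ≃ₗᵢ[ℂ] E} (hB : IsBundle b T P)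
    (hP : ∀ k, IsRealPlane C (P k)) (hJ : ∀ k, IsCStr C (P k) (J k)) (hs : ContDiff ℝ ∞ J)
    (he : ∀ (G : recip b) k x, T G (J k x) = J (k + G) (T G x)) :
    IsBundle b T (lineProj P J) where
  proj k := lineProj_isStarProjection (hP k) (hJ k)
  smooth := (hB.smooth.add (hs.const_smul Complex.I)).const_smul (1 / 2 : ℂ)
  equiv k G x := by
    simp only [lineProj_apply, map_smul, map_add, hB.equiv, he]

end Flip

/-! ### The Euler number, the normalized `Q` and `Φ`, and their independence of choices. -/

namespace Valley

variable {b : Module.Basis (Fin 2) ℝ Plane} {E : Type*} [NormedAddCommGroup E]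
  [InnerProductSpace ℂ E] [CompleteSpace E] {V : Valley b E} {u u' : Plane → Fin 2 → E}

lemma sqrt_two_ne_zero : (Real.sqrt 2 : ℂ) ≠ 0 := by
  rw [Complex.ofReal_ne_zero]; positivity

lemma sqrt_two_mul_self : (Real.sqrt 2 : ℂ) * (Real.sqrt 2 : ℂ) = 2 := by
  rw [← Complex.ofReal_mul, Real.mul_self_sqrt (by norm_num)]; norm_num

lemma Q₀_eq (k₀ k : Plane) : V.Q₀ u k₀ k = (1 / (Real.sqrt 2 : ℂ)) • V.J₀ u k₀ k := by
  rw [J₀, smul_smul, one_div, inv_mul_cancel₀ sqrt_two_ne_zero, one_smul]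

lemma differentiable_P : Differentiable ℝ V.P := V.P_smooth.differentiable (by simp)

lemma Φ₀_eq (hu : V.IsGauge u) (k₀ k : Plane) :
    V.Φ₀ u k₀ k = (1 / 2 : ℂ) * curvatureTrace (V.J₀ u k₀ k) V.P k := by
  rw [Φ₀, Q₀_eq, curvatureTrace_smul V.isRealPlane (isCStr_J₀ hu k₀ k), ← mul_assoc]
  congr 1
  rw [div_mul_div_comm, sqrt_two_mul_self, one_mul]

lemma conj_Φ₀ (hu : V.IsGauge u) (k₀ k : Plane) : conj (V.Φ₀ u k₀ k) = V.Φ₀ u k₀ k := by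
  rw [Φ₀_eq hu, map_mul, curvatureTrace_cstr_real V.isRealPlane (isCStr_J₀ hu k₀ k)
    differentiable_P, map_div₀, map_one, map_ofNat]

lemma conj_N₀ (hu : V.IsGauge u) (k₀ : Plane) : conj (V.N₀ u k₀) = V.N₀ u k₀ := by
  rw [N₀, map_mul, ← integral_conj]
  simp only [conj_Φ₀ hu, map_div₀, map_one, map_mul, map_ofNat, Complex.conj_ofReal]

/-- The sign `N_{k₀} / N`. -/
lemma orientation_sign (hu : V.IsGauge u) (k₀ : Plane) (hN : V.eulerNumber u k₀ ≠ 0) :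
    V.N₀ u k₀ / (V.eulerNumber u k₀ : ℂ) = 1 ∨ V.N₀ u k₀ / (V.eulerNumber u k₀ : ℂ) = -1 := by
  obtain ⟨r, hr⟩ := Complex.conj_eq_iff_real.mp (conj_N₀ hu k₀)
  rw [eulerNumber] at hN ⊢
  rw [hr] at hN ⊢
  rw [Complex.norm_real, Real.norm_eq_abs] at hN ⊢
  have hr0 : (r : ℂ) ≠ 0 := by
    rw [Complex.ofReal_ne_zero]; exact fun h => hN (by rw [h, abs_zero])
  rcases abs_choice r with h | h <;> rw [h]
  · left; exact div_self hr0
  · right; rw [Complex.ofReal_neg, div_neg, div_self hr0]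

/-- `√2 Q`. -/
def J (V : Valley b E) (u : Plane → Fin 2 → E) (k₀ k : Plane) : E →L[ℂ] E :=
  (Real.sqrt 2 : ℂ) • V.Q u k₀ k

lemma Q_eq (k₀ k : Plane) : V.Q u k₀ k = (1 / (Real.sqrt 2 : ℂ)) • V.J u k₀ k := by
  rw [J, smul_smul, one_div, inv_mul_cancel₀ sqrt_two_ne_zero, one_smul]

lemma J_eq (k₀ k : Plane) :
    V.J u k₀ k = (V.N₀ u k₀ / (V.eulerNumber u k₀ : ℂ)) • V.J₀ u k₀ k := by
  rw [J, Q, J₀, smul_comm]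

lemma isCStr_J (hu : V.IsGauge u) {k₀ : Plane} (hN : V.eulerNumber u k₀ ≠ 0) (k : Plane) :
    IsCStr V.C (V.P k) (V.J u k₀ k) := by
  rw [J_eq]
  rcases orientation_sign hu k₀ hN with h | h <;> rw [h]
  · rw [one_smul]; exact isCStr_J₀ hu k₀ k
  · rw [neg_one_smul]; exact (isCStr_J₀ hu k₀ k).neg

lemma contDiff_J (hu : V.IsGauge u) (k₀ : Plane) : ContDiff ℝ ∞ (V.J u k₀) := by
  have h : V.J u k₀ = fun k => (V.N₀ u k₀ / (V.eulerNumber u k₀ : ℂ)) • V.J₀ u k₀ k :=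
    funext fun k => J_eq k₀ k
  rw [h]
  exact (contDiff_J₀ hu k₀).const_smul _

lemma J_equivariant (hO : V.Orientable) (hu : V.IsGauge u) {k₀ : Plane}
    (hN : V.eulerNumber u k₀ ≠ 0) (G : recip b) (k : Plane) (x : E) :
    V.T G (V.J u k₀ k x) = V.J u k₀ (k + G) (V.T G x) :=
  cstr_equivariant hO hu (isCStr_J hu hN) (contDiff_J hu k₀).continuous G k x

lemma Φ_eq (hu : V.IsGauge u) (k₀ k : Plane) :
    V.Φ u k₀ k = (1 / 2 : ℂ) * curvatureTrace (V.J u k₀ k) V.P k := by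
  rw [Φ, Φ₀_eq hu, J_eq, curvatureTrace_smul V.isRealPlane (isCStr_J₀ hu k₀ k)]
  ring

lemma Φ_eq_berry (hu : V.IsGauge u) {k₀ : Plane} (hN : V.eulerNumber u k₀ ≠ 0) (k : Plane) :
    V.Φ u k₀ k = berry (lineProj V.P (V.J u k₀)) k := by
  rw [berry_lineProj V.isRealPlane (isCStr_J hu hN) differentiable_P
    ((contDiff_J hu k₀).differentiable (by simp)), Φ_eq hu]

/-- `N₀` is real, so the factor `N₀ / N` contained in `Φ` is its sign and turns `N₀` into its
absolute value. -/
lemma eulerNumber_eq (hu : V.IsGauge u) {k₀ : Plane} (hN : V.eulerNumber u k₀ ≠ 0) :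
    (V.eulerNumber u k₀ : ℂ) = (1 / (2 * Real.pi) : ℂ) * ∫ k in unitCell b, V.Φ u k₀ k := by
  have h : ∀ k, V.Φ u k₀ k = (V.N₀ u k₀ / (V.eulerNumber u k₀ : ℂ)) * V.Φ₀ u k₀ k := fun k => rfl
  have hN' : (V.eulerNumber u k₀ : ℂ) ≠ 0 := by rwa [Complex.ofReal_ne_zero]
  have h2 : V.N₀ u k₀ * V.N₀ u k₀ = (V.eulerNumber u k₀ : ℂ) * V.eulerNumber u k₀ := by
    rcases orientation_sign hu k₀ hN with h | h
    · rw [div_eq_iff hN'] at h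
      rw [h]; ring
    · rw [div_eq_iff hN'] at h
      rw [h]; ring
  simp only [h, integral_const_mul]
  rw [mul_left_comm]
  change _ = _ * V.N₀ u k₀
  rw [div_mul_eq_mul_div, h2, mul_div_cancel_right₀ _ hN']

section Independence

variable (hu : V.IsGauge u) (hu' : V.IsGauge u') (k₀ k₀' : Plane)
include hu hu'

lemma J₀_unique : V.J₀ u' k₀' = V.J₀ u k₀ ∨ V.J₀ u' k₀' = -V.J₀ u k₀ :=
  cstr_family_unique V.isRealPlane (isCStr_J₀ hu k₀) (isCStr_J₀ hu' k₀')
    (continuous_J₀ hu k₀) (continuous_J₀ hu' k₀')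

/-- A change of gauge or base point multiplies `J₀`, `Φ₀` and `N₀` by the same sign, which therefore
cancels in `Q` and `Φ`. -/
lemma sign_change : ∃ ε : ℂ, (ε = 1 ∨ ε = -1) ∧ (∀ k, V.J₀ u' k₀' k = ε • V.J₀ u k₀ k) ∧
    (∀ k, V.Φ₀ u' k₀' k = ε * V.Φ₀ u k₀ k) ∧ V.N₀ u' k₀' = ε * V.N₀ u k₀ ∧
    V.eulerNumber u' k₀' = V.eulerNumber u k₀ := by
  obtain ⟨ε, hε, h1⟩ : ∃ ε : ℂ, (ε = 1 ∨ ε = -1) ∧ ∀ k, V.J₀ u' k₀' k = ε • V.J₀ u k₀ k := by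
    rcases J₀_unique hu hu' k₀ k₀' with h | h
    · exact ⟨1, Or.inl rfl, fun k => by rw [h, one_smul]⟩
    · exact ⟨-1, Or.inr rfl, fun k => by rw [h, neg_one_smul]; rfl⟩
  have h2 : ∀ k, V.Φ₀ u' k₀' k = ε * V.Φ₀ u k₀ k := fun k => by
    rw [Φ₀_eq hu', Φ₀_eq hu, h1, curvatureTrace_smul V.isRealPlane (isCStr_J₀ hu k₀ k)]
    ring
  have h3 : V.N₀ u' k₀' = ε * V.N₀ u k₀ := by
    simp only [N₀, h2, integral_const_mul]; ring
  refine ⟨ε, hε, h1, h2, h3, ?_⟩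
  rw [eulerNumber, h3, norm_mul, eulerNumber]
  rcases hε with rfl | rfl <;> simp

lemma eulerNumber_independent : V.eulerNumber u' k₀' = V.eulerNumber u k₀ := by
  obtain ⟨ε, -, -, -, -, h⟩ := sign_change hu hu' k₀ k₀'
  exact h

lemma Q_independent : V.Q u' k₀' = V.Q u k₀ := by
  obtain ⟨ε, hε, h1, -, h3, h4⟩ := sign_change hu hu' k₀ k₀'
  funext k
  rw [Q_eq, Q_eq, J_eq, J_eq, h1, h3, h4, smul_smul _ ε]
  congr 2
  rcases hε with rfl | rfl <;> ring

lemma Φ_independent : V.Φ u' k₀' = V.Φ u k₀ := by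
  obtain ⟨ε, hε, -, h2, h3, h4⟩ := sign_change hu hu' k₀ k₀'
  funext k
  rw [Φ, Φ, h2, h3, h4]
  rcases hε with rfl | rfl <;> ring

end Independence

end Valley

/-! ### Green's theorem on one curvilinear quadrilateral. -/

section Cell

/-- The coordinates of a point of the plane. -/
def xy : Plane ≃L[ℝ] ℝ × ℝ :=
  (EuclideanSpace.equiv (Fin 2) ℝ).trans (ContinuousLinearEquiv.finTwoArrow ℝ ℝ)

lemma xy_apply (k : Plane) : xy k = (k 0, k 1) := rfl

lemma measurePreserving_xy : MeasurePreserving xy :=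
  (volume_preserving_finTwoArrow ℝ).comp (PiLp.volume_preserving_ofLp (Fin 2))

lemma plane_eq_unitVec (w : Plane) : w = w 0 • unitVec 0 + w 1 • unitVec 1 := by
  ext i; fin_cases i <;> simp [unitVec]

/-- The curl of a one-form. -/
def curl (θ : Plane → Plane →L[ℝ] ℂ) (k : Plane) : ℂ :=
  fderiv ℝ θ k (unitVec 0) (unitVec 1) - fderiv ℝ θ k (unitVec 1) (unitVec 0)

/-- An alternating bilinear form on the plane is a multiple of the area form. -/
lemma curl_eq (θ : Plane → Plane →L[ℝ] ℂ) (k w w' : Plane) :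
    fderiv ℝ θ k w w' - fderiv ℝ θ k w' w = ((w 0 * w' 1 - w 1 * w' 0 : ℝ) : ℂ) * curl θ k := by
  conv_lhs => rw [plane_eq_unitVec w, plane_eq_unitVec w']
  simp only [map_add, map_smul,  
    _root_.smul_apply, _root_.add_apply, Complex.real_smul, curl]
  push_cast
  ring

/-- The Jacobian determinant of a cell. -/
def jac (φ : ℝ × ℝ → Plane) (p : ℝ × ℝ) : ℝ :=
  (fderiv ℝ φ p (1, 0)) 0 * (fderiv ℝ φ p (0, 1)) 1 -
    (fderiv ℝ φ p (1, 0)) 1 * (fderiv ℝ φ p (0, 1)) 0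

/-- The integral of `v` along a side of the cell `φ`. -/
def sideIntegral (v : Plane → Plane → ℂ) (φ : ℝ × ℝ → Plane) (i : Fin 4) : ℂ :=
  ∫ t in (0 : ℝ)..1, v (φ (squareSide i t)) (deriv (fun t => φ (squareSide i t)) t)

/-- The direction in which a side is traversed. -/
def sideDir (i : Fin 4) : ℝ × ℝ := (![(1, 0), (0, 1), (-1, 0), (0, -1)] : Fin 4 → ℝ × ℝ) i

lemma hasDerivAt_squareSide (i : Fin 4) (t : ℝ) : HasDerivAt (squareSide i) (sideDir i) t := by
  have h1 : HasDerivAt (fun t : ℝ => t) 1 t := hasDerivAt_id t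
  have h2 : HasDerivAt (fun t : ℝ => 1 - t) (-1) t := by simpa using h1.const_sub 1
  fin_cases i
  · exact h1.prodMk (hasDerivAt_const t (0 : ℝ))
  · exact (hasDerivAt_const t (1 : ℝ)).prodMk h1
  · exact h2.prodMk (hasDerivAt_const t (1 : ℝ))
  · exact (hasDerivAt_const t (0 : ℝ)).prodMk h2

variable {φ : ℝ × ℝ → Plane}

lemma hasDerivAt_side (hφ : Differentiable ℝ φ) (i : Fin 4) (t : ℝ) :
    HasDerivAt (fun t => φ (squareSide i t)) (fderiv ℝ φ (squareSide i t) (sideDir i)) t :=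
  (hφ (squareSide i t)).hasFDerivAt.comp_hasDerivAt t (hasDerivAt_squareSide i t)

lemma Ioo_prod_ae_eq : (Set.Ioo (0 : ℝ) 1 ×ˢ Set.Ioo (0 : ℝ) 1 : Set (ℝ × ℝ)) =ᵐ[volume]
    Set.Icc ((0 : ℝ), (0 : ℝ)) (1, 1) := by
  rw [← Set.Icc_prod_Icc, Measure.volume_eq_prod]
  exact Measure.set_prod_ae_eq Ioo_ae_eq_Icc Ioo_ae_eq_Icc

/-- This is the divergence theorem on the unit square for the pullback of `θ`. The second
derivatives of `φ` cancel by symmetry, which leaves the Jacobian times the curl; the last two sides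
are traversed backwards, which supplies their signs. -/
theorem cell_stokes {θ : Plane → Plane →L[ℝ] ℂ} (hφ : ContDiff ℝ 2 φ)
    (hθ : ∀ p ∈ Set.Icc ((0 : ℝ), (0 : ℝ)) (1, 1), ContDiffAt ℝ 1 θ (φ p)) :
    ∑ i, sideIntegral (fun k w => θ k w) φ i =
      ∫ p in Set.Ioo (0 : ℝ) 1 ×ˢ Set.Ioo (0 : ℝ) 1, (jac φ p : ℂ) * curl θ (φ p) := by
  have hd : Differentiable ℝ φ := hφ.differentiable (by simp)
  have hd' : ContDiff ℝ 1 (fderiv ℝ φ) := hφ.fderiv_right (by norm_num)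
  have hdd : Differentiable ℝ (fderiv ℝ φ) := hd'.differentiable (by simp)
  have hsymm : ∀ p v w, fderiv ℝ (fderiv ℝ φ) p v w = fderiv ℝ (fderiv ℝ φ) p w v := fun p v w =>
    (hφ.contDiffAt.isSymmSndFDerivAt (by simp)) v w
  set Ω : ℝ × ℝ → (ℝ × ℝ) → (ℝ × ℝ) →L[ℝ] ℂ := fun p v =>
    ((fderiv ℝ θ (φ p)).comp (fderiv ℝ φ p)).flip (fderiv ℝ φ p v) +
      (θ (φ p)).comp ((fderiv ℝ (fderiv ℝ φ) p).flip v) with hΩ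
  have hder : ∀ v, ∀ p ∈ Set.Icc ((0 : ℝ), (0 : ℝ)) (1, 1),
      HasFDerivAt (fun q => θ (φ q) (fderiv ℝ φ q v)) (Ω p v) p := by
    intro v p hp
    have h1 : HasFDerivAt (fun q => θ (φ q)) ((fderiv ℝ θ (φ p)).comp (fderiv ℝ φ p)) p :=
      ((hθ p hp).differentiableAt (by simp)).hasFDerivAt.comp p (hd p).hasFDerivAt
    have h2 : HasFDerivAt (fun q => fderiv ℝ φ q v) ((fderiv ℝ (fderiv ℝ φ) p).flip v) p := by
      have := (hdd p).hasFDerivAt.clm_apply (hasFDerivAt_const v p)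
      simpa using this
    have h3 := h1.clm_apply h2
    rw [add_comm] at h3
    exact h3
  have hcurl : ∀ p, Ω p (0, 1) (1, 0) + -Ω p (1, 0) (0, 1) = (jac φ p : ℂ) * curl θ (φ p) := by
    intro p
    rw [jac, ← curl_eq]
    simp only [hΩ, _root_.add_apply, ContinuousLinearMap.flip_apply,
      ContinuousLinearMap.comp_apply, hsymm p (1, 0) (0, 1)]
    ring
  have hcont : ∀ v, ContinuousOn (fun q => θ (φ q) (fderiv ℝ φ q v))
      (Set.Icc ((0 : ℝ), (0 : ℝ)) (1, 1)) := fun v p hp =>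
    (hder v p hp).continuousAt.continuousWithinAt
  have hcc : ContinuousOn (fun p => (jac φ p : ℂ) * curl θ (φ p))
      (Set.Icc ((0 : ℝ), (0 : ℝ)) (1, 1)) := by
    intro p hp
    apply ContinuousAt.continuousWithinAt
    have hf : ContinuousAt (fderiv ℝ θ) (φ p) := (hθ p hp).continuousAt_fderiv (by simp)
    have hf' : ContinuousAt (fun q => fderiv ℝ θ (φ q)) p :=
      ContinuousAt.comp (f := φ) hf hd.continuous.continuousAt
    have hc1 : ContinuousAt (fun q => curl θ (φ q)) p :=
      ((hf'.clm_apply continuousAt_const).clm_apply continuousAt_const).sub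
        ((hf'.clm_apply continuousAt_const).clm_apply continuousAt_const)
    have hj : Continuous (jac φ) := by
      have h1 : ∀ v : ℝ × ℝ, Continuous fun q => fderiv ℝ φ q v := fun v =>
        hd'.continuous.clm_apply continuous_const
      have h2 : ∀ (v : ℝ × ℝ) (i : Fin 2), Continuous fun q => (fderiv ℝ φ q v) i := fun v i =>
        (EuclideanSpace.proj (𝕜 := ℝ) i).continuous.comp (h1 v)
      unfold jac
      exact ((h2 _ _).mul (h2 _ _)).sub ((h2 _ _).mul (h2 _ _))
    exact (Complex.continuous_ofReal.comp hj).continuousAt.mul hc1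
  have hmain := integral_divergence_prod_Icc_of_hasFDerivAt_of_le
    (fun q => θ (φ q) (fderiv ℝ φ q (0, 1))) (fun q => -θ (φ q) (fderiv ℝ φ q (1, 0)))
    (fun p => Ω p (0, 1)) (fun p => -Ω p (1, 0)) ((0 : ℝ), (0 : ℝ)) (1, 1)
    (by constructor <;> simp) (hcont _) (hcont _).neg
    (fun p hp => hder _ p ⟨⟨hp.1.1.le, hp.2.1.le⟩, ⟨hp.1.2.le, hp.2.2.le⟩⟩)
    (fun p hp => (hder _ p ⟨⟨hp.1.1.le, hp.2.1.le⟩, ⟨hp.1.2.le, hp.2.2.le⟩⟩).neg) (by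
      simp only [_root_.neg_apply, hcurl]
      exact hcc.integrableOn_compact isCompact_Icc)
  simp only [_root_.neg_apply, hcurl] at hmain
  rw [setIntegral_congr_set Ioo_prod_ae_eq, hmain, Fin.sum_univ_four]
  have hs : ∀ i, sideIntegral (fun k w => θ k w) φ i =
      ∫ t in (0 : ℝ)..1, θ (φ (squareSide i t)) (fderiv ℝ φ (squareSide i t) (sideDir i)) := by
    intro i
    simp only [sideIntegral, (hasDerivAt_side hd i _).deriv]
  have hneg : ∀ q : ℝ × ℝ, ∀ v : ℝ × ℝ, fderiv ℝ φ q (-v) = -fderiv ℝ φ q v := fun q v =>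
    map_neg _ v
  have h0 := hs 0
  have h1 := hs 1
  have h2 : sideIntegral (fun k w => θ k w) φ 2 =
      -∫ t in (0 : ℝ)..1, θ (φ (t, 1)) (fderiv ℝ φ (t, 1) (1, 0)) := by
    have := intervalIntegral.integral_comp_sub_left (a := 0) (b := 1)
      (fun t => θ (φ (t, 1)) (fderiv ℝ φ (t, 1) (1, 0))) 1
    rw [sub_self, sub_zero] at this
    rw [hs, ← this, ← intervalIntegral.integral_neg]
    congr 1; ext t
    have : sideDir 2 = -(1, 0) := by simp [sideDir]
    rw [this, hneg, map_neg]; rfl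
  have h3 : sideIntegral (fun k w => θ k w) φ 3 =
      -∫ t in (0 : ℝ)..1, θ (φ (0, t)) (fderiv ℝ φ (0, t) (0, 1)) := by
    have := intervalIntegral.integral_comp_sub_left (a := 0) (b := 1)
      (fun t => θ (φ (0, t)) (fderiv ℝ φ (0, t) (0, 1))) 1
    rw [sub_self, sub_zero] at this
    rw [hs, ← this, ← intervalIntegral.integral_neg]
    congr 1; ext t
    have : sideDir 3 = -(0, 1) := by simp [sideDir]
    rw [this, hneg, map_neg]; rfl
  rw [h0, h1, h2, h3]
  simp only [intervalIntegral.integral_neg]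
  change (∫ t in (0 : ℝ)..1, θ (φ (t, 0)) (fderiv ℝ φ (t, 0) (1, 0))) +
    (∫ t in (0 : ℝ)..1, θ (φ (1, t)) (fderiv ℝ φ (1, t) (0, 1))) + _ + _ = _
  ring

end Cell

/-! ### Integrals of periodic functions over sets of inequivalent points. -/

section PeriodicIntegral

variable {b : Module.Basis (Fin 2) ℝ Plane} {g : Plane → ℂ}

/-- The square `(0,1)²`. -/
abbrev openSquare : Set (ℝ × ℝ) := Set.Ioo (0 : ℝ) 1 ×ˢ Set.Ioo (0 : ℝ) 1

/-- All lattice translates of a set. -/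
def saturation (b : Module.Basis (Fin 2) ℝ Plane) (s : Set Plane) : Set Plane :=
  ⋃ G : recip b, (fun k => k + (G : Plane)) '' s

lemma measurableSet_translate {s : Set Plane} (hs : MeasurableSet s) (v : Plane) :
    MeasurableSet ((fun k => k + v) '' s) := by
  have : (fun k : Plane => k + v) '' s = (fun k => k + -v) ⁻¹' s := by
    ext k
    constructor
    · rintro ⟨x, hx, rfl⟩; simpa using hx
    · intro h; exact ⟨k + -v, h, by simp⟩
  rw [this]
  exact (measurable_add_const _) hs

lemma measurableSet_saturation {s : Set Plane} (hs : MeasurableSet s) :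
    MeasurableSet (saturation b s) :=
  MeasurableSet.iUnion fun _ => measurableSet_translate hs _

open scoped Pointwise in
/-- A periodic function has the same integral over a set without lattice-equivalent points as over
the corresponding part of the unit cell. -/
lemma setIntegral_saturation (hg : Continuous g) (hp : ∀ k (G : recip b), g (k + G) = g k)
    {s : Set Plane} (hs : MeasurableSet s) (hsb : Bornology.IsBounded s)
    (hd : ∀ x ∈ s, ∀ y ∈ s, ∀ G : recip b, x + G = y → G = 0) :
    ∫ k in saturation b s ∩ unitCell b, g k = ∫ k in s, g k := by
  have hint : ∀ t : Set Plane, Bornology.IsBounded t → IntegrableOn g t := fun t ht =>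
    (hg.continuousOn.integrableOn_compact ht.isCompact_closure).mono_set subset_closure
  have hcell := ZSpan.fundamentalDomain_measurableSet b
  have : VAddInvariantMeasure (Submodule.span ℤ (Set.range b)) Plane volume :=
    inferInstanceAs <| VAddInvariantMeasure (Submodule.span ℤ (Set.range b)).toAddSubgroup Plane _
  -- Both integrals become sums over the lattice translates of `s` intersected with the cell; the
  -- translates are disjoint by `hd`.
  have h1 := (ZSpan.isAddFundamentalDomain b volume).setIntegral_eq_tsum' (hint s hsb)
  have h2 : saturation b s ∩ unitCell b =
      ⋃ G : recip b, ((fun k => k + (G : Plane)) '' s) ∩ unitCell b := by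
    rw [saturation, Set.iUnion_inter]
  rw [h1, h2, integral_iUnion]
  · refine tsum_congr fun G => ?_
    have h3 : (G +ᵥ s : Set Plane) = (fun k => k + (G : Plane)) '' s := by
      rw [← Set.image_vadd]
      refine Set.image_congr fun x _ => ?_
      rw [Submodule.vadd_def, vadd_eq_add, add_comm]
    rw [h3]
    refine setIntegral_congr_fun ((measurableSet_translate hs _).inter hcell) fun x _ => ?_
    rw [Submodule.vadd_def, vadd_eq_add, add_comm, hp]
  · exact fun G => (measurableSet_translate hs _).inter hcell
  · intro G G' hne
    rw [Function.onFun, Set.disjoint_left]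
    rintro k ⟨⟨x, hx, rfl⟩, -⟩ ⟨⟨y, hy, hxy⟩, -⟩
    apply hne
    have := hd y hy x hx (G' - G) (by
      rw [Submodule.coe_sub, ← add_sub_assoc, sub_eq_iff_eq_add]; exact hxy)
    exact (sub_eq_zero.mp this).symm
  · rw [← h2]
    exact hint _ ((ZSpan.fundamentalDomain_isBounded b).subset Set.inter_subset_right)

end PeriodicIntegral

/-! ### Change of variables on a cell. -/

section ChangeOfVariables

variable {φ : ℝ × ℝ → Plane} {g : Plane → ℂ}

lemma volume_image_edges (hφ : Differentiable ℝ φ) :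
    volume (φ '' (Set.Icc ((0 : ℝ), (0 : ℝ)) (1, 1) \ openSquare)) = 0 := by
  have h0 : volume (Set.Icc ((0 : ℝ), (0 : ℝ)) (1, 1) \ openSquare) = 0 :=
    (ae_le_set.mp Ioo_prod_ae_eq.symm.le)
  have hd : Differentiable ℝ fun p => xy (φ p) := xy.differentiable.comp hφ
  have h1 : volume ((fun p => xy (φ p)) '' (Set.Icc ((0 : ℝ), (0 : ℝ)) (1, 1) \ openSquare)) = 0 :=
    addHaar_image_eq_zero_of_differentiableOn_of_addHaar_eq_zero volume hd.differentiableOn h0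
  have h2 := measurePreserving_xy.measure_preimage_emb
    xy.toHomeomorph.measurableEmbedding
    ((fun p => xy (φ p)) '' (Set.Icc ((0 : ℝ), (0 : ℝ)) (1, 1) \ openSquare))
  rw [h1] at h2
  refine measure_mono_null ?_ h2
  rintro _ ⟨p, hp, rfl⟩
  exact ⟨p, hp, rfl⟩

lemma setIntegral_image_openSquare (hφ : Differentiable ℝ φ) (hinj : Set.InjOn φ openSquare)
    (hjac : ∀ p ∈ openSquare, 0 < jac φ p) :
    ∫ k in φ '' openSquare, g k = ∫ p in openSquare, (jac φ p : ℂ) * g (φ p) := by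
  have hm : MeasurableSet openSquare := measurableSet_Ioo.prod measurableSet_Ioo
  set ψ : ℝ × ℝ → ℝ × ℝ := fun p => xy (φ p) with hψ
  have hψ' : ∀ p, HasFDerivAt ψ
      ((xy : Plane →L[ℝ] ℝ × ℝ).comp (fderiv ℝ φ p)) p := fun p =>
    xy.hasFDerivAt.comp p (hφ p).hasFDerivAt
  have hdet : ∀ p, ((xy : Plane →L[ℝ] ℝ × ℝ).comp (fderiv ℝ φ p)).det = jac φ p := by
    intro p
    rw [ContinuousLinearMap.det, ← LinearMap.det_toMatrix (Module.Basis.finTwoProd ℝ),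
      Matrix.det_fin_two]
    simp [LinearMap.toMatrix_apply, xy_apply, jac]
    ring
  have h1 := integral_image_eq_integral_abs_det_fderiv_smul volume hm
    (fun p _ => (hψ' p).hasFDerivWithinAt) (xy.injective.injOn.comp hinj (Set.mapsTo_univ _ _))
    (fun q => g (xy.symm q))
  have h2 : (∫ q in ψ '' openSquare, g (xy.symm q)) = ∫ k in φ '' openSquare, g k := by
    have := measurePreserving_xy.setIntegral_image_emb xy.toHomeomorph.measurableEmbedding
      (fun q => g (xy.symm q)) (φ '' openSquare)
    rw [Set.image_image] at this
    simpa using this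
  rw [← h2, h1]
  refine setIntegral_congr_fun hm fun p hp => ?_
  simp only [hdet, abs_of_pos (hjac p hp), hψ, ContinuousLinearEquiv.symm_apply_apply,
    Complex.real_smul]

end ChangeOfVariables

/-! ### Area and boundary integrals of a region, and Stokes' theorem. -/

namespace Region

variable {b : Module.Basis (Fin 2) ℝ Plane} (D : Region b) {g : Plane → ℂ}

lemma differentiable_cell (j : Fin D.n) : Differentiable ℝ (D.cell j) :=
  (D.smooth j).differentiable (by simp)

lemma injOn_cell (j : Fin D.n) : Set.InjOn (D.cell j) openSquare := fun p hp p' hp' h =>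
  (D.nonoverlap j j p hp p' hp' (by rw [h, sub_self]; exact zero_mem _)).2

lemma measurableSet_image_cell (j : Fin D.n) : MeasurableSet (D.cell j '' openSquare) :=
  (measurableSet_Ioo.prod measurableSet_Ioo).image_of_continuousOn_injOn
    (D.smooth j).continuous.continuousOn (D.injOn_cell j)

/-- The closed and the open cells differ by the countably many translates of the images of the four
edges, which are null sets. -/
lemma carrier_ae_eq : (D.carrier ∩ unitCell b : Set Plane) =ᵐ[volume]
    ⋃ j, saturation b (D.cell j '' openSquare) ∩ unitCell b := by
  have hsub : (⋃ j, saturation b (D.cell j '' openSquare) ∩ unitCell b) ⊆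
      D.carrier ∩ unitCell b := by
    refine Set.iUnion_subset fun j => ?_
    rintro k ⟨hk, hk'⟩
    obtain ⟨G, _, ⟨p, hp, rfl⟩, rfl⟩ := Set.mem_iUnion.mp hk
    exact ⟨⟨j, p, ⟨Set.Ioo_subset_Icc_self hp.1, Set.Ioo_subset_Icc_self hp.2⟩, G, G.2, rfl⟩, hk'⟩
  refine (Filter.EventuallyLE.antisymm (ae_le_set.mpr ?_) (Filter.Eventually.of_forall hsub))
  refine measure_mono_null (t := ⋃ j, ⋃ G : recip b, (fun k => k + (G : Plane)) ''
    (D.cell j '' (Set.Icc ((0 : ℝ), (0 : ℝ)) (1, 1) \ openSquare))) ?_ ?_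
  · rintro k ⟨⟨⟨j, p, hp, G, hG, rfl⟩, hk⟩, hk'⟩
    refine Set.mem_iUnion.mpr ⟨j, Set.mem_iUnion.mpr ⟨⟨G, hG⟩, ⟨D.cell j p, ⟨p, ⟨?_, ?_⟩, rfl⟩, rfl⟩⟩⟩
    · rw [← Set.Icc_prod_Icc]; exact hp
    · intro hp'
      exact hk' (Set.mem_iUnion.mpr ⟨j, Set.mem_iUnion.mpr ⟨⟨G, hG⟩, ⟨_, ⟨p, hp', rfl⟩, rfl⟩⟩, hk⟩)
  · refine measure_iUnion_null fun j => measure_iUnion_null fun G => ?_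
    have h := volume_image_edges (D.differentiable_cell j)
    rw [Set.image_add_right, measure_preimage_add_right, h]

lemma isBounded_image_cell (j : Fin D.n) : Bornology.IsBounded (D.cell j '' openSquare) :=
  ((isCompact_Icc (a := ((0 : ℝ), (0 : ℝ))) (b := (1, 1))).image
    (D.smooth j).continuous).isBounded.subset (Set.image_mono fun p hp => by
      rw [← Set.Icc_prod_Icc]
      exact ⟨Set.Ioo_subset_Icc_self hp.1, Set.Ioo_subset_Icc_self hp.2⟩)

/-- The integral of a periodic function over a region of the torus. -/
lemma integral_carrier (hg : Continuous g) (hp : ∀ k (G : recip b), g (k + G) = g k) :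
    ∫ k in D.carrier ∩ unitCell b, g k =
      ∑ j, ∫ p in openSquare, (jac (D.cell j) p : ℂ) * g (D.cell j p) := by
  rw [setIntegral_congr_set D.carrier_ae_eq, integral_iUnion_fintype]
  · refine Finset.sum_congr rfl fun j _ => ?_
    rw [setIntegral_saturation hg hp (D.measurableSet_image_cell j) (D.isBounded_image_cell j),
      setIntegral_image_openSquare (D.differentiable_cell j) (D.injOn_cell j) (D.jac_pos j)]
    rintro _ ⟨p, hp, rfl⟩ _ ⟨p', hp', rfl⟩ G h
    have := (D.nonoverlap j j p' hp' p hp (by rw [← h, add_sub_cancel_left]; exact G.2)).2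
    rw [this] at h
    simpa using h
  · exact fun j => (measurableSet_saturation (D.measurableSet_image_cell j)).inter
      (ZSpan.fundamentalDomain_measurableSet b)
  · intro j j' hne
    rw [Function.onFun, Set.disjoint_left]
    rintro k ⟨hk, -⟩ ⟨hk', -⟩
    obtain ⟨G, _, ⟨p, hp, rfl⟩, rfl⟩ := Set.mem_iUnion.mp hk
    obtain ⟨G', _, ⟨p', hp', rfl⟩, h⟩ := Set.mem_iUnion.mp hk'
    refine hne (D.nonoverlap j j' p hp p' hp' ?_).1
    have h' : D.cell j p - D.cell j' p' = ((G' - G : recip b) : Plane) := by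
      rw [Submodule.coe_sub, sub_eq_sub_iff_add_eq_add, add_comm (G' : Plane)]
      exact h.symm
    rw [h']; exact (G' - G).2
  · intro j
    exact (hg.continuousOn.integrableOn_compact
      (ZSpan.fundamentalDomain_isBounded b).isCompact_closure).mono_set
        (Set.inter_subset_right.trans subset_closure)

variable {v : Plane → Plane → ℂ}

lemma sideIntegral_partner (hv : ∀ k (G : recip b) w, v (k + G) w = v k w)
    (hn : ∀ k w, v k (-w) = -v k w) {s : Fin D.n × Fin 4} (hs : s ∉ D.bdry) :
    sideIntegral v (D.cell (D.partner s).1) (D.partner s).2 =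
      -sideIntegral v (D.cell s.1) s.2 := by
  obtain ⟨G, hG, h⟩ := D.glued s hs
  have h1 := intervalIntegral.integral_comp_sub_left (a := 0) (b := 1) (fun t =>
    v (D.cell s.1 (squareSide s.2 t)) (deriv (fun t => D.cell s.1 (squareSide s.2 t)) t)) 1
  rw [sub_self, sub_zero] at h1
  rw [sideIntegral, sideIntegral, ← h1, ← intervalIntegral.integral_neg]
  -- The gluing holds on `[0,1]` only, so the derivatives of the two sides can be compared just in
  -- the interior.
  refine intervalIntegral.integral_congr_Ioo_of_le zero_le_one fun t ht => ?_
  have hd := hasDerivAt_side (D.differentiable_cell s.1) s.2 (1 - t)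
  have hd' : HasDerivAt (fun t => D.cell s.1 (squareSide s.2 (1 - t)) + G)
      (-(fderiv ℝ (D.cell s.1) (squareSide s.2 (1 - t)) (sideDir s.2))) t := by
    have := hd.scomp t ((hasDerivAt_id t).const_sub 1)
    simpa using this.add_const G
  have he : (fun t => D.cell (D.partner s).1 (squareSide (D.partner s).2 t)) =ᶠ[𝓝 t]
      fun t => D.cell s.1 (squareSide s.2 (1 - t)) + G := by
    filter_upwards [Ioo_mem_nhds ht.1 ht.2] with t' ht'
    exact h t' (Set.Ioo_subset_Icc_self ht')
  beta_reduce
  rw [he.deriv_eq, hd'.deriv, hd.deriv, he.eq_of_nhds, hv _ ⟨G, hG⟩, hn]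

/-- The involution `partner` turns the sum over the glued sides into its own negative, so these
sides may be added at no cost. -/
lemma boundaryIntegral_eq (hv : ∀ k (G : recip b) w, v (k + G) w = v k w)
    (hn : ∀ k w, v k (-w) = -v k w) :
    D.boundaryIntegral v = ∑ j, ∑ i, sideIntegral v (D.cell j) i := by
  have h1 : ∑ s ∈ D.bdryᶜ, sideIntegral v (D.cell s.1) s.2 = 0 := by
    have h2 : ∑ s ∈ D.bdryᶜ, sideIntegral v (D.cell s.1) s.2 =
        ∑ s ∈ D.bdryᶜ, sideIntegral v (D.cell (D.partner s).1) (D.partner s).2 := by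
      refine (Finset.sum_bij' (fun s _ => D.partner s) (fun s _ => D.partner s) ?_ ?_ ?_ ?_ ?_).symm
      · exact fun s hs => Finset.mem_compl.mpr (D.partner_not_mem s (Finset.mem_compl.mp hs))
      · exact fun s hs => Finset.mem_compl.mpr (D.partner_not_mem s (Finset.mem_compl.mp hs))
      · exact fun s hs => D.partner_partner s (Finset.mem_compl.mp hs)
      · exact fun s hs => D.partner_partner s (Finset.mem_compl.mp hs)
      · exact fun s hs => rfl
    have h3 : ∑ s ∈ D.bdryᶜ, sideIntegral v (D.cell (D.partner s).1) (D.partner s).2 =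
        -∑ s ∈ D.bdryᶜ, sideIntegral v (D.cell s.1) s.2 := by
      rw [← Finset.sum_neg_distrib]
      exact Finset.sum_congr rfl fun s hs =>
        D.sideIntegral_partner hv hn (Finset.mem_compl.mp hs)
    rw [h3] at h2
    exact self_eq_neg.mp h2
  rw [← Fintype.sum_prod_type', ← Finset.sum_add_sum_compl D.bdry, h1, add_zero]
  rfl

variable {θ : Plane → Plane →L[ℝ] ℂ}

lemma continuous_curl (hθ : ContDiff ℝ 1 θ) : Continuous (curl θ) := by
  have := hθ.continuous_fderiv (by simp)
  exact ((this.clm_apply continuous_const).clm_apply continuous_const).sub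
    ((this.clm_apply continuous_const).clm_apply continuous_const)

lemma curl_periodic (hp : ∀ k (G : recip b), θ (k + G) = θ k) (k : Plane) (G : recip b) :
    curl θ (k + G) = curl θ k := by
  have h : (fun q => θ (q + (G : Plane))) = θ := funext fun q => hp q G
  have h2 : fderiv ℝ θ (k + G) = fderiv ℝ θ k := by
    rw [← fderiv_comp_add_right, h]
  rw [curl, curl, h2]

/-- Stokes' theorem on a region of the torus. -/
theorem stokes (hθ : ContDiff ℝ 1 θ) (hp : ∀ k (G : recip b), θ (k + G) = θ k) :
    D.boundaryIntegral (fun k w => θ k w) = ∫ k in D.carrier ∩ unitCell b, curl θ k := by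
  rw [D.integral_carrier (continuous_curl hθ) (curl_periodic hp),
    D.boundaryIntegral_eq (fun k G w => by rw [hp]) (fun k w => map_neg _ w)]
  exact Finset.sum_congr rfl fun j _ => cell_stokes (D.smooth j) fun p _ => hθ.contDiffAt

end Region

/-! ### Local unit sections of a line bundle and their connection forms. -/

section UnitSection

variable {E : Type*} [NormedAddCommGroup E] [InnerProductSpace ℂ E] [CompleteSpace E]

lemma IsLine.of_mem {p : E →L[ℂ] E} {ℓ x : E} (h : IsLine p ℓ) (hx : p x = x) (h1 : ‖x‖ = 1) :
    IsLine p x := by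
  refine ⟨h1, fun y => ?_⟩
  have h2 := h.eq_smul hx
  have h3 : (inner ℂ ℓ x : ℂ) * conj (inner ℂ ℓ x : ℂ) = 1 := by
    have : (inner ℂ x x : ℂ) = 1 := by rw [inner_self_eq_norm_sq_to_K, h1]; simp
    rw [h2, inner_smul_left, inner_smul_right, h.inner_self] at this
    rw [mul_one] at this
    rw [mul_comm]; exact this
  rw [h.2, h2, inner_smul_left, smul_smul]
  congr 1
  linear_combination (-(inner ℂ ℓ y : ℂ)) * h3

/-- The real bilinear map underlying the inner product. -/
def innerR (E : Type*) [NormedAddCommGroup E] [InnerProductSpace ℂ E] : E →L[ℝ] E →L[ℝ] ℂ :=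
  (isBoundedBilinearMap_inner (𝕜 := ℂ) (E := E)).toContinuousLinearMap

variable {p : Plane → E →L[ℂ] E} {s : Plane → E} {U : Set Plane} {k : Plane}

/-- A smooth unit section of a family of rank-one projections over an open set. -/
structure IsUnitSection (p : Plane → E →L[ℂ] E) (s : Plane → E) (U : Set Plane) : Prop where
  isOpen : IsOpen U
  smooth : ContDiffOn ℝ ∞ s U
  line : ∀ q ∈ U, IsLine (p q) (s q)

/-- The projection of a fixed vector, normalized wherever it does not vanish. -/
lemma exists_isUnitSection (hs : ContDiff ℝ ∞ p) (hp : ∀ k, IsStarProjection (p k))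
    (hl : ∀ k, ∃ ℓ, IsLine (p k) ℓ) (ℓ : E) :
    ∃ s, IsUnitSection p s {q | p q ℓ ≠ 0} := by
  have hsm : ContDiff ℝ ∞ fun q => p q ℓ :=
    contDiff_iff_contDiffAt.mpr fun q => hs.contDiffAt.opApply contDiffAt_const
  refine ⟨fun q => ‖p q ℓ‖⁻¹ • p q ℓ, isOpen_ne_fun hsm.continuous continuous_const, ?_, ?_⟩
  · intro q hq
    have h1 : ContDiffAt ℝ ∞ (fun q => ‖p q ℓ‖) q := hsm.contDiffAt.norm ℂ hq
    exact ((h1.inv (norm_ne_zero_iff.mpr hq)).smul hsm.contDiffAt).contDiffWithinAt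
  · intro q hq
    obtain ⟨ℓ', h⟩ := hl q
    refine h.of_mem ?_ ?_
    · refine (((p q).restrictScalars ℝ).map_smul _ _).trans ?_
      exact congrArg _ (proj_apply_apply (hp q) ℓ)
    · rw [norm_smul, norm_inv, norm_norm, inv_mul_cancel₀ (norm_ne_zero_iff.mpr hq)]

/-- The connection one-form `-i ⟨s, ds⟩`. -/
def berryForm (s : Plane → E) (k : Plane) : Plane →L[ℝ] ℂ :=
  (-Complex.I) • (innerR E (s k)).comp (fderiv ℝ s k)

lemma berryForm_apply (s : Plane → E) (k w : Plane) :
    berryForm s k w = -Complex.I * inner ℂ (s k) (fderiv ℝ s k w) := rfl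

namespace IsUnitSection

variable (h : IsUnitSection p s U)
include h

lemma contDiffAt (hk : k ∈ U) : ContDiffAt ℝ ∞ s k := h.smooth.contDiffAt (h.isOpen.mem_nhds hk)

lemma differentiableAt (hk : k ∈ U) : DifferentiableAt ℝ s k :=
  (h.contDiffAt hk).differentiableAt (by simp)

lemma contDiffAt_fderiv (hk : k ∈ U) : ContDiffAt ℝ ∞ (fderiv ℝ s) k :=
  (h.contDiffAt hk).fderiv_right (by simp)

lemma contDiffAt_berryForm (hk : k ∈ U) : ContDiffAt ℝ ∞ (berryForm s) k :=
  (((innerR E).contDiff.contDiffAt.comp k (h.contDiffAt hk)).clm_comp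
    (h.contDiffAt_fderiv hk)).const_smul (-Complex.I)

lemma inner_fderiv_add (hk : k ∈ U) (w : Plane) :
    (inner ℂ (s k) (fderiv ℝ s k w) : ℂ) + inner ℂ (fderiv ℝ s k w) (s k) = 0 := by
  have h1 : HasFDerivAt (fun q => (inner ℂ (s q) (s q) : ℂ)) _ k :=
    (h.differentiableAt hk).hasFDerivAt.inner ℂ (h.differentiableAt hk).hasFDerivAt
  have h2 : (fun q => (inner ℂ (s q) (s q) : ℂ)) =ᶠ[𝓝 k] fun _ => 1 := by
    filter_upwards [h.isOpen.mem_nhds hk] with q hq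
    exact (h.line q hq).inner_self
  have h3 := h1.unique ((hasFDerivAt_const (1 : ℂ) k).congr_of_eventuallyEq h2)
  simpa using congrArg (fun A : Plane →L[ℝ] ℂ => A w) h3

lemma fderiv_proj_apply (hd : Differentiable ℝ p) (hk : k ∈ U) (w : Plane) :
    fderiv ℝ p k w (s k) = fderiv ℝ s k w - p k (fderiv ℝ s k w) := by
  have h1 : (fun q => p q (s q)) =ᶠ[𝓝 k] s := by
    filter_upwards [h.isOpen.mem_nhds hk] with q hq
    exact (h.line q hq).apply
  have h2 := fderiv_opApply (hd k) (h.differentiableAt hk) w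
  rw [h1.fderiv_eq] at h2
  rw [eq_sub_iff_add_eq, ← h2]

/-- The second derivatives of `s` cancel in the curl. Replacing `ds` by its component `(dp) s`
orthogonal to `s` changes `⟨∂ᵢs, ∂ⱼs⟩` by `⟨s, ∂ᵢs⟩⟨s, ∂ⱼs⟩`, because `⟨s, ds⟩` is imaginary; this
term is symmetric and drops out. -/
lemma curl_berryForm (hs : ContDiff ℝ ∞ p) (hp : ∀ k, IsStarProjection (p k)) (hk : k ∈ U) :
    curl (berryForm s) k = berry p k := by
  have hd : Differentiable ℝ p := hs.differentiable (by simp)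
  have hl := h.line k hk
  have hsd := (h.differentiableAt hk).hasFDerivAt
  have hdd := ((h.contDiffAt_fderiv hk).differentiableAt (by simp)).hasFDerivAt
  have h2 : ContDiffAt ℝ 2 s k :=
    (h.contDiffAt hk).of_le ENat.LEInfty.out
  have hsymm : ∀ v w, fderiv ℝ (fderiv ℝ s) k v w = fderiv ℝ (fderiv ℝ s) k w v := fun v w =>
    (h2.isSymmSndFDerivAt (by simp)) v w
  have hder : ∀ v w, fderiv ℝ (berryForm s) k v w = -Complex.I *
      (inner ℂ (fderiv ℝ s k v) (fderiv ℝ s k w) +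
        inner ℂ (s k) (fderiv ℝ (fderiv ℝ s) k v w)) := by
    intro v w
    have h1 : HasFDerivAt (fun q => berryForm s q w) _ k :=
      ((hsd.inner ℂ (hdd.clm_apply (hasFDerivAt_const w k))).const_mul (-Complex.I))
    have h2 := ((h.contDiffAt_berryForm hk).differentiableAt (by simp)).hasFDerivAt.clm_apply
      (hasFDerivAt_const w k)
    have h3 := congrArg (fun A : Plane →L[ℝ] ℂ => A v) (h2.unique h1)
    simp at h3
    rw [h3]
    ring
  have htr : ∀ i j, frTrace (p k ∘L pderiv p i k ∘L pderiv p j k) =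
      inner ℂ (fderiv ℝ p k (unitVec i) (s k)) (fderiv ℝ p k (unitVec j) (s k)) := by
    intro i j
    rw [hl.frTrace_eq (A := p k ∘L pderiv p i k ∘L pderiv p j k)
      (fun x => proj_apply_apply (hp k) _)]
    simp only [ContinuousLinearMap.comp_apply, pderiv]
    rw [← proj_inner (hp k), hl.apply, ← fderiv_inner_symm (hd k) (fun q => proj_inner (hp q))]
  have hin : ∀ v w, (inner ℂ (fderiv ℝ p k v (s k)) (fderiv ℝ p k w (s k)) : ℂ) =
      inner ℂ (fderiv ℝ s k v) (fderiv ℝ s k w) +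
        inner ℂ (s k) (fderiv ℝ s k v) * inner ℂ (s k) (fderiv ℝ s k w) := by
    intro v w
    rw [h.fderiv_proj_apply hd hk, h.fderiv_proj_apply hd hk, hl.2, hl.2]
    simp only [inner_sub_left, inner_sub_right, inner_smul_left, inner_smul_right, hl.inner_self]
    have e1 := h.inner_fderiv_add hk v
    have e2 : conj (inner ℂ (s k) (fderiv ℝ s k v) : ℂ) = inner ℂ (fderiv ℝ s k v) (s k) :=
      inner_conj_symm _ _
    rw [e2]
    linear_combination (-(inner ℂ (s k) (fderiv ℝ s k w) : ℂ)) * e1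
  rw [curl, hder, hder, berry, curvatureTrace, htr, htr, hin, hin, hsymm (unitVec 1)]
  ring

/-- Parallel transport of a unit section along a segment. -/
lemma transport_apply {K : ℝ} (hK : IsProjFamily p K) (hs : ContDiff ℝ ∞ p) (a d : Plane)
    (hU : ∀ t ∈ Set.Icc (0 : ℝ) 1, a + t • d ∈ U) :
    transport p a (a + d) (s (a + d)) =
      Complex.exp (Complex.I * ∫ t in (0 : ℝ)..1, berryForm s (a + t • d) d) • s a := by
  have hd : Differentiable ℝ p := hs.differentiable (by simp)
  set g : ℝ → ℂ := fun t => berryForm s (a + t • d) d with hg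
  set O : Set ℝ := {t | a + t • d ∈ U} with hO
  have hline : Continuous fun t : ℝ => a + t • d := by fun_prop
  have hOo : IsOpen O := h.isOpen.preimage hline
  have hgc : ∀ t ∈ O, ContinuousAt g t := fun t ht =>
    ((h.contDiffAt_berryForm ht).continuousAt.comp (f := fun t : ℝ => a + t • d)
      hline.continuousAt).clm_apply continuousAt_const
  have hgi : ∀ t ∈ Set.Icc (0 : ℝ) 1, IntervalIntegrable g volume 0 t := fun t ht =>
    ContinuousOn.intervalIntegrable fun x hx => (hgc x (hU x (by
      rw [Set.uIcc_of_le ht.1] at hx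
      exact ⟨hx.1, hx.2.trans ht.2⟩))).continuousWithinAt
  have hI : ∀ t ∈ Set.Icc (0 : ℝ) 1, HasDerivAt (fun t => ∫ x in (0 : ℝ)..t, g x) (g t) t :=
    fun t ht => intervalIntegral.integral_hasDerivAt_right (hgi t ht)
      (ContinuousAt.stronglyMeasurableAtFilter hOo hgc t (hU t ht)) (hgc t (hU t ht))
  -- The transported section, corrected by the accumulated phase, is constant: `p (dp) p = 0`
  -- removes the derivative of the transport, and of `ds` only the component along `s` survives.
  set f : ℝ → E := fun t => Complex.exp (-(Complex.I * ∫ x in (0 : ℝ)..t, g x)) •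
    transport p a (a + t • d) (s (a + t • d)) with hf
  have hfd : ∀ t ∈ Set.Icc (0 : ℝ) 1, HasDerivAt f 0 t := by
    intro t ht
    have hk := hU t ht
    have hl := h.line _ hk
    have h1 := hK.hasDerivAt_transport a d t (hd _)
    have h2 : HasDerivAt (fun t : ℝ => s (a + t • d)) (fderiv ℝ s (a + t • d) d) t := by
      have h0 : HasDerivAt (fun t : ℝ => a + t • d) d t := by
        simpa using ((hasDerivAt_id t).smul_const d).const_add a
      exact (h.differentiableAt hk).hasFDerivAt.comp_hasDerivAt t h0
    have h3 := h1.opApply h2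
    have h4 := (((hI t ht).const_mul Complex.I).neg).cexp.smul h3
    refine h4.congr_deriv ?_
    have e1 : transport p a (a + t • d) (fderiv ℝ s (a + t • d) d) =
        (inner ℂ (s (a + t • d)) (fderiv ℝ s (a + t • d) d) : ℂ) •
          transport p a (a + t • d) (s (a + t • d)) := by
      rw [← hK.transport_proj_apply, hl.2, map_smul]
    have e2 : (transport p a (a + t • d) * fderiv ℝ p (a + t • d) d) (s (a + t • d)) = 0 := by
      change transport p a (a + t • d) (fderiv ℝ p (a + t • d) d (s (a + t • d))) = 0
      rw [← hK.transport_proj_apply]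
      nth_rw 1 [← hl.apply]
      rw [proj_fderiv_proj hK.proj (hd _), map_zero]
    rw [e1, e2, zero_add]
    have e3 : g t = -Complex.I *
        (inner ℂ (s (a + t • d)) (fderiv ℝ s (a + t • d) d) : ℂ) := rfl
    rw [e3, smul_smul, ← add_smul]
    simp only [Pi.neg_apply]
    convert zero_smul ℂ _ using 2
    linear_combination (Complex.exp (-(Complex.I * ∫ x in (0 : ℝ)..t, g x)) *
      (inner ℂ (s (a + t • d)) (fderiv ℝ s (a + t • d) d) : ℂ)) * Complex.I_sq
  have hconst := constant_of_has_deriv_right_zero (f := f) (a := 0) (b := 1)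
    (fun t ht => (hfd t ht).continuousAt.continuousWithinAt)
    (fun t ht => (hfd t ⟨ht.1, ht.2.le⟩).hasDerivWithinAt) 1 ⟨zero_le_one, le_rfl⟩
  simp only [hf, one_smul, zero_smul, add_zero, intervalIntegral.integral_same, mul_zero, neg_zero,
    Complex.exp_zero, hK.transport_self] at hconst
  rw [(h.line a (by simpa using hU 0 ⟨le_rfl, zero_le_one⟩)).apply] at hconst
  rw [← hconst, smul_smul, ← Complex.exp_add, add_neg_cancel, Complex.exp_zero, one_smul]

end IsUnitSection

end UnitSection

/-! ### The flux through a parallelogram and its additivity. -/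

section Parallelogram

/-- The parallelogram at `a` with edges `c₁`, `c₂`. -/
def affineCell (a c₁ c₂ : Plane) (p : ℝ × ℝ) : Plane := a + p.1 • c₁ + p.2 • c₂

/-- The oriented area. -/
def area (c₁ c₂ : Plane) : ℝ := c₁ 0 * c₂ 1 - c₁ 1 * c₂ 0

lemma hasFDerivAt_affineCell (a c₁ c₂ : Plane) (p : ℝ × ℝ) : HasFDerivAt (affineCell a c₁ c₂)
    ((ContinuousLinearMap.fst ℝ ℝ ℝ).smulRight c₁ + (ContinuousLinearMap.snd ℝ ℝ ℝ).smulRight c₂)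
    p :=
  (((ContinuousLinearMap.fst ℝ ℝ ℝ).smulRight c₁).hasFDerivAt.const_add a).add
    ((ContinuousLinearMap.snd ℝ ℝ ℝ).smulRight c₂).hasFDerivAt

lemma fderiv_affineCell (a c₁ c₂ : Plane) (p v : ℝ × ℝ) :
    fderiv ℝ (affineCell a c₁ c₂) p v = v.1 • c₁ + v.2 • c₂ := by
  rw [(hasFDerivAt_affineCell a c₁ c₂ p).fderiv]; rfl

lemma contDiff_affineCell {n : WithTop ℕ∞} (a c₁ c₂ : Plane) : ContDiff ℝ n (affineCell a c₁ c₂) := by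
  unfold affineCell; fun_prop

lemma jac_affineCell (a c₁ c₂ : Plane) (p : ℝ × ℝ) : jac (affineCell a c₁ c₂) p = area c₁ c₂ := by
  simp [jac, fderiv_affineCell, area]

/-- The integral of `F` over a parallelogram. -/
def flux (F : Plane → ℂ) (a c₁ c₂ : Plane) : ℂ :=
  ∫ x in (0 : ℝ)..1, ∫ y in (0 : ℝ)..1, (area c₁ c₂ : ℂ) * F (affineCell a c₁ c₂ (x, y))

variable {F : Plane → ℂ}

lemma flux_eq (hF : Continuous F) (a c₁ c₂ : Plane) :
    flux F a c₁ c₂ = ∫ p in openSquare, (jac (affineCell a c₁ c₂) p : ℂ) * F (affineCell a c₁ c₂ p) := by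
  simp only [jac_affineCell]
  rw [setIntegral_congr_set Ioo_prod_ae_eq, flux, ← Set.Icc_prod_Icc, Measure.volume_eq_prod,
    setIntegral_prod]
  · rw [intervalIntegral.integral_of_le zero_le_one, ← integral_Icc_eq_integral_Ioc]
    refine setIntegral_congr_fun measurableSet_Icc fun x _ => ?_
    rw [intervalIntegral.integral_of_le zero_le_one, ← integral_Icc_eq_integral_Ioc]
  · have hc : Continuous (affineCell a c₁ c₂) := (contDiff_affineCell (n := 0) a c₁ c₂).continuous
    exact (continuous_const.mul (hF.comp hc)).continuousOn.integrableOn_compact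
      (isCompact_Icc.prod isCompact_Icc)

/-- Halving is the only subdivision needed: it drives the induction on the size of the parallelogram
in `hasHolonomy`. -/
lemma integral_halve {g : ℝ → ℂ} (hg : Continuous g) : ∫ x in (0 : ℝ)..1, g x =
    (1 / 2 : ℂ) * (∫ x in (0 : ℝ)..1, g (1 / 2 * x)) +
      (1 / 2 : ℂ) * ∫ x in (0 : ℝ)..1, g (1 / 2 * x + 1 / 2) := by
  have h1 := intervalIntegral.smul_integral_comp_mul_add (a := 0) (b := 1) g (1 / 2) 0
  have h2 := intervalIntegral.smul_integral_comp_mul_add (a := 0) (b := 1) g (1 / 2) (1 / 2)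
  norm_num at h1 h2
  rw [← intervalIntegral.integral_add_adjacent_intervals (b := 1 / 2)
    (hg.intervalIntegrable _ _) (hg.intervalIntegrable _ _)]
  norm_num
  rw [h1, h2]

lemma flux_double_left (hF : Continuous F) (a h c : Plane) :
    flux F a (h + h) c = flux F a h c + flux F (a + h) h c := by
  have hc : Continuous fun q : ℝ × ℝ => F (affineCell a (h + h) c q) :=
    hF.comp (contDiff_affineCell (n := 0) a _ c).continuous
  rw [flux, integral_halve]
  · simp only [flux]
    have ha : (area (h + h) c : ℂ) = 2 * (area h c : ℂ) := by
      rw [area, area]; push_cast; simp; ring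
    have e1 : ∀ x y : ℝ, affineCell a (h + h) c (1 / 2 * x, y) = affineCell a h c (x, y) :=
      fun x y => by simp only [affineCell]; module
    have e2 : ∀ x y : ℝ, affineCell a (h + h) c (1 / 2 * x + 1 / 2, y) =
      affineCell (a + h) h c (x, y) := fun x y => by simp only [affineCell]; module
    simp only [e1, e2, ha, mul_assoc, intervalIntegral.integral_const_mul]
    ring
  · exact intervalIntegral.continuous_parametric_intervalIntegral_of_continuous'
      (continuous_const.mul hc) 0 1

lemma flux_double_right (hF : Continuous F) (a h c : Plane) :
    flux F a c (h + h) = flux F a c h + flux F (a + h) c h := by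
  have hc : Continuous fun q : ℝ × ℝ => F (affineCell a c (h + h) q) :=
    hF.comp (contDiff_affineCell (n := 0) a c _).continuous
  have ha : (area c (h + h) : ℂ) = 2 * (area c h : ℂ) := by
    rw [area, area]; push_cast; simp; ring
  have e1 : ∀ x y : ℝ, affineCell a c (h + h) (x, 1 / 2 * y) = affineCell a c h (x, y) :=
    fun x y => by simp only [affineCell]; module
  have e2 : ∀ x y : ℝ, affineCell a c (h + h) (x, 1 / 2 * y + 1 / 2) =
    affineCell (a + h) c h (x, y) := fun x y => by simp only [affineCell]; module
  have h1 : ∀ x, ∫ y in (0 : ℝ)..1, (area c (h + h) : ℂ) * F (affineCell a c (h + h) (x, y)) =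
      (∫ y in (0 : ℝ)..1, (area c h : ℂ) * F (affineCell a c h (x, y))) +
        ∫ y in (0 : ℝ)..1, (area c h : ℂ) * F (affineCell (a + h) c h (x, y)) := by
    intro x
    rw [integral_halve]
    · simp only [e1, e2, ha, mul_assoc, intervalIntegral.integral_const_mul]
      ring
    · exact continuous_const.mul (hc.comp (by fun_prop : Continuous fun y : ℝ => (x, y)))
  have hi : ∀ a' : Plane, IntervalIntegrable (fun x : ℝ => ∫ y in (0 : ℝ)..1,
      (area c h : ℂ) * F (affineCell a' c h (x, y))) volume 0 1 := fun a' =>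
    Continuous.intervalIntegrable
      (intervalIntegral.continuous_parametric_intervalIntegral_of_continuous'
        (continuous_const.mul (hF.comp (contDiff_affineCell (n := 0) a' c h).continuous)) 0 1) _ _
  rw [flux, flux, flux, ← intervalIntegral.integral_add (hi a) (hi (a + h))]
  simp only [h1]

end Parallelogram

/-! ### Continuity of the Berry curvature. -/

section Continuity

variable {E : Type*} [NormedAddCommGroup E] [InnerProductSpace ℂ E] [CompleteSpace E]
  {p : Plane → E →L[ℂ] E}

/-- Near each point the Berry curvature is the curl of the smooth connection form of a local unit
section, whereas the definition of `frTrace` does not exhibit continuity. -/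
lemma continuous_berry (hs : ContDiff ℝ ∞ p) (hp : ∀ k, IsStarProjection (p k))
    (hl : ∀ k, ∃ ℓ, IsLine (p k) ℓ) : Continuous (berry p) := by
  rw [continuous_iff_continuousAt]
  intro k
  obtain ⟨ℓ, hℓ⟩ := hl k
  obtain ⟨s, hs'⟩ := exists_isUnitSection hs hp hl ℓ
  have hk : k ∈ {q | p q ℓ ≠ 0} := by
    rw [Set.mem_ofPred_eq, hℓ.apply, ← norm_ne_zero_iff, hℓ.1]; exact one_ne_zero
  have h1 : ContinuousAt (fderiv ℝ (berryForm s)) k :=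
    ((hs'.contDiffAt_berryForm hk).of_le (by simp : (1 : WithTop ℕ∞) ≤ ∞)).continuousAt_fderiv
      (by simp)
  have h2 : ContinuousAt (curl (berryForm s)) k :=
    ((h1.clm_apply continuousAt_const).clm_apply continuousAt_const).sub
      ((h1.clm_apply continuousAt_const).clm_apply continuousAt_const)
  refine h2.congr ?_
  filter_upwards [hs'.isOpen.mem_nhds hk] with q hq
  exact hs'.curl_berryForm hs hp hq

end Continuity

/-! ### Holonomy around a parallelogram. -/

section Holonomy

variable {E : Type*} [NormedAddCommGroup E] [InnerProductSpace ℂ E] [CompleteSpace E]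
  {p : Plane → E →L[ℂ] E} {K : ℝ}

/-- Transport along the two paths formed by edges of a parallelogram differs by the phase `z`. -/
def HasHolonomy (p : Plane → E →L[ℂ] E) (a c₁ c₂ : Plane) (z : ℂ) : Prop :=
  transport p a (a + c₁) * transport p (a + c₁) (a + c₁ + c₂) =
    z • (transport p a (a + c₂) * transport p (a + c₂) (a + c₁ + c₂))

lemma IsProjFamily.transport_double (hK : IsProjFamily p K) (a h : Plane) :
    transport p a (a + h) * transport p (a + h) (a + (h + h)) = transport p a (a + (h + h)) := by
  have := hK.transport_comp a h 0 1 2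
  rwa [zero_smul, add_zero, one_smul, two_smul] at this

/-- Two adjacent parallelograms share an edge; the transport along it cancels and the phases
multiply. -/
lemma HasHolonomy.double_left (hK : IsProjFamily p K) {a h c : Plane} {z z' : ℂ}
    (h1 : HasHolonomy p a h c z) (h2 : HasHolonomy p (a + h) h c z') :
    HasHolonomy p a (h + h) c (z * z') := by
  unfold HasHolonomy at h1 h2 ⊢
  have e1 := hK.transport_double a h
  have e2 := hK.transport_double (a + c) h
  rw [add_right_comm a c h, show a + c + (h + h) = a + (h + h) + c by abel] at e2
  rw [add_assoc a h h] at h2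
  rw [← e1, mul_assoc, h2, mul_smul_comm, ← mul_assoc, h1, smul_mul_assoc, smul_smul, mul_assoc, e2,
    mul_comm z]

lemma HasHolonomy.double_right (hK : IsProjFamily p K) {a h c : Plane} {z z' : ℂ}
    (h1 : HasHolonomy p a c h z) (h2 : HasHolonomy p (a + h) c h z') :
    HasHolonomy p a c (h + h) (z * z') := by
  unfold HasHolonomy at h1 h2 ⊢
  have e1 := hK.transport_double a h
  have e2 := hK.transport_double (a + c) h
  rw [add_right_comm a h c, add_assoc (a + c) h h, add_assoc a h h] at h2
  rw [← e2, ← mul_assoc, h1, smul_mul_assoc, mul_assoc, h2, mul_smul_comm, ← mul_assoc, e1,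
    smul_smul]

variable (hK : IsProjFamily p K) (hs : ContDiff ℝ ∞ p) (hl : ∀ k, ∃ ℓ, IsLine (p k) ℓ)
include hK hs hl

/-- The smallness condition keeps `p q ℓ` nonzero on the whole parallelogram, since `p` is
Lipschitz. One unit section is then available there, the four transports are exponentials of its
connection form, and `cell_stokes` adds them up. -/
lemma hasHolonomy_of_small {a c₁ c₂ : Plane} (hc : |K| * (‖c₁‖ + ‖c₂‖) < 1) :
    HasHolonomy p a c₁ c₂ (Complex.exp (Complex.I * flux (berry p) a c₁ c₂)) := by
  obtain ⟨ℓ, hℓ⟩ := hl a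
  obtain ⟨s, hs'⟩ := exists_isUnitSection hs hK.proj hl ℓ
  have hU : ∀ q ∈ Set.Icc ((0 : ℝ), (0 : ℝ)) (1, 1),
      affineCell a c₁ c₂ q ∈ {q | p q ℓ ≠ 0} := by
    rintro ⟨x, y⟩ hq h0
    obtain ⟨⟨hx0, hy0⟩, hx1, hy1⟩ := hq
    simp only at hx0 hy0 hx1 hy1
    have h1 : ‖p a ℓ - p (affineCell a c₁ c₂ (x, y)) ℓ‖ ≤
        |K| * (‖c₁‖ + ‖c₂‖) := by
      rw [← _root_.sub_apply]
      refine (ContinuousLinearMap.le_opNorm _ _).trans ?_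
      rw [hℓ.1, mul_one]
      refine (hK.lip _ _).trans (mul_le_mul (le_abs_self K) ?_ (norm_nonneg _) (abs_nonneg _))
      rw [show a - affineCell a c₁ c₂ (x, y) = -(x • c₁ + y • c₂) by
        simp only [affineCell]; module, norm_neg]
      refine (norm_add_le _ _).trans (add_le_add ?_ ?_)
      · rw [norm_smul, Real.norm_of_nonneg hx0]
        exact mul_le_of_le_one_left (norm_nonneg _) hx1
      · rw [norm_smul, Real.norm_of_nonneg hy0]
        exact mul_le_of_le_one_left (norm_nonneg _) hy1
    rw [h0, sub_zero, hℓ.apply, hℓ.1] at h1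
    linarith
  have hmem : ∀ x y : ℝ, 0 ≤ x → x ≤ 1 → 0 ≤ y → y ≤ 1 →
      affineCell a c₁ c₂ (x, y) ∈ {q | p q ℓ ≠ 0} := fun x y h1 h2 h3 h4 =>
    hU (x, y) ⟨⟨h1, h3⟩, ⟨h2, h4⟩⟩
  set I : Plane → Plane → ℂ := fun k d => ∫ t in (0 : ℝ)..1, berryForm s (k + t • d) d with hI
  have t1 := hs'.transport_apply hK hs a c₁ fun t ht => by
    have := hmem t 0 ht.1 ht.2 le_rfl zero_le_one
    rwa [affineCell, zero_smul, add_zero] at this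
  have t2 := hs'.transport_apply hK hs (a + c₁) c₂ fun t ht => by
    have := hmem 1 t zero_le_one le_rfl ht.1 ht.2
    rwa [affineCell, one_smul] at this
  have t3 := hs'.transport_apply hK hs a c₂ fun t ht => by
    have := hmem 0 t le_rfl zero_le_one ht.1 ht.2
    rwa [affineCell, zero_smul, add_zero] at this
  have t4 := hs'.transport_apply hK hs (a + c₂) c₁ fun t ht => by
    have := hmem t 1 ht.1 ht.2 zero_le_one le_rfl
    rwa [affineCell, one_smul, add_right_comm] at this
  have hstokes := cell_stokes (θ := berryForm s) (contDiff_affineCell a c₁ c₂)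
    (fun q hq => (hs'.contDiffAt_berryForm (hU q hq)).of_le (by simp))
  have hcurl : (∫ q in openSquare, (jac (affineCell a c₁ c₂) q : ℂ) *
      curl (berryForm s) (affineCell a c₁ c₂ q)) = flux (berry p) a c₁ c₂ := by
    rw [flux_eq (continuous_berry hs hK.proj hl)]
    refine setIntegral_congr_fun (measurableSet_Ioo.prod measurableSet_Ioo) fun q hq => ?_
    rw [hs'.curl_berryForm hs hK.proj
      (hU q ⟨⟨hq.1.1.le, hq.2.1.le⟩, ⟨hq.1.2.le, hq.2.2.le⟩⟩)]
  have hside : ∀ i, sideIntegral (fun k w => berryForm s k w) (affineCell a c₁ c₂) i =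
      (![I a c₁, I (a + c₁) c₂, -I (a + c₂) c₁, -I a c₂] : Fin 4 → ℂ) i := by
    have hd := (contDiff_affineCell (n := 2) a c₁ c₂).differentiable (by simp)
    have hrev : ∀ k d : Plane, ∫ t in (0 : ℝ)..1, berryForm s (k + (1 - t) • d) (-d) = -I k d := by
      intro k d
      have := intervalIntegral.integral_comp_sub_left (a := 0) (b := 1)
        (fun t => berryForm s (k + t • d) d) 1
      rw [sub_self, sub_zero] at this
      rw [hI]
      beta_reduce
      rw [← this, ← intervalIntegral.integral_neg]
      simp only [map_neg]
    intro i
    simp only [sideIntegral, (hasDerivAt_side hd i _).deriv, fderiv_affineCell]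
    fin_cases i
    · simp [squareSide, sideDir, affineCell, hI]
    · simp [squareSide, sideDir, affineCell, hI]
    · simp only [squareSide, sideDir, affineCell, ← hrev]
      simp [add_right_comm]
    · simp only [squareSide, sideDir, affineCell, ← hrev]
      simp
  have hI' : I a c₁ + I (a + c₁) c₂ = flux (berry p) a c₁ c₂ + (I a c₂ + I (a + c₂) c₁) := by
    rw [hcurl, Fin.sum_univ_four, hside, hside, hside, hside] at hstokes
    simp at hstokes
    linear_combination hstokes
  have hline := hs'.line (a + c₁ + c₂) (by
    have := hmem 1 1 zero_le_one le_rfl zero_le_one le_rfl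
    rwa [affineCell, one_smul, one_smul] at this)
  unfold HasHolonomy
  have key : (transport p a (a + c₁) * transport p (a + c₁) (a + c₁ + c₂)) (s (a + c₁ + c₂)) =
      (Complex.exp (Complex.I * flux (berry p) a c₁ c₂) •
        (transport p a (a + c₂) * transport p (a + c₂) (a + c₁ + c₂))) (s (a + c₁ + c₂)) := by
    rw [_root_.smul_apply, mul_apply_eq_comp, mul_apply_eq_comp, t2, map_smul, t1]
    rw [add_right_comm, t4, map_smul, t3]
    simp only [smul_smul, ← Complex.exp_add]
    congr 2
    change Complex.I * I (a + c₁) c₂ + Complex.I * I a c₁ = _ + (Complex.I * I (a + c₂) c₁ +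
      Complex.I * I a c₂)
    linear_combination Complex.I * hI'
  ext x
  have hx : ∀ k x, transport p k (a + c₁ + c₂) x =
      (inner ℂ (s (a + c₁ + c₂)) x : ℂ) • transport p k (a + c₁ + c₂) (s (a + c₁ + c₂)) := by
    intro k x
    rw [← hK.transport_proj_apply, hline.2, map_smul]
  have e1 : ∀ x, (transport p a (a + c₁) * transport p (a + c₁) (a + c₁ + c₂)) x =
      transport p a (a + c₁) (transport p (a + c₁) (a + c₁ + c₂) x) := fun _ => rfl
  have e2 : ∀ x, (transport p a (a + c₂) * transport p (a + c₂) (a + c₁ + c₂)) x =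
      transport p a (a + c₂) (transport p (a + c₂) (a + c₁ + c₂) x) := fun _ => rfl
  rw [_root_.smul_apply, e1, e2] at key ⊢
  rw [hx, map_smul, key, hx _ x, map_smul]
  exact smul_comm _ _ _

/-- Parallel transport around a parallelogram is given by the flux of the Berry curvature. -/
theorem hasHolonomy (a c₁ c₂ : Plane) :
    HasHolonomy p a c₁ c₂ (Complex.exp (Complex.I * flux (berry p) a c₁ c₂)) := by
  have hF := continuous_berry hs hK.proj hl
  -- Induction on the number of halvings of both edges needed to reach the small case.
  have key : ∀ (n : ℕ) (a c₁ c₂ : Plane), |K| * (‖c₁‖ + ‖c₂‖) < 2 ^ n →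
      HasHolonomy p a c₁ c₂ (Complex.exp (Complex.I * flux (berry p) a c₁ c₂)) := by
    intro n
    induction n with
    | zero => exact fun a c₁ c₂ h => hasHolonomy_of_small hK hs hl (by simpa using h)
    | succ n ih =>
      intro a c₁ c₂ h
      have hn : ∀ c : Plane, ‖(1 / 2 : ℝ) • c‖ = 1 / 2 * ‖c‖ := fun c => by
        rw [norm_smul, Real.norm_of_nonneg (by norm_num)]
      have hh : |K| * (‖(1 / 2 : ℝ) • c₁‖ + ‖(1 / 2 : ℝ) • c₂‖) < 2 ^ n := by
        rw [hn, hn]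
        rw [pow_succ] at h
        linarith
      have h1 : (1 / 2 : ℝ) • c₁ + (1 / 2 : ℝ) • c₁ = c₁ := by module
      have h2 : (1 / 2 : ℝ) • c₂ + (1 / 2 : ℝ) • c₂ = c₂ := by module
      have hv : ∀ a, HasHolonomy p a ((1 / 2 : ℝ) • c₁) c₂
          (Complex.exp (Complex.I * flux (berry p) a ((1 / 2 : ℝ) • c₁) c₂)) := fun a => by
        have := (ih a _ _ hh).double_right hK (ih (a + (1 / 2 : ℝ) • c₂) _ _ hh)
        rwa [← Complex.exp_add, ← mul_add, ← flux_double_right hF, h2] at this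
      have := (hv a).double_left hK (hv (a + (1 / 2 : ℝ) • c₁))
      rwa [← Complex.exp_add, ← mul_add, ← flux_double_left hF, h1] at this
  obtain ⟨n, hn⟩ := pow_unbounded_of_one_lt (|K| * (‖c₁‖ + ‖c₂‖)) one_lt_two
  exact key n a c₁ c₂ hn

end Holonomy

/-! ### Periodic gauges of line bundles, and holonomies in them. -/

section PeriodicGauge

variable {b : Module.Basis (Fin 2) ℝ Plane} {E : Type*} [NormedAddCommGroup E]
  [InnerProductSpace ℂ E] [CompleteSpace E] {T : recip b → E ≃ₗᵢ[ℂ] E} {p : Plane → E →L[ℂ] E}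
  {ℓ : Plane → E} {K : ℝ} {k k' : Plane}

lemma fract_add_lattice (k : Plane) (G : recip b) : ZSpan.fract b (k + G) = ZSpan.fract b k :=
  ZSpan.fract_add_ZSpan b k G.2

lemma fract_add_floor (k : Plane) : ZSpan.fract b k + (ZSpan.floor b k : Plane) = k := by
  rw [ZSpan.fract_apply, sub_add_cancel]

lemma floor_add_lattice (k : Plane) (G : recip b) :
    ZSpan.floor b (k + G) = G + ZSpan.floor b k := by
  apply Subtype.ext
  have h := fract_add_lattice k G
  rw [ZSpan.fract_apply, ZSpan.fract_apply, sub_eq_sub_iff_add_eq_add] at h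
  rw [Submodule.coe_add]
  have h' : k + ((ZSpan.floor b (k + G) : recip b) : Plane) = k + (G + (ZSpan.floor b k : Plane)) := by
    rw [← h, add_assoc]
  exact add_left_cancel h'

/-- The periodic extension of a choice of vectors on the unit cell. -/
def extend (T : recip b → E ≃ₗᵢ[ℂ] E) (ℓ : Plane → E) (k : Plane) : E :=
  T (ZSpan.floor b k) (ℓ (ZSpan.fract b k))

lemma extend_add (hT : ∀ G G' x, T (G + G') x = T G (T G' x)) (ℓ : Plane → E) (k : Plane)
    (G : recip b) : extend T ℓ (k + G) = T G (extend T ℓ k) := by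
  rw [extend, floor_add_lattice, hT, fract_add_lattice, extend]

lemma IsBundle.isLine_apply (hB : IsBundle b T p) {x : E} (h : IsLine (p k) x) (G : recip b) :
    IsLine (p (k + G)) (T G x) := by
  refine ⟨by rw [LinearIsometryEquiv.norm_map, h.1], fun y => ?_⟩
  obtain ⟨y, rfl⟩ := (T G).surjective y
  rw [← hB.equiv, h.2, map_smul, LinearIsometryEquiv.inner_map_map]

/-- A periodic choice of unit vectors in a family of lines. -/
structure IsLineGauge (T : recip b → E ≃ₗᵢ[ℂ] E) (p : Plane → E →L[ℂ] E) (ℓ : Plane → E) : Prop where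
  line : ∀ k, IsLine (p k) (ℓ k)
  periodic : ∀ k (G : recip b), ℓ (k + G) = T G (ℓ k)

lemma IsBundle.exists_isLineGauge (hB : IsBundle b T p)
    (hT : ∀ G G' x, T (G + G') x = T G (T G' x)) (hl : ∀ k, ∃ ℓ, IsLine (p k) ℓ) :
    ∃ ℓ, IsLineGauge T p ℓ := by
  choose ℓ hℓ using hl
  refine ⟨extend T ℓ, fun k => ?_, extend_add hT ℓ⟩
  have := hB.isLine_apply (hℓ (ZSpan.fract b k)) (ZSpan.floor b k)
  rwa [fract_add_floor] at this

/-- The holonomy from `k'` to `k` along the segment, in a gauge. -/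
def hol (p : Plane → E →L[ℂ] E) (ℓ : Plane → E) (k k' : Plane) : ℂ :=
  inner ℂ (ℓ k) (transport p k k' (ℓ k'))

section

variable (hK : IsProjFamily p K) (hℓ : ∀ k, IsLine (p k) (ℓ k))
include hK hℓ

lemma transport_eq_hol (k k' : Plane) : transport p k k' (ℓ k') = hol p ℓ k k' • ℓ k :=
  (hℓ k).eq_smul (hK.proj_transport_apply _ _ _)

lemma hol_self (k : Plane) : hol p ℓ k k = 1 := by
  rw [hol, hK.transport_self, (hℓ k).apply, (hℓ k).inner_self]

lemma conj_hol (k k' : Plane) : conj (hol p ℓ k k') = hol p ℓ k' k := by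
  rw [hol, hol, inner_conj_symm, hK.transport_inner]

lemma hol_eq_of_mul {k₁ k₂ k₃ : Plane}
    (h : transport p k₁ k₂ * transport p k₂ k₃ = transport p k₁ k₃) :
    hol p ℓ k₁ k₂ * hol p ℓ k₂ k₃ = hol p ℓ k₁ k₃ := by
  have h1 := congrArg (fun A : E →L[ℂ] E => A (ℓ k₃)) h
  change transport p k₁ k₂ (transport p k₂ k₃ (ℓ k₃)) = transport p k₁ k₃ (ℓ k₃) at h1
  rw [transport_eq_hol hK hℓ, map_smul, transport_eq_hol hK hℓ, transport_eq_hol hK hℓ,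
    smul_smul] at h1
  have h2 := congrArg (fun x => (inner ℂ (ℓ k₁) x : ℂ)) h1
  simp only [inner_smul_right, (hℓ k₁).inner_self, mul_one] at h2
  rw [mul_comm, h2]

lemma hol_mul_hol (k k' : Plane) : hol p ℓ k k' * hol p ℓ k' k = 1 := by
  rw [← hol_self hK hℓ k]
  exact hol_eq_of_mul hK hℓ (by rw [hK.transport_mul_reverse, hK.transport_self])

lemma hol_ne_zero (k k' : Plane) : hol p ℓ k k' ≠ 0 :=
  left_ne_zero_of_mul_eq_one (hol_mul_hol hK hℓ k k')

lemma hol_parallelogram (hs : ContDiff ℝ ∞ p) (a c₁ c₂ : Plane) :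
    hol p ℓ a (a + c₁) * hol p ℓ (a + c₁) (a + c₁ + c₂) * (hol p ℓ (a + c₁ + c₂) (a + c₂) *
      hol p ℓ (a + c₂) a) = Complex.exp (Complex.I * flux (berry p) a c₁ c₂) := by
  have h := congrArg (fun A : E →L[ℂ] E => A (ℓ (a + c₁ + c₂)))
    (hasHolonomy hK hs (fun k => ⟨ℓ k, hℓ k⟩) a c₁ c₂)
  change transport p a (a + c₁) (transport p (a + c₁) (a + c₁ + c₂) (ℓ (a + c₁ + c₂))) =
    Complex.exp (Complex.I * flux (berry p) a c₁ c₂) • transport p a (a + c₂) (transport p (a + c₂) (a + c₁ + c₂) (ℓ (a + c₁ + c₂))) at h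
  simp only [transport_eq_hol hK hℓ, map_smul, smul_smul] at h
  have h2 := congrArg (fun x => (inner ℂ (ℓ a) x : ℂ)) h
  simp only [inner_smul_right, (hℓ a).inner_self, mul_one] at h2
  have e1 := hol_mul_hol hK hℓ (a + c₂) (a + c₁ + c₂)
  have e2 := hol_mul_hol hK hℓ a (a + c₂)
  linear_combination (hol p ℓ (a + c₁ + c₂) (a + c₂) * hol p ℓ (a + c₂) a) * h2 +
    Complex.exp (Complex.I * flux (berry p) a c₁ c₂) * (e2 + hol p ℓ a (a + c₂) *
      hol p ℓ (a + c₂) a * e1)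

end

lemma IsBundle.hol_periodic (hB : IsBundle b T p) (hℓ : IsLineGauge T p ℓ) (k k' : Plane)
    (G : recip b) : hol p ℓ (k + G) (k' + G) = hol p ℓ k k' := by
  rw [hol, hol, hℓ.periodic, hℓ.periodic, ← transport_equivariant hB,
    LinearIsometryEquiv.inner_map_map]

end PeriodicGauge

/-! ### Maps between line bundles and the one-form `v`. -/

section LineMap

variable {b : Module.Basis (Fin 2) ℝ Plane}
  {E₁ : Type*} [NormedAddCommGroup E₁] [InnerProductSpace ℂ E₁] [CompleteSpace E₁]
  {E₂ : Type*} [NormedAddCommGroup E₂] [InnerProductSpace ℂ E₂] [CompleteSpace E₂]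
  {T₁ : recip b → E₁ ≃ₗᵢ[ℂ] E₁} {T₂ : recip b → E₂ ≃ₗᵢ[ℂ] E₂}
  {p₁ : Plane → E₁ →L[ℂ] E₁} {p₂ : Plane → E₂ →L[ℂ] E₂} {β : Plane → E₂ →L[ℂ] E₁} {n : Plane → ℝ}

/-- A smooth equivariant family of maps between two families of lines, with squared norm `n`. -/
structure IsLineMap (T₁ : recip b → E₁ ≃ₗᵢ[ℂ] E₁) (T₂ : recip b → E₂ ≃ₗᵢ[ℂ] E₂)
    (p₁ : Plane → E₁ →L[ℂ] E₁) (p₂ : Plane → E₂ →L[ℂ] E₂) (β : Plane → E₂ →L[ℂ] E₁)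
    (n : Plane → ℝ) : Prop where
  bundle₁ : IsBundle b T₁ p₁
  bundle₂ : IsBundle b T₂ p₂
  line₁ : ∀ k, ∃ ℓ, IsLine (p₁ k) ℓ
  line₂ : ∀ k, ∃ ℓ, IsLine (p₂ k) ℓ
  smooth : ContDiff ℝ ∞ β
  left : ∀ k x, p₁ k (β k x) = β k x
  right : ∀ k x, β k (p₂ k x) = β k x
  equiv : ∀ k (G : recip b) x, T₁ G (β k x) = β (k + G) (T₂ G x)
  mul_adj : ∀ k x, β k (ContinuousLinearMap.adjoint (β k) x) = (n k : ℂ) • p₁ k x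

/-- `n v`: the imaginary part of `Tr[β dβ†]`. -/
def imForm (β : Plane → E₂ →L[ℂ] E₁) (k : Plane) : Plane →L[ℝ] ℂ :=
  ∑ i, (((frTrace (β k ∘L fderiv ℝ (fun q => ContinuousLinearMap.adjoint (β q)) k
    (unitVec i))).im : ℂ)) • Complex.ofRealCLM.comp (EuclideanSpace.proj (𝕜 := ℝ) i)

namespace IsLineMap

variable (h : IsLineMap T₁ T₂ p₁ p₂ β n)
include h

lemma proj_adj (k : Plane) (x : E₁) :
    p₂ k (ContinuousLinearMap.adjoint (β k) x) = ContinuousLinearMap.adjoint (β k) x := by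
  refine ext_inner_left ℂ fun y => ?_
  rw [← proj_inner (h.bundle₂.proj k), ContinuousLinearMap.adjoint_inner_right,
    ContinuousLinearMap.adjoint_inner_right, h.right]

lemma norm_adj_sq {k : Plane} {ℓ : E₁} (hℓ : IsLine (p₁ k) ℓ) :
    ‖ContinuousLinearMap.adjoint (β k) ℓ‖ ^ 2 = n k := by
  have h1 : (inner ℂ (ContinuousLinearMap.adjoint (β k) ℓ)
      (ContinuousLinearMap.adjoint (β k) ℓ) : ℂ) = n k := by
    rw [ContinuousLinearMap.adjoint_inner_left, h.mul_adj, hℓ.apply, inner_smul_right,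
      hℓ.inner_self, mul_one]
  rw [@norm_sq_eq_re_inner ℂ, h1]; simp

lemma nonneg (k : Plane) : 0 ≤ n k := by
  obtain ⟨ℓ, hℓ⟩ := h.line₁ k
  rw [← h.norm_adj_sq hℓ]; positivity

lemma adj_smooth : ContDiff ℝ ∞ fun q => ContinuousLinearMap.adjoint (β q) :=
  contDiff_iff_contDiffAt.mpr fun _ => h.smooth.contDiffAt.opAdjoint

lemma exists_section (k : Plane) : ∃ s U, k ∈ U ∧ IsUnitSection p₁ s U := by
  obtain ⟨ℓ, hℓ⟩ := h.line₁ k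
  obtain ⟨s, hs⟩ := exists_isUnitSection h.bundle₁.smooth h.bundle₁.proj h.line₁ ℓ
  refine ⟨s, _, ?_, hs⟩
  rw [Set.mem_ofPred_eq, hℓ.apply, ← norm_ne_zero_iff, hℓ.1]; exact one_ne_zero

lemma n_eq {s : Plane → E₁} {U : Set Plane} (hs : IsUnitSection p₁ s U) {q : Plane} (hq : q ∈ U) :
    n q = ‖ContinuousLinearMap.adjoint (β q) (s q)‖ ^ 2 := (h.norm_adj_sq (hs.line q hq)).symm

lemma contDiff_n : ContDiff ℝ ∞ n := by
  rw [contDiff_iff_contDiffAt]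
  intro k
  obtain ⟨s, U, hk, hs⟩ := h.exists_section k
  have h1 : ContDiffAt ℝ ∞ (fun q => ‖ContinuousLinearMap.adjoint (β q) (s q)‖ ^ 2) k :=
    (h.adj_smooth.contDiffAt.opApply (hs.contDiffAt hk)).norm_sq ℂ
  refine h1.congr_of_eventuallyEq ?_
  filter_upwards [hs.isOpen.mem_nhds hk] with q hq
  exact h.n_eq hs hq

lemma adj_equiv (k : Plane) (G : recip b) (x : E₁) :
    T₂ G (ContinuousLinearMap.adjoint (β k) x) =
      ContinuousLinearMap.adjoint (β (k + G)) (T₁ G x) := by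
  refine ext_inner_left ℂ fun y => ?_
  obtain ⟨y, rfl⟩ := (T₂ G).surjective y
  rw [ContinuousLinearMap.adjoint_inner_right, ← h.equiv, LinearIsometryEquiv.inner_map_map,
    LinearIsometryEquiv.inner_map_map, ContinuousLinearMap.adjoint_inner_right]

lemma n_periodic (k : Plane) (G : recip b) : n (k + G) = n k := by
  obtain ⟨ℓ, hℓ⟩ := h.line₁ k
  rw [← h.norm_adj_sq hℓ, ← h.norm_adj_sq (h.bundle₁.isLine_apply hℓ G), ← h.adj_equiv,
    LinearIsometryEquiv.norm_map]

lemma trace_eq {k : Plane} {ℓ : E₁} (hℓ : IsLine (p₁ k) ℓ) (w : Plane) :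
    frTrace (β k ∘L fderiv ℝ (fun q => ContinuousLinearMap.adjoint (β q)) k w) =
      inner ℂ (ContinuousLinearMap.adjoint (β k) ℓ)
        (fderiv ℝ (fun q => ContinuousLinearMap.adjoint (β q)) k w ℓ) := by
  rw [hℓ.frTrace_eq (A := β k ∘L fderiv ℝ (fun q => ContinuousLinearMap.adjoint (β q)) k w)
    (fun x => h.left k _), ContinuousLinearMap.adjoint_inner_left]
  rfl

lemma imForm_apply (k w : Plane) : imForm β k w =
    ((frTrace (β k ∘L fderiv ℝ (fun q => ContinuousLinearMap.adjoint (β q)) k w)).im : ℂ) := by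
  obtain ⟨ℓ, hℓ⟩ := h.line₁ k
  simp only [imForm, h.trace_eq hℓ]
  rw [Fin.sum_univ_two]
  conv_rhs => rw [plane_eq_unitVec w]
  simp [inner_add_right, inner_smul_right_eq_smul]
  ring

lemma imForm_eq {k : Plane} {ℓ : E₁} (hℓ : IsLine (p₁ k) ℓ) (w : Plane) : imForm β k w =
    ((inner ℂ (ContinuousLinearMap.adjoint (β k) ℓ)
        (fderiv ℝ (fun q => ContinuousLinearMap.adjoint (β q)) k w ℓ) : ℂ).im : ℂ) := by
  rw [h.imForm_apply, h.trace_eq hℓ]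

lemma contDiff_imForm : ContDiff ℝ ∞ (imForm β) := by
  rw [contDiff_iff_contDiffAt]
  intro k
  obtain ⟨s, U, hk, hs⟩ := h.exists_section k
  have h0 : ContDiff ℝ ∞ (fderiv ℝ fun q => ContinuousLinearMap.adjoint (β q)) :=
    h.adj_smooth.fderiv_right (by simp)
  have h1 : ∀ i, ContDiffAt ℝ ∞ (fun q => (((inner ℂ (ContinuousLinearMap.adjoint (β q) (s q))
      (fderiv ℝ (fun q => ContinuousLinearMap.adjoint (β q)) q (unitVec i) (s q)) : ℂ).im : ℂ))) k :=
    fun i => Complex.ofRealCLM.contDiff.contDiffAt.comp k (Complex.imCLM.contDiff.contDiffAt.comp k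
      ((h.adj_smooth.contDiffAt.opApply (hs.contDiffAt hk)).inner ℂ
        ((h0.contDiffAt.clm_apply contDiffAt_const).opApply (hs.contDiffAt hk))))
  have h2 : ContDiffAt ℝ ∞ (fun q => ∑ i, (((inner ℂ (ContinuousLinearMap.adjoint (β q) (s q))
      (fderiv ℝ (fun q => ContinuousLinearMap.adjoint (β q)) q (unitVec i) (s q)) : ℂ).im : ℂ)) •
      Complex.ofRealCLM.comp (EuclideanSpace.proj (𝕜 := ℝ) i)) k :=
    ContDiffAt.sum fun i _ => (h1 i).smul contDiffAt_const
  refine h2.congr_of_eventuallyEq ?_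
  filter_upwards [hs.isOpen.mem_nhds hk] with q hq
  simp only [imForm, h.trace_eq (hs.line q hq)]

lemma imForm_periodic (k : Plane) (G : recip b) : imForm β (k + G) = imForm β k := by
  obtain ⟨ℓ, hℓ⟩ := h.line₁ k
  have hd : Differentiable ℝ fun q => ContinuousLinearMap.adjoint (β q) :=
    h.adj_smooth.differentiable (by simp)
  ext w
  rw [h.imForm_eq (h.bundle₁.isLine_apply hℓ G), h.imForm_eq hℓ, ← h.adj_equiv,
    ← fderiv_equivariant hd (T₁ G) (T₂ G) G (fun k x => h.adj_equiv k G x),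
    LinearIsometryEquiv.inner_map_map]

/-- The section of the second family of lines corresponding to a section of the first. -/
lemma dual_section {s : Plane → E₁} {U : Set Plane} (hs : IsUnitSection p₁ s U) :
    IsUnitSection p₂ (fun q => (Real.sqrt (n q))⁻¹ • ContinuousLinearMap.adjoint (β q) (s q))
      (U ∩ {q | n q ≠ 0}) where
  isOpen := hs.isOpen.inter (isOpen_ne_fun h.contDiff_n.continuous continuous_const)
  smooth q hq := by
    have h1 : ContDiffAt ℝ ∞ (fun q => (Real.sqrt (n q))⁻¹) q :=
      (h.contDiff_n.contDiffAt.sqrt hq.2).inv (Real.sqrt_ne_zero'.mpr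
        (lt_of_le_of_ne (h.nonneg q) (Ne.symm hq.2)))
    exact (h1.smul (h.adj_smooth.contDiffAt.opApply (hs.contDiffAt hq.1))).contDiffWithinAt
  line q hq := by
    obtain ⟨ℓ, hℓ⟩ := h.line₂ q
    have hpos : 0 < n q := lt_of_le_of_ne (h.nonneg q) (Ne.symm hq.2)
    refine hℓ.of_mem ?_ ?_
    · refine (((p₂ q).restrictScalars ℝ).map_smul _ _).trans ?_
      exact congrArg _ (h.proj_adj q _)
    · have h1 := h.n_eq hs hq.1
      have h2 : Real.sqrt (n q) = ‖ContinuousLinearMap.adjoint (β q) (s q)‖ := by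
        rw [h1, Real.sqrt_sq (norm_nonneg _)]
      rw [norm_smul, norm_inv, Real.norm_of_nonneg (Real.sqrt_nonneg _), ← h2]
      exact inv_mul_cancel₀ (Real.sqrt_ne_zero'.mpr hpos)

/-- Write `β† s = √n t`. In `⟨β† s, (dβ†) s⟩ = ⟨β† s, d(β† s) - β† ds⟩` the derivative of `√n`
contributes a real number, and the imaginary part of the rest is `n` times that of `⟨t, dt⟩ - ⟨s,
ds⟩`, both of which are imaginary. -/
lemma imForm_eq_sub {s : Plane → E₁} {U : Set Plane} (hs : IsUnitSection p₁ s U) {q : Plane}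
    (hq : q ∈ U ∩ {q | n q ≠ 0}) (w : Plane) : ((n q : ℂ))⁻¹ * imForm β q w =
      berryForm (fun q => (Real.sqrt (n q))⁻¹ • ContinuousLinearMap.adjoint (β q) (s q)) q w -
        berryForm s q w := by
  have ht := h.dual_section hs
  set t : Plane → E₂ := fun q => (Real.sqrt (n q))⁻¹ • ContinuousLinearMap.adjoint (β q) (s q) with ht'
  have hpos : 0 < n q := lt_of_le_of_ne (h.nonneg q) (Ne.symm hq.2)
  have hr : Real.sqrt (n q) ≠ 0 := Real.sqrt_ne_zero'.mpr hpos
  have hl := hs.line q hq.1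
  have hlt := ht.line q hq
  have hb : ContinuousLinearMap.adjoint (β q) (s q) = Real.sqrt (n q) • t q := by
    rw [ht', smul_smul, mul_inv_cancel₀ hr, one_smul]
  have hder : fderiv ℝ (fun q => ContinuousLinearMap.adjoint (β q)) q w (s q) +
      ContinuousLinearMap.adjoint (β q) (fderiv ℝ s q w) =
      Real.sqrt (n q) • fderiv ℝ t q w + (fderiv ℝ (fun q => Real.sqrt (n q)) q w) • t q := by
    have e1 : (fun q => ContinuousLinearMap.adjoint (β q) (s q)) =ᶠ[𝓝 q]
        fun q => Real.sqrt (n q) • t q := by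
      filter_upwards [ht.isOpen.mem_nhds hq] with q' hq'
      have hpos' : 0 < n q' := lt_of_le_of_ne (h.nonneg q') (Ne.symm hq'.2)
      rw [ht', smul_smul, mul_inv_cancel₀ (Real.sqrt_ne_zero'.mpr hpos'), one_smul]
    have e2 := fderiv_opApply ((h.adj_smooth.differentiable (by simp)) q)
      (hs.differentiableAt hq.1) w
    rw [e1.fderiv_eq] at e2
    have e3 : DifferentiableAt ℝ (fun q => Real.sqrt (n q)) q :=
      ((h.contDiff_n.differentiable (by simp)) q).sqrt hq.2
    rw [fderiv_fun_smul e3 (ht.differentiableAt hq)] at e2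
    simpa using e2.symm
  have hz : (inner ℂ (ContinuousLinearMap.adjoint (β q) (s q))
      (fderiv ℝ (fun q => ContinuousLinearMap.adjoint (β q)) q w (s q)) : ℂ) =
      n q * inner ℂ (t q) (fderiv ℝ t q w) + (Real.sqrt (n q) *
        fderiv ℝ (fun q => Real.sqrt (n q)) q w : ℝ) - n q * inner ℂ (s q) (fderiv ℝ s q w) := by
    have e0 : (inner ℂ (ContinuousLinearMap.adjoint (β q) (s q))
        (ContinuousLinearMap.adjoint (β q) (fderiv ℝ s q w)) : ℂ) =
        n q * inner ℂ (s q) (fderiv ℝ s q w) := by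
      rw [ContinuousLinearMap.adjoint_inner_left, h.mul_adj, inner_smul_right,
        ← proj_inner (h.bundle₁.proj q), hl.apply]
    rw [eq_sub_of_add_eq hder, inner_sub_right, e0, inner_add_right, hb]
    have hsq : (Real.sqrt (n q) : ℂ) * Real.sqrt (n q) = n q := by
      rw [← Complex.ofReal_mul, Real.mul_self_sqrt hpos.le]
    simp only [inner_smul_left_eq_smul, inner_smul_right_eq_smul, Complex.real_smul,
      hlt.inner_self]
    push_cast
    linear_combination (inner ℂ (t q) (fderiv ℝ t q w) : ℂ) * hsq
  have him : ∀ z : ℂ, z + conj z = 0 → (z.im : ℂ) = -Complex.I * z := by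
    intro z hz
    have : z.re = 0 := by
      have := congrArg Complex.re hz
      simp at this; linarith
    apply Complex.ext <;> simp [this]
  have i1 := him (inner ℂ (s q) (fderiv ℝ s q w))
    (by rw [inner_conj_symm]; exact hs.inner_fderiv_add hq.1 w)
  have i2 := him (inner ℂ (t q) (fderiv ℝ t q w))
    (by rw [inner_conj_symm]; exact ht.inner_fderiv_add hq w)
  rw [h.imForm_eq hl, hz, berryForm_apply, berryForm_apply, ← i1, ← i2]
  have hn0 : (n q : ℂ) ≠ 0 := by rw [Complex.ofReal_ne_zero]; exact hpos.ne'
  have : ((n q : ℂ) * inner ℂ (t q) (fderiv ℝ t q w) + (Real.sqrt (n q) *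
        fderiv ℝ (fun q => Real.sqrt (n q)) q w : ℝ) - n q * inner ℂ (s q) (fderiv ℝ s q w)).im =
        n q * (inner ℂ (t q) (fderiv ℝ t q w) : ℂ).im - n q * (inner ℂ (s q) (fderiv ℝ s q w) : ℂ).im := by
    simp only [Complex.sub_im, Complex.add_im, Complex.ofReal_im, Complex.im_ofReal_mul, add_zero]
  rw [this]
  push_cast
  field_simp

end IsLineMap

end LineMap

/-! ### The cut-off near the zeros, and lower bounds away from them. -/

section Cutoff

/-- A smooth function of `t` equal to `1 / t` for `t ≥ δ` and vanishing for `t ≤ δ / 2`. -/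
def cutInv (δ t : ℝ) : ℝ := Real.smoothTransition (2 * t / δ - 1) / t

lemma cutInv_of_ge {δ t : ℝ} (hδ : 0 < δ) (h : δ ≤ t) : cutInv δ t = t⁻¹ := by
  rw [cutInv, Real.smoothTransition.one_of_one_le, one_div]
  rw [le_sub_iff_add_le, le_div_iff₀ hδ]; linarith

lemma contDiff_cutInv {δ : ℝ} (hδ : 0 < δ) : ContDiff ℝ ∞ (cutInv δ) := by
  rw [contDiff_iff_contDiffAt]
  intro t
  rcases lt_or_ge t (δ / 2) with ht | ht
  · refine (contDiffAt_const (c := (0 : ℝ))).congr_of_eventuallyEq ?_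
    filter_upwards [Iio_mem_nhds ht] with t' ht'
    rw [cutInv, Real.smoothTransition.zero_of_nonpos, zero_div]
    rw [sub_nonpos, div_le_one hδ]
    have : t' < δ / 2 := ht'
    linarith
  · have h1 : ContDiffAt ℝ ∞ (fun t : ℝ => 2 * t / δ - 1) t := by fun_prop
    exact (Real.smoothTransition.contDiff.contDiffAt.comp t h1).div contDiffAt_id
      (by have : 0 < δ / 2 := by positivity
          exact (this.trans_le ht).ne')

variable {b : Module.Basis (Fin 2) ℝ Plane}

/-- Modulo the lattice `S` is compact, so `n` has a positive minimum on it; half of the minimum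
serves as `δ`. -/
lemma exists_pos_lt_of_periodic {n : Plane → ℝ} (hn : Continuous n)
    (hp : ∀ k (G : recip b), n (k + G) = n k) {S : Set Plane} (hS : IsClosed S)
    (hSp : ∀ k ∈ S, ∀ G : recip b, k + G ∈ S) (hpos : ∀ k ∈ S, 0 < n k) :
    ∃ δ > 0, ∀ k ∈ S, δ < n k := by
  have hc : IsCompact (S ∩ closure (unitCell b)) :=
    (ZSpan.fundamentalDomain_isBounded b).isCompact_closure.inter_left hS
  have hfr : ∀ k ∈ S, ZSpan.fract b k ∈ S ∩ closure (unitCell b) := fun k hk => by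
    refine ⟨?_, subset_closure (ZSpan.fract_mem_fundamentalDomain b k)⟩
    have := hSp k hk (-ZSpan.floor b k)
    rwa [Submodule.coe_neg, ← sub_eq_add_neg, ← ZSpan.fract_apply] at this
  have hnf : ∀ k, n (ZSpan.fract b k) = n k := fun k => by
    conv_rhs => rw [← fract_add_floor (b := b) k, hp]
  rcases (S ∩ closure (unitCell b)).eq_empty_or_nonempty with h0 | h0
  · refine ⟨1, one_pos, fun k hk => ?_⟩
    have := hfr k hk
    rw [h0] at this
    exact this.elim
  · obtain ⟨k₀, hk₀, hmin⟩ := hc.exists_isMinOn h0 hn.continuousOn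
    refine ⟨n k₀ / 2, half_pos (hpos k₀ hk₀.1), fun k hk => ?_⟩
    have h1 : n k₀ ≤ n (ZSpan.fract b k) := hmin (hfr k hk)
    rw [hnf] at h1
    linarith [hpos k₀ hk₀.1]

end Cutoff

/-! ### Topology of the carrier of a region. -/

namespace Region

variable {b : Module.Basis (Fin 2) ℝ Plane} (D : Region b)

lemma carrier_add {k : Plane} (hk : k ∈ D.carrier) (G : recip b) : k + G ∈ D.carrier := by
  obtain ⟨j, p, hp, G', hG', rfl⟩ := hk
  exact ⟨j, p, hp, G' + G, add_mem hG' G.2, by rw [add_assoc]⟩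

lemma interior_add {k : Plane} (hk : k ∈ interior D.carrier) (G : recip b) :
    k + G ∈ interior D.carrier := by
  rw [mem_interior_iff_mem_nhds] at hk ⊢
  have h1 : (fun q : Plane => q + -(G : Plane)) ⁻¹' D.carrier ∈ 𝓝 (k + G) := by
    refine (continuous_add_const (-(G : Plane))).continuousAt.preimage_mem_nhds ?_
    rwa [add_neg_cancel_right]
  filter_upwards [h1] with q hq
  have := D.carrier_add hq G
  rwa [neg_add_cancel_right] at this

open scoped Pointwise in
lemma isClosed_translates {K : Set Plane} (hK : IsCompact K) :
    IsClosed {k : Plane | ∃ x ∈ K, ∃ G ∈ recip b, k = x + G} := by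
  have h1 : IsClosed ((recip b : Submodule ℤ Plane) : Set Plane) := by
    have : DiscreteTopology (recip b).toAddSubgroup :=
      inferInstanceAs (DiscreteTopology (Submodule.span ℤ (Set.range b)))
    exact AddSubgroup.isClosed_of_discrete (H := (recip b).toAddSubgroup)
  have h2 : IsClosed (K + ((recip b : Submodule ℤ Plane) : Set Plane)) := h1.add_left_of_isCompact hK
  convert h2 using 1
  ext k
  rw [Set.mem_add]
  exact ⟨fun ⟨x, hx, G, hG, h⟩ => ⟨x, hx, G, hG, h.symm⟩,
    fun ⟨x, hx, G, hG, h⟩ => ⟨x, hx, G, hG, h.symm⟩⟩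

lemma isClosed_carrier : IsClosed D.carrier := by
  have h1 : IsCompact (⋃ j, D.cell j '' (Set.Icc (0 : ℝ) 1 ×ˢ Set.Icc (0 : ℝ) 1)) :=
    isCompact_iUnion fun j => (isCompact_Icc.prod isCompact_Icc).image (D.smooth j).continuous
  convert isClosed_translates (b := b) h1 using 1
  ext k
  constructor
  · rintro ⟨j, p, hp, G, hG, rfl⟩
    exact ⟨_, Set.mem_iUnion.mpr ⟨j, p, hp, rfl⟩, G, hG, rfl⟩
  · rintro ⟨x, hx, G, hG, rfl⟩
    obtain ⟨j, p, hp, rfl⟩ := Set.mem_iUnion.mp hx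
    exact ⟨j, p, hp, G, hG, rfl⟩

end Region

/-! ### Winding numbers of a map between line bundles. -/

namespace IsLineMap

variable {b : Module.Basis (Fin 2) ℝ Plane}
  {E₁ : Type*} [NormedAddCommGroup E₁] [InnerProductSpace ℂ E₁] [CompleteSpace E₁]
  {E₂ : Type*} [NormedAddCommGroup E₂] [InnerProductSpace ℂ E₂] [CompleteSpace E₂]
  {T₁ : recip b → E₁ ≃ₗᵢ[ℂ] E₁} {T₂ : recip b → E₂ ≃ₗᵢ[ℂ] E₂}
  {p₁ : Plane → E₁ →L[ℂ] E₁} {p₂ : Plane → E₂ →L[ℂ] E₂} {β : Plane → E₂ →L[ℂ] E₁} {n : Plane → ℝ}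

/-- The one-form `v`. -/
def normForm (β : Plane → E₂ →L[ℂ] E₁) (n : Plane → ℝ) (k : Plane) : Plane →L[ℝ] ℂ :=
  ((n k : ℂ))⁻¹ • imForm β k

/-- The one-form `v` cut off near its singularities. -/
def cutForm (β : Plane → E₂ →L[ℂ] E₁) (n : Plane → ℝ) (δ : ℝ) (k : Plane) : Plane →L[ℝ] ℂ :=
  ((cutInv δ (n k) : ℝ) : ℂ) • imForm β k

/-- The density whose integral over a region is the winding number along its boundary. -/
def windingDensity (p₁ : Plane → E₁ →L[ℂ] E₁) (p₂ : Plane → E₂ →L[ℂ] E₂) (β : Plane → E₂ →L[ℂ] E₁)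
    (n : Plane → ℝ) (δ : ℝ) (k : Plane) : ℂ :=
  curl (cutForm β n δ) k + (berry p₁ k - berry p₂ k)

/-- `2π` times the winding number. -/
def lineWinding (p₁ : Plane → E₁ →L[ℂ] E₁) (p₂ : Plane → E₂ →L[ℂ] E₂) (β : Plane → E₂ →L[ℂ] E₁)
    (n : Plane → ℝ) (D : Region b) : ℂ :=
  D.boundaryIntegral (fun k w => normForm β n k w) +
    ∫ k in D.carrier ∩ unitCell b, (berry p₁ k - berry p₂ k)

variable (h : IsLineMap T₁ T₂ p₁ p₂ β n) {δ : ℝ}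
include h

/-- By `imForm_eq_sub`, `v` is locally the difference of two connection forms, and the curl of each
is a Berry curvature. -/
lemma curl_normForm {k : Plane} (hk : n k ≠ 0) : curl (normForm β n) k = berry p₂ k - berry p₁ k := by
  obtain ⟨s, U, hkU, hs⟩ := h.exists_section k
  have ht := h.dual_section hs
  have hk' : k ∈ U ∩ {q | n q ≠ 0} := ⟨hkU, hk⟩
  have h1 : normForm β n =ᶠ[𝓝 k] fun q => berryForm (fun q => (Real.sqrt (n q))⁻¹ •
      ContinuousLinearMap.adjoint (β q) (s q)) q - berryForm s q := by
    filter_upwards [ht.isOpen.mem_nhds hk'] with q hq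
    ext w
    exact h.imForm_eq_sub hs hq w
  have d1 := (ht.contDiffAt_berryForm hk').differentiableAt (by simp)
  have d2 := (hs.contDiffAt_berryForm hkU).differentiableAt (by simp)
  rw [← ht.curl_berryForm h.bundle₂.smooth h.bundle₂.proj hk',
    ← hs.curl_berryForm h.bundle₁.smooth h.bundle₁.proj hkU, curl, h1.fderiv_eq,
    fderiv_fun_sub d1 d2, curl, curl]
  simp only [_root_.sub_apply]
  ring

lemma contDiff_cutForm (hδ : 0 < δ) : ContDiff ℝ ∞ (cutForm β n δ) :=
  (Complex.ofRealCLM.contDiff.comp ((contDiff_cutInv hδ).comp h.contDiff_n)).smul h.contDiff_imForm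

lemma cutForm_periodic (k : Plane) (G : recip b) : cutForm β n δ (k + G) = cutForm β n δ k := by
  rw [cutForm, cutForm, h.n_periodic, h.imForm_periodic]

lemma cutForm_of_ge (hδ : 0 < δ) {k : Plane} (hk : δ ≤ n k) :
    cutForm β n δ k = normForm β n k := by
  rw [cutForm, normForm, cutInv_of_ge hδ hk, Complex.ofReal_inv]

lemma continuous_berry₁ : Continuous (berry p₁) :=
  continuous_berry h.bundle₁.smooth h.bundle₁.proj h.line₁

lemma continuous_berry₂ : Continuous (berry p₂) :=
  continuous_berry h.bundle₂.smooth h.bundle₂.proj h.line₂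

lemma continuous_windingDensity (hδ : 0 < δ) : Continuous (windingDensity p₁ p₂ β n δ) :=
  (Region.continuous_curl ((h.contDiff_cutForm hδ).of_le (by simp))).add
    (h.continuous_berry₁.sub h.continuous_berry₂)

/-- Where `n > δ` the cut-off form is `v` itself, whose curl cancels the curvatures. The density
thus lives near the zeros. -/
lemma windingDensity_eq_zero (hδ : 0 < δ) {k : Plane} (hk : δ < n k) :
    windingDensity p₁ p₂ β n δ k = 0 := by
  have h1 : cutForm β n δ =ᶠ[𝓝 k] normForm β n := by
    filter_upwards [(isOpen_lt continuous_const h.contDiff_n.continuous).mem_nhds hk] with q hq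
    exact h.cutForm_of_ge hδ (le_of_lt hq)
  have h2 := h.curl_normForm (hδ.trans hk).ne'
  rw [windingDensity, curl, h1.fderiv_eq]
  rw [curl] at h2
  rw [h2]; ring

lemma integrableOn_of_continuous {g : Plane → ℂ} (hg : Continuous g) {s : Set Plane}
    (hs : s ⊆ unitCell b) : IntegrableOn g s :=
  (hg.continuousOn.integrableOn_compact
    (ZSpan.fundamentalDomain_isBounded b).isCompact_closure).mono_set (hs.trans subset_closure)

lemma integral_windingDensity (hδ : 0 < δ) (D : Region b) :
    ∫ k in D.carrier ∩ unitCell b, windingDensity p₁ p₂ β n δ k =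
      D.boundaryIntegral (fun k w => cutForm β n δ k w) +
        ∫ k in D.carrier ∩ unitCell b, (berry p₁ k - berry p₂ k) := by
  have hc := (h.contDiff_cutForm hδ).of_le (by simp : (1 : WithTop ℕ∞) ≤ ∞)
  rw [D.stokes hc h.cutForm_periodic, ← integral_add]
  · rfl
  · exact h.integrableOn_of_continuous (Region.continuous_curl hc) Set.inter_subset_right
  · exact h.integrableOn_of_continuous (h.continuous_berry₁.sub h.continuous_berry₂)
      Set.inter_subset_right

/-- For `δ` below the values of `n` on the boundary, the cut-off does not alter the boundary
integral, and the cut-off form is smooth across the zeros, so that Stokes' theorem applies. -/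
lemma lineWinding_eq (hδ : 0 < δ) (D : Region b)
    (hD : ∀ s ∈ D.bdry, ∀ t ∈ Set.Icc (0 : ℝ) 1, δ ≤ n (D.side s t)) :
    lineWinding p₁ p₂ β n D = ∫ k in D.carrier ∩ unitCell b, windingDensity p₁ p₂ β n δ k := by
  rw [h.integral_windingDensity hδ, lineWinding]
  congr 1
  refine Finset.sum_congr rfl fun s hs => ?_
  refine intervalIntegral.integral_congr fun t ht => ?_
  rw [Set.uIcc_of_le zero_le_one] at ht
  simp only
  rw [h.cutForm_of_ge hδ (hD s hs t ht)]

lemma exists_boundary_bound (D : Region b)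
    (hD : ∀ s ∈ D.bdry, ∀ t ∈ Set.Icc (0 : ℝ) 1, n (D.side s t) ≠ 0) :
    ∃ δ > 0, ∀ s ∈ D.bdry, ∀ t ∈ Set.Icc (0 : ℝ) 1, δ ≤ n (D.side s t) := by
  have hc : ∀ s, Continuous (D.side s) := fun s => by
    have : Continuous (squareSide s.2) := continuous_iff_continuousAt.mpr fun t =>
      (hasDerivAt_squareSide s.2 t).continuousAt
    exact (D.smooth s.1).continuous.comp this
  have h1 : ∀ s : D.bdry, ∃ δ > 0, ∀ t ∈ Set.Icc (0 : ℝ) 1, δ ≤ n (D.side s t) := by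
    intro s
    obtain ⟨t, ht, hmin⟩ := isCompact_Icc.exists_isMinOn (s := Set.Icc (0 : ℝ) 1)
      ⟨0, by simp⟩ (h.contDiff_n.continuous.comp (hc s)).continuousOn
    exact ⟨n (D.side s t), lt_of_le_of_ne (h.nonneg _) (Ne.symm (hD s s.2 t ht)),
      fun t' ht' => hmin ht'⟩
  choose δ hδ hb using h1
  obtain ⟨δ₀, h0, hle⟩ : ∃ δ₀ > 0, ∀ s, δ₀ ≤ δ s := by
    rcases isEmpty_or_nonempty D.bdry with he | he
    · exact ⟨1, one_pos, fun s => he.elim s⟩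
    · obtain ⟨s, hs⟩ := Finite.exists_min δ
      exact ⟨δ s, hδ s, hs⟩
  exact ⟨δ₀, h0, fun s hs t ht => (hle ⟨s, hs⟩).trans (hb ⟨s, hs⟩ t ht)⟩

/-- The winding number of a region depends only on the zeros inside. -/
theorem lineWinding_congr {D D' : Region b}
    (hD : ∀ s ∈ D.bdry, ∀ t ∈ Set.Icc (0 : ℝ) 1, n (D.side s t) ≠ 0)
    (hD' : ∀ s ∈ D'.bdry, ∀ t ∈ Set.Icc (0 : ℝ) 1, n (D'.side s t) ≠ 0)
    (h1 : ∀ k ∈ D.carrier, n k = 0 → k ∈ interior D'.carrier)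
    (h2 : ∀ k ∈ D'.carrier, n k = 0 → k ∈ interior D.carrier) :
    lineWinding p₁ p₂ β n D = lineWinding p₁ p₂ β n D' := by
  classical
  obtain ⟨δ₁, hδ₁, hb₁⟩ := h.exists_boundary_bound D hD
  obtain ⟨δ₂, hδ₂, hb₂⟩ := h.exists_boundary_bound D' hD'
  -- The points of one region outside the interior of the other contain no zeros, so `n` is bounded
  -- below there. Where `n ≤ δ` the two regions then have the same points.
  obtain ⟨δ₃, hδ₃, hb₃⟩ := exists_pos_lt_of_periodic (b := b) h.contDiff_n.continuous h.n_periodic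
    (S := D.carrier \ interior D'.carrier ∪ D'.carrier \ interior D.carrier)
    ((D.isClosed_carrier.sdiff isOpen_interior).union (D'.isClosed_carrier.sdiff isOpen_interior))
    (by
      have aux : ∀ D D' : Region b, ∀ k ∈ D.carrier \ interior D'.carrier, ∀ G : recip b,
          k + G ∈ D.carrier \ interior D'.carrier := fun D D' k hk G =>
        ⟨D.carrier_add hk.1 G, fun h' => hk.2 (by
          have := D'.interior_add h' (-G)
          rwa [Submodule.coe_neg, add_neg_cancel_right] at this)⟩
      exact fun k hk G => hk.imp (fun h' => aux D D' k h' G) (fun h' => aux D' D k h' G))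
    (fun k hk => lt_of_le_of_ne (h.nonneg k) fun h0 => hk.elim
      (fun h' => h'.2 (h1 k h'.1 h0.symm)) (fun h' => h'.2 (h2 k h'.1 h0.symm)))
  set δ := min δ₁ (min δ₂ δ₃)
  have hδ : 0 < δ := lt_min hδ₁ (lt_min hδ₂ hδ₃)
  have l1 : δ ≤ δ₁ := min_le_left _ _
  have l2 : δ ≤ δ₂ := (min_le_right _ _).trans (min_le_left _ _)
  have l3 : δ ≤ δ₃ := (min_le_right _ _).trans (min_le_right _ _)
  rw [h.lineWinding_eq hδ D fun s hs t ht => l1.trans (hb₁ s hs t ht),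
    h.lineWinding_eq hδ D' fun s hs t ht => l2.trans (hb₂ s hs t ht)]
  have hmD := fun D : Region b =>
    D.isClosed_carrier.measurableSet.inter (ZSpan.fundamentalDomain_measurableSet b)
  rw [← integral_indicator (hmD D), ← integral_indicator (hmD D')]
  congr 1
  funext k
  by_cases hk : δ < n k
  · rw [Set.indicator_apply, Set.indicator_apply, h.windingDensity_eq_zero hδ hk]; simp
  · have hk3 : ¬δ₃ < n k := fun h' => hk (l3.trans_lt h')
    have : k ∈ D.carrier ↔ k ∈ D'.carrier := by
      constructor
      · intro h'
        by_contra hc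
        exact hk3 (hb₃ k (Or.inl ⟨h', fun hi => hc (interior_subset hi)⟩))
      · intro h'
        by_contra hc
        exact hk3 (hb₃ k (Or.inr ⟨h', fun hi => hc (interior_subset hi)⟩))
    rw [Set.indicator_apply, Set.indicator_apply]
    simp only [Set.mem_inter_iff, this]

/-- The sum of the winding numbers of regions enclosing all zeros. -/
theorem sum_lineWinding {ι : Type*} [Fintype ι] (D : ι → Region b) (D₀ : Region b)
    (hD₀ : D₀.bdry = ∅) (hc₀ : D₀.carrier = Set.univ)
    (hD : ∀ i, ∀ s ∈ (D i).bdry, ∀ t ∈ Set.Icc (0 : ℝ) 1, n ((D i).side s t) ≠ 0)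
    (h1 : ∀ k, n k = 0 → ∃ i, k ∈ interior (D i).carrier)
    (h2 : ∀ k, n k = 0 → ∀ i j, k ∈ (D i).carrier → k ∈ (D j).carrier → i = j) :
    ∑ i, lineWinding p₁ p₂ β n (D i) = ∫ k in unitCell b, (berry p₁ k - berry p₂ k) := by
  classical
  have hbd := fun i => h.exists_boundary_bound (D i) (hD i)
  choose δ₁ hδ₁ hb₁ using hbd
  -- The set consists of the points interior to no region and of those common to two regions. It
  -- contains no zeros, so `n` is bounded below on it.
  obtain ⟨δ₂, hδ₂, hb₂⟩ := exists_pos_lt_of_periodic (b := b) h.contDiff_n.continuous h.n_periodic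
    (S := (⋂ i, (interior (D i).carrier)ᶜ) ∪
      ⋃ i, ⋃ j, if i = j then ∅ else (D i).carrier ∩ (D j).carrier)
    (by
      refine (isClosed_iInter fun i => isOpen_interior.isClosed_compl).union
        (isClosed_iUnion_of_finite fun i => isClosed_iUnion_of_finite fun j => ?_)
      split_ifs
      · exact isClosed_empty
      · exact (D i).isClosed_carrier.inter (D j).isClosed_carrier)
    (by
      rintro k (hk | hk) G
      · left
        rw [Set.mem_iInter] at hk ⊢
        intro i h'
        refine hk i ?_
        have := (D i).interior_add h' (-G)
        rwa [Submodule.coe_neg, add_neg_cancel_right] at this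
      · right
        simp only [Set.mem_iUnion] at hk ⊢
        obtain ⟨i, j, hk⟩ := hk
        refine ⟨i, j, ?_⟩
        split_ifs at hk ⊢ with hij
        · exact hk
        · exact ⟨(D i).carrier_add hk.1 G, (D j).carrier_add hk.2 G⟩)
    (by
      intro k hk
      refine lt_of_le_of_ne (h.nonneg k) fun h0 => ?_
      rcases hk with hk | hk
      · obtain ⟨i, hi⟩ := h1 k h0.symm
        exact (Set.mem_iInter.mp hk i) hi
      · simp only [Set.mem_iUnion] at hk
        obtain ⟨i, j, hk⟩ := hk
        split_ifs at hk with hij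
        · exact hk
        · exact hij (h2 k h0.symm i j hk.1 hk.2))
  obtain ⟨δ₀, hδ₀, hle⟩ : ∃ δ₀ > 0, ∀ i, δ₀ ≤ δ₁ i := by
    rcases isEmpty_or_nonempty ι with he | he
    · exact ⟨1, one_pos, fun s => he.elim s⟩
    · obtain ⟨s, hs⟩ := Finite.exists_min δ₁
      exact ⟨δ₁ s, hδ₁ s, hs⟩
  set δ := min δ₀ δ₂
  have hδ : 0 < δ := lt_min hδ₀ hδ₂
  have l2 : δ ≤ δ₂ := min_le_right _ _
  have hmD := fun D : Region b =>
    D.isClosed_carrier.measurableSet.inter (ZSpan.fundamentalDomain_measurableSet b)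
  -- The torus has no boundary, so the integral of the density over the whole cell is that of the
  -- curvature difference alone.
  have e0 := h.integral_windingDensity hδ D₀
  rw [Region.boundaryIntegral, hD₀, Finset.sum_empty, zero_add, hc₀, Set.univ_inter] at e0
  rw [← e0, ← integral_indicator (ZSpan.fundamentalDomain_measurableSet b)]
  have e1 : ∀ i, lineWinding p₁ p₂ β n (D i) =
      ∫ k, ((D i).carrier ∩ unitCell b).indicator (windingDensity p₁ p₂ β n δ) k := fun i => by
    rw [h.lineWinding_eq hδ (D i) fun s hs t ht =>
      ((min_le_left _ _).trans (hle i)).trans (hb₁ i s hs t ht), integral_indicator (hmD (D i))]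
  simp only [e1]
  rw [← integral_finsetSum]
  · congr 1
    funext k
    by_cases hk : δ < n k
    · simp only [Set.indicator_apply, h.windingDensity_eq_zero hδ hk]; simp
    -- A point with `n ≤ δ` lies in exactly one of the regions, so the indicator functions add up to
    -- one there.
    · have hk2 : ¬δ₂ < n k := fun h' => hk (l2.trans_lt h')
      have hS : k ∉ (⋂ i, (interior (D i).carrier)ᶜ) ∪
        ⋃ i, ⋃ j, if i = j then ∅ else (D i).carrier ∩ (D j).carrier := fun h' => hk2 (hb₂ k h')
      rw [Set.mem_union, not_or] at hS
      obtain ⟨hS1, hS2⟩ := hS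
      simp only [Set.mem_iInter, Set.mem_compl_iff, not_forall, not_not] at hS1
      obtain ⟨i, hi⟩ := hS1
      rw [Finset.sum_eq_single i]
      · simp only [Set.indicator_apply, Set.mem_inter_iff, interior_subset hi, true_and]
      · intro j _ hj
        rw [Set.indicator_of_notMem]
        rintro ⟨hkj, -⟩
        refine hS2 ?_
        simp only [Set.mem_iUnion]
        refine ⟨j, i, ?_⟩
        rw [if_neg hj]
        exact ⟨hkj, interior_subset hi⟩
      · exact fun h' => (h' (Finset.mem_univ _)).elim
  · intro i _
    rw [integrable_indicator_iff (hmD (D i))]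
    exact h.integrableOn_of_continuous (h.continuous_windingDensity hδ) Set.inter_subset_right

end IsLineMap

/-! ### Discrete Stokes formula, and regions made of parallelograms. -/

namespace Region

variable {b : Module.Basis (Fin 2) ℝ Plane} (D : Region b)

/-- The multiplicative analogue of `boundaryIntegral_eq`: glued sides are run in opposite directions
and contribute inverse factors. -/
lemma prod_bdry {f : Plane → Plane → ℂ} (hper : ∀ k k' (G : recip b), f (k + G) (k' + G) = f k k')
    (hinv : ∀ k k', f k k' * f k' k = 1) (hself : ∀ k, f k k = 1) :
    ∏ s ∈ D.bdry, f (D.side s 0) (D.side s 1) = ∏ j, ∏ i, f (D.side (j, i) 0) (D.side (j, i) 1) := by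
  have hends : ∀ s ∉ D.bdry, ∃ G : recip b, D.side (D.partner s) 0 = D.side s 1 + G ∧
      D.side (D.partner s) 1 = D.side s 0 + G := by
    intro s hs
    obtain ⟨G, hG, h⟩ := D.glued s hs
    refine ⟨⟨G, hG⟩, ?_, ?_⟩
    · have := h 0 (by simp)
      rwa [sub_zero] at this
    · have := h 1 (by simp)
      rwa [sub_self] at this
  have h1 : ∏ s ∈ D.bdryᶜ, f (D.side s 0) (D.side s 1) = 1 := by
    refine Finset.prod_involution (fun s _ => D.partner s) ?_ ?_ ?_ ?_
    · intro s hs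
      obtain ⟨G, e0, e1⟩ := hends s (Finset.mem_compl.mp hs)
      rw [e0, e1, hper, hinv]
    · intro s hs hne hps
      obtain ⟨G, e0, e1⟩ := hends s (Finset.mem_compl.mp hs)
      rw [hps] at e0 e1
      apply hne
      -- A side glued to itself is reversed up to the translation `G`; this forces `2 G = 0`, so its
      -- endpoints coincide and its factor is already one.
      have hG : (2 : ℝ) • (G : Plane) = 0 := by
        have : D.side s 0 = D.side s 0 + G + G := by
          nth_rw 1 [e0]; rw [e1]
        rw [two_smul]
        rw [add_assoc] at this
        exact left_eq_add.mp this
      have hG' : (G : Plane) = 0 := by simpa using hG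
      rw [hG', add_zero] at e0
      rw [e0, hself]
    · exact fun s hs => Finset.mem_compl.mpr (D.partner_not_mem s (Finset.mem_compl.mp hs))
    · exact fun s hs => D.partner_partner s (Finset.mem_compl.mp hs)
  rw [← Fintype.prod_prod_type', ← Finset.prod_mul_prod_compl D.bdry, h1, mul_one]

/-- All cells are parallelograms. -/
def IsAffine : Prop := ∀ j, ∃ a c₁ c₂, D.cell j = affineCell a c₁ c₂

lemma IsAffine.side_eq {D : Region b} (hD : D.IsAffine) (s : Fin D.n × Fin 4) (t : ℝ) :
    D.side s t = D.side s 0 + t • (D.side s 1 - D.side s 0) := by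
  obtain ⟨a, c₁, c₂, h⟩ := hD s.1
  obtain ⟨j, i⟩ := s
  simp only at h
  simp only [Region.side, h, affineCell, squareSide]
  fin_cases i <;> simp <;> module

end Region

/-! ### Integrality of winding numbers. -/

namespace IsLineMap

variable {b : Module.Basis (Fin 2) ℝ Plane}
  {E₁ : Type*} [NormedAddCommGroup E₁] [InnerProductSpace ℂ E₁] [CompleteSpace E₁]
  {E₂ : Type*} [NormedAddCommGroup E₂] [InnerProductSpace ℂ E₂] [CompleteSpace E₂]
  {T₁ : recip b → E₁ ≃ₗᵢ[ℂ] E₁} {T₂ : recip b → E₂ ≃ₗᵢ[ℂ] E₂}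
  {p₁ : Plane → E₁ →L[ℂ] E₁} {p₂ : Plane → E₂ →L[ℂ] E₂} {β : Plane → E₂ →L[ℂ] E₁} {n : Plane → ℝ}
  {ℓ₁ : Plane → E₁} {ℓ₂ : Plane → E₂} {K₁ K₂ : ℝ}

/-- The phase of a map between lines, in given gauges. -/
def phase (β : Plane → E₂ →L[ℂ] E₁) (n : Plane → ℝ) (ℓ₁ : Plane → E₁) (ℓ₂ : Plane → E₂)
    (k : Plane) : ℂ := inner ℂ (ℓ₁ k) (β k (ℓ₂ k)) / (Real.sqrt (n k) : ℂ)

lemma _root_.EulerPairing.IsLine.inner_mul_inner {E : Type*} [NormedAddCommGroup E]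
    [InnerProductSpace ℂ E] [CompleteSpace E] {p : E →L[ℂ] E} {x y : E} (hx : IsLine p x)
    (hy : IsLine p y) : (inner ℂ x y : ℂ) * inner ℂ y x = 1 := by
  have h1 := hx.eq_smul hy.apply
  have h2 := hy.inner_self
  nth_rw 2 [h1] at h2
  rwa [inner_smul_right] at h2

lemma _root_.EulerPairing.IsBundle.berry_periodic {E : Type*} [NormedAddCommGroup E]
    [InnerProductSpace ℂ E] [CompleteSpace E] {T : recip b → E ≃ₗᵢ[ℂ] E} {p : Plane → E →L[ℂ] E}
    (hB : IsBundle b T p) (hl : ∀ k, ∃ ℓ, IsLine (p k) ℓ) (k : Plane) (G : recip b) :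
    berry p (k + G) = berry p k := by
  obtain ⟨ℓ, hℓ⟩ := hl k
  have hG : IsLine (p (k + G)) (T G ℓ) := hB.isLine_apply hℓ G
  have hd := hB.smooth.differentiable (by simp)
  have key : ∀ w x, fderiv ℝ p (k + G) w (T G x) = T G (fderiv ℝ p k w x) :=
    fun w x => (fderiv_equivariant hd (T G) (T G) G (fun q y => hB.equiv q G y) k w x).symm
  have h1 : ∀ i j, frTrace (p (k + G) ∘L pderiv p i (k + G) ∘L pderiv p j (k + G)) =
      frTrace (p k ∘L pderiv p i k ∘L pderiv p j k) := by
    intro i j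
    rw [hG.frTrace_eq, hℓ.frTrace_eq]
    · simp only [ContinuousLinearMap.comp_apply, pderiv, key, ← hB.equiv,
        LinearIsometryEquiv.inner_map_map]
    · intro x; simp only [ContinuousLinearMap.comp_apply]; exact proj_apply_apply (hB.proj _) _
    · intro x; simp only [ContinuousLinearMap.comp_apply]; exact proj_apply_apply (hB.proj _) _
  rw [berry, berry, curvatureTrace, curvatureTrace, h1, h1]

/-- The holonomy around the cells of a region is given by the Berry flux. -/
lemma _root_.EulerPairing.IsBundle.prod_hol {E : Type*} [NormedAddCommGroup E]
    [InnerProductSpace ℂ E] [CompleteSpace E] {T : recip b → E ≃ₗᵢ[ℂ] E} {p : Plane → E →L[ℂ] E}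
    {ℓ : Plane → E} {K : ℝ} (hB : IsBundle b T p) (hK : IsProjFamily p K)
    (hℓ : ∀ k, IsLine (p k) (ℓ k)) {D : Region b} (hD : D.IsAffine) :
    ∏ j, ∏ i, hol p ℓ (D.side (j, i) 0) (D.side (j, i) 1) =
      Complex.exp (Complex.I * ∫ k in D.carrier ∩ unitCell b, berry p k) := by
  have hl : ∀ k, ∃ ℓ, IsLine (p k) ℓ := fun k => ⟨ℓ k, hℓ k⟩
  have hc : Continuous (berry p) := continuous_berry hB.smooth hB.proj hl
  rw [D.integral_carrier hc (hB.berry_periodic hl), Finset.mul_sum, Complex.exp_sum]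
  refine Finset.prod_congr rfl fun j _ => ?_
  obtain ⟨a, c₁, c₂, hj⟩ := hD j
  have h1 := hol_parallelogram hK hℓ hB.smooth a c₁ c₂
  rw [flux_eq hc, ← hj] at h1
  rw [← h1, Fin.prod_univ_four]
  simp only [Region.side, hj, squareSide, affineCell]
  simp [mul_assoc]

variable (h : IsLineMap T₁ T₂ p₁ p₂ β n)
include h

/-- Parallel transport along a segment without zeros. -/
lemma hol_segment (hK₁ : IsProjFamily p₁ K₁) (hK₂ : IsProjFamily p₂ K₂)
    (hℓ₁ : ∀ k, IsLine (p₁ k) (ℓ₁ k)) (hℓ₂ : ∀ k, IsLine (p₂ k) (ℓ₂ k)) {k d : Plane}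
    (hd : |K₁| * ‖d‖ < 1) (hn : ∀ t ∈ Set.Icc (0 : ℝ) 1, n (k + t • d) ≠ 0) :
    hol p₁ ℓ₁ k (k + d) * phase β n ℓ₁ ℓ₂ (k + d) = phase β n ℓ₁ ℓ₂ k *
      Complex.exp (-(Complex.I * ∫ t in (0 : ℝ)..1, normForm β n (k + t • d) d)) *
        hol p₂ ℓ₂ k (k + d) := by
  -- In a section `s` near the segment and in its dual `t`, the two transports are exponentials of
  -- the integrals of the connection forms, whose difference is `v`. The phases at the ends convert
  -- from `s` and `t` to the given gauges.
  obtain ⟨s, hs⟩ := exists_isUnitSection h.bundle₁.smooth h.bundle₁.proj h.line₁ (ℓ₁ k)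
  have hU : ∀ t ∈ Set.Icc (0 : ℝ) 1, k + t • d ∈ {q | p₁ q (ℓ₁ k) ≠ 0} := by
    intro t ht h0
    have h1 : ‖p₁ k (ℓ₁ k) - p₁ (k + t • d) (ℓ₁ k)‖ ≤ |K₁| * ‖d‖ := by
      rw [← _root_.sub_apply]
      refine (ContinuousLinearMap.le_opNorm _ _).trans ?_
      rw [(hℓ₁ k).1, mul_one]
      refine (hK₁.lip _ _).trans (mul_le_mul (le_abs_self K₁) ?_ (norm_nonneg _) (abs_nonneg _))
      rw [show k - (k + t • d) = -(t • d) by module, norm_neg, norm_smul, Real.norm_of_nonneg ht.1]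
      exact mul_le_of_le_one_left (norm_nonneg _) ht.2
    rw [h0, sub_zero, (hℓ₁ k).apply, (hℓ₁ k).1] at h1
    linarith
  have ht := h.dual_section hs
  set t : Plane → E₂ := fun q => (Real.sqrt (n q))⁻¹ • ContinuousLinearMap.adjoint (β q) (s q) with htd
  have hU' : ∀ x ∈ Set.Icc (0 : ℝ) 1, k + x • d ∈ {q | p₁ q (ℓ₁ k) ≠ 0} ∩ {q | n q ≠ 0} :=
    fun x hx => ⟨hU x hx, hn x hx⟩
  have t1 := hs.transport_apply hK₁ h.bundle₁.smooth k d hU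
  have t2 := ht.transport_apply hK₂ h.bundle₂.smooth k d hU'
  have hline : Continuous fun t : ℝ => k + t • d := by fun_prop
  have c1 : IntervalIntegrable (fun x : ℝ => berryForm s (k + x • d) d) volume 0 1 :=
    ContinuousOn.intervalIntegrable fun x hx => by
      rw [Set.uIcc_of_le zero_le_one] at hx
      exact (((hs.contDiffAt_berryForm (hU x hx)).continuousAt.comp (f := fun t : ℝ => k + t • d)
        hline.continuousAt).clm_apply continuousAt_const).continuousWithinAt
  have c2 : IntervalIntegrable (fun x : ℝ => berryForm t (k + x • d) d) volume 0 1 :=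
    ContinuousOn.intervalIntegrable fun x hx => by
      rw [Set.uIcc_of_le zero_le_one] at hx
      exact (((ht.contDiffAt_berryForm (hU' x hx)).continuousAt.comp (f := fun t : ℝ => k + t • d)
        hline.continuousAt).clm_apply continuousAt_const).continuousWithinAt
  have hint : ∫ x in (0 : ℝ)..1, normForm β n (k + x • d) d =
      (∫ x in (0 : ℝ)..1, berryForm t (k + x • d) d) -
        ∫ x in (0 : ℝ)..1, berryForm s (k + x • d) d := by
    rw [← intervalIntegral.integral_sub c2 c1]
    refine intervalIntegral.integral_congr fun x hx => ?_
    rw [Set.uIcc_of_le zero_le_one] at hx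
    exact h.imForm_eq_sub hs (hU' x hx) d
  set A := ∫ x in (0 : ℝ)..1, berryForm s (k + x • d) d
  set B := ∫ x in (0 : ℝ)..1, berryForm t (k + x • d) d
  have hk0 : k ∈ {q | p₁ q (ℓ₁ k) ≠ 0} ∩ {q | n q ≠ 0} := by simpa using hU' 0 (by simp)
  have hk1 : k + d ∈ {q | p₁ q (ℓ₁ k) ≠ 0} ∩ {q | n q ≠ 0} := by simpa using hU' 1 (by simp)
  have hphase : ∀ q ∈ {q | p₁ q (ℓ₁ k) ≠ 0} ∩ {q | n q ≠ 0},
      phase β n ℓ₁ ℓ₂ q = inner ℂ (ℓ₁ q) (s q) * inner ℂ (t q) (ℓ₂ q) := by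
    intro q hq
    have hr : Real.sqrt (n q) ≠ 0 :=
      Real.sqrt_ne_zero'.mpr (lt_of_le_of_ne (h.nonneg q) (Ne.symm hq.2))
    have hr' : (Real.sqrt (n q) : ℂ) ≠ 0 := by rwa [Complex.ofReal_ne_zero]
    have hb : ContinuousLinearMap.adjoint (β q) (s q) = Real.sqrt (n q) • t q := by
      rw [htd, smul_smul, mul_inv_cancel₀ hr, one_smul]
    rw [phase, ← ContinuousLinearMap.adjoint_inner_left, (hs.line q hq.1).eq_smul (hℓ₁ q).apply,
      map_smul, hb, inner_smul_left, inner_smul_left_eq_smul, inner_conj_symm, Complex.real_smul,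
      inner_smul_left, inner_conj_symm, (hs.line q hq.1).inner_self]
    field_simp
  have hs1 : hol p₁ ℓ₁ k (k + d) = inner ℂ (s (k + d)) (ℓ₁ (k + d)) * Complex.exp (Complex.I * A) *
      inner ℂ (ℓ₁ k) (s k) := by
    rw [hol, (hs.line _ hk1.1).eq_smul (hℓ₁ (k + d)).apply, map_smul, t1, inner_smul_right,
      inner_smul_right, inner_smul_right, (hs.line _ hk1.1).inner_self, mul_one, mul_assoc]
  have hs2 : hol p₂ ℓ₂ k (k + d) = inner ℂ (t (k + d)) (ℓ₂ (k + d)) * Complex.exp (Complex.I * B) *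
      inner ℂ (ℓ₂ k) (t k) := by
    rw [hol, (ht.line _ hk1).eq_smul (hℓ₂ (k + d)).apply, map_smul, t2, inner_smul_right,
      inner_smul_right, inner_smul_right, (ht.line _ hk1).inner_self, mul_one, mul_assoc]
  rw [hint, hphase _ hk0, hphase _ hk1, hs1, hs2]
  have m1 := (hs.line _ hk1.1).inner_mul_inner (hℓ₁ (k + d))
  have m2 := (ht.line _ hk0).inner_mul_inner (hℓ₂ k)
  have e : Complex.exp (-(Complex.I * (B - A))) * Complex.exp (Complex.I * B) =
      Complex.exp (Complex.I * A) := by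
    rw [← Complex.exp_add]; congr 1; ring
  linear_combination (Complex.exp (Complex.I * A) * inner ℂ (ℓ₁ k) (s k) *
    inner ℂ (t (k + d)) (ℓ₂ (k + d))) * m1 - (inner ℂ (ℓ₁ k) (s k) *
      inner ℂ (t (k + d)) (ℓ₂ (k + d))) * Complex.exp (Complex.I * A) * m2 -
      (inner ℂ (ℓ₁ k) (s k) * inner ℂ (t (k + d)) (ℓ₂ (k + d)) * (inner ℂ (t k) (ℓ₂ k) *
        inner ℂ (ℓ₂ k) (t k))) * e

/-- The winding number of a region composed of parallelograms is an integer. -/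
theorem lineWinding_integer (hT₁ : ∀ G G' x, T₁ (G + G') x = T₁ G (T₁ G' x))
    (hT₂ : ∀ G G' x, T₂ (G + G') x = T₂ G (T₂ G' x)) (hK₁ : IsProjFamily p₁ K₁)
    {D : Region b} (hD : D.IsAffine)
    (hn : ∀ s ∈ D.bdry, ∀ t ∈ Set.Icc (0 : ℝ) 1, n (D.side s t) ≠ 0)
    (hshort : ∀ s ∈ D.bdry, |K₁| * ‖D.side s 1 - D.side s 0‖ < 1) :
    ∃ m : ℤ, lineWinding p₁ p₂ β n D = 2 * Real.pi * m := by
  classical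
  obtain ⟨K₂, hK₂⟩ := h.bundle₂.exists_isProjFamily
  obtain ⟨ℓ₁, g₁⟩ := h.bundle₁.exists_isLineGauge hT₁ h.line₁
  obtain ⟨ℓ₂, g₂⟩ := h.bundle₂.exists_isLineGauge hT₂ h.line₂
  -- The transport in the bundle of homomorphisms from the second line to the first.
  set r : Plane → Plane → ℂ := fun k k' => hol p₁ ℓ₁ k k' * hol p₂ ℓ₂ k' k with hr
  -- The corners of inner cells may be zeros of the map. There the value `1` serves, since `c` only
  -- has to be periodic and nonzero for the quotients to telescope.
  set c : Plane → ℂ := fun k => if n k = 0 then 1 else phase β n ℓ₁ ℓ₂ k with hc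
  have hc0 : ∀ k, c k ≠ 0 := by
    intro k
    by_cases h0 : n k = 0
    · simp only [hc, if_pos h0]; exact one_ne_zero
    · simp only [hc, if_neg h0]
      have hpos : 0 < n k := lt_of_le_of_ne (h.nonneg k) (Ne.symm h0)
      have hr' : (Real.sqrt (n k) : ℂ) ≠ 0 := by
        rw [Complex.ofReal_ne_zero]; exact Real.sqrt_ne_zero'.mpr hpos
      refine div_ne_zero (fun h1 => h0 ?_) hr'
      have h2 : ContinuousLinearMap.adjoint (β k) (ℓ₁ k) = 0 := by
        rw [← h.proj_adj, (g₂.line k).2, ← inner_conj_symm,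
          ContinuousLinearMap.adjoint_inner_left, h1, map_zero, zero_smul]
      rw [← h.norm_adj_sq (g₁.line k), h2]; simp
  have hcp : ∀ k (G : recip b), c (k + G) = c k := by
    intro k G
    simp only [hc, h.n_periodic, phase, g₁.periodic, g₂.periodic, ← h.equiv,
      LinearIsometryEquiv.inner_map_map]
  have e1 := D.prod_bdry (f := r)
    (fun k k' G => by
      simp only [hr, h.bundle₁.hol_periodic g₁, h.bundle₂.hol_periodic g₂])
    (fun k k' => by
      have a1 := hol_mul_hol hK₁ g₁.line k k'
      have a2 := hol_mul_hol hK₂ g₂.line k' k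
      simp only [hr]
      linear_combination (hol p₂ ℓ₂ k' k * hol p₂ ℓ₂ k k') * a1 + a2)
    (fun k => by simp only [hr, hol_self hK₁ g₁.line, hol_self hK₂ g₂.line, mul_one])
  have e2 := D.prod_bdry (f := fun k k' => c k / c k')
    (fun k k' G => by rw [hcp, hcp])
    (fun k k' => by
      have := hc0 k; have := hc0 k'
      field_simp)
    (fun k => div_self (hc0 k))
  have e3 : ∏ j, ∏ i, c (D.side (j, i) 0) / c (D.side (j, i) 1) = 1 := by
    refine Finset.prod_eq_one fun j _ => ?_
    rw [Fin.prod_univ_four]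
    simp only [Region.side, squareSide]
    simp
    have i0 := hc0 (D.cell j (0, 0))
    have i1 := hc0 (D.cell j (1, 0))
    have i2 := hc0 (D.cell j (1, 1))
    have i3 := hc0 (D.cell j (0, 1))
    field_simp
  have e4 : ∏ j, ∏ i, r (D.side (j, i) 0) (D.side (j, i) 1) =
      Complex.exp (Complex.I * ∫ k in D.carrier ∩ unitCell b, (berry p₁ k - berry p₂ k)) := by
    have hi : ∀ k k', r k k' = hol p₁ ℓ₁ k k' * (hol p₂ ℓ₂ k k')⁻¹ := fun k k' => by
      rw [hr]
      simp only
      rw [eq_inv_of_mul_eq_one_right (hol_mul_hol hK₂ g₂.line k k')]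
    simp only [hi, Finset.prod_mul_distrib, Finset.prod_inv_distrib]
    rw [h.bundle₁.prod_hol hK₁ g₁.line hD, h.bundle₂.prod_hol hK₂ g₂.line hD, integral_sub
      (h.integrableOn_of_continuous h.continuous_berry₁ Set.inter_subset_right)
      (h.integrableOn_of_continuous h.continuous_berry₂ Set.inter_subset_right), mul_sub,
      Complex.exp_sub, div_eq_mul_inv]
  -- On a boundary side `hol_segment` expresses the transport through `exp(-i ∫ v)` and the phases
  -- at the endpoints. With `e2` and `e3` the quotients of phases multiply to one.
  have e5 : ∏ s ∈ D.bdry, (r (D.side s 0) (D.side s 1) * Complex.exp (Complex.I *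
      ∫ t in (0 : ℝ)..1, normForm β n (D.side s t) (deriv (D.side s) t))) =
      ∏ s ∈ D.bdry, c (D.side s 0) / c (D.side s 1) := by
    refine Finset.prod_congr rfl fun s hs => ?_
    set k := D.side s 0 with hk
    set d := D.side s 1 - D.side s 0 with hd
    have hside : D.side s = fun t => k + t • d := funext fun t => hD.side_eq s t
    have hder : ∀ t, deriv (D.side s) t = d := fun t => by
      rw [hside]
      have : HasDerivAt (fun t : ℝ => k + t • d) d t := by
        simpa using ((hasDerivAt_id t).smul_const d).const_add k
      exact this.deriv
    have hkd : D.side s 1 = k + d := by rw [hd]; abel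
    have hseg := h.hol_segment hK₁ hK₂ g₁.line g₂.line (k := k) (d := d) (hshort s hs)
      (fun t ht => by have := hn s hs t ht; rwa [hside] at this)
    have hn0 : n k ≠ 0 := hn s hs 0 (by simp)
    have hn1 : n (k + d) ≠ 0 := by rw [← hkd]; exact hn s hs 1 (by simp)
    have hc1 : c (k + d) = phase β n ℓ₁ ℓ₂ (k + d) := if_neg hn1
    have hck : c k = phase β n ℓ₁ ℓ₂ k := if_neg hn0
    have hint : ∫ t in (0 : ℝ)..1, normForm β n (D.side s t) (deriv (D.side s) t) =
        ∫ t in (0 : ℝ)..1, normForm β n (k + t • d) d := by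
      simp only [hder]; rw [hside]
    rw [hint, hkd, eq_div_iff (hc0 _)]
    rw [← hc1, ← hck] at hseg
    have a2 := hol_mul_hol hK₂ g₂.line k (k + d)
    set X := ∫ t in (0 : ℝ)..1, normForm β n (k + t • d) d
    have ex : Complex.exp (-(Complex.I * X)) * Complex.exp (Complex.I * X) = 1 := by
      rw [← Complex.exp_add, neg_add_cancel, Complex.exp_zero]
    simp only [hr]
    linear_combination (hol p₂ ℓ₂ (k + d) k * Complex.exp (Complex.I * X)) * hseg +
      (c k * hol p₂ ℓ₂ k (k + d) * hol p₂ ℓ₂ (k + d) k) * ex + c k * a2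
  have e6 : Complex.exp (Complex.I * lineWinding p₁ p₂ β n D) = 1 := by
    rw [lineWinding, mul_add, Complex.exp_add, ← e4, ← e1, Region.boundaryIntegral, Finset.mul_sum,
      Complex.exp_sum, mul_comm, ← Finset.prod_mul_distrib, e5, e2, e3]
  obtain ⟨m, hm⟩ := Complex.exp_eq_one_iff.mp e6
  refine ⟨m, ?_⟩
  have hI : Complex.I ≠ 0 := Complex.I_ne_zero
  apply mul_left_cancel₀ hI
  rw [hm]; ring

end IsLineMap

/-- The Chern number of a line bundle on the torus is an integer. -/
theorem IsBundle.chern_integer {b : Module.Basis (Fin 2) ℝ Plane} {E : Type*}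
    [NormedAddCommGroup E] [InnerProductSpace ℂ E] [CompleteSpace E]
    {T : recip b → E ≃ₗᵢ[ℂ] E} {p : Plane → E →L[ℂ] E} (hB : IsBundle b T p)
    (hT : ∀ G G' x, T (G + G') x = T G (T G' x)) (hl : ∀ k, ∃ ℓ, IsLine (p k) ℓ)
    {D : Region b} (hD : D.IsAffine) (hb : D.bdry = ∅) (hc : D.carrier = Set.univ) :
    ∃ m : ℤ, ∫ k in unitCell b, berry p k = 2 * Real.pi * m := by
  obtain ⟨K, hK⟩ := hB.exists_isProjFamily
  obtain ⟨ℓ, g⟩ := hB.exists_isLineGauge hT hl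
  -- With an empty boundary the product of the holonomies over all sides equals one, so `exp(i ∫
  -- berry) = 1`.
  have h1 := hB.prod_hol hK g.line hD
  rw [← D.prod_bdry (fun k k' G => hB.hol_periodic g k k' G) (hol_mul_hol hK g.line)
    (hol_self hK g.line), hb, Finset.prod_empty, hc, Set.univ_inter] at h1
  obtain ⟨m, hm⟩ := Complex.exp_eq_one_iff.mp h1.symm
  refine ⟨m, mul_left_cancel₀ Complex.I_ne_zero ?_⟩
  rw [hm]; ring

/-! ### Grids on the torus and regions enclosing closed sets. -/

section Grid

variable {b : Module.Basis (Fin 2) ℝ Plane}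

lemma area_ne_zero (e : Module.Basis (Fin 2) ℝ Plane) : area (e 0) (e 1) ≠ 0 := by
  intro h
  have key : ∀ s t : ℝ, s • e 0 + t • e 1 = 0 → s = 0 ∧ t = 0 := fun s t hst =>
    ⟨by simpa using congrArg (fun x => e.repr x 0) hst,
      by simpa using congrArg (fun x => e.repr x 1) hst⟩
  have h1 := key (e 1 1) (-(e 0 1)) (by
    ext i; fin_cases i
    · simp only [area] at h; simp; linarith
    · simp; ring)
  have h0 := key (e 1 0) (-(e 0 0)) (by
    ext i; fin_cases i
    · simp; ring
    · simp only [area] at h; simp; linarith)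
  refine e.ne_zero 0 ?_
  ext i; fin_cases i
  · simpa using h0.2
  · simpa using h1.2

/-- A positively oriented basis of the lattice. -/
lemma exists_oriented_basis (b : Module.Basis (Fin 2) ℝ Plane) :
    ∃ e : Module.Basis (Fin 2) ℝ Plane, recip e = recip b ∧ 0 < area (e 0) (e 1) := by
  rcases lt_or_gt_of_ne (area_ne_zero b) with h | h
  · refine ⟨b.reindex (Equiv.swap 0 1), ?_, ?_⟩
    · rw [recip, Module.Basis.range_reindex]
    · simp only [Module.Basis.reindex_apply, Equiv.symm_swap, Equiv.swap_apply_left,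
        Equiv.swap_apply_right]
      have : area (b 1) (b 0) = -area (b 0) (b 1) := by unfold area; ring
      linarith
  · exact ⟨b, rfl, h⟩

lemma mem_recip_iff (e : Module.Basis (Fin 2) ℝ Plane) (s t : ℝ) :
    s • e 0 + t • e 1 ∈ recip e ↔ (∃ m : ℤ, s = m) ∧ ∃ m : ℤ, t = m := by
  have h0 : e.repr (s • e 0 + t • e 1) 0 = s := by simp
  have h1 : e.repr (s • e 0 + t • e 1) 1 = t := by simp
  rw [Module.Basis.mem_span_iff_repr_mem, Fin.forall_fin_two, h0, h1]
  simp [eq_comm]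

/-- A cell of the grid with `N` subdivisions in each direction. -/
def gridCell (e : Module.Basis (Fin 2) ℝ Plane) (N : ℕ) (i j : ℤ) : ℝ × ℝ → Plane :=
  affineCell (((i : ℝ) / N) • e 0 + ((j : ℝ) / N) • e 1) ((N : ℝ)⁻¹ • e 0) ((N : ℝ)⁻¹ • e 1)

lemma gridCell_apply (e : Module.Basis (Fin 2) ℝ Plane) (N : ℕ) (i j : ℤ) (p : ℝ × ℝ) :
    gridCell e N i j p = ((i + p.1) / N) • e 0 + ((j + p.2) / N) • e 1 := by
  simp only [gridCell, affineCell, div_eq_mul_inv]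
  module

variable (e : Module.Basis (Fin 2) ℝ Plane) (N : ℕ) [NeZero N]

/-- Up to lattice translations a cell depends only on the residues of its indices; neighbours of the
outermost cells wrap around. -/
lemma gridCell_congr {i j i' j' : ℤ} (hi : (i : ZMod N) = i') (hj : (j : ZMod N) = j') :
    ∃ G ∈ recip e, ∀ p, gridCell e N i' j' p = gridCell e N i j p + G := by
  rw [ZMod.intCast_eq_intCast_iff_dvd_sub] at hi hj
  obtain ⟨m, hm⟩ := hi
  obtain ⟨n, hn⟩ := hj
  refine ⟨(m : ℝ) • e 0 + (n : ℝ) • e 1, (mem_recip_iff e _ _).mpr ⟨⟨m, rfl⟩, n, rfl⟩, fun p => ?_⟩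
  have hN : (N : ℝ) ≠ 0 := Nat.cast_ne_zero.mpr (NeZero.ne N)
  have h1 : (i' : ℝ) = i + N * m := by
    have : i' = i + N * m := by linarith
    rw [this]; push_cast; ring
  have h2 : (j' : ℝ) = j + N * n := by
    have : j' = j + N * n := by linarith
    rw [this]; push_cast; ring
  rw [gridCell_apply, gridCell_apply, h1, h2]
  have e1 : ((i : ℝ) + N * m + p.1) / N = (i + p.1) / N + m := by field_simp; ring
  have e2 : ((j : ℝ) + N * n + p.2) / N = (j + p.2) / N + n := by field_simp; ring
  rw [e1, e2]
  module

/-- The cell labelled by residues. -/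
def gridSquare (q : ZMod N × ZMod N) : ℝ × ℝ → Plane := gridCell e N q.1.val q.2.val

/-- The square on the other side of an edge, and its matching edge. -/
def gridNeighbor (s : (ZMod N × ZMod N) × Fin 4) : (ZMod N × ZMod N) × Fin 4 :=
  (![((s.1.1, s.1.2 - 1), 2), ((s.1.1 + 1, s.1.2), 3), ((s.1.1, s.1.2 + 1), 0),
    ((s.1.1 - 1, s.1.2), 1)] : Fin 4 → (ZMod N × ZMod N) × Fin 4) s.2

lemma gridNeighbor_gridNeighbor (s : (ZMod N × ZMod N) × Fin 4) :
    gridNeighbor N (gridNeighbor N s) = s := by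
  obtain ⟨⟨x, y⟩, i⟩ := s
  fin_cases i <;> simp [gridNeighbor]

lemma gridNeighbor_glued (s : (ZMod N × ZMod N) × Fin 4) : ∃ G ∈ recip e, ∀ t : ℝ,
    gridSquare e N (gridNeighbor N s).1 (squareSide (gridNeighbor N s).2 t) =
      gridSquare e N s.1 (squareSide s.2 (1 - t)) + G := by
  obtain ⟨⟨x, y⟩, i⟩ := s
  have aux : ∀ (di dj : ℤ), ∃ G ∈ recip e, ∀ p : ℝ × ℝ,
      gridSquare e N (x + di, y + dj) p = gridSquare e N (x, y) (p.1 + di, p.2 + dj) + G := by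
    intro di dj
    obtain ⟨G, hG, h⟩ := gridCell_congr e N (i := x.val + di) (j := y.val + dj)
      (i' := (x + di : ZMod N).val) (j' := (y + dj : ZMod N).val) (by simp) (by simp)
    refine ⟨G, hG, fun p => ?_⟩
    rw [gridSquare, gridSquare, h, gridCell_apply, gridCell_apply]
    push_cast
    congr 4 <;> ring
  fin_cases i
  · obtain ⟨G, hG, h⟩ := aux 0 (-1)
    refine ⟨G, hG, fun t => ?_⟩
    have := h (1 - t, 1)
    simpa [gridNeighbor, squareSide, sub_eq_add_neg] using this
  · obtain ⟨G, hG, h⟩ := aux 1 0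
    refine ⟨G, hG, fun t => ?_⟩
    have := h (0, 1 - t)
    simpa [gridNeighbor, squareSide, sub_eq_add_neg] using this
  · obtain ⟨G, hG, h⟩ := aux 0 1
    refine ⟨G, hG, fun t => ?_⟩
    have := h (t, 0)
    simpa [gridNeighbor, squareSide, sub_eq_add_neg] using this
  · obtain ⟨G, hG, h⟩ := aux (-1) 0
    refine ⟨G, hG, fun t => ?_⟩
    have := h (1, t)
    simpa [gridNeighbor, squareSide, sub_eq_add_neg] using this

/-- In each direction, the parameters of two interior points differ by a number strictly between
`-1` and `1`; equivalence modulo the lattice makes it an integer, hence zero. -/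
lemma gridSquare_injective {q q' : ZMod N × ZMod N} {p p' : ℝ × ℝ}
    (hp : p ∈ Set.Ioo (0 : ℝ) 1 ×ˢ Set.Ioo (0 : ℝ) 1)
    (hp' : p' ∈ Set.Ioo (0 : ℝ) 1 ×ˢ Set.Ioo (0 : ℝ) 1)
    (h : gridSquare e N q p - gridSquare e N q' p' ∈ recip e) : q = q' ∧ p = p' := by
  have hN : (N : ℝ) ≠ 0 := Nat.cast_ne_zero.mpr (NeZero.ne N)
  rw [gridSquare, gridSquare, gridCell_apply, gridCell_apply, add_sub_add_comm, ← sub_smul,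
    ← sub_smul, mem_recip_iff] at h
  have aux : ∀ {x x' : ZMod N} {a a' : ℝ}, a ∈ Set.Ioo (0 : ℝ) 1 → a' ∈ Set.Ioo (0 : ℝ) 1 →
      (∃ m : ℤ, ((x.val : ℤ) + a) / N - ((x'.val : ℤ) + a') / N = (m : ℝ)) → x = x' ∧ a = a' := by
    rintro x x' a a' ⟨ha0, ha1⟩ ⟨hb0, hb1⟩ ⟨m, hm⟩
    field_simp at hm
    have h1 : a - a' = ((N * m - x.val + x'.val : ℤ) : ℝ) := by
      push_cast at hm ⊢; linarith
    have h2 : (N * m - x.val + x'.val : ℤ) = 0 := by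
      have l1 : ((-1 : ℤ) : ℝ) < ((N * m - x.val + x'.val : ℤ) : ℝ) := by
        rw [← h1]; push_cast; linarith
      have l2 : ((N * m - x.val + x'.val : ℤ) : ℝ) < ((1 : ℤ) : ℝ) := by
        rw [← h1]; push_cast; linarith
      have := Int.cast_lt.mp l1
      have := Int.cast_lt.mp l2
      omega
    rw [h2] at h1
    refine ⟨?_, by simpa [sub_eq_zero] using h1⟩
    have h3 : ((N * m - x.val + x'.val : ℤ) : ZMod N) = 0 := by rw [h2]; simp
    push_cast at h3
    simp only [ZMod.natCast_self, zero_mul, zero_sub, ZMod.natCast_val, ZMod.cast_id', id] at h3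
    exact (neg_add_eq_zero.mp h3)
  obtain ⟨a1, a2⟩ := aux hp.1 hp'.1 h.1
  obtain ⟨a3, a4⟩ := aux hp.2 hp'.2 h.2
  exact ⟨Prod.ext a1 a3, Prod.ext a2 a4⟩

/-- The region composed of a set of squares of the grid. -/
def gridRegion {e : Module.Basis (Fin 2) ℝ Plane} (he : recip e = recip b)
    (ha : 0 < area (e 0) (e 1)) (A : Finset (ZMod N × ZMod N)) : Region b where
  n := A.card
  cell j := gridSquare e N (A.equivFin.symm j)
  smooth j := contDiff_affineCell _ _ _
  jac_pos j p _ := by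
    have h1 := jac_affineCell ((((A.equivFin.symm j : ZMod N × ZMod N).1.val : ℤ) / (N : ℝ)) • e 0 +
      (((A.equivFin.symm j : ZMod N × ZMod N).2.val : ℤ) / (N : ℝ)) • e 1) ((N : ℝ)⁻¹ • e 0)
      ((N : ℝ)⁻¹ • e 1) p
    have h2 : area ((N : ℝ)⁻¹ • e 0) ((N : ℝ)⁻¹ • e 1) = ((N : ℝ)⁻¹) ^ 2 * area (e 0) (e 1) := by
      simp only [area, PiLp.smul_apply, smul_eq_mul]; ring
    have hN : (0 : ℝ) < N := Nat.cast_pos.mpr (NeZero.pos N)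
    have h3 : 0 < ((N : ℝ)⁻¹) ^ 2 * area (e 0) (e 1) := by positivity
    rw [← h2, ← h1] at h3
    exact h3
  nonoverlap j j' p hp p' hp' h := by
    rw [← he] at h
    obtain ⟨h1, h2⟩ := gridSquare_injective e N hp hp' h
    exact ⟨A.equivFin.symm.injective (Subtype.ext h1), h2⟩
  bdry := Finset.univ.filter fun s => (gridNeighbor N (A.equivFin.symm s.1, s.2)).1 ∉ A
  partner s := if h : (gridNeighbor N (A.equivFin.symm s.1, s.2)).1 ∈ A then
    (A.equivFin ⟨_, h⟩, (gridNeighbor N (A.equivFin.symm s.1, s.2)).2) else s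
  partner_not_mem s hs := by
    simp only [Finset.mem_filter, Finset.mem_univ, true_and, not_not] at hs ⊢
    simp only [dif_pos hs, Equiv.symm_apply_apply, Prod.mk.eta, gridNeighbor_gridNeighbor]
    exact (A.equivFin.symm s.1).2
  partner_partner s hs := by
    simp only [Finset.mem_filter, Finset.mem_univ, true_and, not_not] at hs
    have h1 : (gridNeighbor N (gridNeighbor N (A.equivFin.symm s.1, s.2))).1 ∈ A := by
      rw [gridNeighbor_gridNeighbor]; exact (A.equivFin.symm s.1).2
    simp only [dif_pos hs, Equiv.symm_apply_apply, Prod.mk.eta, gridNeighbor_gridNeighbor,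
      Subtype.coe_eta, Equiv.apply_symm_apply, Finset.coe_mem, dite_true]
  glued s hs := by
    simp only [Finset.mem_filter, Finset.mem_univ, true_and, not_not] at hs
    obtain ⟨G, hG, h⟩ := gridNeighbor_glued e N (A.equivFin.symm s.1, s.2)
    refine ⟨G, he ▸ hG, fun t _ => ?_⟩
    simp only [dif_pos hs, Equiv.symm_apply_apply]
    exact h t

variable {e : Module.Basis (Fin 2) ℝ Plane} (he : recip e = recip b) (ha : 0 < area (e 0) (e 1))
  (A : Finset (ZMod N × ZMod N))

/-- The lattice translates of a square of the grid. -/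
def gridBlock (b e : Module.Basis (Fin 2) ℝ Plane) (N : ℕ) (q : ZMod N × ZMod N) : Set Plane :=
  {k | ∃ x ∈ gridSquare e N q '' (Set.Icc (0 : ℝ) 1 ×ˢ Set.Icc (0 : ℝ) 1), ∃ G ∈ recip b, k = x + G}

lemma continuous_gridSquare (q : ZMod N × ZMod N) : Continuous (gridSquare e N q) :=
  (contDiff_affineCell (n := 0) _ _ _).continuous

lemma isClosed_gridBlock (q : ZMod N × ZMod N) : IsClosed (gridBlock b e N q) :=
  Region.isClosed_translates
    ((isCompact_Icc.prod isCompact_Icc).image (continuous_gridSquare N q))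

lemma gridRegion_carrier : (gridRegion N he ha A).carrier = ⋃ q ∈ A, gridBlock b e N q := by
  ext k
  simp only [Set.mem_iUnion]
  constructor
  · rintro ⟨j, p, hp, G, hG, rfl⟩
    exact ⟨A.equivFin.symm j, (A.equivFin.symm j).2, _, ⟨p, hp, rfl⟩, G, hG, rfl⟩
  · rintro ⟨q, hq, _, ⟨p, hp, rfl⟩, G, hG, rfl⟩
    refine ⟨A.equivFin ⟨q, hq⟩, p, hp, G, hG, ?_⟩
    simp [gridRegion]

lemma gridRegion_isAffine : (gridRegion N he ha A).IsAffine := fun _ => ⟨_, _, _, rfl⟩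

include he in
lemma exists_mem_gridBlock (k : Plane) : ∃ q, k ∈ gridBlock b e N q := by
  have hN : (0 : ℝ) < N := Nat.cast_pos.mpr (NeZero.pos N)
  set s := e.repr k 0
  set t := e.repr k 1
  have hk : k = s • e 0 + t • e 1 := by
    conv_lhs => rw [← e.sum_repr k, Fin.sum_univ_two]
  have hq : k = gridCell e N ⌊N * s⌋ ⌊N * t⌋ (Int.fract (N * s), Int.fract (N * t)) := by
    rw [gridCell_apply, Int.floor_add_fract, Int.floor_add_fract, mul_div_cancel_left₀ _ hN.ne',
      mul_div_cancel_left₀ _ hN.ne', hk]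
  obtain ⟨G, hG, h⟩ := gridCell_congr e N (i := ((⌊N * s⌋ : ZMod N)).val)
    (j := ((⌊N * t⌋ : ZMod N)).val) (i' := ⌊N * s⌋) (j' := ⌊N * t⌋) (by simp) (by simp)
  refine ⟨(⌊N * s⌋, ⌊N * t⌋), _, ⟨(Int.fract (N * s), Int.fract (N * t)), ⟨⟨Int.fract_nonneg _,
    (Int.fract_lt_one _).le⟩, Int.fract_nonneg _, (Int.fract_lt_one _).le⟩, rfl⟩, G, he ▸ hG, ?_⟩
  rw [hq, h]
  rfl

lemma gridRegion_univ : (gridRegion N he ha Finset.univ).bdry = ∅ ∧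
    (gridRegion N he ha Finset.univ).carrier = Set.univ := by
  constructor
  · exact Finset.filter_eq_empty_iff.mpr fun s _ h => h (Finset.mem_univ _)
  · rw [gridRegion_carrier]
    refine Set.eq_univ_of_forall fun k => ?_
    obtain ⟨q, hq⟩ := exists_mem_gridBlock N he k
    exact Set.mem_biUnion (Finset.mem_univ q) hq

/-- A boundary side borders a square outside `A`, so it misses every set that meets only squares of
`A`. -/
lemma gridRegion_side_mem {s : Fin (gridRegion N he ha A).n × Fin 4}
    (hs : s ∈ (gridRegion N he ha A).bdry) : ∃ q ∈ A, ∃ q' ∉ A, ∀ t ∈ Set.Icc (0 : ℝ) 1,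
      (gridRegion N he ha A).side s t ∈ gridBlock b e N q ∩ gridBlock b e N q' := by
  have hsq : ∀ (i : Fin 4), ∀ t ∈ Set.Icc (0 : ℝ) 1,
      squareSide i t ∈ Set.Icc (0 : ℝ) 1 ×ˢ Set.Icc (0 : ℝ) 1 := by
    rintro i t ⟨h0, h1⟩
    fin_cases i <;> simp [squareSide, h0, h1]
  refine ⟨_, (A.equivFin.symm s.1).2, _, (Finset.mem_filter.mp hs).2, fun t ht => ⟨?_, ?_⟩⟩
  · exact ⟨_, ⟨_, hsq s.2 t ht, rfl⟩, 0, zero_mem _, by rw [add_zero]; rfl⟩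
  · obtain ⟨G, hG, h⟩ := gridNeighbor_glued e N (A.equivFin.symm s.1, s.2)
    have h1 := h (1 - t)
    rw [sub_sub_cancel] at h1
    refine ⟨_, ⟨_, hsq (gridNeighbor N (A.equivFin.symm s.1, s.2)).2 (1 - t) ⟨by linarith [ht.2], by linarith [ht.1]⟩, rfl⟩, -G,
      neg_mem (he ▸ hG), ?_⟩
    rw [h1, add_neg_cancel_right]
    rfl

lemma norm_gridSquare_sub_le (q : ZMod N × ZMod N) {p p' : ℝ × ℝ}
    (hp : p ∈ Set.Icc (0 : ℝ) 1 ×ˢ Set.Icc (0 : ℝ) 1)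
    (hp' : p' ∈ Set.Icc (0 : ℝ) 1 ×ˢ Set.Icc (0 : ℝ) 1) :
    ‖gridSquare e N q p - gridSquare e N q p'‖ ≤ (‖e 0‖ + ‖e 1‖) / N := by
  have hN : (0 : ℝ) < N := Nat.cast_pos.mpr (NeZero.pos N)
  have h : gridSquare e N q p - gridSquare e N q p' =
      (N : ℝ)⁻¹ • ((p.1 - p'.1) • e 0 + (p.2 - p'.2) • e 1) := by
    simp only [gridSquare, gridCell, affineCell]; module
  have aux : ∀ {x y : ℝ}, x ∈ Set.Icc (0 : ℝ) 1 → y ∈ Set.Icc (0 : ℝ) 1 → ‖x - y‖ ≤ 1 := by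
    rintro x y ⟨h0, h1⟩ ⟨h2, h3⟩
    rw [Real.norm_eq_abs, abs_le]; constructor <;> linarith
  rw [h, norm_smul, norm_inv, Real.norm_of_nonneg hN.le, div_eq_inv_mul]
  gcongr
  refine (norm_add_le _ _).trans (add_le_add ?_ ?_)
  · rw [norm_smul]; exact mul_le_of_le_one_left (norm_nonneg _) (aux hp.1 hp'.1)
  · rw [norm_smul]; exact mul_le_of_le_one_left (norm_nonneg _) (aux hp.2 hp'.2)

lemma gridBlock_dist {q : ZMod N × ZMod N} {k k' : Plane} (hk : k ∈ gridBlock b e N q)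
    (hk' : k' ∈ gridBlock b e N q) :
    ∃ G : recip b, ‖k - (k' + G)‖ ≤ (‖e 0‖ + ‖e 1‖) / N := by
  obtain ⟨_, ⟨p, hp, rfl⟩, G, hG, rfl⟩ := hk
  obtain ⟨_, ⟨p', hp', rfl⟩, G', hG', rfl⟩ := hk'
  refine ⟨⟨G - G', sub_mem hG hG'⟩, ?_⟩
  have : gridSquare e N q p + G - (gridSquare e N q p' + G' + (G - G')) =
    gridSquare e N q p - gridSquare e N q p' := by abel
  rw [this]
  exact norm_gridSquare_sub_le N q hp hp'

lemma continuous_toTorus : Continuous (toTorus b) := continuous_quotient_mk'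

lemma toTorus_add (k : Plane) {G : Plane} (hG : G ∈ recip b) : toTorus b (k + G) = toTorus b k :=
  QuotientAddGroup.mk_add_of_mem k hG

lemma isPreconnected_gridBlock (q : ZMod N × ZMod N) :
    IsPreconnected (toTorus b '' gridBlock b e N q) := by
  have h1 : toTorus b '' gridBlock b e N q =
      toTorus b '' (gridSquare e N q '' (Set.Icc (0 : ℝ) 1 ×ˢ Set.Icc (0 : ℝ) 1)) := by
    ext x
    constructor
    · rintro ⟨_, ⟨y, hy, G, hG, rfl⟩, rfl⟩
      exact ⟨y, hy, (toTorus_add y hG).symm⟩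
    · rintro ⟨y, hy, rfl⟩
      exact ⟨y, ⟨y, hy, 0, zero_mem _, (add_zero y).symm⟩, rfl⟩
  rw [h1]
  exact ((isPreconnected_Icc.prod isPreconnected_Icc).image _
    (continuous_gridSquare N q).continuousOn).image _ continuous_toTorus.continuousOn

/-- A connected closed set of the torus is enclosed by an arbitrarily close region composed of
short-sided parallelograms. -/
theorem exists_region {Z Z' : Set Plane} (hZ : IsClosed Z) (hZ' : IsClosed Z')
    (hZp : ∀ k ∈ Z, ∀ G : recip b, k + G ∈ Z) (hZp' : ∀ k ∈ Z', ∀ G : recip b, k + G ∈ Z')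
    (hdisj : Disjoint Z Z') (hconn : IsConnected (toTorus b '' Z)) {ρ : ℝ} (hρ : 0 < ρ) :
    ∃ D : Region b, D.IsAffine ∧ IsConnected (toTorus b '' D.carrier) ∧ Z ⊆ interior D.carrier ∧
      Disjoint D.carrier Z' ∧ (∀ s ∈ D.bdry, ∀ t ∈ Set.Icc (0 : ℝ) 1, D.side s t ∉ Z) ∧
      ∀ s ∈ D.bdry, ‖D.side s 1 - D.side s 0‖ < ρ := by
  classical
  obtain ⟨e, he, ha⟩ := exists_oriented_basis b
  -- Disjoint closed periodic sets have positive distance, because the distance function to `Z'` is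
  -- periodic and continuous.
  obtain ⟨δ, hδ, hsep⟩ : ∃ δ > 0, ∀ k ∈ Z, ∀ k' ∈ Z', δ ≤ ‖k - k'‖ := by
    rcases Z'.eq_empty_or_nonempty with h0 | h0
    · exact ⟨1, one_pos, fun k _ k' hk' => by rw [h0] at hk'; exact hk'.elim⟩
    · have aux : ∀ (k : Plane) (G : recip b), Metric.infDist (k + G) Z' ≤ Metric.infDist k Z' := by
        intro k G
        refine (Metric.le_infDist h0).mpr fun y hy => ?_
        refine (Metric.infDist_le_dist_of_mem (hZp' y hy G)).trans ?_
        rw [dist_add_right]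
      have hper : ∀ (k : Plane) (G : recip b), Metric.infDist (k + G) Z' = Metric.infDist k Z' := by
        intro k G
        refine le_antisymm (aux k G) ?_
        have := aux (k + G) (-G)
        rwa [Submodule.coe_neg, add_neg_cancel_right] at this
      obtain ⟨δ, hδ, h⟩ := exists_pos_lt_of_periodic (b := b)
        (Metric.continuous_infDist_pt Z') hper hZ hZp fun k hk =>
          (hZ'.notMem_iff_infDist_pos h0).mp fun hk' => Set.disjoint_left.mp hdisj hk hk'
      refine ⟨δ, hδ, fun k hk k' hk' => ?_⟩
      rw [← dist_eq_norm]
      exact (h k hk).le.trans (Metric.infDist_le_dist_of_mem hk')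
  -- The grid is so fine that a square meeting `Z` cannot reach `Z'` and has sides shorter than `ρ`.
  obtain ⟨N₀, hN₀⟩ := exists_nat_gt ((‖e 0‖ + ‖e 1‖) / min δ ρ)
  have hN1 : (‖e 0‖ + ‖e 1‖) / ((N₀ + 1 : ℕ) : ℝ) < min δ ρ := by
    have hm : 0 < min δ ρ := lt_min hδ hρ
    rw [div_lt_comm₀ (by positivity) hm]
    push_cast; linarith
  set N := N₀ + 1 with hN
  set A : Finset (ZMod N × ZMod N) :=
    Finset.univ.filter fun q => (gridBlock b e N q ∩ Z).Nonempty with hA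
  have hmA : ∀ q, q ∈ A ↔ (gridBlock b e N q ∩ Z).Nonempty := fun q => by simp [hA]
  have hcar := gridRegion_carrier N he ha A
  have hZc : Z ⊆ (gridRegion N he ha A).carrier := by
    intro k hk
    obtain ⟨q, hq⟩ := exists_mem_gridBlock N he k
    rw [hcar]
    exact Set.mem_biUnion ((hmA q).mpr ⟨k, hq, hk⟩) hq
  refine ⟨gridRegion N he ha A, gridRegion_isAffine N he ha A, ?_, ?_, ?_, ?_, ?_⟩
  · obtain ⟨x₀, hx₀⟩ := hconn.1
    refine ⟨⟨x₀, Set.image_mono hZc hx₀⟩, isPreconnected_of_forall x₀ ?_⟩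
    rintro _ ⟨k, hk, rfl⟩
    rw [hcar] at hk
    obtain ⟨q, hq, hkq⟩ := Set.mem_iUnion₂.mp hk
    obtain ⟨z, hzq, hz⟩ := (hmA q).mp hq
    refine ⟨toTorus b '' Z ∪ toTorus b '' gridBlock b e N q, ?_, Or.inl hx₀,
      Or.inr ⟨k, hkq, rfl⟩, ?_⟩
    · rw [← Set.image_union]
      refine Set.image_mono (Set.union_subset hZc ?_)
      rw [hcar]
      exact Set.subset_biUnion_of_mem (u := fun q => gridBlock b e N q) hq
    · exact IsPreconnected.union (toTorus b z) ⟨z, hz, rfl⟩ ⟨z, hzq, rfl⟩ hconn.2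
        (isPreconnected_gridBlock N q)
  -- The squares outside `A` form a closed set disjoint from `Z`, and its open complement is
  -- contained in the carrier.
  · have hcl : IsClosed (⋃ q ∈ Aᶜ, gridBlock b e N q) :=
      isClosed_biUnion_finset fun q _ => isClosed_gridBlock N q
    have hsub : (⋃ q ∈ Aᶜ, gridBlock b e N q)ᶜ ⊆ (gridRegion N he ha A).carrier := by
      intro k hk
      obtain ⟨q, hq⟩ := exists_mem_gridBlock N he k
      rw [hcar]
      refine Set.mem_biUnion (by_contra fun hqA => hk ?_) hq
      exact Set.mem_biUnion (Finset.mem_compl.mpr hqA) hq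
    refine Set.Subset.trans (fun k hk => ?_) (interior_maximal hsub hcl.isOpen_compl)
    intro hk'
    obtain ⟨q, hq, hkq⟩ := Set.mem_iUnion₂.mp hk'
    exact Finset.mem_compl.mp hq ((hmA q).mpr ⟨k, hkq, hk⟩)
  · rw [Set.disjoint_left]
    intro k hk hk'
    rw [hcar] at hk
    obtain ⟨q, hq, hkq⟩ := Set.mem_iUnion₂.mp hk
    obtain ⟨z, hzq, hz⟩ := (hmA q).mp hq
    obtain ⟨G, hG⟩ := gridBlock_dist N hzq hkq
    have h1 := hsep z hz _ (hZp' k hk' G)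
    exact absurd (h1.trans hG) (not_le.mpr (hN1.trans_le (min_le_left _ _)))
  · intro s hs t ht hz
    obtain ⟨q, hq, q', hq', h⟩ := gridRegion_side_mem N he ha A hs
    exact hq' ((hmA q').mpr ⟨_, (h t ht).2, hz⟩)
  · intro s hs
    refine lt_of_le_of_lt ?_ (hN1.trans_le (min_le_right _ _))
    refine norm_gridSquare_sub_le N _ ?_ ?_ <;>
    · generalize s.2 = i
      fin_cases i <;> simp [squareSide]

/-- The torus as a region. -/
lemma exists_torus_region (b : Module.Basis (Fin 2) ℝ Plane) :
    ∃ D : Region b, D.IsAffine ∧ D.bdry = ∅ ∧ D.carrier = Set.univ := by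
  obtain ⟨e, he, ha⟩ := exists_oriented_basis b
  exact ⟨gridRegion 1 he ha Finset.univ, gridRegion_isAffine 1 he ha _, gridRegion_univ 1 he ha⟩

end Grid

/-! ### Pair states as operators. -/

section TensorOperator

variable {E₁ : Type*} [NormedAddCommGroup E₁] [InnerProductSpace ℂ E₁] [CompleteSpace E₁]
  {E₂ : Type*} [NormedAddCommGroup E₂] [InnerProductSpace ℂ E₂] [CompleteSpace E₂]

/-- The operator `|x⟩⟨C y|` of a pair state `x ⊗ y`, linear in the pair state. -/
def tensorOpLin (E₁ : Type*) [NormedAddCommGroup E₁] [InnerProductSpace ℂ E₁] [CompleteSpace E₁]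
    (C : E₂ ≃ₗᵢ⋆[ℂ] E₂) :
    E₁ ⊗[ℂ] E₂ →ₗ[ℂ] E₂ →L[ℂ] E₁ :=
  TensorProduct.lift (LinearMap.mk₂ ℂ (fun x y => InnerProductSpace.rankOne ℂ x (C y))
    (fun x x' y => by simp) (fun c x y => by simp) (fun x y y' => by simp)
    (fun c x y => by simp [C.map_smulₛₗ]))

lemma tensorOpLin_tmul (C : E₂ ≃ₗᵢ⋆[ℂ] E₂) (x : E₁) (y : E₂) :
    tensorOpLin E₁ C (x ⊗ₜ y) = InnerProductSpace.rankOne ℂ x (C y) := by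
  simp [tensorOpLin]

/-- Both the norm bound for `tensorOp` and its injectivity are read off from this duality with
product vectors. -/
lemma inner_tensorOpLin {C : E₂ ≃ₗᵢ⋆[ℂ] E₂} (hC : ∀ x, C (C x) = x) (z : E₁ ⊗[ℂ] E₂) (x : E₁)
    (w : E₂) : (inner ℂ x (tensorOpLin E₁ C z w) : ℂ) = inner ℂ (x ⊗ₜ[ℂ] C w) z := by
  induction z using TensorProduct.induction_on with
  | zero => simp
  | tmul x' y =>
    rw [tensorOpLin_tmul, TensorProduct.inner_tmul, InnerProductSpace.rankOne_apply,
      inner_smul_right, ← anti_inner C w, hC, mul_comm]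
  | add a b ha hb => rw [map_add, _root_.add_apply, inner_add_right, inner_add_right, ha, hb]

/-- The operator of a pair state. -/
def tensorOp (E₁ : Type*) [NormedAddCommGroup E₁] [InnerProductSpace ℂ E₁] [CompleteSpace E₁]
    {C : E₂ ≃ₗᵢ⋆[ℂ] E₂} (hC : ∀ x, C (C x) = x) : E₁ ⊗[ℂ] E₂ →L[ℂ] E₂ →L[ℂ] E₁ :=
  (tensorOpLin E₁ C).mkContinuous 1 fun z => by
    rw [one_mul]
    refine ContinuousLinearMap.opNorm_le_bound _ (norm_nonneg _) fun w => ?_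
    set y := tensorOpLin E₁ C z w with hy
    -- The pair state is tested against `y ⊗ C w`, whose norm is `‖y‖ ‖w‖`.
    have h1 : ‖y‖ ^ 2 ≤ ‖y‖ * (‖z‖ * ‖w‖) := by
      have h2 : ((‖y‖ ^ 2 : ℝ) : ℂ) = inner ℂ (y ⊗ₜ[ℂ] C w) z := by
        rw [← inner_tensorOpLin hC, ← hy, inner_self_eq_norm_sq_to_K]; simp
      have h3 : ‖y‖ ^ 2 = ‖(inner ℂ (y ⊗ₜ[ℂ] C w) z : ℂ)‖ := by
        rw [← h2, Complex.norm_real, Real.norm_of_nonneg (by positivity)]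
      rw [h3]
      refine (norm_inner_le_norm (𝕜 := ℂ) (y ⊗ₜ[ℂ] C w) z).trans ?_
      rw [TensorProduct.norm_tmul, LinearIsometryEquiv.norm_map]
      exact le_of_eq (by ring)
    rcases (norm_nonneg y).eq_or_lt with h0 | h0
    · rw [← h0]; positivity
    · rw [pow_two] at h1
      exact le_of_mul_le_mul_left h1 h0

lemma tensorOp_tmul {C : E₂ ≃ₗᵢ⋆[ℂ] E₂} (hC : ∀ x, C (C x) = x) (x : E₁) (y : E₂) :
    tensorOp E₁ hC (x ⊗ₜ y) = InnerProductSpace.rankOne ℂ x (C y) :=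
  tensorOpLin_tmul C x y

lemma tensorOp_injective {C : E₂ ≃ₗᵢ⋆[ℂ] E₂} (hC : ∀ x, C (C x) = x) :
    Function.Injective (tensorOp E₁ hC) := by
  intro z z' h
  rw [TensorProduct.ext_iff_inner_right (𝕜 := ℂ)]
  intro x y
  have h1 : tensorOpLin E₁ C z = tensorOpLin E₁ C z' := h
  rw [← hC y]
  refine (inner_conj_symm (𝕜 := ℂ) _ _).symm.trans (Eq.trans ?_ (inner_conj_symm (𝕜 := ℂ) _ _))
  congr 1
  exact (inner_tensorOpLin hC z x (C y)).symm.trans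
    ((by rw [h1] : _ = _).trans (inner_tensorOpLin hC z' x (C y)))

end TensorOperator

/-! ### Periodicity, reality and smoothness of the pairing operator `P_Δ`. -/

section PairingOp

variable {b : Module.Basis (Fin 2) ℝ Plane}
  {E₁ : Type*} [NormedAddCommGroup E₁] [InnerProductSpace ℂ E₁] [CompleteSpace E₁]
  {E₂ : Type*} [NormedAddCommGroup E₂] [InnerProductSpace ℂ E₂] [CompleteSpace E₂]
  {V₁ : Valley b E₁} {V₂ : Valley b E₂} {u₁ u₁' : Plane → Fin 2 → E₁} {u₂ u₂' : Plane → Fin 2 → E₂}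

lemma ketbra_apply (u : Fin 2 → E₁) (M : Matrix (Fin 2) (Fin 2) ℂ) (w : Fin 2 → E₂) (x : E₂) :
    ketbra u M w x = ∑ a, ∑ a', (M a a' * inner ℂ (w a') x) • u a := by
  simp [ketbra, smul_smul]

/-- The matrix elements of an operator from one plane to the other. -/
def coeff (u : Fin 2 → E₁) (w : Fin 2 → E₂) (A : E₂ →L[ℂ] E₁) : Matrix (Fin 2) (Fin 2) ℂ :=
  Matrix.of fun a a' => inner ℂ (u a) (A (w a'))

lemma coeff_ketbra {p₁ : E₁ →L[ℂ] E₁} {p₂ : E₂ →L[ℂ] E₂} {u : Fin 2 → E₁} {w : Fin 2 → E₂}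
    (hu : IsFrame p₁ u) (hw : IsFrame p₂ w) (M : Matrix (Fin 2) (Fin 2) ℂ) :
    coeff u w (ketbra u M w) = M := by
  ext a a'
  fin_cases a <;> fin_cases a' <;>
    simp [coeff, ketbra_apply, inner_add_right, inner_smul_right, hu.inner_eq, hw.inner_eq]

lemma ketbra_coeff {p₁ : E₁ →L[ℂ] E₁} {p₂ : E₂ →L[ℂ] E₂} {u : Fin 2 → E₁} {w : Fin 2 → E₂}
    (hu : IsFrame p₁ u) (hw : IsFrame p₂ w) {A : E₂ →L[ℂ] E₁} (h₁ : ∀ x, p₁ (A x) = A x)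
    (h₂ : ∀ x, A (p₂ x) = A x) : ketbra u (coeff u w A) w = A := by
  ext x
  rw [ketbra_apply, ← h₂ x, ← h₁, hw.expand, hu.expand, map_sum]
  refine Finset.sum_congr rfl fun a _ => ?_
  simp only [coeff, Matrix.of_apply, map_smul, inner_sum, inner_smul_right]
  rw [← Finset.sum_smul]
  congr 1
  exact Finset.sum_congr rfl fun _ _ => mul_comm _ _

/-- Equivariant real operators from the plane of the second valley at the opposite momentum to the
plane of the first valley. -/
structure IsPairingOp (V₁ : Valley b E₁) (V₂ : Valley b E₂) (B : Plane → E₂ →L[ℂ] E₁) : Prop where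
  smooth : ContDiff ℝ ∞ B
  left : ∀ k x, V₁.P k (B k x) = B k x
  right : ∀ k x, B k (V₂.P (-k) x) = B k x
  real : ∀ k x, V₁.C (B k x) = B k (V₂.C x)
  equiv : ∀ k (G : recip b) x, V₁.T G (B k x) = B (k + G) (V₂.T (-G) x)

lemma Valley.IsGauge.conjFrame {E : Type*} [NormedAddCommGroup E] [InnerProductSpace ℂ E]
    [CompleteSpace E] {V : Valley b E} {u : Plane → Fin 2 → E} (hu : V.IsGauge u) :
    V.IsGauge (V.conjFrame u) where
  orthonormal k := by
    have h := (hu.isFrame k).inner_eq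
    rw [orthonormal_iff_ite]
    intro a c
    rw [Valley.conjFrame, Valley.conjFrame, anti_inner, h]
    simp [eq_comm]
  mem k a := by
    rw [Valley.conjFrame, ← (V.isRealPlane k).comm, hu.mem]
  periodic k G a := by
    rw [Valley.conjFrame, hu.periodic, V.C_T, Valley.conjFrame]

section Ketbra

variable (hu₁ : V₁.IsGauge u₁) (hu₂ : V₂.IsGauge u₂) (Δ : Plane → Matrix (Fin 2) (Fin 2) ℂ)
include hu₁

lemma proj_PΔ (k : Plane) (x : E₂) : V₁.P k (PΔ V₂ u₁ u₂ Δ k x) = PΔ V₂ u₁ u₂ Δ k x := by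
  simp only [PΔ, ketbra_apply, map_sum, map_smul, hu₁.mem]

omit hu₁
include hu₂

lemma PΔ_proj (k : Plane) (x : E₂) : PΔ V₂ u₁ u₂ Δ k (V₂.P (-k) x) = PΔ V₂ u₁ u₂ Δ k x := by
  simp only [PΔ, ketbra_apply, ← proj_inner (V₂.P_proj (-k)), hu₂.conjFrame.mem]

include hu₁

lemma PΔ_equiv_iff (k : Plane) (G : recip b) :
    (∀ x, V₁.T G (PΔ V₂ u₁ u₂ Δ k x) = PΔ V₂ u₁ u₂ Δ (k + G) (V₂.T (-G) x)) ↔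
      Δ (k + G) = Δ k := by
  have hG : -(k + (G : Plane)) = -k + ((-G : recip b) : Plane) := by
    rw [Submodule.coe_neg, neg_add]
  have h1 : ∀ x, PΔ V₂ u₁ u₂ Δ (k + G) (V₂.T (-G) x) =
      V₁.T G (ketbra (u₁ k) (Δ (k + G)) (V₂.conjFrame u₂ (-k)) x) := by
    intro x
    simp only [PΔ, ketbra_apply, map_sum, map_smul]
    refine Finset.sum_congr rfl fun a _ => Finset.sum_congr rfl fun a' _ => ?_
    rw [hu₁.periodic, hG, hu₂.conjFrame.periodic, LinearIsometryEquiv.inner_map_map]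
  constructor
  · intro h
    have h2 : PΔ V₂ u₁ u₂ Δ k = ketbra (u₁ k) (Δ (k + G)) (V₂.conjFrame u₂ (-k)) := by
      ext x
      exact (V₁.T G).injective ((h x).trans (h1 x))
    have h3 := congrArg (coeff (u₁ k) (V₂.conjFrame u₂ (-k))) h2
    rw [PΔ, coeff_ketbra (hu₁.isFrame k) (hu₂.conjFrame.isFrame (-k)),
      coeff_ketbra (hu₁.isFrame k) (hu₂.conjFrame.isFrame (-k))] at h3
    exact h3.symm
  · intro h x
    rw [h1, h]; rfl

/-- The matrix product on the right collects the matrix elements of `C P_Δ C` in the frames in which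
`P_Δ` has the matrix `Δ`. -/
lemma PΔ_real_iff (k : Plane) :
    (∀ x, V₁.C (PΔ V₂ u₁ u₂ Δ k x) = PΔ V₂ u₁ u₂ Δ k (V₂.C x)) ↔
      V₁.sewing u₁ k * (Δ k).map conj * (V₂.sewing u₂ (-k))ᵀ = Δ k := by
  have f₁ := hu₁.isFrame k
  have f₂ := hu₂.conjFrame.isFrame (-k)
  have key : ∀ a a', inner ℂ (u₁ k a) (V₁.C (PΔ V₂ u₁ u₂ Δ k (V₂.C (V₂.conjFrame u₂ (-k) a')))) =
      (V₁.sewing u₁ k * (Δ k).map conj * (V₂.sewing u₂ (-k))ᵀ) a a' := by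
    intro a a'
    have e1 : V₂.C (V₂.conjFrame u₂ (-k) a') = u₂ (-k) a' := V₂.C_sq _
    rw [e1]
    simp only [PΔ, ketbra_apply, map_add, V₁.C.map_smulₛₗ, map_mul, inner_conj_symm, inner_add_right,
      inner_smul_right, Matrix.mul_apply, Matrix.transpose_apply, Matrix.map_apply, Valley.sewing,
      Matrix.of_apply, Fin.sum_univ_two]
    simp only [Valley.conjFrame]
    ring
  constructor
  · intro h
    ext a a'
    rw [← key, h, V₂.C_sq]
    exact congrFun (congrFun (coeff_ketbra f₁ f₂ (Δ k)) a) a'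
  · intro h x
    have h1 : ∀ a', V₁.C (PΔ V₂ u₁ u₂ Δ k (V₂.C (V₂.conjFrame u₂ (-k) a'))) =
        PΔ V₂ u₁ u₂ Δ k (V₂.conjFrame u₂ (-k) a') := by
      intro a'
      refine (f₁.expand_of_mem (by rw [← (V₁.isRealPlane k).comm, proj_PΔ hu₁])).trans
        ((Finset.sum_congr rfl fun a _ => ?_).trans (f₁.expand_of_mem (proj_PΔ hu₁ Δ k _)).symm)
      rw [key, h]
      congr 1
      exact (congrFun (congrFun (coeff_ketbra f₁ f₂ (Δ k)) a) a').symm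
    have h2 : ∀ y, V₁.C (PΔ V₂ u₁ u₂ Δ k (V₂.C y)) = PΔ V₂ u₁ u₂ Δ k y := by
      intro y
      rw [← PΔ_proj hu₂ Δ k y, ← PΔ_proj hu₂ Δ k (V₂.C y), ← (V₂.isRealPlane (-k)).comm, f₂.expand]
      simp only [map_sum, map_smul, V₁.C.map_smulₛₗ, V₂.C.map_smulₛₗ, h1, Complex.conj_conj]
    rw [← h2 (V₂.C x), V₂.C_sq]

omit hu₁ hu₂

lemma tensorOp_sum (k : Plane) : tensorOp E₁ V₂.C_sq
    (∑ a, ∑ a', Δ k a a' • (u₁ k a ⊗ₜ[ℂ] u₂ (-k) a')) = PΔ V₂ u₁ u₂ Δ k := by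
  simp only [map_sum, map_smul, tensorOp_tmul]
  rfl

end Ketbra

/-- Near each momentum there are smooth real frames. -/
lemma exists_smooth_realFrame {E : Type*} [NormedAddCommGroup E] [InnerProductSpace ℂ E]
    [CompleteSpace E] {C : E ≃ₗᵢ⋆[ℂ] E} {P J : Plane → E →L[ℂ] E} (hP : ∀ k, IsRealPlane C (P k))
    (hJ : ∀ k, IsCStr C (P k) (J k)) (hPs : ContDiff ℝ ∞ P) (hJs : ContDiff ℝ ∞ J) (k₀ : Plane) :
    ∃ e : Plane → Fin 2 → E, (∀ a, ContDiffAt ℝ ∞ (fun k => e k a) k₀) ∧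
      ∀ᶠ k in 𝓝 k₀, IsRealFrame C (P k) (e k) := by
  obtain ⟨f, hf⟩ := (hP k₀).exists_realFrame
  set s : Plane → E := fun k => P k (f 0) with hs
  have hs0 : s k₀ = f 0 := hf.apply 0
  have hss : ContDiff ℝ ∞ s := by
    rw [contDiff_iff_contDiffAt]
    exact fun k => hPs.contDiffAt.opApply contDiffAt_const
  have hne : s k₀ ≠ 0 := by rw [hs0]; exact hf.orthonormal.ne_zero 0
  have hU : ∀ᶠ k in 𝓝 k₀, s k ≠ 0 := hss.continuous.continuousAt.eventually_ne hne
  have hg : ContDiffAt ℝ ∞ (fun k => ‖s k‖⁻¹ • s k) k₀ :=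
    ((hss.contDiffAt.norm ℂ hne).inv (norm_ne_zero_iff.mpr hne)).smul hss.contDiffAt
  refine ⟨fun k => ![‖s k‖⁻¹ • s k, J k (‖s k‖⁻¹ • s k)], fun a => ?_, ?_⟩
  · fin_cases a
    · exact hg
    · exact hJs.contDiffAt.opApply hg
  · filter_upwards [hU] with k hk
    have hPs' : P k (s k) = s k := proj_apply_apply (hP k).proj _
    have hCs : C (s k) = s k := by rw [hs]; simp only; rw [(hP k).comm, hf.real]
    set g := ‖s k‖⁻¹ • s k with hgdef
    have hgc : g = ((‖s k‖⁻¹ : ℝ) : ℂ) • s k := (Complex.coe_smul _ _).symm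
    have pg : P k g = g := by rw [hgc, map_smul, hPs']
    have cg : C g = g := by rw [hgc, C.map_smulₛₗ, hCs, Complex.conj_ofReal]
    have ng : ‖g‖ = 1 := by
      rw [hgdef, norm_smul, norm_inv, norm_norm, inv_mul_cancel₀ (norm_ne_zero_iff.mpr hk)]
    refine ⟨isFrame_pair (hP k).proj (hP k).frame (orthonormal_pair ng ?_ ?_) ?_, ?_⟩
    · exact ((hJ k).norm_apply pg).trans ng
    · exact (hJ k).inner_apply_self cg
    · intro a; fin_cases a
      · exact pg
      · exact (hJ k).proj_apply g
    · intro a; fin_cases a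
      · exact cg
      · show C (J k g) = J k g
        rw [(hJ k).real, cg]

/-- `P_Δ` is the image of the pair state under the bounded map `tensorOp`. Conversely, in a smooth
local real frame `e` of the second valley the pair state is `∑ P_Δ e_a ⊗ e_a`, although the gauges
need not be continuous. -/
lemma PΔ_smooth_iff (hu₂ : V₂.IsGauge u₂)
    (Δ : Plane → Matrix (Fin 2) (Fin 2) ℂ) :
    (ContDiff ℝ ∞ fun k => ∑ a, ∑ a', Δ k a a' • (u₁ k a ⊗ₜ[ℂ] u₂ (-k) a')) ↔
      ContDiff ℝ ∞ (PΔ V₂ u₁ u₂ Δ) := by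
  constructor
  · intro h
    have := ((tensorOp E₁ V₂.C_sq).restrictScalars ℝ).contDiff.comp h
    convert this using 1
    funext k
    exact (tensorOp_sum Δ k).symm
  · intro h
    rw [contDiff_iff_contDiffAt]
    intro k₀
    obtain ⟨e, he, hev⟩ := exists_smooth_realFrame (P := fun k => V₂.P (-k))
      (J := fun k => V₂.J₀ u₂ 0 (-k)) (fun k => V₂.isRealPlane (-k))
      (fun k => Valley.isCStr_J₀ hu₂ 0 (-k)) (V₂.P_smooth.comp contDiff_neg)
      ((Valley.contDiff_J₀ hu₂ 0).comp contDiff_neg) k₀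
    have h1 : ContDiffAt ℝ ∞ (fun k => ∑ a, TensorProduct.mkL ℂ E₁ E₂
        (PΔ V₂ u₁ u₂ Δ k (e k a)) (e k a)) k₀ := by
      refine ContDiffAt.sum fun a _ => ?_
      have hB : IsBoundedBilinearMap ℝ fun x : E₁ × E₂ => TensorProduct.mkL ℂ E₁ E₂ x.1 x.2 :=
        ((TensorProduct.mkL ℂ E₁ E₂).bilinearRestrictScalars ℝ).isBoundedBilinearMap
      exact hB.contDiff.contDiffAt.comp (g := fun x : E₁ × E₂ => TensorProduct.mkL ℂ E₁ E₂ x.1 x.2)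
        k₀ ((h.contDiffAt.opApply (he a)).prodMk (he a))
    refine h1.congr_of_eventuallyEq ?_
    filter_upwards [hev] with k hk
    -- It suffices that both pair states have the same operator, namely `P_Δ` expanded in the real
    -- frame.
    apply tensorOp_injective V₂.C_sq
    rw [tensorOp_sum]
    ext x
    simp only [map_sum, TensorProduct.mkL_apply_apply, tensorOp_tmul, _root_.sum_apply,
      InnerProductSpace.rankOne_apply, hk.real]
    rw [← PΔ_proj hu₂ Δ k x, hk.expand, map_sum]
    simp only [map_smul]

end PairingOp

/-! ### Elimination of spin, and gauge covariance. -/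

section PairingIff

variable {b : Module.Basis (Fin 2) ℝ Plane}
  {E₁ : Type*} [NormedAddCommGroup E₁] [InnerProductSpace ℂ E₁] [CompleteSpace E₁]
  {E₂ : Type*} [NormedAddCommGroup E₂] [InnerProductSpace ℂ E₂] [CompleteSpace E₂]
  {V₁ : Valley b E₁} {V₂ : Valley b E₂} {u₁ u₁' : Plane → Fin 2 → E₁} {u₂ u₂' : Plane → Fin 2 → E₂}
  {Sp : Matrix (Fin 2) (Fin 2) ℂ}

/-- `(i s_y) Π^* (i s_y)ᵀ = s_y Π^* s_y = Π`, so the spin factor reproduces itself and only the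
orbital condition is left. -/
lemma kronecker_spin (h : pauliY * Sp.map conj * pauliY = Sp) (U₁ U₂ M : Matrix (Fin 2) (Fin 2) ℂ) :
    (U₁ ⊗ₖ (Complex.I • pauliY)) * (M ⊗ₖ Sp).map conj * (U₂ ⊗ₖ (Complex.I • pauliY))ᵀ =
      (U₁ * M.map conj * U₂ᵀ) ⊗ₖ Sp := by
  have h1 : (M ⊗ₖ Sp).map conj = M.map conj ⊗ₖ Sp.map conj := by
    ext ⟨i, j⟩ ⟨i', j'⟩
    simp
  have h2 : (U₂ ⊗ₖ (Complex.I • pauliY))ᵀ = U₂ᵀ ⊗ₖ (Complex.I • pauliY)ᵀ := by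
    ext ⟨i, j⟩ ⟨i', j'⟩
    simp
  have h3 : (Complex.I • pauliY)ᵀ = -(Complex.I • pauliY) := by
    ext i j
    fin_cases i <;> fin_cases j <;> simp [pauliY]
  have h4 : Complex.I • pauliY * Sp.map conj * -(Complex.I • pauliY) = Sp := by
    conv_rhs => rw [← h]
    simp only [Matrix.smul_mul, Matrix.mul_neg, Matrix.mul_smul, smul_smul, Complex.I_mul_I,
      neg_smul, one_smul, neg_neg]
  rw [h1, h2, h3, ← Matrix.mul_kronecker_mul, ← Matrix.mul_kronecker_mul, h4]

lemma kronecker_right_cancel (h : Sp ≠ 0) {M M' : Matrix (Fin 2) (Fin 2) ℂ} :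
    M ⊗ₖ Sp = M' ⊗ₖ Sp ↔ M = M' := by
  refine ⟨fun hM => ?_, fun hM => by rw [hM]⟩
  obtain ⟨p, q, hpq⟩ : ∃ p q, Sp p q ≠ 0 := by
    by_contra! hc
    exact h (Matrix.ext hc)
  ext i j
  have h1 := congrFun (congrFun hM (i, p)) (j, q)
  simp only [Matrix.kroneckerMap_apply] at h1
  exact mul_right_cancel₀ hpq h1

/-- A pairing matrix is admissible if and only if its operator is. -/
lemma isPairing_iff (hu₁ : V₁.IsGauge u₁) (hu₂ : V₂.IsGauge u₂)
    (h : pauliY * Sp.map conj * pauliY = Sp) (h' : Spᴴ * Sp = 1)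
    (Δ : Plane → Matrix (Fin 2) (Fin 2) ℂ) :
    IsPairing V₁ V₂ u₁ u₂ Δ Sp ↔ IsPairingOp V₁ V₂ (PΔ V₂ u₁ u₂ Δ) := by
  have hSp : Sp ≠ 0 := fun h0 => by
    rw [h0, Matrix.mul_zero] at h'
    exact zero_ne_one h'
  constructor
  · intro hΔ
    refine ⟨(PΔ_smooth_iff hu₂ Δ).mp hΔ.smooth, proj_PΔ hu₁ Δ, PΔ_proj hu₂ Δ,
      fun k => (PΔ_real_iff hu₁ hu₂ Δ k).mpr ?_,
      fun k G => (PΔ_equiv_iff hu₁ hu₂ Δ k G).mpr (hΔ.periodic k G)⟩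
    have := hΔ.invariant k
    rwa [kronecker_spin h, kronecker_right_cancel hSp] at this
  · intro hB
    refine ⟨fun k G => (PΔ_equiv_iff hu₁ hu₂ Δ k G).mp (hB.equiv k G), h, h', fun k => ?_,
      (PΔ_smooth_iff hu₂ Δ).mpr hB.smooth⟩
    rw [kronecker_spin h, kronecker_right_cancel hSp]
    exact (PΔ_real_iff hu₁ hu₂ Δ k).mp (hB.real k)

/-- The matrix elements of an operator transform like the pairing matrix. -/
lemma coeff_changeGauge (hu₁ : V₁.IsGauge u₁) (hu₂ : V₂.IsGauge u₂) {B : Plane → E₂ →L[ℂ] E₁}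
    (h₁ : ∀ k x, V₁.P k (B k x) = B k x) (h₂ : ∀ k x, B k (V₂.P (-k) x) = B k x) (k : Plane) :
    coeff (u₁' k) (V₂.conjFrame u₂' (-k)) (B k) =
      changeGauge u₁ u₁' u₂ u₂' (fun q => coeff (u₁ q) (V₂.conjFrame u₂ (-q)) (B q)) k := by
  conv_lhs => rw [← ketbra_coeff (hu₁.isFrame k) (hu₂.conjFrame.isFrame (-k)) (h₁ k) (h₂ k)]
  ext a a'
  simp only [changeGauge, coeff, Matrix.of_apply, ketbra_apply, Matrix.mul_apply, Fin.sum_univ_two,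
    Matrix.conjTranspose_apply, Matrix.map_apply, inner_add_right, inner_smul_right]
  have e : ∀ c, inner ℂ (V₂.conjFrame u₂ (-k) c) (V₂.conjFrame u₂' (-k) a') =
      conj (inner ℂ (u₂ (-k) c) (u₂' (-k) a')) := fun c => by
    rw [Valley.conjFrame, Valley.conjFrame, anti_inner, inner_conj_symm]
  have e' : ∀ c, star (inner ℂ (u₁ k c) (u₁' k a)) = inner ℂ (u₁' k a) (u₁ k c) := fun c => by
    rw [← starRingEnd_apply, inner_conj_symm]
  rw [e, e, e', e']
  ring

end PairingIff

/-! ### The two channels as parts of `P_Δ` intertwining the complex structures. -/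

namespace Data

variable {b : Module.Basis (Fin 2) ℝ Plane}
  {E₁ : Type*} [NormedAddCommGroup E₁] [InnerProductSpace ℂ E₁] [CompleteSpace E₁]
  {E₂ : Type*} [NormedAddCommGroup E₂] [InnerProductSpace ℂ E₂] [CompleteSpace E₂]

/-- The assumptions on the normal state and the pairing. -/
structure IsRegular (S : Data b E₁ E₂) : Prop where
  orientable₁ : S.V₁.Orientable
  orientable₂ : S.V₂.Orientable
  gauge₁ : S.V₁.IsGauge S.u₁
  gauge₂ : S.V₂.IsGauge S.u₂
  ne_zero₁ : S.N₁ ≠ 0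
  ne_zero₂ : S.N₂ ≠ 0
  pairing : IsPairingOp S.V₁ S.V₂ S.PΔ

variable {S : Data b E₁ E₂}

/-- The complex structure of the first valley. -/
def J₁ (S : Data b E₁ E₂) : Plane → E₁ →L[ℂ] E₁ := S.V₁.J S.u₁ S.k₁

/-- The complex structure of the second valley. -/
def J₂ (S : Data b E₁ E₂) : Plane → E₂ →L[ℂ] E₂ := S.V₂.J S.u₂ S.k₂

lemma Pb_apply (c : Channel) (k : Plane) (x : E₂) : S.Pb c k x =
    (1 / 2 : ℂ) • (S.PΔ k x - (c.sgn : ℂ) • S.J₁ k (S.PΔ k (S.J₂ (-k) x))) := by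
  have h : (1 / (Real.sqrt 2 : ℂ)) * (1 / (Real.sqrt 2 : ℂ)) = 1 / 2 := by
    rw [div_mul_div_comm, Valley.sqrt_two_mul_self, one_mul]
  simp only [Pb, Q₁, Q₂, Valley.Q_eq, J₁, J₂, _root_.sub_apply, _root_.smul_apply,
    ContinuousLinearMap.comp_apply, map_smul, smul_sub, smul_smul]
  rw [h, mul_comm (c.sgn : ℂ)]

lemma sgn_mul_sgn (c : Channel) : (c.sgn : ℂ) * c.sgn = 1 := by
  cases c <;> simp [Channel.sgn]

lemma conj_sgn (c : Channel) : conj (c.sgn : ℂ) = c.sgn := by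
  cases c <;> simp [Channel.sgn]

lemma Pb_perp_add_Pb_para (k : Plane) : S.Pb .perp k + S.Pb .para k = S.PΔ k := by
  simp only [Pb, Channel.sgn]
  push_cast
  rw [one_smul, neg_one_smul]
  module

namespace IsRegular

variable (h : S.IsRegular) (c : Channel)
include h

lemma cstr₁ (k : Plane) : IsCStr S.V₁.C (S.V₁.P k) (S.J₁ k) :=
  Valley.isCStr_J h.gauge₁ h.ne_zero₁ k

lemma cstr₂ (k : Plane) : IsCStr S.V₂.C (S.V₂.P k) (S.J₂ k) :=
  Valley.isCStr_J h.gauge₂ h.ne_zero₂ k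

lemma equiv₁ (G : recip b) (k : Plane) (x : E₁) :
    S.V₁.T G (S.J₁ k x) = S.J₁ (k + G) (S.V₁.T G x) :=
  Valley.J_equivariant h.orientable₁ h.gauge₁ h.ne_zero₁ G k x

lemma equiv₂ (G : recip b) (k : Plane) (x : E₂) :
    S.V₂.T G (S.J₂ k x) = S.J₂ (k + G) (S.V₂.T G x) :=
  Valley.J_equivariant h.orientable₂ h.gauge₂ h.ne_zero₂ G k x

lemma smooth₁ : ContDiff ℝ ∞ S.J₁ := Valley.contDiff_J h.gauge₁ S.k₁

lemma smooth₂ : ContDiff ℝ ∞ S.J₂ := Valley.contDiff_J h.gauge₂ S.k₂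

lemma isPairingOp_Pb : IsPairingOp S.V₁ S.V₂ (S.Pb c) where
  smooth := by
    have h1 : ContDiff ℝ ∞ fun k => S.J₁ k ∘L S.PΔ k ∘L S.J₂ (-k) := by
      rw [contDiff_iff_contDiffAt]
      exact fun k => h.smooth₁.contDiffAt.opComp
        (h.pairing.smooth.contDiffAt.opComp (h.smooth₂.comp contDiff_neg).contDiffAt)
    convert (h.pairing.smooth.sub (h1.const_smul (c.sgn : ℂ))).const_smul (1 / 2 : ℂ) using 1
    ext k x
    exact Pb_apply c k x
  left k x := by
    simp only [Pb_apply, map_smul, map_sub, h.pairing.left, (h.cstr₁ k).proj_apply]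
  right k x := by
    simp only [Pb_apply, h.pairing.right, (h.cstr₂ (-k)).apply_proj]
  real k x := by
    simp only [Pb_apply, S.V₁.C.map_smulₛₗ, map_sub, conj_sgn, (h.cstr₁ k).real, h.pairing.real,
      (h.cstr₂ (-k)).real, map_div₀, map_one, map_ofNat]
  equiv k G x := by
    have e : ∀ y, S.V₂.T (-G) (S.J₂ (-k) y) = S.J₂ (-(k + G)) (S.V₂.T (-G) y) := fun y => by
      rw [h.equiv₂, Submodule.coe_neg, neg_add]
    simp only [Pb_apply, map_smul, map_sub, h.equiv₁, h.pairing.equiv, e]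

/-- With `σ = (-1)^b`, `P_b = ½ (P_Δ - σ J₁ P_Δ J₂)` is the component of `P_Δ` satisfying `J₁ B = σ
B J₂`, since both structures square to minus the projection and `σ² = 1`. -/
lemma J₁_Pb (k : Plane) (x : E₂) : S.J₁ k (S.Pb c k x) = (c.sgn : ℂ) • S.Pb c k (S.J₂ (-k) x) := by
  simp only [Pb_apply, map_smul, map_sub, (h.cstr₁ k).sq, (h.cstr₂ (-k)).sq, map_neg, h.pairing.left,
    h.pairing.right, smul_neg, sub_neg_eq_add]
  rw [smul_comm (c.sgn : ℂ) (1 / 2 : ℂ), smul_add (c.sgn : ℂ), smul_smul (c.sgn : ℂ) (c.sgn : ℂ), sgn_mul_sgn,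
    one_smul, add_comm]

lemma Pb_J₂ (k : Plane) (x : E₂) : S.Pb c k (S.J₂ (-k) x) = (c.sgn : ℂ) • S.J₁ k (S.Pb c k x) := by
  rw [h.J₁_Pb, smul_smul, sgn_mul_sgn, one_smul]

lemma adj_J₁ (k : Plane) (x : E₁) : ContinuousLinearMap.adjoint (S.Pb c k) (S.J₁ k x) =
    (c.sgn : ℂ) • S.J₂ (-k) (ContinuousLinearMap.adjoint (S.Pb c k) x) := by
  refine ext_inner_left ℂ fun y => ?_
  rw [ContinuousLinearMap.adjoint_inner_right, inner_smul_right]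
  have h1 := (h.cstr₁ k).skew (S.Pb c k y) x
  have h2 := (h.cstr₂ (-k)).skew y (ContinuousLinearMap.adjoint (S.Pb c k) x)
  rw [ContinuousLinearMap.adjoint_inner_right, h.Pb_J₂, inner_smul_left, conj_sgn] at h2
  linear_combination -(c.sgn : ℂ) * h2 + inner ℂ (S.J₁ k (S.Pb c k y)) x * sgn_mul_sgn c + h1

lemma adj_real (k : Plane) (x : E₁) : S.V₂.C (ContinuousLinearMap.adjoint (S.Pb c k) x) =
    ContinuousLinearMap.adjoint (S.Pb c k) (S.V₁.C x) := by
  refine ext_inner_left ℂ fun y => ?_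
  rw [ContinuousLinearMap.adjoint_inner_right, ← S.V₂.C_sq y, anti_inner,
    ← (h.isPairingOp_Pb c).real, anti_inner, ContinuousLinearMap.adjoint_inner_left]

/-- `P_b P_b†` is real and symmetric, and it commutes with `J₁` because the two channel signs
cancel; `exists_smul_proj` applies. -/
lemma exists_Pb_mul_adj (k : Plane) : ∃ r : ℝ, ∀ x,
    S.Pb c k (ContinuousLinearMap.adjoint (S.Pb c k) x) = (r : ℂ) • S.V₁.P k x := by
  have hB := h.isPairingOp_Pb c
  have hadj : ∀ x, ContinuousLinearMap.adjoint (S.Pb c k) (S.V₁.P k x) =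
      ContinuousLinearMap.adjoint (S.Pb c k) x := fun x => by
    refine ext_inner_left ℂ fun y => ?_
    rw [ContinuousLinearMap.adjoint_inner_right, ← proj_inner (S.V₁.P_proj k), hB.left,
      ContinuousLinearMap.adjoint_inner_right]
  obtain ⟨r, hr⟩ := (h.cstr₁ k).exists_smul_proj (S.V₁.isRealPlane k)
    (A := S.Pb c k ∘L ContinuousLinearMap.adjoint (S.Pb c k)) (fun x => hB.left k _)
    (fun x => by simp only [ContinuousLinearMap.comp_apply, hadj])
    (fun x y => by
      simp only [ContinuousLinearMap.comp_apply]
      rw [← ContinuousLinearMap.adjoint_inner_right, ContinuousLinearMap.adjoint_inner_left])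
    (fun x => by simp only [ContinuousLinearMap.comp_apply]; rw [hB.real, h.adj_real])
    (fun x => by
      simp only [ContinuousLinearMap.comp_apply]
      rw [h.adj_J₁, map_smul, h.Pb_J₂, smul_smul, sgn_mul_sgn, one_smul])
  exact ⟨r, fun x => congrArg (fun A : E₁ →L[ℂ] E₁ => A x) hr⟩

lemma trace_Δb (k : Plane) {r : ℝ} (hr : ∀ x,
    S.Pb c k (ContinuousLinearMap.adjoint (S.Pb c k) x) = (r : ℂ) • S.V₁.P k x) :
    Matrix.trace (S.Δb c k * (S.Δb c k)ᴴ) = 2 * r := by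
  have f₂ := h.gauge₂.conjFrame.isFrame (-k)
  have h1 : ∀ a, ∑ a', S.Δb c k a a' * star (S.Δb c k a a') = r := by
    intro a
    have e1 : ContinuousLinearMap.adjoint (S.Pb c k) (S.u₁ k a) =
        ∑ a', star (S.Δb c k a a') • S.V₂.conjFrame S.u₂ (-k) a' := by
      have hp : S.V₂.P (-k) (ContinuousLinearMap.adjoint (S.Pb c k) (S.u₁ k a)) =
          ContinuousLinearMap.adjoint (S.Pb c k) (S.u₁ k a) := by
        refine ext_inner_left ℂ fun y => ?_
        rw [← proj_inner (S.V₂.P_proj (-k)), ContinuousLinearMap.adjoint_inner_right,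
          ContinuousLinearMap.adjoint_inner_right, (h.isPairingOp_Pb c).right]
      refine (f₂.expand_of_mem hp).trans (Finset.sum_congr rfl fun a' _ => ?_)
      congr 1
      rw [ContinuousLinearMap.adjoint_inner_right, Δb, Matrix.of_apply, ← starRingEnd_apply,
        inner_conj_symm]
    have e2 := congrArg (fun z => (inner ℂ (S.u₁ k a) z : ℂ)) (hr (S.u₁ k a))
    simp only [inner_smul_right, h.gauge₁.mem, (h.gauge₁.isFrame k).inner_eq, if_true, mul_one] at e2
    rw [← e2, e1, map_sum, inner_sum]
    refine Finset.sum_congr rfl fun a' _ => ?_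
    rw [map_smul, inner_smul_right, mul_comm]
    rfl
  simp only [Matrix.trace, Matrix.diag_apply, Matrix.mul_apply, Matrix.conjTranspose_apply, h1]
  simp

/-- `P_b P_b† = |Δ_b|² P_+`. -/
lemma Pb_mul_adj (k : Plane) (x : E₁) :
    S.Pb c k (ContinuousLinearMap.adjoint (S.Pb c k) x) = ((S.absΔ c k ^ 2 : ℝ) : ℂ) • S.V₁.P k x := by
  obtain ⟨r, hr⟩ := h.exists_Pb_mul_adj c k
  have h1 := h.trace_Δb c k hr
  have h2 : 0 ≤ r := by
    have e := congrArg (fun z => (inner ℂ (S.u₁ k 0) z : ℂ)) (hr (S.u₁ k 0))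
    simp only [inner_smul_right, h.gauge₁.mem, (h.gauge₁.isFrame k).inner_eq, if_true, mul_one] at e
    rw [← ContinuousLinearMap.adjoint_inner_left, inner_self_eq_norm_sq_to_K] at e
    have e' : ‖ContinuousLinearMap.adjoint (S.Pb c k) (S.u₁ k 0)‖ ^ 2 = r :=
      Complex.ofReal_injective (by rw [Complex.ofReal_pow]; exact e)
    rw [← e']; positivity
  have h3 : S.absΔ c k ^ 2 = r := by
    rw [absΔ, h1]
    simp only [Complex.mul_re, Complex.re_ofNat, Complex.ofReal_re, Complex.im_ofNat, zero_mul,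
      sub_zero]
    rw [Real.sq_sqrt (by positivity)]; ring
  rw [h3, hr]

lemma absΔ_eq_zero_iff (k : Plane) : S.absΔ c k = 0 ↔ S.Δb c k = 0 := by
  obtain ⟨r, hr⟩ := h.exists_Pb_mul_adj c k
  constructor
  · intro h0
    have h1 : S.Pb c k = 0 := by
      have e : ∀ x, ContinuousLinearMap.adjoint (S.Pb c k) x = 0 := fun x => by
        rw [← inner_self_eq_zero (𝕜 := ℂ), ContinuousLinearMap.adjoint_inner_left,
          h.Pb_mul_adj, h0]
        simp
      ext y
      refine ext_inner_left ℂ fun x => ?_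
      rw [← ContinuousLinearMap.adjoint_inner_left, e]; simp
    ext a a'
    simp [Δb, h1]
  · intro h0
    simp [absΔ, h0]

end IsRegular

end Data

/-! ### Reduction of a channel to a map between line bundles. -/

namespace Data

variable {b : Module.Basis (Fin 2) ℝ Plane}
  {E₁ : Type*} [NormedAddCommGroup E₁] [InnerProductSpace ℂ E₁] [CompleteSpace E₁]
  {E₂ : Type*} [NormedAddCommGroup E₂] [InnerProductSpace ℂ E₂] [CompleteSpace E₂]
  {S : Data b E₁ E₂}

/-- The lines of the first valley. -/
def line₁ (S : Data b E₁ E₂) : Plane → E₁ →L[ℂ] E₁ := lineProj S.V₁.P S.J₁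

/-- The lines of the second valley at the opposite momentum, in the channel `c`. -/
def line₂ (S : Data b E₁ E₂) (c : Channel) : Plane → E₂ →L[ℂ] E₂ :=
  lineProj (fun k => S.V₂.P (-k)) fun k => (c.sgn : ℂ) • S.J₂ (-k)

/-- The pairing between the lines. -/
def linePairing (S : Data b E₁ E₂) (c : Channel) (k : Plane) : E₂ →L[ℂ] E₁ :=
  S.line₁ k ∘L S.Pb c k

namespace IsRegular

variable (h : S.IsRegular) (c : Channel)
include h

lemma isBundle₁ : IsBundle b S.V₁.T S.line₁ :=
  lineProj_isBundle S.V₁.isBundle S.V₁.isRealPlane h.cstr₁ h.smooth₁ h.equiv₁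

lemma cstr₂_neg (k : Plane) : IsCStr S.V₂.C (S.V₂.P (-k)) ((c.sgn : ℂ) • S.J₂ (-k)) :=
  (h.cstr₂ (-k)).sgn_smul c

lemma smooth₂_neg : ContDiff ℝ ∞ fun k => (c.sgn : ℂ) • S.J₂ (-k) :=
  (h.smooth₂.comp contDiff_neg).const_smul (c.sgn : ℂ)

lemma isBundle₂ : IsBundle b (fun G => S.V₂.T (-G)) (S.line₂ c) :=
  lineProj_isBundle S.V₂.isBundle.comp_neg (fun k => S.V₂.isRealPlane (-k)) (h.cstr₂_neg c)
    (h.smooth₂_neg c) fun G k x => by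
      rw [_root_.smul_apply, _root_.smul_apply, map_smul, h.equiv₂, Submodule.coe_neg, neg_add]

lemma exists_isLine₁ (k : Plane) : ∃ ℓ, IsLine (S.line₁ k) ℓ := by
  obtain ⟨e, -, -, -, he⟩ := lineProj_exists_isLine (P := S.V₁.P) (S.V₁.isRealPlane k) (h.cstr₁ k)
  exact ⟨_, he⟩

lemma exists_isLine₂ (k : Plane) : ∃ ℓ, IsLine (S.line₂ c k) ℓ := by
  obtain ⟨e, -, -, -, he⟩ := lineProj_exists_isLine (P := fun k => S.V₂.P (-k))
    (J := fun k => (c.sgn : ℂ) • S.J₂ (-k)) (k := k) (S.V₂.isRealPlane (-k)) (h.cstr₂_neg c k)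
  exact ⟨_, he⟩

/-- By `J₁_Pb`, `P_b` maps eigenlines of `σ J₂(-k)` to eigenlines of `J₁(k)` with the same
eigenvalue, so projecting before or after it makes no difference. -/
lemma linePairing_eq (k : Plane) (x : E₂) :
    S.linePairing c k x = S.Pb c k (S.line₂ c k x) := by
  rw [linePairing, ContinuousLinearMap.comp_apply, line₁, line₂, lineProj_apply, lineProj_apply,
    map_smul, map_add, map_smul, _root_.smul_apply, map_smul, ← h.J₁_Pb,
    (h.isPairingOp_Pb c).left, (h.isPairingOp_Pb c).right]

lemma adjoint_linePairing (k : Plane) : ContinuousLinearMap.adjoint (S.linePairing c k) =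
    ContinuousLinearMap.adjoint (S.Pb c k) ∘L S.line₁ k := by
  rw [linePairing, ContinuousLinearMap.adjoint_comp, ← ContinuousLinearMap.star_eq_adjoint (S.line₁ k),
    (h.isBundle₁.proj k).isSelfAdjoint.star_eq]

lemma P_line₁ (k : Plane) (x : E₁) : S.V₁.P k (S.line₁ k x) = S.line₁ k x := by
  simp only [line₁, lineProj_apply, map_smul, map_add, proj_apply_apply (S.V₁.P_proj k),
    (h.cstr₁ k).proj_apply]

/-- Through this reduction the general results on line maps become statements about `Δ_b`:
`Pb_mul_adj` identifies the squared norm with `|Δ_b|²`, so the zeros are the same. -/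
lemma isLineMap : IsLineMap S.V₁.T (fun G => S.V₂.T (-G)) S.line₁ (S.line₂ c) (S.linePairing c)
    (fun k => S.absΔ c k ^ 2) where
  bundle₁ := h.isBundle₁
  bundle₂ := h.isBundle₂ c
  line₁ := h.exists_isLine₁
  line₂ := h.exists_isLine₂ c
  smooth := by
    rw [contDiff_iff_contDiffAt]
    exact fun k => h.isBundle₁.smooth.contDiffAt.opComp (h.isPairingOp_Pb c).smooth.contDiffAt
  left k x := proj_apply_apply (h.isBundle₁.proj k) _
  right k x := by
    rw [h.linePairing_eq, h.linePairing_eq, proj_apply_apply ((h.isBundle₂ c).proj k)]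
  equiv k G x := by
    simp only [linePairing, ContinuousLinearMap.comp_apply, h.isBundle₁.equiv,
      (h.isPairingOp_Pb c).equiv]
  mul_adj k x := by
    rw [h.adjoint_linePairing, linePairing, ContinuousLinearMap.comp_apply,
      ContinuousLinearMap.comp_apply, h.Pb_mul_adj, map_smul, h.P_line₁,
      proj_apply_apply (h.isBundle₁.proj k)]

lemma Φ₁_eq (k : Plane) : S.V₁.Φ S.u₁ S.k₁ k = berry S.line₁ k :=
  Valley.Φ_eq_berry h.gauge₁ h.ne_zero₁ k

/-- The channel sign multiplies the complex structure and hence its curvature; reflecting the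
momentum changes no sign, as two derivatives are involved. -/
lemma Φ₂_eq (k : Plane) : (c.sgn : ℂ) * S.V₂.Φ S.u₂ S.k₂ (-k) = berry (S.line₂ c) k := by
  rw [line₂, berry_lineProj (fun k => S.V₂.isRealPlane (-k)) (h.cstr₂_neg c)
    (S.V₂.isBundle.comp_neg.smooth.differentiable (by simp)) ((h.smooth₂_neg c).differentiable (by simp)),
    curvatureTrace_comp_neg, curvatureTrace_smul S.V₂.isRealPlane (h.cstr₂ (-k)),
    Valley.Φ_eq h.gauge₂]
  simp only [J₂]
  ring

lemma isDifferentiable_Pb : Differentiable ℝ (S.Pb c) :=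
  (h.isPairingOp_Pb c).smooth.differentiable (by simp)

/-- The connection `v_b` is the normalized one-form of the pairing between the lines. -/
lemma vb_eq {k : Plane} (hk : S.absΔ c k ≠ 0) (w : Plane) :
    S.vb c k w = IsLineMap.normForm (S.linePairing c) (fun k => S.absΔ c k ^ 2) k w := by
  have hM := h.isLineMap c
  have hB := h.isPairingOp_Pb c
  have hd : DifferentiableAt ℝ (S.Pb c) k := h.isDifferentiable_Pb c k
  obtain ⟨e, he, j0, j1, hl⟩ := lineProj_exists_isLine (P := S.V₁.P) (S.V₁.isRealPlane k) (h.cstr₁ k)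
  set ℓ := Valley.chernFrame (fun _ => e) k 0 with hℓ
  have hv : ℓ = (1 / (Real.sqrt 2 : ℂ)) • (e 0 + Complex.I • e 1) := rfl
  have hs : (1 / (Real.sqrt 2 : ℂ)) * (1 / (Real.sqrt 2 : ℂ)) = 1 / 2 := by
    rw [div_mul_div_comm, Valley.sqrt_two_mul_self, one_mul]
  have hcs : conj (1 / (Real.sqrt 2 : ℂ)) = 1 / (Real.sqrt 2 : ℂ) := by
    rw [map_div₀, Complex.conj_ofReal, map_one]
  set A : Plane → E₁ →L[ℂ] E₂ := fun q => ContinuousLinearMap.adjoint (S.Pb c q) with hA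
  have hAs : DifferentiableAt ℝ A k := (adjR E₂ E₁).differentiableAt.comp k hd
  set dA := fderiv ℝ A k w with hdA
  -- The matrix of `P_b dP_b†` in a real frame has real entries. Both `v_b` and the imaginary part
  -- of the trace on the line are given by its antisymmetric part.
  set X : Fin 2 → Fin 2 → ℂ := fun i j => inner ℂ (e i) (S.Pb c k (dA (e j))) with hX
  have hXr : ∀ i j, conj (X i j) = X i j := by
    intro i j
    refine real_inner (C := S.V₁.C) _ _ (he.real i) ?_
    rw [hB.real]
    congr 1
    have := fderiv_intertwine (antiR S.V₁.C) (antiR S.V₂.C) hAs hAs (fun q x => h.adj_real c q x) w (e j)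
    simp only [antiR_apply] at this
    rw [hdA, this, he.real]
  -- the derivative of the normalized adjoint
  have hn : ContDiff ℝ ∞ fun k => S.absΔ c k ^ 2 := hM.contDiff_n
  have hpos : 0 < S.absΔ c k := lt_of_le_of_ne (Real.sqrt_nonneg _) (Ne.symm hk)
  have habs : DifferentiableAt ℝ (fun q => (S.absΔ c q)⁻¹) k := by
    have h1 : S.absΔ c = fun q => Real.sqrt (S.absΔ c q ^ 2) :=
      funext fun q => (Real.sqrt_sq (Real.sqrt_nonneg _)).symm
    have h2 : DifferentiableAt ℝ (S.absΔ c) k := by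
      rw [h1]
      exact (hn.differentiable (by simp) k).sqrt (by positivity)
    exact h2.inv hk
  have hadj : ∀ q, ContinuousLinearMap.adjoint (S.Phat c q) = (S.absΔ c q)⁻¹ • A q := by
    intro q
    rw [Phat, map_smulₛₗ, map_inv₀, Complex.conj_ofReal, ← Complex.ofReal_inv]
    exact (Complex.coe_smul _ _)
  have hfd : fderiv ℝ (fun q => ContinuousLinearMap.adjoint (S.Phat c q)) k w =
      (S.absΔ c k)⁻¹ • dA + (fderiv ℝ (fun q => (S.absΔ c q)⁻¹) k w) • A k := by
    simp only [hadj]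
    rw [fderiv_fun_smul habs hAs]
    simp [hdA]
  set n := S.absΔ c k with hndef
  set d := fderiv ℝ (fun q => (S.absΔ c q)⁻¹) k w with hddef
  -- The derivative of the normalization contributes multiples of `e_a`, which are orthogonal to `J₁
  -- e_a`.
  have hvb : S.vb c k w = (2 * (n : ℂ) ^ 2)⁻¹ * (X 0 1 - X 1 0) := by
    rw [vb, hfd, he.frTrace_eq (A := _ ∘L _) (fun x => by
      simp only [ContinuousLinearMap.comp_apply, Q₁, Valley.Q_eq, _root_.smul_apply, map_smul]
      congr 1
      exact (h.cstr₁ k).proj_apply _)]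
    have e1 : ∀ x, S.Q₁ k x = (1 / (Real.sqrt 2 : ℂ)) • S.J₁ k x := fun x => by
      rw [Q₁, Valley.Q_eq]; rfl
    have e2 : ∀ a, S.Pb c k (A k (e a)) = ((n ^ 2 : ℝ) : ℂ) • e a := fun a => by
      rw [hA]; simp only; rw [h.Pb_mul_adj, he.apply]
    have e3 : ∀ a, (inner ℂ (e a) ((S.Q₁ k ∘L S.Phat c k ∘L ((n)⁻¹ • dA + d • A k)) (e a)) : ℂ) =
        -(1 / (Real.sqrt 2 : ℂ)) * (n : ℂ)⁻¹ * inner ℂ (S.J₁ k (e a))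
          (((n⁻¹ : ℝ) : ℂ) • S.Pb c k (dA (e a)) + (d : ℂ) • ((n ^ 2 : ℝ) : ℂ) • e a) := by
      intro a
      rw [(h.cstr₁ k).skew, ContinuousLinearMap.comp_apply, ContinuousLinearMap.comp_apply, e1,
        _root_.add_apply, _root_.smul_apply, _root_.smul_apply, ← Complex.coe_smul, ← Complex.coe_smul,
        Phat, _root_.smul_apply, map_add, map_smul, map_smul, map_smul, e2, inner_smul_right,
        inner_smul_right]
      ring
    rw [Fin.sum_univ_two, e3, e3, j0, j1]
    simp only [inner_add_right, inner_smul_right, inner_neg_left, he.inner_eq]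
    have hn0 : (n : ℂ) ≠ 0 := by rwa [Complex.ofReal_ne_zero]
    simp only [hX]
    simp
    have hs' : (Real.sqrt 2 : ℂ)⁻¹ * (Real.sqrt 2 : ℂ)⁻¹ = 1 / 2 := by simpa using hs
    linear_combination ((n : ℂ)⁻¹ * (n : ℂ)⁻¹ * (inner ℂ (e 0) (S.Pb c k (dA (e 1))) - inner ℂ (e 1) (S.Pb c k (dA (e 0))))) * hs'
  -- the one-form
  have hform : imForm (S.linePairing c) k w = (1 / 2 : ℂ) * (X 0 1 - X 1 0) := by
    have e0 : (fun q => ContinuousLinearMap.adjoint (S.linePairing c q)) = fun q => A q ∘L S.line₁ q :=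
      funext fun q => h.adjoint_linePairing c q
    have hld : DifferentiableAt ℝ S.line₁ k := h.isBundle₁.smooth.differentiable (by simp) k
    rw [hM.imForm_apply, hl.frTrace_eq (A := _ ∘L _) (fun x => hM.left k _), e0,
      fderiv_opComp hAs hld]
    -- The derivative of the line projection drops out, because `P_b P_b†` is a multiple of `P₊` and
    -- `⟨ℓ, (dp) ℓ⟩ = 0`.
    have e4 : (inner ℂ ℓ ((S.linePairing c k ∘L (fderiv ℝ A k w ∘L S.line₁ k + A k ∘L fderiv ℝ S.line₁ k w)) ℓ) : ℂ) =
        inner ℂ ℓ (S.Pb c k (dA ℓ)) := by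
      have e5 : S.line₁ k ℓ = ℓ := hl.apply
      have e6 := proj_fderiv_proj h.isBundle₁.proj hld w ℓ
      rw [e5] at e6
      have e7 : S.V₁.P k ℓ = ℓ := by rw [← e5, h.P_line₁]
      have e8 : (inner ℂ ℓ (fderiv ℝ S.line₁ k w ℓ) : ℂ) = 0 := by
        nth_rw 1 [← e5]
        rw [proj_inner (h.isBundle₁.proj k), e6, inner_zero_right]
      have e9 : ∀ y, S.Pb c k (A k y) = ((n ^ 2 : ℝ) : ℂ) • S.V₁.P k y := h.Pb_mul_adj c k
      rw [linePairing, ContinuousLinearMap.comp_apply, ContinuousLinearMap.comp_apply,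
        ← proj_inner (h.isBundle₁.proj k), e5, _root_.add_apply, ContinuousLinearMap.comp_apply,
        ContinuousLinearMap.comp_apply, e5, map_add, e9, inner_add_right, inner_smul_right,
        ← proj_inner (S.V₁.P_proj k), e7, e8, mul_zero, add_zero]
    have e10 : (inner ℂ ℓ (S.Pb c k (dA ℓ)) : ℂ) =
        (1 / 2) * (X 0 0 + Complex.I * X 0 1 - Complex.I * X 1 0 + X 1 1) := by
      rw [hv]
      simp only [map_smul, map_add, inner_smul_left, inner_smul_right, inner_add_left,
        inner_add_right, hcs, Complex.conj_I, hX]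
      linear_combination (inner ℂ (e 0) (S.Pb c k (dA (e 0))) -
        Complex.I * inner ℂ (e 1) (S.Pb c k (dA (e 0))) +
        Complex.I * inner ℂ (e 0) (S.Pb c k (dA (e 1))) -
        Complex.I * Complex.I * inner ℂ (e 1) (S.Pb c k (dA (e 1)))) * hs -
        (1 / 2) * inner ℂ (e 1) (S.Pb c k (dA (e 1))) * Complex.I_mul_I
    rw [e4, e10, Complex.im_eq_sub_conj]
    simp only [map_mul, map_add, map_sub, hXr, Complex.conj_I, map_div₀, map_one, map_ofNat]
    field_simp
    ring
  have hn0 : (n : ℂ) ≠ 0 := by rwa [Complex.ofReal_ne_zero]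
  have hfin : IsLineMap.normForm (S.linePairing c) (fun k => S.absΔ c k ^ 2) k w =
      ((n ^ 2 : ℝ) : ℂ)⁻¹ * imForm (S.linePairing c) k w := rfl
  rw [hvb, hfin, hform, Complex.ofReal_pow]
  field_simp

lemma winding_eq (D : Region b) (hD : ∀ s ∈ D.bdry, ∀ t ∈ Set.Icc (0 : ℝ) 1, S.absΔ c (D.side s t) ≠ 0) :
    S.winding c D = (1 / (2 * Real.pi) : ℂ) * IsLineMap.lineWinding S.line₁ (S.line₂ c)
      (S.linePairing c) (fun k => S.absΔ c k ^ 2) D := by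
  rw [winding, IsLineMap.lineWinding, mul_add]
  congr 1
  · congr 1
    refine Finset.sum_congr rfl fun s hs => intervalIntegral.integral_congr fun t ht => ?_
    rw [Set.uIcc_of_le zero_le_one] at ht
    exact h.vb_eq c (hD s hs t ht) _
  · simp only [h.Φ₁_eq, h.Φ₂_eq c]

end IsRegular

end Data

/-! ### Reflection invariance of integrals over the cell. -/

section Reflection

variable {b : Module.Basis (Fin 2) ℝ Plane}

/-- The integral of a periodic function over the unit cell is invariant under reflection. -/
lemma setIntegral_comp_neg {g : Plane → ℂ} (hg : Continuous g)
    (hp : ∀ k (G : recip b), g (k + G) = g k) :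
    ∫ k in unitCell b, g (-k) = ∫ k in unitCell b, g k := by
  have hfr : ∀ x ∈ unitCell b, ZSpan.fract b x = x := fun x hx => ZSpan.fract_eq_self.mpr hx
  set s : Set Plane := (fun k : Plane => -k) ⁻¹' unitCell b with hs
  have hm : MeasurableSet s := measurable_neg (ZSpan.fundamentalDomain_measurableSet b)
  have hb : Bornology.IsBounded s := by
    have h1 := (ZSpan.fundamentalDomain_isBounded b).isCompact_closure.image continuous_neg
    refine h1.isBounded.subset fun x hx => ⟨-x, subset_closure hx, neg_neg x⟩
  -- The reflected cell is again a fundamental domain: no two of its points are equivalent, which is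
  -- checked here, and its translates cover the plane (`h2`).
  have h1 := setIntegral_saturation hg hp hm hb (fun x hx y hy G hxy => by
    have e1 : -y + (G : Plane) = -x := by rw [← hxy]; abel
    have e2 := fract_add_lattice (b := b) (-y) G
    rw [e1, hfr (-x) hx, hfr (-y) hy] at e2
    rw [e2] at e1
    exact Subtype.ext (by simpa using e1))
  have h2 : saturation b s = Set.univ := by
    refine Set.eq_univ_of_forall fun k => Set.mem_iUnion.mpr ⟨-ZSpan.floor b (-k),
      -ZSpan.fract b (-k), ?_, ?_⟩
    · show - -ZSpan.fract b (-k) ∈ unitCell b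
      rw [neg_neg]; exact ZSpan.fract_mem_fundamentalDomain b (-k)
    · simp only [Submodule.coe_neg]
      rw [← neg_add, fract_add_floor, neg_neg]
  rw [h2, Set.univ_inter] at h1
  rw [h1]
  have h3 := (Measure.measurePreserving_neg (volume : Measure Plane)).setIntegral_preimage_emb
    (Homeomorph.neg Plane).measurableEmbedding (fun k => g (-k)) (unitCell b)
  simp only [neg_neg] at h3
  exact h3.symm

end Reflection

/-! ### Integrality of the Euler numbers, total winding, and existence of zeros. -/

namespace Data

variable {b : Module.Basis (Fin 2) ℝ Plane}
  {E₁ : Type*} [NormedAddCommGroup E₁] [InnerProductSpace ℂ E₁] [CompleteSpace E₁]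
  {E₂ : Type*} [NormedAddCommGroup E₂] [InnerProductSpace ℂ E₂] [CompleteSpace E₂]
  {S : Data b E₁ E₂}

namespace IsRegular

variable (h : S.IsRegular) (c : Channel)
include h

/-- Each Euler number is the Chern number of an eigenline, and it is nonnegative as an absolute
value. -/
lemma exists_eulerNumber_eq : (∃ n : ℕ, S.N₁ = n) ∧ ∃ n : ℕ, S.N₂ = n := by
  obtain ⟨D, hD, hb, hc⟩ := exists_torus_region b
  have key : ∀ {x : ℝ} {m : ℤ} {z : ℂ}, 0 ≤ x → (x : ℂ) = (1 / (2 * Real.pi) : ℂ) * z →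
      z = 2 * Real.pi * m → ∃ n : ℕ, x = n := by
    intro x m z hx h1 h2
    have hpi : (Real.pi : ℂ) ≠ 0 := Complex.ofReal_ne_zero.mpr Real.pi_ne_zero
    have h3 : (x : ℂ) = m := by rw [h1, h2]; field_simp
    have h4 : x = m := by exact_mod_cast h3
    have h5 : 0 ≤ m := by rw [h4] at hx; exact_mod_cast hx
    obtain ⟨n, rfl⟩ := Int.eq_ofNat_of_zero_le h5
    exact ⟨n, by rw [h4]; simp⟩
  constructor
  · obtain ⟨m, hm⟩ := h.isBundle₁.chern_integer S.V₁.T_add h.exists_isLine₁ hD hb hc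
    refine key (norm_nonneg _) (Valley.eulerNumber_eq h.gauge₁ h.ne_zero₁) (m := m) ?_
    simp only [h.Φ₁_eq, hm]
  · have hB : IsBundle b S.V₂.T (lineProj S.V₂.P S.J₂) :=
      lineProj_isBundle S.V₂.isBundle S.V₂.isRealPlane h.cstr₂ h.smooth₂ h.equiv₂
    obtain ⟨m, hm⟩ := hB.chern_integer S.V₂.T_add (fun k => by
      obtain ⟨e, -, -, -, he⟩ := lineProj_exists_isLine (P := S.V₂.P) (S.V₂.isRealPlane k) (h.cstr₂ k)
      exact ⟨_, he⟩) hD hb hc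
    refine key (norm_nonneg _) (Valley.eulerNumber_eq h.gauge₂ h.ne_zero₂) (m := m) ?_
    simp only [Valley.Φ_eq_berry h.gauge₂ h.ne_zero₂]
    exact hm

/-- The curvatures integrate to `2π` times the Chern numbers of the two lines, `N₊` and `(-1)^b N₋`;
the reflection of the second valley does not change its integral. -/
lemma integral_berry : ∫ k in unitCell b, (berry S.line₁ k - berry (S.line₂ c) k) =
    2 * Real.pi * (S.N₁ - c.sgn * S.N₂) := by
  have hM := h.isLineMap c
  have hpi : (Real.pi : ℂ) ≠ 0 := Complex.ofReal_ne_zero.mpr Real.pi_ne_zero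
  have h1 : (S.N₁ : ℂ) = (1 / (2 * Real.pi) : ℂ) * ∫ k in unitCell b, berry S.line₁ k := by
    have := Valley.eulerNumber_eq h.gauge₁ h.ne_zero₁
    simp only [h.Φ₁_eq] at this
    exact this
  have h2 : (S.N₂ : ℂ) = (1 / (2 * Real.pi) : ℂ) * ∫ k in unitCell b, S.V₂.Φ S.u₂ S.k₂ k :=
    Valley.eulerNumber_eq h.gauge₂ h.ne_zero₂
  have hB : IsBundle b S.V₂.T (lineProj S.V₂.P S.J₂) :=
    lineProj_isBundle S.V₂.isBundle S.V₂.isRealPlane h.cstr₂ h.smooth₂ h.equiv₂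
  have hl : ∀ k, ∃ ℓ, IsLine (lineProj S.V₂.P S.J₂ k) ℓ := fun k => by
    obtain ⟨e, -, -, -, he⟩ := lineProj_exists_isLine (P := S.V₂.P) (S.V₂.isRealPlane k) (h.cstr₂ k)
    exact ⟨_, he⟩
  have hΦ : S.V₂.Φ S.u₂ S.k₂ = berry (lineProj S.V₂.P S.J₂) :=
    funext (Valley.Φ_eq_berry h.gauge₂ h.ne_zero₂)
  have h3 : ∫ k in unitCell b, S.V₂.Φ S.u₂ S.k₂ (-k) = ∫ k in unitCell b, S.V₂.Φ S.u₂ S.k₂ k := by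
    rw [hΦ]
    exact setIntegral_comp_neg (continuous_berry hB.smooth hB.proj hl) (hB.berry_periodic hl)
  rw [integral_sub (hM.integrableOn_of_continuous hM.continuous_berry₁ subset_rfl)
    (hM.integrableOn_of_continuous hM.continuous_berry₂ subset_rfl)]
  simp only [← h.Φ₂_eq c]
  rw [integral_const_mul, h3, h1, h2]
  field_simp

lemma absΔ_periodic (k : Plane) (G : recip b) : S.absΔ c (k + G) = S.absΔ c k := by
  have := (h.isLineMap c).n_periodic k G
  exact (sq_eq_sq₀ (Real.sqrt_nonneg _) (Real.sqrt_nonneg _)).mp this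

lemma isClosed_zeros : IsClosed {k | S.absΔ c k = 0} := by
  have h1 : {k | S.absΔ c k = 0} = {k | S.absΔ c k ^ 2 = 0} := by ext k; simp
  rw [h1]
  exact isClosed_eq (h.isLineMap c).contDiff_n.continuous continuous_const

lemma toTorus_mem_zeroSet (k : Plane) : toTorus b k ∈ S.zeroSet c ↔ S.absΔ c k = 0 := by
  refine ⟨?_, fun hk => ⟨k, hk, rfl⟩⟩
  rintro ⟨k', hk', hkk⟩
  have h1 : -k' + k ∈ (recip b).toAddSubgroup := QuotientAddGroup.eq.mp hkk
  have h2 := h.absΔ_periodic c k' ⟨-k' + k, h1⟩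
  rw [add_neg_cancel_left] at h2
  rw [h2]; exact hk'

omit h in
lemma _root_.EulerPairing.isClosed_component {X : Type*} [TopologicalSpace X]
    (i : ConnectedComponents X) : IsClosed {x : X | ConnectedComponents.mk x = i} := by
  obtain ⟨x, rfl⟩ := ConnectedComponents.surjective_coe i
  have : {y : X | ConnectedComponents.mk y = ConnectedComponents.mk x} = connectedComponent x :=
    Set.ext fun y => ConnectedComponents.coe_eq_coe'
  rw [this]
  exact isClosed_connectedComponent

lemma isClosed_zeroPoints (i : S.ZeroRegion c) : IsClosed (S.zeroPoints c i) := by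
  set φ : {k // S.absΔ c k = 0} → S.zeroSet c :=
    fun k => ⟨toTorus b k, (h.toTorus_mem_zeroSet c k).mpr k.2⟩ with hφ
  have hc : Continuous φ := (continuous_toTorus.comp continuous_subtype_val).subtype_mk _
  have h1 : S.zeroPoints c i = Subtype.val '' (φ ⁻¹' {x | ConnectedComponents.mk x = i}) := by
    ext k
    constructor
    · rintro ⟨hk, hi⟩
      exact ⟨⟨k, (h.toTorus_mem_zeroSet c k).mp hk⟩, hi, rfl⟩
    · rintro ⟨k, hi, rfl⟩
      exact ⟨_, hi⟩
  rw [h1]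
  exact ((h.isClosed_zeros c).isClosedEmbedding_subtypeVal).isClosedMap _
    ((isClosed_component i).preimage hc)

omit h in
lemma zeroPoints_add (i : S.ZeroRegion c) {k : Plane} (hk : k ∈ S.zeroPoints c i) (G : recip b) :
    k + G ∈ S.zeroPoints c i := by
  have h1 : toTorus b (k + G) = toTorus b k := toTorus_add k G.2
  obtain ⟨hk, hi⟩ := hk
  refine ⟨h1 ▸ hk, ?_⟩
  rw [← hi]
  congr 1
  exact Subtype.ext h1

omit h in
lemma isConnected_zeroPoints (i : S.ZeroRegion c) : IsConnected (toTorus b '' S.zeroPoints c i) := by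
  obtain ⟨x, rfl⟩ := ConnectedComponents.surjective_coe i
  have h1 : toTorus b '' S.zeroPoints c (x : S.ZeroRegion c) = Subtype.val '' connectedComponent x := by
    ext y
    constructor
    · rintro ⟨k, ⟨hk, hi⟩, rfl⟩
      exact ⟨_, ConnectedComponents.coe_eq_coe'.mp hi, rfl⟩
    · rintro ⟨z, hz, rfl⟩
      obtain ⟨k, hk, hkz⟩ := z.2
      refine ⟨k, ⟨hkz ▸ z.2, ?_⟩, hkz⟩
      rw [← ConnectedComponents.coe_eq_coe'.mpr hz]
      congr 1
      exact Subtype.ext hkz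
  rw [h1]
  exact isConnected_connectedComponent.image _ continuous_subtype_val.continuousOn

lemma exists_mem_zeroPoints {k : Plane} (hk : S.absΔ c k = 0) : ∃ i, k ∈ S.zeroPoints c i :=
  ⟨_, (h.toTorus_mem_zeroSet c k).mpr hk, rfl⟩

omit h in
lemma zeroPoints_unique {k : Plane} {i j : S.ZeroRegion c} (hi : k ∈ S.zeroPoints c i)
    (hj : k ∈ S.zeroPoints c j) : i = j := by
  obtain ⟨_, rfl⟩ := hi
  obtain ⟨_, rfl⟩ := hj
  rfl

/-- Each region of zeros is enclosed by a region whose winding number is an integer. -/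
lemma exists_encloses [Finite (S.ZeroRegion c)] (i : S.ZeroRegion c) :
    ∃ D, S.Encloses c D i ∧ ∃ m : ℤ, S.winding c D = m := by
  have hM := h.isLineMap c
  obtain ⟨K, hK⟩ := h.isBundle₁.exists_isProjFamily
  -- The other components form a closed set because they are finite in number. The bound `ρ` makes
  -- every side short enough for `lineWinding_integer`.
  obtain ⟨D, hD, hconn, hint, hdisj, hbd, hshort⟩ := exists_region (b := b)
    (Z' := ⋃ j ∈ {j | j ≠ i}, S.zeroPoints c j)
    (h.isClosed_zeroPoints c i)
    ((Set.toFinite {j | j ≠ i}).isClosed_biUnion fun j _ => h.isClosed_zeroPoints c j)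
    (fun k hk G => zeroPoints_add c i hk G)
    (fun k hk G => by
      obtain ⟨j, hj, hk⟩ := Set.mem_iUnion₂.mp hk
      exact Set.mem_biUnion hj (zeroPoints_add c j hk G))
    (by
      rw [Set.disjoint_left]
      intro k hk hk'
      obtain ⟨j, hj, hk'⟩ := Set.mem_iUnion₂.mp hk'
      exact hj (zeroPoints_unique c hk' hk))
    (isConnected_zeroPoints c i) (ρ := (|K| + 1)⁻¹) (by positivity)
  have hno : ∀ k ∈ D.carrier, S.absΔ c k = 0 → k ∈ S.zeroPoints c i := by
    intro k hk h0
    obtain ⟨j, hj⟩ := h.exists_mem_zeroPoints c h0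
    by_cases hji : j = i
    · rwa [← hji]
    · exact (Set.disjoint_left.mp hdisj hk (Set.mem_biUnion hji hj)).elim
  have hbd' : ∀ s ∈ D.bdry, ∀ t ∈ Set.Icc (0 : ℝ) 1, S.absΔ c (D.side s t) ≠ 0 := by
    intro s hs t ht h0
    refine hbd s hs t ht (hno _ ⟨s.1, squareSide s.2 t, ?_, 0, zero_mem _, (add_zero _).symm⟩ h0)
    generalize s.2 = i
    obtain ⟨h0, h1⟩ := ht
    fin_cases i <;> simp [squareSide, h0, h1]
  refine ⟨D, ⟨hconn, hint, hno, hbd'⟩, ?_⟩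
  obtain ⟨m, hm⟩ := hM.lineWinding_integer S.V₁.T_add
    (fun G G' x => by rw [neg_add]; exact S.V₂.T_add _ _ x) hK hD
    (fun s hs t ht => pow_ne_zero 2 (hbd' s hs t ht))
    (fun s hs => by
      have h1 := hshort s hs
      have h2 : 0 ≤ |K| := abs_nonneg K
      calc |K| * ‖D.side s 1 - D.side s 0‖ ≤ |K| * (|K| + 1)⁻¹ := by gcongr
        _ < 1 := by rw [← div_eq_mul_inv, div_lt_one (by positivity)]; linarith)
  refine ⟨m, ?_⟩
  have hpi : (Real.pi : ℂ) ≠ 0 := Complex.ofReal_ne_zero.mpr Real.pi_ne_zero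
  rw [h.winding_eq c D hbd', hm]
  field_simp

/-- `exists_encloses` provides for each component one region with integral winding. Any other valid
region encloses the same zeros, and the chosen regions together enclose all zeros, each once. -/
theorem totalWinding [Finite (S.ZeroRegion c)] : S.TotalWinding c (S.N₁ - (c.sgn : ℂ) * S.N₂) := by
  classical
  have hM := h.isLineMap c
  have hpi : (Real.pi : ℂ) ≠ 0 := Complex.ofReal_ne_zero.mpr Real.pi_ne_zero
  have := Fintype.ofFinite (S.ZeroRegion c)
  choose D hD w hw using h.exists_encloses c
  refine ⟨w, fun i => ⟨⟨D i, hD i⟩, fun D' hD' => ?_⟩, ?_⟩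
  · rw [← hw i, h.winding_eq c D' hD'.boundary, h.winding_eq c (D i) (hD i).boundary]
    congr 1
    refine hM.lineWinding_congr (fun s hs t ht => pow_ne_zero 2 (hD'.boundary s hs t ht))
      (fun s hs t ht => pow_ne_zero 2 ((hD i).boundary s hs t ht)) (fun k hk h0 => ?_)
      fun k hk h0 => ?_
    · exact (hD i).interior (hD'.no_other k hk (pow_eq_zero_iff two_ne_zero |>.mp h0))
    · exact hD'.interior ((hD i).no_other k hk (pow_eq_zero_iff two_ne_zero |>.mp h0))
  · obtain ⟨D₀, -, hb₀, hc₀⟩ := exists_torus_region b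
    have h1 := hM.sum_lineWinding D D₀ hb₀ hc₀
      (fun i s hs t ht => pow_ne_zero 2 ((hD i).boundary s hs t ht))
      (fun k h0 => by
        obtain ⟨i, hi⟩ := h.exists_mem_zeroPoints c (pow_eq_zero_iff two_ne_zero |>.mp h0)
        exact ⟨i, (hD i).interior hi⟩)
      (fun k h0 i j hi hj => by
        have h0' := pow_eq_zero_iff two_ne_zero |>.mp h0
        exact zeroPoints_unique c ((hD i).no_other k hi h0') ((hD j).no_other k hj h0'))
    rw [h.integral_berry] at h1
    rw [finsum_eq_sum_of_fintype, Int.cast_sum]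
    simp only [← hw]
    have h2 : ∀ i, S.winding c (D i) = (1 / (2 * Real.pi) : ℂ) * IsLineMap.lineWinding S.line₁
        (S.line₂ c) (S.linePairing c) (fun k => S.absΔ c k ^ 2) (D i) :=
      fun i => h.winding_eq c (D i) (hD i).boundary
    simp only [h2]
    rw [← Finset.mul_sum, h1]
    field_simp

/-- A channel with nonvanishing total winding has zeros. -/
lemma exists_zero (hne : (S.N₁ : ℝ) - c.sgn * S.N₂ ≠ 0) : ∃ k, S.Δb c k = 0 := by
  by_contra! hcon
  have hM := h.isLineMap c
  have h0 : ∀ k, S.absΔ c k ≠ 0 := fun k hk => hcon k ((h.absΔ_eq_zero_iff c k).mp hk)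
  obtain ⟨D₀, -, hb₀, hc₀⟩ := exists_torus_region b
  -- Without zeros the empty family of regions is admissible, so the total curvature difference
  -- vanishes.
  have h1 := hM.sum_lineWinding (ι := Empty) (fun i => i.elim) D₀ hb₀ hc₀ (fun i => i.elim)
    (fun k hk => (pow_ne_zero 2 (h0 k) hk).elim) (fun k hk => (pow_ne_zero 2 (h0 k) hk).elim)
  rw [h.integral_berry] at h1
  have hpi : (Real.pi : ℂ) ≠ 0 := Complex.ofReal_ne_zero.mpr Real.pi_ne_zero
  simp only [Finset.univ_eq_empty, Finset.sum_empty, zero_eq_mul, mul_eq_zero, OfNat.ofNat_ne_zero,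
    hpi, false_or] at h1
  exact hne (by exact_mod_cast h1)

end IsRegular

end Data

/-! ### Independence of gauges and base points. -/

namespace Data

variable {b : Module.Basis (Fin 2) ℝ Plane}
  {E₁ : Type*} [NormedAddCommGroup E₁] [InnerProductSpace ℂ E₁] [CompleteSpace E₁]
  {E₂ : Type*} [NormedAddCommGroup E₂] [InnerProductSpace ℂ E₂] [CompleteSpace E₂]
  {S : Data b E₁ E₂}

namespace IsRegular

variable (h : S.IsRegular) {u₁' : Plane → Fin 2 → E₁} {u₂' : Plane → Fin 2 → E₂}
  (hu₁ : S.V₁.IsGauge u₁') (hu₂ : S.V₂.IsGauge u₂') (k₁' k₂' : Plane)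
include h hu₁ hu₂

lemma regauge_PΔ : (S.regauge u₁' u₂' k₁' k₂').PΔ = S.PΔ := by
  funext k
  have h1 : (fun q => coeff (S.u₁ q) (S.V₂.conjFrame S.u₂ (-q)) (S.PΔ q)) = S.Δ :=
    funext fun q => coeff_ketbra (h.gauge₁.isFrame q) (h.gauge₂.conjFrame.isFrame (-q)) _
  have h2 := coeff_changeGauge (u₁' := u₁') (u₂' := u₂') h.gauge₁ h.gauge₂ h.pairing.left
    h.pairing.right k
  rw [h1] at h2
  change ketbra (u₁' k) (changeGauge S.u₁ u₁' S.u₂ u₂' S.Δ k) (S.V₂.conjFrame u₂' (-k)) = _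
  rw [← h2]
  exact ketbra_coeff (hu₁.isFrame k) (hu₂.conjFrame.isFrame (-k)) (h.pairing.left k)
    (h.pairing.right k)

omit hu₂ in
lemma regauge_Q₁ : (S.regauge u₁' u₂' k₁' k₂').Q₁ = S.Q₁ :=
  Valley.Q_independent h.gauge₁ hu₁ S.k₁ k₁'

omit hu₁ in
lemma regauge_Q₂ : (S.regauge u₁' u₂' k₁' k₂').Q₂ = S.Q₂ :=
  Valley.Q_independent h.gauge₂ hu₂ S.k₂ k₂'

omit hu₂ in
lemma regauge_N₁ : (S.regauge u₁' u₂' k₁' k₂').N₁ = S.N₁ :=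
  Valley.eulerNumber_independent h.gauge₁ hu₁ S.k₁ k₁'

omit hu₁ in
lemma regauge_N₂ : (S.regauge u₁' u₂' k₁' k₂').N₂ = S.N₂ :=
  Valley.eulerNumber_independent h.gauge₂ hu₂ S.k₂ k₂'

lemma regauge : (S.regauge u₁' u₂' k₁' k₂').IsRegular where
  orientable₁ := h.orientable₁
  orientable₂ := h.orientable₂
  gauge₁ := hu₁
  gauge₂ := hu₂
  ne_zero₁ := by rw [h.regauge_N₁ hu₁]; exact h.ne_zero₁
  ne_zero₂ := by rw [h.regauge_N₂ hu₂]; exact h.ne_zero₂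
  pairing := by rw [h.regauge_PΔ hu₁ hu₂]; exact h.pairing

lemma regauge_Pb (c : Channel) : (S.regauge u₁' u₂' k₁' k₂').Pb c = S.Pb c := by
  funext k
  rw [Pb, Pb, h.regauge_PΔ hu₁ hu₂, h.regauge_Q₁ hu₁, h.regauge_Q₂ hu₂]

lemma regauge_Δb (c : Channel) :
    (S.regauge u₁' u₂' k₁' k₂').Δb c = changeGauge S.u₁ u₁' S.u₂ u₂' (S.Δb c) := by
  funext k
  have h1 := coeff_changeGauge (u₁' := u₁') (u₂' := u₂') h.gauge₁ h.gauge₂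
    (h.isPairingOp_Pb c).left (h.isPairingOp_Pb c).right k
  rw [← h.regauge_Pb hu₁ hu₂ k₁' k₂' c] at h1
  refine h1.trans ?_
  rw [h.regauge_Pb hu₁ hu₂ k₁' k₂' c]
  rfl

/-- `|Δ_b|` is determined by the operator `P_b` through `P_b P_b† = |Δ_b|² P₊`, so no matrices have
to be compared. -/
lemma regauge_absΔ (c : Channel) : (S.regauge u₁' u₂' k₁' k₂').absΔ c = S.absΔ c := by
  funext k
  have h1 := (h.regauge hu₁ hu₂ k₁' k₂').Pb_mul_adj c k (S.u₁ k 0)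
  rw [h.regauge_Pb hu₁ hu₂, h.Pb_mul_adj] at h1
  change _ = _ • S.V₁.P k (S.u₁ k 0) at h1
  rw [h.gauge₁.mem] at h1
  have h2 := smul_left_injective ℂ ((h.gauge₁.orthonormal k).ne_zero 0) h1
  have h3 : S.absΔ c k ^ 2 = (S.regauge u₁' u₂' k₁' k₂').absΔ c k ^ 2 := by exact_mod_cast h2
  exact ((sq_eq_sq₀ (Real.sqrt_nonneg _) (Real.sqrt_nonneg _)).mp h3).symm

lemma regauge_vb (c : Channel) : (S.regauge u₁' u₂' k₁' k₂').vb c = S.vb c := by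
  have h1 : (S.regauge u₁' u₂' k₁' k₂').Phat c = S.Phat c := by
    funext k
    rw [Phat, Phat, h.regauge_absΔ hu₁ hu₂, h.regauge_Pb hu₁ hu₂]
  funext k w
  rw [vb, vb, h1, h.regauge_Q₁ hu₁]

lemma regauge_winding (c : Channel) (D : Region b) :
    (S.regauge u₁' u₂' k₁' k₂').winding c D = S.winding c D := by
  have h1 : S.V₁.Φ u₁' k₁' = S.V₁.Φ S.u₁ S.k₁ := Valley.Φ_independent h.gauge₁ hu₁ S.k₁ k₁'
  have h2 : S.V₂.Φ u₂' k₂' = S.V₂.Φ S.u₂ S.k₂ := Valley.Φ_independent h.gauge₂ hu₂ S.k₂ k₂'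
  rw [winding, winding, h.regauge_vb hu₁ hu₂, ← h1, ← h2]
  rfl

end IsRegular

end Data

/-! ### Real oriented gauges and Chern gauges. -/

namespace Valley

variable {b : Module.Basis (Fin 2) ℝ Plane} {E : Type*} [NormedAddCommGroup E]
  [InnerProductSpace ℂ E] [CompleteSpace E] {V : Valley b E} {u r : Plane → Fin 2 → E}

lemma coeffs_self {p : E →L[ℂ] E} {e : Fin 2 → E} (he : IsFrame p e) : coeffs e e = 1 := by
  ext i j
  simp [coeffs, he.inner_eq, Matrix.one_apply]

lemma rot_eq_of_det {p : E →L[ℂ] E} {C : E ≃ₗᵢ⋆[ℂ] E} {e f : Fin 2 → E} (he : IsRealFrame C p e)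
    (hf : IsRealFrame C p f) : rot e = (coeffs f e).det • rot f := by
  rw [← hf.ketbra_eq he.apply, he.ketbra_eq he.apply, coeffs_self he.toIsFrame, Matrix.det_one,
    one_smul]

/-- In a real gauge the Wilson determinant is that of the frame at `k'` relative to the transported
frame, and it compares their rotations. -/
lemma detW_realFrame (hr : V.IsGauge r) (hC : ∀ k a, V.C (r k a) = r k a) (k k' : Plane) :
    rot (r k') = V.detW r k k' •
      (transport V.P k' k ∘L rot (r k) ∘L transport V.P k k') := by
  have he : IsRealFrame V.C (V.P k) (r k) := ⟨hr.isFrame k, hC k⟩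
  have he' : IsRealFrame V.C (V.P k') (r k') := ⟨hr.isFrame k', hC k'⟩
  rw [rot_eq_of_det he' (transport_realFrame he k'), detW_eq hr he, coeffs_self he.toIsFrame,
    Matrix.det_one, map_one, one_mul, rot_transport]

/-- Real oriented gauges define the complex structure up to a sign. -/
lemma IsRealOriented.rot_eq (hr : V.IsRealOriented r) (hu : V.IsGauge u) {k₀ : Plane}
    (hN : V.eulerNumber u k₀ ≠ 0) :
    (fun k => rot (r k)) = V.J u k₀ ∨ (fun k => rot (r k)) = -V.J u k₀ := by
  obtain ⟨K, hK⟩ := V.isBundle.exists_isProjFamily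
  have hf : ∀ k, IsRealFrame V.C (V.P k) (r k) := fun k => ⟨hr.toIsGauge.isFrame k, hr.real k⟩
  refine cstr_family_unique V.isRealPlane (isCStr_J hu hN) (fun k => (hf k).isCStr)
    (contDiff_J hu k₀).continuous ?_
  refine (continuous_cstr_transport hK 0 (rot (r 0))).congr fun k => ?_
  rw [detW_realFrame hr.toIsGauge hr.real 0 k, hr.oriented, one_smul]

/-- Real oriented gauges. -/
lemma exists_realOriented (hO : V.Orientable) (hu : V.IsGauge u) {k₀ : Plane}
    (hN : V.eulerNumber u k₀ ≠ 0) :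
    ∃ r, V.IsRealOriented r ∧ ∀ k, rot (r k) = V.J u k₀ k := by
  obtain ⟨K, hK⟩ := V.isBundle.exists_isProjFamily
  choose e he j0 j1 using fun k => (isCStr_J hu hN k).exists_adapted (V.isRealPlane k)
  -- Frames adapted to `J` are chosen on the unit cell and translated. Equivariance of `J`, which
  -- rests on orientability, keeps them adapted everywhere.
  set r : Plane → Fin 2 → E := fun k a => extend V.T (fun q => e q a) k with hr
  have hrf : ∀ k, IsRealFrame V.C (V.P k) (r k) := by
    intro k
    have := isRealFrame_T (he (ZSpan.fract b k)) (ZSpan.floor b k)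
    rwa [fract_add_floor] at this
  have hrot : ∀ k, rot (r k) = V.J u k₀ k := by
    intro k
    refine ((isCStr_J hu hN k).eq_rot (hrf k) ?_).symm
    have := J_equivariant hO hu hN (ZSpan.floor b k) (ZSpan.fract b k) (e (ZSpan.fract b k) 0)
    rw [fract_add_floor, j0] at this
    exact this.symm
  have hg : V.IsGauge r := ⟨fun k => (hrf k).orthonormal, fun k => (hrf k).apply,
    fun k G a => extend_add V.T_add _ k G⟩
  refine ⟨r, ⟨hg, fun k => (hrf k).real, fun k k' => ?_⟩, hrot⟩
  have h1 := detW_realFrame hg (fun k => (hrf k).real) k k'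
  have hpar : transport V.P k' k ∘L V.J u k₀ k ∘L transport V.P k k' = V.J u k₀ k' := by
    ext x
    simp only [ContinuousLinearMap.comp_apply]
    rw [cstr_parallel hK V.isRealPlane (isCStr_J hu hN) (contDiff_J hu k₀).continuous,
      hK.transport_reverse_apply, (isCStr_J hu hN k').apply_proj]
  rw [hrot, hrot, hpar] at h1
  have h2 : (V.detW r k k' - 1) • V.J u k₀ k' = 0 := by rw [sub_smul, ← h1, one_smul, sub_self]
  exact sub_eq_zero.mp ((smul_eq_zero.mp h2).resolve_right
    ((isCStr_J hu hN k').ne_zero (V.isRealPlane k')))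

lemma bandProj_chernFrame_zero {J : Plane → E →L[ℂ] E} (hf : ∀ k, IsRealFrame V.C (V.P k) (r k))
    (hJ : ∀ k, rot (r k) = J k) : bandProj (chernFrame r) 0 = lineProj V.P J := by
  funext k
  ext x
  rw [(chernFrame_isLine (e := r) (hf k) (hJ k).symm).2]
  simp [bandProj]

/-- Reversing the second real vector exchanges the two components of the Chern gauge and turns `J`
into `-J`. -/
lemma bandProj_chernFrame_one {J : Plane → E →L[ℂ] E} (hf : ∀ k, IsRealFrame V.C (V.P k) (r k))
    (hJ : ∀ k, rot (r k) = J k) : bandProj (chernFrame r) 1 = lineProj V.P (-J) := by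
  set r' : Plane → Fin 2 → E := fun k => ![r k 0, -r k 1] with hr'
  have hf' : ∀ k, IsRealFrame V.C (V.P k) (r' k) := fun k => by
    refine ⟨isFrame_pair (V.P_proj k) (V.isRealPlane k).frame (orthonormal_pair ?_ ?_ ?_) ?_, ?_⟩
    · exact (hf k).orthonormal.1 0
    · exact (norm_neg _).trans ((hf k).orthonormal.1 1)
    · show inner ℂ (r k 0) (-r k 1) = 0
      rw [inner_neg_right, (hf k).inner_eq]; simp
    · intro a; fin_cases a
      · exact (hf k).apply 0
      · show V.P k (-r k 1) = -r k 1
        rw [map_neg, (hf k).apply]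
    · intro a; fin_cases a
      · exact (hf k).real 0
      · show V.C (-r k 1) = -r k 1
        rw [map_neg, (hf k).real]
  have hJ' : ∀ k, rot (r' k) = (-J) k := fun k => by
    rw [Pi.neg_apply, ← hJ]
    ext x
    simp [rot_apply, r']
    abel
  rw [← bandProj_chernFrame_zero hf' hJ']
  funext k
  simp only [bandProj, chernFrame, r']
  simp [sub_eq_add_neg]

lemma chernNumber_zero (hf : ∀ k, IsRealFrame V.C (V.P k) (r k)) (hu : V.IsGauge u) {k₀ : Plane}
    (hN : V.eulerNumber u k₀ ≠ 0) (hJ : ∀ k, rot (r k) = V.J u k₀ k) :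
    chernNumber b (chernFrame r) 0 = V.eulerNumber u k₀ := by
  rw [eulerNumber_eq hu hN, chernNumber, bandProj_chernFrame_zero hf hJ]
  simp only [Φ_eq_berry hu hN]
  rfl

/-- The curvature in `berry_lineProj` is odd in the complex structure. -/
lemma chernNumber_one (hr : V.IsRealOriented r) (hu : V.IsGauge u) {k₀ : Plane}
    (hN : V.eulerNumber u k₀ ≠ 0) :
    chernNumber b (chernFrame r) 1 = -chernNumber b (chernFrame r) 0 := by
  have hf : ∀ k, IsRealFrame V.C (V.P k) (r k) := fun k => ⟨hr.toIsGauge.isFrame k, hr.real k⟩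
  set J : Plane → E →L[ℂ] E := fun k => rot (r k) with hJ
  have hs : Differentiable ℝ J := by
    have h1 : Differentiable ℝ (V.J u k₀) := (contDiff_J hu k₀).differentiable (by simp)
    rcases hr.rot_eq hu hN with h | h
    · rw [hJ, h]; exact h1
    · rw [hJ, h]; exact h1.neg
  have hc : ∀ k, IsCStr V.C (V.P k) (J k) := fun k => (hf k).isCStr
  have h0 : ∀ k, berry (lineProj V.P (-J)) k = -berry (lineProj V.P J) k := fun k => by
    rw [berry_lineProj V.isRealPlane hc differentiable_P hs,
      berry_lineProj (J := -J) V.isRealPlane (fun k => (hc k).neg) differentiable_P hs.neg]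
    have := curvatureTrace_smul V.isRealPlane (hc k) (-1)
    rw [neg_one_smul] at this
    rw [Pi.neg_apply, this]; ring
  rw [chernNumber, chernNumber, bandProj_chernFrame_zero hf (fun _ => rfl),
    bandProj_chernFrame_one hf (fun _ => rfl)]
  rw [← mul_neg, ← integral_neg]
  congr 1
  exact integral_congr_ae (ae_of_all _ h0)

end Valley

/-! ### The flux through strips of the unit cell. -/

section Flux

lemma flux_smul (F : Plane → ℂ) (e₀ e₁ : Plane) (x : ℝ) : flux F 0 (x • e₀) e₁ =
    (area e₀ e₁ : ℂ) * ∫ s in (0 : ℝ)..x, ∫ t in (0 : ℝ)..1, F (s • e₀ + t • e₁) := by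
  have h := intervalIntegral.smul_integral_comp_mul_right (a := 0) (b := 1)
    (fun s => ∫ t in (0 : ℝ)..1, F (s • e₀ + t • e₁)) x
  rw [zero_mul, one_mul] at h
  rw [← h, Complex.real_smul, ← mul_assoc, ← intervalIntegral.integral_const_mul, flux]
  refine intervalIntegral.integral_congr fun s _ => ?_
  simp only [intervalIntegral.integral_const_mul, affineCell, zero_add, smul_smul]
  congr 1
  simp only [area, PiLp.smul_apply, smul_eq_mul]
  push_cast
  ring

variable {F : Plane → ℂ} (hF : Continuous F) (e₀ e₁ : Plane)
include hF

lemma continuous_flux_smul : Continuous fun x : ℝ => flux F 0 (x • e₀) e₁ := by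
  simp only [flux_smul]
  refine continuous_const.mul (intervalIntegral.continuous_primitive (fun a c => ?_) 0)
  refine Continuous.intervalIntegrable ?_ _ _
  exact intervalIntegral.continuous_parametric_intervalIntegral_of_continuous'
    (f := fun s t => F (s • e₀ + t • e₁)) (hF.comp (by fun_prop : Continuous fun q : ℝ × ℝ => q.1 • e₀ + q.2 • e₁)) 0 1

lemma flux_smul_add_one (hp : ∀ k, F (k + e₀) = F k) (x : ℝ) :
    flux F 0 ((x + 1) • e₀) e₁ = flux F 0 (x • e₀) e₁ + flux F 0 e₀ e₁ := by
  have hg : Continuous fun s : ℝ => ∫ t in (0 : ℝ)..1, F (s • e₀ + t • e₁) :=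
    intervalIntegral.continuous_parametric_intervalIntegral_of_continuous'
      (f := fun s t => F (s • e₀ + t • e₁)) (hF.comp (by fun_prop : Continuous fun q : ℝ × ℝ => q.1 • e₀ + q.2 • e₁)) 0 1
  have hper : Function.Periodic (fun s : ℝ => ∫ t in (0 : ℝ)..1, F (s • e₀ + t • e₁)) 1 := by
    intro s
    refine intervalIntegral.integral_congr fun t _ => ?_
    rw [← hp (s • e₀ + t • e₁)]
    congr 1
    module
  have h1 := flux_smul F e₀ e₁ 1
  rw [one_smul] at h1
  rw [flux_smul, flux_smul, h1, hper.intervalIntegral_add_eq_add 0 x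
    (fun _ _ => hg.intervalIntegrable _ _), mul_add, zero_add]

omit e₀ e₁ in
-- The torus is the grid region with a single cell, `N = 1`, spanned by the oriented basis.
lemma flux_basis {b e : Module.Basis (Fin 2) ℝ Plane} (he : recip e = recip b)
    (ha : 0 < area (e 0) (e 1)) (hp : ∀ k (G : recip b), F (k + G) = F k) :
    flux F 0 (e 0) (e 1) = ∫ k in unitCell b, F k := by
  have hD := (gridRegion_univ 1 he ha).2
  have h := (gridRegion 1 he ha Finset.univ).integral_carrier hF hp
  rw [hD, Set.univ_inter] at h
  rw [h, flux_eq hF]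
  have hc : ∀ j, (gridRegion 1 he ha Finset.univ).cell j = affineCell 0 (e 0) (e 1) := by
    intro j
    have h0 : ∀ z : ZMod 1, ((z.val : ℤ) : ℝ) = 0 := fun z => by
      rw [Subsingleton.elim z 0]; simp
    change gridSquare e 1 _ = _
    rw [gridSquare, gridCell, h0, h0]
    simp
  simp only [hc, Finset.sum_const, Finset.card_univ, Fintype.card_fin]
  have hn : (gridRegion 1 he ha Finset.univ).n = 1 := by
    change (Finset.univ : Finset (ZMod 1 × ZMod 1)).card = 1
    rfl
  rw [hn, one_smul]

end Flux

/-! ### The gauge obtained by transport along a comb of lines. -/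

section CombGauge

variable {b : Module.Basis (Fin 2) ℝ Plane} {E : Type*} [NormedAddCommGroup E]
  [InnerProductSpace ℂ E] [CompleteSpace E] {T : recip b → E ≃ₗᵢ[ℂ] E} {p : Plane → E →L[ℂ] E}
  {ℓ : Plane → E} {K : ℝ} (e : Module.Basis (Fin 2) ℝ Plane)

/-- Transport from the origin along the first basis vector and then along the second one. -/
def comb (p : Plane → E →L[ℂ] E) (ℓ : Plane → E) (k : Plane) : E :=
  transport p k (e.coord 0 k • e 0) (transport p (e.coord 0 k • e 0) 0 (ℓ 0))

lemma coord_decomp (k : Plane) : k = e.coord 0 k • e 0 + e.coord 1 k • e 1 := by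
  conv_lhs => rw [← e.sum_repr k, Fin.sum_univ_two]
  rfl

lemma continuous_coord (i : Fin 2) : Continuous (e.coord i) :=
  LinearMap.continuous_of_finiteDimensional _

lemma continuous_comb (hK : IsProjFamily p K) : Continuous (comb e p ℓ) := by
  have h0 : Continuous fun k : Plane => e.coord 0 k • e 0 :=
    (continuous_coord e 0).smul continuous_const
  have h1 := hK.continuous_transport.comp (continuous_id.prodMk h0)
  have h2 := hK.continuous_transport.comp (h0.prodMk (continuous_const (y := (0 : Plane))))
  exact h1.clm_apply (h2.clm_apply continuous_const)

section

variable (hK : IsProjFamily p K) (hℓ : ∀ k, IsLine (p k) (ℓ k))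
include hK hℓ

lemma comb_eq (k : Plane) : comb e p ℓ k =
    (hol p ℓ k (e.coord 0 k • e 0) * hol p ℓ (e.coord 0 k • e 0) 0) • ℓ k := by
  rw [comb, transport_eq_hol hK hℓ, map_smul, transport_eq_hol hK hℓ, smul_smul, mul_comm]

lemma hol_comp (a d : Plane) (s t u : ℝ) :
    hol p ℓ (a + s • d) (a + t • d) * hol p ℓ (a + t • d) (a + u • d) =
      hol p ℓ (a + s • d) (a + u • d) :=
  hol_eq_of_mul hK hℓ (hK.transport_comp a d s t u)

lemma norm_hol (k k' : Plane) : ‖hol p ℓ k k'‖ = 1 := by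
  have h := hol_mul_hol hK hℓ k k'
  rw [← conj_hol hK hℓ k k', Complex.mul_conj, Complex.normSq_eq_norm_sq] at h
  have h2 : ‖hol p ℓ k k'‖ ^ 2 = 1 := by exact_mod_cast h
  exact (pow_eq_one_iff_of_nonneg (norm_nonneg _) two_ne_zero).mp h2

lemma norm_comb (k : Plane) : ‖comb e p ℓ k‖ = 1 := by
  rw [comb_eq e hK hℓ, norm_smul, norm_mul, norm_hol hK hℓ, norm_hol hK hℓ, (hℓ k).1]
  norm_num

lemma proj_comb (k : Plane) : p k (comb e p ℓ k) = comb e p ℓ k :=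
  hK.proj_transport_apply _ _ _

end

variable (hK : IsProjFamily p K) (hB : IsBundle b T p) (hℓ : IsLineGauge T p ℓ) (G : recip b)
include hK hB hℓ

lemma comb_add_fst (hG : (G : Plane) = e 0) (k : Plane) :
    comb e p ℓ (k + G) = hol p ℓ (e 0) 0 • T G (comb e p ℓ k) := by
  have hx : e.coord 0 (k + G) • e 0 = e.coord 0 k • e 0 + G := by
    rw [hG, map_add, add_smul]; simp
  have h1 := hol_comp hK hℓ.line 0 (e 0) (e.coord 0 k + 1) 1 0
  have h2 := hB.hol_periodic hℓ (e.coord 0 k • e 0) 0 G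
  simp only [zero_add, add_smul, one_smul, zero_smul] at h1 h2
  rw [hG] at h2
  rw [comb_eq e hK hℓ.line, comb_eq e hK hℓ.line, hx, hB.hol_periodic hℓ, hℓ.periodic, map_smul,
    smul_smul, hG, ← h1, h2]
  congr 1
  ring

/-- Compared with a shift by `e 0`, which gives a constant phase, the comb here closes up around the
parallelogram with edges `x` and `e 1` at the origin; its flux appears as an additional phase
depending on the first coordinate. -/
lemma comb_add_snd (hG : (G : Plane) = e 1) (k : Plane) :
    comb e p ℓ (k + G) = (hol p ℓ (e 1) 0 * Complex.exp (-(Complex.I *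
      flux (berry p) 0 (e.coord 0 k • e 0) (e 1)))) • T G (comb e p ℓ k) := by
  have hx : e.coord 0 (k + G) = e.coord 0 k := by rw [hG, map_add]; simp
  set x := e.coord 0 k • e 0 with hxd
  have hk : k + G = x + (e.coord 1 k + 1) • e 1 := by
    conv_lhs => rw [coord_decomp e k, hG]
    rw [hxd]; module
  have h1 := hol_comp hK hℓ.line x (e 1) (e.coord 1 k + 1) 1 0
  rw [← hk, one_smul, zero_smul, add_zero] at h1
  have h2 := hB.hol_periodic hℓ k x G
  rw [hG] at h1 h2
  have h3 := hol_parallelogram hK hℓ.line hB.smooth 0 x (e 1)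
  have h4 := hB.hol_periodic hℓ x 0 G
  simp only [zero_add, hG] at h3 h4
  have h5 := hol_mul_hol hK hℓ.line 0 x
  have h6 := hol_mul_hol hK hℓ.line x (x + e 1)
  have h7 : hol p ℓ (x + e 1) x = hol p ℓ (e 1) 0 *
      Complex.exp (-(Complex.I * flux (berry p) 0 x (e 1))) := by
    rw [Complex.exp_neg, ← h3, eq_mul_inv_iff_mul_eq₀, h4]
    · linear_combination (hol p ℓ 0 x * hol p ℓ x 0 * hol p ℓ (e 1) 0) * h6 + hol p ℓ (e 1) 0 * h5
    · rw [h3]; exact Complex.exp_ne_zero _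
  rw [comb_eq e hK hℓ.line, comb_eq e hK hℓ.line, hx, ← hxd, hℓ.periodic, map_smul,
    smul_smul, hG, ← h1, h2, h7]
  congr 1
  ring

end CombGauge

/-! ### Line bundles with equal Chern number are isomorphic. -/

section LineIso

variable {b : Module.Basis (Fin 2) ℝ Plane}
  {E₁ : Type*} [NormedAddCommGroup E₁] [InnerProductSpace ℂ E₁] [CompleteSpace E₁]
  {E₂ : Type*} [NormedAddCommGroup E₂] [InnerProductSpace ℂ E₂] [CompleteSpace E₂]
  {T₁ : recip b → E₁ ≃ₗᵢ[ℂ] E₁} {T₂ : recip b → E₂ ≃ₗᵢ[ℂ] E₂}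
  {p₁ : Plane → E₁ →L[ℂ] E₁} {p₂ : Plane → E₂ →L[ℂ] E₂}

lemma apply_zero_of_add (hT₁ : ∀ G G' x, T₁ (G + G') x = T₁ G (T₁ G' x)) (x : E₁) :
    T₁ 0 x = x := by
  have := hT₁ 0 0 x
  rw [add_zero] at this
  exact ((LinearIsometryEquiv.injective _ this)).symm

lemma apply_apply_of_add_eq_zero (hT₁ : ∀ G G' x, T₁ (G + G') x = T₁ G (T₁ G' x))
    {G G' : recip b} (h : G + G' = 0) (x : E₁) : T₁ G (T₁ G' x) = x := by
  rw [← hT₁, h, apply_zero_of_add hT₁]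

lemma equivariant_of_basis {e : Module.Basis (Fin 2) ℝ Plane} (he : recip e = recip b)
    (hT₁ : ∀ G G' x, T₁ (G + G') x = T₁ G (T₁ G' x))
    (hT₂ : ∀ G G' x, T₂ (G + G') x = T₂ G (T₂ G' x)) {β : Plane → E₂ →L[ℂ] E₁}
    (h : ∀ i, ∀ G : recip b, (G : Plane) = e i → ∀ k x, T₁ G (β k x) = β (k + G) (T₂ G x))
    (k : Plane) (G : recip b) (x : E₂) : T₁ G (β k x) = β (k + G) (T₂ G x) := by
  obtain ⟨G, hG⟩ := G
  have hG' : G ∈ AddSubgroup.closure (Set.range e) := by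
    rw [← Submodule.span_int_eq_addSubgroupClosure]
    exact (he.symm ▸ hG : G ∈ recip e)
  induction hG' using AddSubgroup.closure_induction generalizing k x with
  | mem g hg =>
    obtain ⟨i, rfl⟩ := hg
    exact h i _ rfl k x
  | zero =>
    change T₁ 0 _ = β _ (T₂ 0 x)
    rw [apply_zero_of_add hT₁, apply_zero_of_add hT₂, add_zero]
  | add g g' hg hg' ih ih' =>
    have m : ∀ {g}, g ∈ AddSubgroup.closure (Set.range e) → g ∈ recip b := fun {g} hg => by
      rw [← Submodule.span_int_eq_addSubgroupClosure] at hg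
      exact (he ▸ hg : g ∈ recip b)
    have h1 : (⟨g + g', hG⟩ : recip b) = ⟨g', m hg'⟩ + ⟨g, m hg⟩ := Subtype.ext (add_comm _ _)
    rw [h1, hT₁, hT₂, ih _ _ (m hg), ih' _ _ (m hg')]
    change β (k + g + g') _ = β (k + (g' + g)) _
    rw [add_assoc, add_comm g]
  | neg g hg ih =>
    have m : g ∈ recip b := by simpa using neg_mem hG
    have h0 : (⟨g, m⟩ : recip b) + ⟨-g, hG⟩ = 0 := Subtype.ext (add_neg_cancel g)
    apply (T₁ ⟨g, m⟩).injective
    have := ih (k + -g) (T₂ ⟨-g, hG⟩ x) m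
    rw [apply_apply_of_add_eq_zero hT₁ h0, this, apply_apply_of_add_eq_zero hT₂ h0]
    simp

/-- Line bundles with the same Chern number are isomorphic. -/
lemma exists_continuous_iso (h₁ : IsBundle b T₁ p₁) (h₂ : IsBundle b T₂ p₂)
    (hT₁ : ∀ G G' x, T₁ (G + G') x = T₁ G (T₁ G' x))
    (hT₂ : ∀ G G' x, T₂ (G + G') x = T₂ G (T₂ G' x))
    (hl₁ : ∀ k, ∃ ℓ, IsLine (p₁ k) ℓ) (hl₂ : ∀ k, ∃ ℓ, IsLine (p₂ k) ℓ)
    (hc : ∫ k in unitCell b, berry p₁ k = ∫ k in unitCell b, berry p₂ k) :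
    ∃ β : Plane → E₂ →L[ℂ] E₁, Continuous β ∧ (∀ k x, p₁ k (β k x) = β k x) ∧
      (∀ k x, β k (p₂ k x) = β k x) ∧
      (∀ k (G : recip b) x, T₁ G (β k x) = β (k + G) (T₂ G x)) ∧ ∀ k, β k ≠ 0 := by
  obtain ⟨e, he, ha⟩ := exists_oriented_basis b
  obtain ⟨K₁, hK₁⟩ := h₁.exists_isProjFamily
  obtain ⟨K₂, hK₂⟩ := h₂.exists_isProjFamily
  obtain ⟨ℓ₁, g₁⟩ := h₁.exists_isLineGauge hT₁ hl₁
  obtain ⟨ℓ₂, g₂⟩ := h₂.exists_isLineGauge hT₂ hl₂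
  have c₁ := continuous_berry h₁.smooth h₁.proj hl₁
  have c₂ := continuous_berry h₂.smooth h₂.proj hl₂
  have hmem : ∀ i, e i ∈ recip b := fun i => he ▸ Submodule.subset_span ⟨i, rfl⟩
  obtain ⟨m, hm⟩ := h₁.chern_integer hT₁ hl₁ (gridRegion_isAffine 1 (he := he) (ha := ha) (A := Finset.univ))
    (gridRegion_univ 1 he ha).1 (gridRegion_univ 1 he ha).2
  set f₁ : ℝ → ℂ := fun x => flux (berry p₁) 0 (x • e 0) (e 1)
  set f₂ : ℝ → ℂ := fun x => flux (berry p₂) 0 (x • e 0) (e 1)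
  have hf₁ : Continuous f₁ := continuous_flux_smul c₁ _ _
  have hf₂ : Continuous f₂ := continuous_flux_smul c₂ _ _
  have hs₁ : ∀ x, f₁ (x + 1) = f₁ x + 2 * Real.pi * m := fun x => by
    rw [← hm, ← flux_basis c₁ he ha (h₁.berry_periodic hl₁)]
    exact flux_smul_add_one c₁ _ _ (fun k => h₁.berry_periodic hl₁ k ⟨e 0, hmem 0⟩) x
  have hs₂ : ∀ x, f₂ (x + 1) = f₂ x + 2 * Real.pi * m := fun x => by
    rw [← hm, hc, ← flux_basis c₂ he ha (h₂.berry_periodic hl₂)]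
    exact flux_smul_add_one c₂ _ _ (fun k => h₂.berry_periodic hl₂ k ⟨e 0, hmem 0⟩) x
  -- By the equality of the Chern numbers `f₁` and `f₂` grow by the same real amount `2πm` over a
  -- period, so `θ` is periodic. The conjugate stems from the bra in `β`.
  set θ : ℝ → ℂ := fun x => Complex.I * (conj (f₂ x) - f₁ x)
  have hθ : Continuous θ := continuous_const.mul ((Complex.continuous_conj.comp hf₂).sub hf₁)
  have hθ1 : ∀ x, θ (x + 1) = θ x := fun x => by
    simp only [θ, hs₁, hs₂, map_add, map_mul, Complex.conj_ofReal, map_intCast, map_ofNat]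
    ring
  have hex : ∀ i, ∃ z, Complex.exp z = hol p₁ ℓ₁ (e i) 0 * conj (hol p₂ ℓ₂ (e i) 0) := fun i =>
    ⟨_, Complex.exp_log (mul_ne_zero (hol_ne_zero hK₁ g₁.line _ _)
      ((map_ne_zero _).mpr (hol_ne_zero hK₂ g₂.line _ _)))⟩
  choose z hz using hex
  -- The exponential of `φ` absorbs the quotient of the transition phases of the two combs: a shift
  -- of the first coordinate contributes `z 0`, a shift of the second `z 1 + θ`.
  set φ : Plane → ℂ := fun k => -((e.coord 0 k : ℂ) * z 0 + (e.coord 1 k : ℂ) * (z 1 + θ (e.coord 0 k)))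
  have hφ : Continuous φ := by
    have d0 := continuous_coord e 0
    have d1 := continuous_coord e 1
    exact (((Complex.continuous_ofReal.comp d0).mul continuous_const).add
      ((Complex.continuous_ofReal.comp d1).mul (continuous_const.add (hθ.comp d0)))).neg
  set β : Plane → E₂ →L[ℂ] E₁ := fun k => Complex.exp (φ k) •
    InnerProductSpace.rankOne ℂ (comb e p₁ ℓ₁ k) (comb e p₂ ℓ₂ k)
  have hβ : ∀ k x, β k x = (Complex.exp (φ k) * inner ℂ (comb e p₂ ℓ₂ k) x) • comb e p₁ ℓ₁ k :=
    fun k x => by simp [β, smul_smul]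
  have key : ∀ (i : Fin 2) (G : recip b) (k : Plane) (a₁ a₂ : ℂ),
      comb e p₁ ℓ₁ (k + G) = a₁ • T₁ G (comb e p₁ ℓ₁ k) →
      comb e p₂ ℓ₂ (k + G) = a₂ • T₂ G (comb e p₂ ℓ₂ k) →
      Complex.exp (φ (k + G)) * (a₁ * conj a₂) = Complex.exp (φ k) →
      ∀ x, T₁ G (β k x) = β (k + G) (T₂ G x) := fun i G k a₁ a₂ e1 e2 e3 x => by
    rw [hβ, hβ, e1, e2, map_smul, smul_smul, inner_smul_left, LinearIsometryEquiv.inner_map_map,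
      ← e3]
    congr 1
    ring
  refine ⟨β, ?_, fun k x => ?_, fun k x => ?_, ?_, fun k h0 => ?_⟩
  · have d1 := continuous_comb (ℓ := ℓ₁) e hK₁
    have d2 := continuous_comb (ℓ := ℓ₂) e hK₂
    refine (Complex.continuous_exp.comp hφ).smul ?_
    exact ((ContinuousLinearMap.toSpanSingletonCLE (𝕜 := ℂ)).continuous.comp d1).clm_comp
      ((innerSL ℂ).continuous.comp d2)
  · rw [hβ, map_smul, proj_comb e hK₁ g₁.line]
  · rw [hβ, hβ]
    have := (h₂.proj k).isSelfAdjoint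
    rw [← ContinuousLinearMap.adjoint_inner_left, ← ContinuousLinearMap.star_eq_adjoint, this.star_eq,
      proj_comb e hK₂ g₂.line]
  · refine equivariant_of_basis he hT₁ hT₂ fun i G hG k => ?_
    fin_cases i
    · refine key 0 G k _ _ (comb_add_fst e hK₁ h₁ g₁ G hG k) (comb_add_fst e hK₂ h₂ g₂ G hG k) ?_
      have x0 : e.coord 0 (k + G) = e.coord 0 k + 1 := by
        rw [show (G : Plane) = e 0 from hG, map_add]; simp
      have x1 : e.coord 1 (k + G) = e.coord 1 k := by
        rw [show (G : Plane) = e 0 from hG, map_add]; simp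
      rw [← hz 0, ← Complex.exp_add]
      simp only [φ, x0, x1, hθ1]
      congr 1
      push_cast
      ring
    · refine key 1 G k _ _ (comb_add_snd e hK₁ h₁ g₁ G hG k) (comb_add_snd e hK₂ h₂ g₂ G hG k) ?_
      have x0 : e.coord 0 (k + G) = e.coord 0 k := by
        rw [show (G : Plane) = e 1 from hG, map_add]; simp
      have x1 : e.coord 1 (k + G) = e.coord 1 k + 1 := by
        rw [show (G : Plane) = e 1 from hG, map_add]; simp
      rw [map_mul, ← Complex.exp_conj, mul_mul_mul_comm, ← hz 1, ← Complex.exp_add, ← Complex.exp_add,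
        ← Complex.exp_add]
      simp only [φ, x0, x1, θ, f₁, f₂, map_neg, map_mul, Complex.conj_I]
      congr 1
      push_cast
      ring
  · have h1 := hβ k (comb e p₂ ℓ₂ k)
    rw [h0, inner_self_eq_norm_sq_to_K, norm_comb e hK₂ g₂.line] at h1
    have h2 := congrArg norm h1
    simp [norm_smul, norm_comb e hK₁ g₁.line] at h2
    exact Complex.exp_ne_zero _ (norm_eq_zero.mp h2.symm)

lemma norm_equivariant {A A' : E₂ →L[ℂ] E₁} (G : recip b)
    (h : ∀ x, T₁ G (A x) = A' (T₂ G x)) : ‖A'‖ = ‖A‖ := by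
  refine le_antisymm (A'.opNorm_le_bound (norm_nonneg _) fun y => ?_)
    (A.opNorm_le_bound (norm_nonneg _) fun x => ?_)
  · have := h ((T₂ G).symm y)
    rw [LinearIsometryEquiv.apply_symm_apply] at this
    rw [← this, LinearIsometryEquiv.norm_map, ← (T₂ G).symm.norm_map y]
    exact A.le_opNorm _
  · rw [← (T₁ G).norm_map, h, ← (T₂ G).norm_map x]
    exact A'.le_opNorm _

/-- A continuous equivariant family of operators is a uniform limit of smooth ones. -/
lemma exists_smooth_equivariant_approx {β : Plane → E₂ →L[ℂ] E₁} (hβ : Continuous β)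
    (hE : ∀ k (G : recip b) x, T₁ G (β k x) = β (k + G) (T₂ G x)) {ε : ℝ} (hε : 0 < ε) :
    ∃ β' : Plane → E₂ →L[ℂ] E₁, ContDiff ℝ ∞ β' ∧
      (∀ k (G : recip b) x, T₁ G (β' k x) = β' (k + G) (T₂ G x)) ∧ ∀ k, ‖β' k - β k‖ ≤ ε := by
  obtain ⟨δ, hδ, hu⟩ : ∃ δ > 0, ∀ k k', ‖k' - k‖ < δ → ‖β k' - β k‖ < ε := by
    have hc := (ZSpan.fundamentalDomain_isBounded b).isCompact_closure
    have h1 := hc.uniformContinuousAt_of_continuousAt β (fun k _ => hβ.continuousAt)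
      (Metric.dist_mem_uniformity hε)
    obtain ⟨δ, hδ, h2⟩ := Metric.mem_uniformity_dist.mp h1
    refine ⟨δ, hδ, fun k k' hk => ?_⟩
    set G := ZSpan.floor b k
    have h3 : ‖β (ZSpan.fract b k + G + (k' - k)) - β (ZSpan.fract b k + G)‖ =
        ‖β (ZSpan.fract b k + (k' - k)) - β (ZSpan.fract b k)‖ := by
      rw [add_right_comm]
      refine norm_equivariant (T₁ := T₁) (T₂ := T₂) G fun x => ?_
      rw [_root_.sub_apply, _root_.sub_apply, map_sub, hE, hE]
    rw [fract_add_floor, add_sub_cancel] at h3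
    rw [h3, ← dist_eq_norm, dist_comm]
    have h4 : dist (ZSpan.fract b k) (ZSpan.fract b k + (k' - k)) < δ := by
      rwa [dist_eq_norm, sub_add_cancel_left, norm_neg]
    exact h2 h4 (subset_closure (ZSpan.fract_mem_fundamentalDomain b k))
  obtain ⟨φ⟩ : Nonempty {φ : ContDiffBump (0 : Plane) // φ.rOut = δ} :=
    ⟨⟨⟨δ / 2, δ, by positivity, by linarith⟩, rfl⟩⟩
  obtain ⟨φ, hφ⟩ := φ
  set L : ℝ →L[ℝ] (E₂ →L[ℂ] E₁) →L[ℝ] (E₂ →L[ℂ] E₁) := ContinuousLinearMap.lsmul ℝ ℝ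
  have hs : HasCompactSupport (φ.normed volume) := φ.hasCompactSupport_normed
  have hloc : LocallyIntegrable β volume := hβ.locallyIntegrable
  -- Convolution with a scalar bump commutes with translations and with the lattice action; it moves
  -- `β` by at most its oscillation on balls of radius `δ`.
  refine ⟨convolution (φ.normed volume) β L volume, ?_, fun k G x => ?_, fun k => ?_⟩
  · exact hs.contDiff_convolution_left L φ.contDiff_normed hloc
  · have hex : ∀ k, Integrable (fun t => L (φ.normed volume t) (β (k - t))) volume := fun k =>
      hs.convolutionExists_left L φ.continuous_normed hloc k
    rw [convolution_def, convolution_def, ContinuousLinearMap.integral_apply (hex k),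
      ContinuousLinearMap.integral_apply (hex (k + G)), ← (T₁ G).coe_toContinuousLinearEquiv,
      ← ContinuousLinearEquiv.integral_comp_comm]
    refine integral_congr_ae (.of_forall fun t => ?_)
    change T₁ G ((φ.normed volume t • β (k - t)) x) = (φ.normed volume t • β (k + G - t)) (T₂ G x)
    rw [_root_.smul_apply, _root_.smul_apply, ← Complex.coe_smul, map_smul, hE, Complex.coe_smul]
    congr 3
    abel
  · rw [← dist_eq_norm]
    refine φ.dist_normed_convolution_le hβ.aestronglyMeasurable fun x hx => ?_
    rw [hφ, Metric.mem_ball, dist_eq_norm] at hx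
    rw [dist_eq_norm]
    exact (hu k x hx).le

/-- Line bundles with the same Chern number are isomorphic. -/
theorem exists_smooth_iso (h₁ : IsBundle b T₁ p₁) (h₂ : IsBundle b T₂ p₂)
    (hT₁ : ∀ G G' x, T₁ (G + G') x = T₁ G (T₁ G' x))
    (hT₂ : ∀ G G' x, T₂ (G + G') x = T₂ G (T₂ G' x))
    (hl₁ : ∀ k, ∃ ℓ, IsLine (p₁ k) ℓ) (hl₂ : ∀ k, ∃ ℓ, IsLine (p₂ k) ℓ)
    (hc : ∫ k in unitCell b, berry p₁ k = ∫ k in unitCell b, berry p₂ k) :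
    ∃ β : Plane → E₂ →L[ℂ] E₁, ContDiff ℝ ∞ β ∧ (∀ k x, p₁ k (β k x) = β k x) ∧
      (∀ k x, β k (p₂ k x) = β k x) ∧
      (∀ k (G : recip b) x, T₁ G (β k x) = β (k + G) (T₂ G x)) ∧ ∀ k, β k ≠ 0 := by
  obtain ⟨β, hβ, e1, e2, hE, h0⟩ := exists_continuous_iso h₁ h₂ hT₁ hT₂ hl₁ hl₂ hc
  obtain ⟨δ, hδ, hb⟩ := exists_pos_lt_of_periodic (b := b) hβ.norm
    (fun k G => norm_equivariant (T₁ := T₁) (T₂ := T₂) G (hE k G)) isClosed_univ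
    (fun _ _ _ => Set.mem_univ _) (fun k _ => norm_pos_iff.mpr (h0 k))
  obtain ⟨β', hs, hE', hd⟩ := exists_smooth_equivariant_approx hβ hE hδ
  -- The smooth approximation need not respect the lines, so it is compressed by the two
  -- projections.
  refine ⟨fun k => p₁ k ∘L β' k ∘L p₂ k, ?_, fun k x => ?_, fun k x => ?_, fun k G x => ?_,
    fun k hk => ?_⟩
  · exact contDiff_iff_contDiffAt.mpr fun k =>
      h₁.smooth.contDiffAt.opComp (hs.contDiffAt.opComp h₂.smooth.contDiffAt)
  · simpa using congrArg (fun A : E₁ →L[ℂ] E₁ => A (β' k (p₂ k x))) (h₁.proj k).isIdempotentElem.eq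
  · simpa using congrArg (fun A : E₂ →L[ℂ] E₂ => p₁ k (β' k (A x))) (h₂.proj k).isIdempotentElem.eq
  · simp only [ContinuousLinearMap.comp_apply, h₁.equiv, hE', h₂.equiv]
  -- If the compression vanished at `k`, the compressed error `β' - β` would equal `-β k`, whose
  -- norm exceeds the bound on the error.
  · have h1 : p₁ k ∘L (β' k - β k) ∘L p₂ k = -β k := by
      rw [ContinuousLinearMap.sub_comp, ContinuousLinearMap.comp_sub,
        show p₁ k ∘L β' k ∘L p₂ k = 0 from hk, zero_sub]
      congr 1
      ext x
      simp [e1, e2]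
    have h2 : ‖β k‖ ≤ ‖β' k - β k‖ := by
      rw [← norm_neg, ← h1]
      refine (ContinuousLinearMap.opNorm_comp_le _ _).trans ?_
      refine (mul_le_mul (norm_starProjection_le (h₁.proj k))
        (ContinuousLinearMap.opNorm_comp_le _ _) (norm_nonneg _) zero_le_one).trans ?_
      rw [one_mul]
      exact mul_le_of_le_one_right (norm_nonneg _) (norm_starProjection_le (h₂.proj k))
    linarith [hb k (Set.mem_univ _), hd k]

end LineIso

/-! ### A pairing whose channel `⊥` vanishes nowhere. -/

section PerpPairing

variable {b : Module.Basis (Fin 2) ℝ Plane}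
  {E₁ : Type*} [NormedAddCommGroup E₁] [InnerProductSpace ℂ E₁] [CompleteSpace E₁]
  {E₂ : Type*} [NormedAddCommGroup E₂] [InnerProductSpace ℂ E₂] [CompleteSpace E₂]

/-- Conjugation of operators by antiunitaries, as a real linear map. -/
def conjOp (C₁ : E₁ ≃ₗᵢ⋆[ℂ] E₁) (C₂ : E₂ ≃ₗᵢ⋆[ℂ] E₂) : (E₂ →L[ℂ] E₁) →L[ℝ] E₂ →L[ℂ] E₁ :=
  LinearMap.mkContinuous
    { toFun := fun A => C₁.toContinuousLinearEquiv.toContinuousLinearMap.comp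
        (A.comp C₂.toContinuousLinearEquiv.toContinuousLinearMap)
      map_add' := fun A B => by ext x; simp
      map_smul' := fun r A => by
        ext x
        change C₁ (r • A (C₂ x)) = r • C₁ (A (C₂ x))
        rw [← Complex.coe_smul, C₁.map_smulₛₗ, Complex.conj_ofReal, Complex.coe_smul] } 1
    fun A => by
      rw [one_mul]
      refine ContinuousLinearMap.opNorm_le_bound _ (norm_nonneg _) fun x => ?_
      change ‖C₁ (A (C₂ x))‖ ≤ _
      rw [C₁.norm_map, ← C₂.norm_map x]
      exact A.le_opNorm _

lemma conjOp_apply (C₁ : E₁ ≃ₗᵢ⋆[ℂ] E₁) (C₂ : E₂ ≃ₗᵢ⋆[ℂ] E₂) (A : E₂ →L[ℂ] E₁) (x : E₂) :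
    conjOp C₁ C₂ A x = C₁ (A (C₂ x)) := rfl

namespace Data.IsRegular

variable {S : Data b E₁ E₂} (h : S.IsRegular)
include h

lemma J₁_line₁ (k : Plane) (x : E₁) : S.J₁ k (S.line₁ k x) = -Complex.I • S.line₁ k x := by
  simp only [line₁, lineProj_apply, map_smul, map_add, (h.cstr₁ k).sq, (h.cstr₁ k).apply_proj]
  match_scalars
  · linear_combination (1 / 2 : ℂ) * Complex.I_sq
  · ring

lemma line₂_J₂ (k : Plane) (x : E₂) :
    S.line₂ .perp k (S.J₂ (-k) x) = -Complex.I • S.line₂ .perp k x := by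
  simp only [line₂, lineProj_apply, map_smul, map_add, Channel.sgn, Int.cast_one, one_smul,
    (h.cstr₂ (-k)).sq, (h.cstr₂ (-k)).proj_apply]
  match_scalars
  · linear_combination (1 / 2 : ℂ) * Complex.I_sq
  · ring

lemma line₂_P (k : Plane) (x : E₂) : S.line₂ .perp k (S.V₂.P (-k) x) = S.line₂ .perp k x := by
  simp only [line₂, lineProj_apply, proj_apply_apply (S.V₂.P_proj (-k)), _root_.smul_apply,
    (h.cstr₂ (-k)).apply_proj]

/-- A pairing operator without zeros in the channel `⊥`. -/
lemma exists_pairingOp (hN : S.N₁ = S.N₂) : ∃ B : Plane → E₂ →L[ℂ] E₁,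
    IsPairingOp S.V₁ S.V₂ B ∧ (∀ k x, S.J₁ k (B k x) = B k (S.J₂ (-k) x)) ∧ ∀ k, B k ≠ 0 := by
  have hc : ∫ k in unitCell b, berry S.line₁ k = ∫ k in unitCell b, berry (S.line₂ .perp) k := by
    have h0 := h.integral_berry .perp
    have i₁ := (continuous_berry h.isBundle₁.smooth h.isBundle₁.proj h.exists_isLine₁)
    have i₂ := (continuous_berry (h.isBundle₂ .perp).smooth (h.isBundle₂ .perp).proj
      (h.exists_isLine₂ .perp))
    have hi : ∀ {g : Plane → ℂ}, Continuous g → IntegrableOn g (unitCell b) := fun hg =>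
      (hg.continuousOn.integrableOn_compact
        (ZSpan.fundamentalDomain_isBounded b).isCompact_closure).mono_set subset_closure
    rw [integral_sub (hi i₁) (hi i₂), hN] at h0
    simpa [Channel.sgn, sub_eq_zero] using h0
  obtain ⟨β, hs, e₁, e₂, hE, h0⟩ := exists_smooth_iso h.isBundle₁ (h.isBundle₂ .perp) S.V₁.T_add
    (fun G G' x => by rw [neg_add, S.V₂.T_add]) h.exists_isLine₁ (h.exists_isLine₂ .perp) hc
  have hJ₁ : ∀ k x, S.J₁ k (β k x) = -Complex.I • β k x := fun k x => by
    rw [← e₁, h.J₁_line₁]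
  have hJ₂ : ∀ k x, β k (S.J₂ (-k) x) = -Complex.I • β k x := fun k x => by
    rw [← e₂, h.line₂_J₂, map_smul, e₂]
  have hP₁ : ∀ k x, S.V₁.P k (β k x) = β k x := fun k x => by rw [← e₁, h.P_line₁]
  have hP₂ : ∀ k x, β k (S.V₂.P (-k) x) = β k x := fun k x => by rw [← e₂, h.line₂_P, e₂]
  -- The sum with the conjugate is real. It still intertwines the complex structures: `β` relates
  -- their `-i` eigenlines and its conjugate the `+i` eigenlines.
  refine ⟨fun k => β k + conjOp S.V₁.C S.V₂.C (β k), ⟨?_, fun k x => ?_, fun k x => ?_,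
    fun k x => ?_, fun k G x => ?_⟩, fun k x => ?_, fun k hk => h0 k ?_⟩
  · exact hs.add ((conjOp S.V₁.C S.V₂.C).contDiff.comp hs)
  · rw [_root_.add_apply, map_add, conjOp_apply, ← (S.V₁.isRealPlane k).comm, hP₁, hP₁]
  · rw [_root_.add_apply, _root_.add_apply, conjOp_apply, conjOp_apply,
      (S.V₂.isRealPlane (-k)).comm, hP₂, hP₂]
  · rw [_root_.add_apply, _root_.add_apply, map_add, conjOp_apply, conjOp_apply, S.V₁.C_sq,
      S.V₂.C_sq, add_comm]
  · rw [_root_.add_apply, _root_.add_apply, map_add, conjOp_apply, conjOp_apply, ← S.V₁.C_T, hE,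
      hE, S.V₂.C_T]
  · rw [_root_.add_apply, _root_.add_apply, map_add, conjOp_apply, conjOp_apply,
      ← (h.cstr₁ k).real, (h.cstr₂ (-k)).real, hJ₁, hJ₂, hJ₁]
    rw [hJ₂]
  -- The conjugate part has values in the `+i` eigenline, which the projection onto the `-i`
  -- eigenline annihilates; so the sum vanishes only if `β` does.
  · have hz : ∀ x, S.line₁ k (conjOp S.V₁.C S.V₂.C (β k) x) = 0 := fun x => by
      rw [conjOp_apply, line₁, lineProj_apply, ← (h.cstr₁ k).real, hJ₁,
        ← (S.V₁.isRealPlane k).comm, hP₁, S.V₁.C.map_smulₛₗ, smul_smul]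
      simp
    ext x
    have := congrArg (fun A : E₂ →L[ℂ] E₁ => S.line₁ k (A x)) hk
    simpa [hz, e₁] using this

/-- For equal Euler numbers, some pairing on the same normal state has no zeros in the channel
`⊥`. -/
theorem exists_pairing_perp_ne_zero (hN : S.N₁ = S.N₂) {Sp : Matrix (Fin 2) (Fin 2) ℂ}
    (hs : pauliY * Sp.map conj * pauliY = Sp) (hs' : Spᴴ * Sp = 1) :
    ∃ Δ', IsPairing S.V₁ S.V₂ S.u₁ S.u₂ Δ' Sp ∧ ∀ k, (S.withPairing Δ').Δb .perp k ≠ 0 := by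
  obtain ⟨B, hB, hJ, h0⟩ := h.exists_pairingOp hN
  set Δ' : Plane → Matrix (Fin 2) (Fin 2) ℂ := fun k =>
    coeff (S.u₁ k) (S.V₂.conjFrame S.u₂ (-k)) (B k)
  have hΔ : EulerPairing.PΔ S.V₂ S.u₁ S.u₂ Δ' = B := funext fun k =>
    ketbra_coeff (h.gauge₁.isFrame k) (h.gauge₂.conjFrame.isFrame (-k)) (hB.left k) (hB.right k)
  refine ⟨Δ', (isPairing_iff h.gauge₁ h.gauge₂ hs hs' Δ').mpr (hΔ ▸ hB), fun k hk => h0 k ?_⟩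
  -- An operator intertwining the complex structures lies entirely in the channel `⊥`, so it
  -- coincides with its own component there.
  have hPb : (S.withPairing Δ').Pb .perp k = B k := by
    ext x
    rw [Pb_apply]
    change (1 / 2 : ℂ) • (EulerPairing.PΔ S.V₂ S.u₁ S.u₂ Δ' k x - ((Channel.perp.sgn : ℤ) : ℂ) •
      S.J₁ k (EulerPairing.PΔ S.V₂ S.u₁ S.u₂ Δ' k (S.J₂ (-k) x))) = B k x
    rw [hΔ, ← hJ, (h.cstr₁ k).sq, hB.left, Channel.sgn, Int.cast_one, one_smul]
    module
  have h1 : coeff (S.u₁ k) (S.V₂.conjFrame S.u₂ (-k)) (B k) = 0 := by rw [← hPb]; exact hk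
  rw [← ketbra_coeff (h.gauge₁.isFrame k) (h.gauge₂.conjFrame.isFrame (-k)) (hB.left k) (hB.right k),
    h1]
  simp [ketbra]

end Data.IsRegular

end PerpPairing

end EulerPairing

end

/-! ### The theorem. -/

open EulerPairing

theorem mainTheorem1 {E₁ E₂ : Type*}
    [NormedAddCommGroup E₁] [InnerProductSpace ℂ E₁] [CompleteSpace E₁]
    [NormedAddCommGroup E₂] [InnerProductSpace ℂ E₂] [CompleteSpace E₂]
    (b : Module.Basis (Fin 2) ℝ Plane) (S : Data b E₁ E₂) (Sp : Matrix (Fin 2) (Fin 2) ℂ)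
    (hO₁ : S.V₁.Orientable) (hO₂ : S.V₂.Orientable)
    (hu₁ : S.V₁.IsGauge S.u₁) (hu₂ : S.V₂.IsGauge S.u₂)
    (hN₁ : S.N₁ ≠ 0) (hN₂ : S.N₂ ≠ 0)
    (hΔ : IsPairing S.V₁ S.V₂ S.u₁ S.u₂ S.Δ Sp) :
    -- the splitting into two channels
    (∀ k, S.Δ k = S.Δb .perp k + S.Δb .para k) ∧
    (∀ c k, S.Pb c k = ketbra (S.u₁ k) (S.Δb c k) (S.V₂.conjFrame S.u₂ (-k))) ∧
    (∀ c, ContDiff ℝ ∞ (S.Pb c)) ∧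
    -- independence of the gauges and of the base points
    (∀ u₁' u₂' k₁' k₂', S.V₁.IsGauge u₁' → S.V₂.IsGauge u₂' →
      (S.regauge u₁' u₂' k₁' k₂').N₁ = S.N₁ ∧ (S.regauge u₁' u₂' k₁' k₂').N₂ = S.N₂ ∧
      (S.regauge u₁' u₂' k₁' k₂').PΔ = S.PΔ ∧
      (S.regauge u₁' u₂' k₁' k₂').Q₁ = S.Q₁ ∧ (S.regauge u₁' u₂' k₁' k₂').Q₂ = S.Q₂ ∧
      ∀ c, (S.regauge u₁' u₂' k₁' k₂').Pb c = S.Pb c ∧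
        (S.regauge u₁' u₂' k₁' k₂').Δb c = changeGauge S.u₁ u₁' S.u₂ u₂' (S.Δb c) ∧
        (S.regauge u₁' u₂' k₁' k₂').absΔ c = S.absΔ c ∧
        (S.regauge u₁' u₂' k₁' k₂').vb c = S.vb c ∧
        ∀ D, (S.regauge u₁' u₂' k₁' k₂').winding c D = S.winding c D) ∧
    -- the Euler numbers are integers
    (∃ n₁ n₂ : ℕ, S.N₁ = n₁ ∧ S.N₂ = n₂) ∧
    -- the total winding number of the zeros, and its consequences
    (∀ c, (∃ k, S.absΔ c k ≠ 0) → Finite (S.ZeroRegion c) →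
      S.TotalWinding c (S.N₁ - (c.sgn : ℂ) * S.N₂)) ∧
    (∀ c, (S.N₁ : ℝ) - c.sgn * S.N₂ ≠ 0 → ∃ k, S.Δb c k = 0) ∧
    (S.N₁ = 1 → S.N₂ = 1 →
      (∃ k, S.Δb .para k = 0) ∧
      ((∃ k, S.absΔ .para k ≠ 0) → Finite (S.ZeroRegion .para) → S.TotalWinding .para 2) ∧
      ∃ Δ', IsPairing S.V₁ S.V₂ S.u₁ S.u₂ Δ' Sp ∧
        ∀ k, (S.withPairing Δ').Δb .perp k ≠ 0) ∧
    -- Chern gauges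
    (∃ r₁ r₂, S.V₁.IsRealOriented r₁ ∧ S.V₂.IsRealOriented r₂ ∧
      Valley.chernNumber b (Valley.chernFrame r₁) 0 = S.N₁ ∧
      Valley.chernNumber b (Valley.chernFrame r₂) 0 = S.N₂) ∧
    (∀ r₁ r₂, S.V₁.IsRealOriented r₁ → S.V₂.IsRealOriented r₂ →
      Valley.chernNumber b (Valley.chernFrame r₁) 0 = S.N₁ →
      Valley.chernNumber b (Valley.chernFrame r₂) 0 = S.N₂ →
      Valley.chernNumber b (Valley.chernFrame r₁) 1 = -S.N₁ ∧
      Valley.chernNumber b (Valley.chernFrame r₂) 1 = -S.N₂ ∧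
      ∀ c, (∃ k, S.absΔ c k ≠ 0) → Finite (S.ZeroRegion c) →
        S.TotalWinding c (-Valley.chernNumber b (Valley.chernFrame r₁) 1 +
          (c.sgn : ℂ) * Valley.chernNumber b (Valley.chernFrame r₂) 1)) := by
  have hS : S.IsRegular := ⟨hO₁, hO₂, hu₁, hu₂, hN₁, hN₂,
    (isPairing_iff hu₁ hu₂ hΔ.spin_invariant hΔ.spin_unitary S.Δ).mp hΔ⟩
  have htot := fun c (hf : Finite (S.ZeroRegion c)) => hS.totalWinding c
  have hex : ∀ c, (S.N₁ : ℝ) - c.sgn * S.N₂ ≠ 0 → ∃ k, S.Δb c k = 0 := fun c => hS.exists_zero c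
  have hsgn : ((Channel.para.sgn : ℤ) : ℝ) = -1 := by simp [Channel.sgn]
  refine ⟨fun k => ?_, fun c k => ?_, fun c => (hS.isPairingOp_Pb c).smooth, ?_, ?_,
    fun c _ hf => htot c hf, hex, fun h1 h2 => ⟨hex _ ?_, fun _ hf => ?_, ?_⟩, ?_, ?_⟩
  · have h1 := coeff_ketbra (hu₁.isFrame k) (hu₂.conjFrame.isFrame (-k)) (S.Δ k)
    have h2 : coeff (S.u₁ k) (S.V₂.conjFrame S.u₂ (-k)) (S.PΔ k) = S.Δ k := h1
    rw [← h2, ← Data.Pb_perp_add_Pb_para]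
    ext a a'
    exact inner_add_right _ _ _
  · exact (ketbra_coeff (hu₁.isFrame k) (hu₂.conjFrame.isFrame (-k))
      ((hS.isPairingOp_Pb c).left k) ((hS.isPairingOp_Pb c).right k)).symm
  · exact fun u₁' u₂' k₁' k₂' hu₁' hu₂' => ⟨hS.regauge_N₁ hu₁' .., hS.regauge_N₂ hu₂' ..,
      hS.regauge_PΔ hu₁' hu₂' .., hS.regauge_Q₁ hu₁' .., hS.regauge_Q₂ hu₂' .., fun c =>
      ⟨hS.regauge_Pb hu₁' hu₂' .., hS.regauge_Δb hu₁' hu₂' .., hS.regauge_absΔ hu₁' hu₂' ..,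
        hS.regauge_vb hu₁' hu₂' .., hS.regauge_winding hu₁' hu₂' _ _ _⟩⟩
  · obtain ⟨⟨n₁, h₁⟩, n₂, h₂⟩ := hS.exists_eulerNumber_eq
    exact ⟨n₁, n₂, h₁, h₂⟩
  · rw [h1, h2, hsgn]
    norm_num
  · have h3 := htot .para hf
    rw [h1, h2] at h3
    convert h3 using 1
    simp [Channel.sgn]
    norm_num
  · exact hS.exists_pairing_perp_ne_zero (h1.trans h2.symm) hΔ.spin_invariant hΔ.spin_unitary
  · obtain ⟨r₁, hr₁, hJ₁⟩ := Valley.exists_realOriented hO₁ hu₁ (k₀ := S.k₁) hN₁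
    obtain ⟨r₂, hr₂, hJ₂⟩ := Valley.exists_realOriented hO₂ hu₂ (k₀ := S.k₂) hN₂
    exact ⟨r₁, r₂, hr₁, hr₂,
      Valley.chernNumber_zero (fun k => ⟨hr₁.toIsGauge.isFrame k, hr₁.real k⟩) hu₁ hN₁ hJ₁,
      Valley.chernNumber_zero (fun k => ⟨hr₂.toIsGauge.isFrame k, hr₂.real k⟩) hu₂ hN₂ hJ₂⟩
  · intro r₁ r₂ hr₁ hr₂ hc₁ hc₂
    have e₁ := Valley.chernNumber_one hr₁ hu₁ (k₀ := S.k₁) hN₁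
    have e₂ := Valley.chernNumber_one hr₂ hu₂ (k₀ := S.k₂) hN₂
    rw [hc₁] at e₁
    rw [hc₂] at e₂
    refine ⟨e₁, e₂, fun c _ hf => ?_⟩
    rw [e₁, e₂, neg_neg, mul_neg, ← sub_eq_add_neg]
    exact htot c hf
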